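/- Let $k$ be a field of characteristic $0$, and let $\mathcal{A}$ be a modular operad in the category of chain complexes over $k$, with components $\mathcal{A}((g,n))$ (a complex of representations of $S_n$, zero if $2(g-1)+n\le 0$; write $\mathcal{A}((g,I))$ for the extension to finite sets $I$). Assume that every $\mathcal{A}((g,n))$ is finite-dimensional. **Feynman transform.** For a stable graph $G$ (finite, connected, with legs, and with a genus $g(v)\ge 0$ at each vertex) let $\mathcal{A}((G))=\bigotimes_{v}\mathcal{A}((g(v),\mathrm{Leg}(v)))$, where $\mathrm{Leg}(v)$ is the set of flags at $v$. The genus of $G$ is $g(G)=\sum_v(g(v)-1)+|\mathrm{Edge}(G)|+1$. Let $\mathfrak{K}(G)=\mathrm{Det}(\mathrm{Edge}(G))$, the top exterior power of $k^{\mathrm{Edge}(G)}$ placed in degree $-|\mathrm{Edge}(G)|$. The Feynman transform $\mathsf{F}\mathcal{A}$ has components $$\mathsf{F}\mathcal{A}((g,n))=\operatorname*{colim}_{G}\ \mathfrak{K}(G)\otimes\mathcal{A}((G))^*,$$ the colimit running over the groupoid of stable graphs $G$ of genus $g$ with legs labelled by $\{1,\dots,n\}$; its differential is the sum of the differential of $\mathcal{A}^*$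 and of the map with components $(e\wedge-)\otimes\mathcal{A}((G\to G/e))^*$, summed over the edges $e$ of $G$. **Characteristics.** Let $p_1,p_2,\dots$ be the power sums. For a finite-dimensional complex $V$ of representations of $S_n$ put $$\mathrm{ch}_n(V)=\frac1{n!}\sum_{\sigma\in S_n}\Bigl(\sum_i(-1)^i\,\mathrm{Tr}_{V_i}(\sigma)\Bigr)\,p_{a_1}p_{a_2}\cdots,$$ where $a_1,a_2,\dots$ are the lengths of the cycles of $\sigma$ (fixed points included), and put $$\mathbf{Ch}(\mathcal{V})=\sum_{2(g-1)+n>0}\hbar^{g-1}\,\mathrm{ch}_n(\mathcal{V}((g,n))).$$ This lies in the ring of series in $\hbar^{\pm1},p_1,p_2,\dots$ over $k$ completed with respect to the weight, where $\hbar$ has weight $2$ and $p_n$ has weight $n$. In this ring let $p_n\circ f(\hbar,p_1,p_2,\dots)=f(\hbar^n,p_n,p_{2n},\dots)$ and $$\mathrm{Exp}(f)=\exp\Bigl(\sum_{n\ge1}\tfrac1n\,p_n\circ f\Bigr),\qquad \mathrm{Log}(f)=\sum_{n\ge1}\frac{\mu(n)}{n}\log(p_n\circ f),$$ for $f$ of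 positive weight, respectively for $f=1+{}$(terms of positive weight), where $\mu$ is the Möbius function. Let $$\Delta=\sum_{n=1}^\infty\hbar^n\Bigl(\frac n2\frac{\partial^2}{\partial p_n^2}+\frac{\partial}{\partial p_{2n}}\Bigr).$$ **Statement.** Every $\mathsf{F}\mathcal{A}((g,n))$ is finite-dimensional, and $$\mathbf{Ch}(\mathsf{F}\mathcal{A})=\mathrm{Log}\bigl(\exp(-\Delta)\,\mathrm{Exp}(\mathbf{Ch}(\mathcal{A}))\bigr).$$ -/

import Mathlib

universe u w

namespace ModularOperads

open Sum

/-- A finite graph with legs (not necessarily connected): finite sets `V` of vertices, `E` of edges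
and `L` of legs, and a genus for every vertex. The flags of the graph are the legs and the two halves
`(e, false)`, `(e, true)` of every edge `e`; `vert` sends a flag to its vertex. The linear orders on
vertices and edges, and the numbering of the two halves of an edge, are auxiliary data: they serve to
write down signs, and morphisms need not respect them. -/
structure Graph where
  V : Type
  E : Type
  L : Type
  [fintypeV : Fintype V]
  [linearOrderV : LinearOrder V]
  [fintypeE : Fintype E]
  [linearOrderE : LinearOrder E]
  [finiteL : Finite L]
  vert : L ⊕ E × Bool → V
  genus : V → ℕ

attribute [instance] Graph.fintypeV Graph.linearOrderV Graph.fintypeE Graph.linearOrderE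
  Graph.finiteL

namespace Graph

/-- The flags: legs and half-edges. -/
abbrev Flag (G : Graph) : Type := G.L ⊕ G.E × Bool

/-- The flags at the vertex `v`. -/
abbrev Star (G : Graph) (v : G.V) : Type := {a : G.Flag // G.vert a = v}

/-- `u` and `v` are the two ends of an edge in `P`. -/
def Joined (G : Graph) (P : G.E → Prop) (u v : G.V) : Prop :=
  ∃ e, P e ∧ ∃ b, G.vert (inr (e, b)) = u ∧ G.vert (inr (e, !b)) = v

/-- `u` and `v` are joined by a path whose edges are all in `P`. -/
abbrev Chain (G : Graph) (P : G.E → Prop) : G.V → G.V → Prop :=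
  Relation.ReflTransGen (G.Joined P)

theorem Chain.mono {G : Graph} {P Q : G.E → Prop} (h : ∀ e, P e → Q e) {u v : G.V}
    (c : G.Chain P u v) : G.Chain Q u v := by
  induction c with
  | refl => exact .refl
  | tail _ hj ih =>
    obtain ⟨e, he, hb⟩ := hj
    exact ih.tail ⟨e, h e he, hb⟩

/-- The graph is connected (and not empty). -/
def Connected (G : Graph) : Prop :=
  Nonempty G.V ∧ ∀ u v, G.Chain (fun _ => True) u v

/-- The genus of a connected graph is `∑ (g(v) - 1) + |E| + 1`; the equation `g(G) = g` is written
here without subtraction. -/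
def HasGenus (G : Graph) (g : ℕ) : Prop :=
  ∑ v, G.genus v + Fintype.card G.E + 1 = g + Fintype.card G.V

open Classical in
/-- A morphism of graphs `G → H`: some edges of `G` (those outside the range of `onE`) are contracted,
and the result is identified with `H`. `onV` is the induced map on vertices, `onE` and `onL` the
inclusions of the edges and legs of `H` in those of `G`, and `flip e` tells whether the numberings of
the two halves of `e` and of `onE e` differ. Each `onV ⁻¹ {v}`, with the contracted edges over
`v`, is a connected graph (`conn`) of genus `g(v)` (`genus_eq`). In particular the morphisms with
`onV` and `onE` bijective are the isomorphisms. -/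
structure Hom (G H : Graph) where
  onV : G.V → H.V
  onE : H.E → G.E
  flip : H.E → Bool
  onL : H.L ≃ G.L
  onE_inj : Function.Injective onE
  onV_surj : Function.Surjective onV
  vert_leg : ∀ l, onV (G.vert (inl (onL l))) = H.vert (inl l)
  vert_edge : ∀ e b, onV (G.vert (inr (onE e, xor b (flip e)))) = H.vert (inr (e, b))
  contract : ∀ e, e ∉ Set.range onE → ∀ b b', onV (G.vert (inr (e, b))) = onV (G.vert (inr (e, b')))
  conn : ∀ u v, onV u = onV v → G.Chain (fun e => e ∉ Set.range onE) u v
  genus_eq : ∀ v, ∑ u with onV u = v, G.genus u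
      + Finset.card {e | e ∉ Set.range onE ∧ onV (G.vert (inr (e, false))) = v} + 1
    = H.genus v + Finset.card {u | onV u = v}

namespace Hom

variable {G H K : Graph}

theorem ext' {f f' : Hom G H} (h1 : f.onV = f'.onV) (h2 : f.onE = f'.onE)
    (h3 : f.flip = f'.flip) (h4 : f.onL = f'.onL) : f = f' := by
  cases f; cases f'; simp_all

theorem chain_lift (f : Hom G H) (Q : H.E → Prop) {x y : H.V} (h : H.Chain Q x y) :
    ∀ u v, f.onV u = x → f.onV v = y →
      G.Chain (fun e => e ∉ Set.range f.onE ∨ ∃ a, Q a ∧ f.onE a = e) u v := by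
  have mono : ∀ {u v}, G.Chain (fun e => e ∉ Set.range f.onE) u v →
      G.Chain (fun e => e ∉ Set.range f.onE ∨ ∃ a, Q a ∧ f.onE a = e) u v := by
    intro u v h
    exact Chain.mono (fun e he => Or.inl he) h
  induction h with
  | refl => intro u v hu hv; exact mono (f.conn u v (hu.trans hv.symm))
  | tail _ hj ih =>
    obtain ⟨a, ha, b, h1, h2⟩ := hj
    intro u v hu hv
    refine (ih u _ hu ((f.vert_edge a b).trans h1)).trans ?_
    refine Relation.ReflTransGen.head (b := G.vert (inr (f.onE a, xor (!b) (f.flip a)))) ?_ ?_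
    · refine ⟨f.onE a, Or.inr ⟨a, ha, rfl⟩, xor b (f.flip a), rfl, ?_⟩
      simp
    · exact mono (f.conn _ _ ((f.vert_edge a (!b)).trans (h2.trans hv.symm)))

open Classical in
theorem genus_sum (f : Hom G H) (Z : Finset H.V) :
    ∑ u with f.onV u ∈ Z, G.genus u
      + Finset.card {e | e ∉ Set.range f.onE ∧ f.onV (G.vert (inr (e, false))) ∈ Z} + Z.card
    = ∑ x ∈ Z, H.genus x + Finset.card {u | f.onV u ∈ Z} := by
  have h := Finset.sum_congr (rfl : Z = Z) (fun v _ => f.genus_eq v)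
  simp only [Finset.sum_add_distrib] at h
  have e1 : ∑ v ∈ Z, ∑ u with f.onV u = v, G.genus u = ∑ u with f.onV u ∈ Z, G.genus u := by
    rw [← Finset.sum_fiberwise_of_maps_to (s := {u | f.onV u ∈ Z}) (t := Z) (g := f.onV)
      (by simp)]
    refine Finset.sum_congr rfl fun v hv => Finset.sum_congr ?_ fun _ _ => rfl
    ext u; simp only [Finset.mem_filter, Finset.mem_univ, true_and]
    constructor
    · rintro rfl; exact ⟨hv, rfl⟩
    · exact fun h => h.2
  have e2 : ∑ v ∈ Z, Finset.card {u | f.onV u = v} = Finset.card {u | f.onV u ∈ Z} := by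
    rw [Finset.card_eq_sum_card_fiberwise (s := {u | f.onV u ∈ Z}) (t := Z) (f := f.onV)
      (by intro u; simp)]
    refine Finset.sum_congr rfl fun v hv => congrArg _ ?_
    ext u; simp only [Finset.mem_filter, Finset.mem_univ, true_and]
    constructor
    · rintro rfl; exact ⟨hv, rfl⟩
    · exact fun h => h.2
  have e3 : ∑ v ∈ Z, Finset.card {e | e ∉ Set.range f.onE ∧ f.onV (G.vert (inr (e, false))) = v}
      = Finset.card {e | e ∉ Set.range f.onE ∧ f.onV (G.vert (inr (e, false))) ∈ Z} := by
    rw [Finset.card_eq_sum_card_fiberwise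
      (s := {e | e ∉ Set.range f.onE ∧ f.onV (G.vert (inr (e, false))) ∈ Z}) (t := Z)
      (f := fun e => f.onV (G.vert (inr (e, false)))) (by intro e; simp +contextual)]
    refine Finset.sum_congr rfl fun v hv => congrArg _ ?_
    ext u; simp only [Finset.mem_filter, Finset.mem_univ, true_and]
    constructor
    · rintro ⟨h, rfl⟩; exact ⟨⟨h, hv⟩, rfl⟩
    · exact fun h => ⟨h.1.1, h.2⟩
  rw [e1, e2, e3] at h
  simpa using h

theorem connected_iff (f : Hom G H) : G.Connected ↔ H.Connected := by
  constructor
  · rintro ⟨⟨v⟩, h⟩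
    refine ⟨⟨f.onV v⟩, fun x y => ?_⟩
    obtain ⟨u, rfl⟩ := f.onV_surj x
    obtain ⟨v, rfl⟩ := f.onV_surj y
    have := h u v
    clear * - this
    induction this with
    | refl => exact .refl
    | tail _ hj ih =>
      refine ih.trans ?_
      obtain ⟨e, -, b, rfl, rfl⟩ := hj
      by_cases he : e ∈ Set.range f.onE
      · obtain ⟨a, rfl⟩ := he
        refine .single ⟨a, trivial, xor b (f.flip a), ?_, ?_⟩
        · rw [← f.vert_edge]; simp
        · rw [← f.vert_edge]; simp
      · rw [f.contract e he b (!b)]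
  · rintro ⟨⟨v⟩, h⟩
    obtain ⟨u, rfl⟩ := f.onV_surj v
    refine ⟨⟨u⟩, fun u v => ?_⟩
    exact Chain.mono (fun _ _ => trivial) (f.chain_lift _ (h (f.onV u) (f.onV v)) u v rfl rfl)

open Classical in
theorem card_E (f : Hom G H) :
    Finset.card {e | e ∉ Set.range f.onE} + Fintype.card H.E = Fintype.card G.E := by
  have : Finset.univ.filter (fun e => e ∈ Set.range f.onE) = Finset.univ.map ⟨f.onE, f.onE_inj⟩ := by
    ext; simp
  have h2 := Finset.card_filter_add_card_filter_not (s := (Finset.univ : Finset G.E))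
    (p := fun e => e ∈ Set.range f.onE)
  rw [this, Finset.card_map] at h2
  simp only [Finset.card_univ] at h2
  omega

theorem hasGenus_iff (f : Hom G H) (g : ℕ) : G.HasGenus g ↔ H.HasGenus g := by
  classical
  have h1 := f.genus_sum Finset.univ
  have h2 := f.card_E
  simp only [Finset.mem_univ, and_true, Finset.filter_true, Finset.card_univ] at h1
  unfold HasGenus
  omega

/-- The composition of morphisms. -/
def comp (h : Hom H K) (f : Hom G H) : Hom G K where
  onV := h.onV ∘ f.onV
  onE := f.onE ∘ h.onE
  flip e := xor (h.flip e) (f.flip (h.onE e))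
  onL := h.onL.trans f.onL
  onE_inj := f.onE_inj.comp h.onE_inj
  onV_surj := h.onV_surj.comp f.onV_surj
  vert_leg l := by simp [f.vert_leg, h.vert_leg]
  vert_edge e b := by
    simp only [Function.comp]
    rw [← Bool.xor_assoc, f.vert_edge, h.vert_edge]
  contract e he b b' := by
    simp only [Function.comp]
    by_cases h1 : e ∈ Set.range f.onE
    · obtain ⟨x, rfl⟩ := h1
      have hx : x ∉ Set.range h.onE := by
        rintro ⟨y, rfl⟩; exact he ⟨y, rfl⟩
      have := h.contract x hx (xor b (f.flip x)) (xor b' (f.flip x))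
      rw [← f.vert_edge, ← f.vert_edge] at this
      simpa using this
    · rw [f.contract e h1 b b']
  conn u v huv := by
    refine Chain.mono ?_ (f.chain_lift _ (h.conn (f.onV u) (f.onV v) huv) u v rfl rfl)
    intro e he
    rintro ⟨y, rfl⟩
    rcases he with he | ⟨a, ha, hae⟩
    · exact he ⟨_, rfl⟩
    · exact ha ⟨y, (f.onE_inj hae).symm⟩
  genus_eq z := by
    classical
    have h1 := h.genus_eq z
    have h2 := f.genus_sum {x | h.onV x = z}
    simp only [Finset.mem_filter, Finset.mem_univ, true_and] at h2
    have h3 : Finset.card {e | e ∉ Set.range (f.onE ∘ h.onE)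
          ∧ (h.onV ∘ f.onV) (G.vert (inr (e, false))) = z}
        = Finset.card {e | e ∉ Set.range f.onE ∧ h.onV (f.onV (G.vert (inr (e, false)))) = z}
        + Finset.card {e | e ∉ Set.range h.onE ∧ h.onV (H.vert (inr (e, false))) = z} := by
      rw [← Finset.card_map ⟨f.onE, f.onE_inj⟩ (s := {e | e ∉ Set.range h.onE ∧ _}),
        ← Finset.card_union_of_disjoint]
      · congr 1
        ext e
        simp only [Finset.mem_filter, Finset.mem_univ, true_and, Finset.mem_union,
          Finset.mem_map, Function.Embedding.coeFn_mk, Function.comp]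
        by_cases h1 : e ∈ Set.range f.onE
        · obtain ⟨x, rfl⟩ := h1
          constructor
          · rintro ⟨hx, hz⟩
            have hx' : x ∉ Set.range h.onE := by
              rintro ⟨y, rfl⟩; exact hx ⟨y, rfl⟩
            refine Or.inr ⟨x, ⟨hx', ?_⟩, rfl⟩
            rw [h.contract x hx' false (f.flip x)]
            have := f.vert_edge x (f.flip x)
            simp only [Bool.xor_self] at this
            rwa [← this]
          · rintro (⟨hx, -⟩ | ⟨x', ⟨hx', hz⟩, hxx⟩)
            · exact absurd ⟨x, rfl⟩ hx
            · obtain rfl := f.onE_inj hxx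
              refine ⟨?_, ?_⟩
              · rintro ⟨y, hy⟩; exact hx' ⟨y, f.onE_inj hy⟩
              · rw [h.contract x' hx' false (f.flip x')] at hz
                have := f.vert_edge x' (f.flip x')
                simp only [Bool.xor_self] at this
                rwa [← this] at hz
        · constructor
          · rintro ⟨_, hz⟩; exact Or.inl ⟨h1, hz⟩
          · rintro (⟨_, hz⟩ | ⟨x, _, rfl⟩)
            · refine ⟨?_, hz⟩
              rintro ⟨y, rfl⟩; exact h1 ⟨_, rfl⟩
            · exact absurd ⟨x, rfl⟩ h1
      · rw [Finset.disjoint_left]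
        intro e he he'
        simp only [Finset.mem_filter, Finset.mem_univ, true_and, Finset.mem_map,
          Function.Embedding.coeFn_mk] at he he'
        obtain ⟨x, _, rfl⟩ := he'
        exact he.1 ⟨x, rfl⟩
    rw [h3]
    simp only [Function.comp]
    omega

/-- Two morphisms that contract the same edges differ by an isomorphism. -/
theorem exists_comp_eq (f : Hom G H) (f' : Hom G K)
    (hr : Set.range f.onE = Set.range f'.onE) :
    ∃ h : Hom H K, h.comp f = f' ∧ Function.Bijective h.onV ∧ Function.Bijective h.onE := by
  classical
  have hconst : ∀ u v, f.onV u = f.onV v → f'.onV u = f'.onV v := by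
    intro u v huv
    have := f.conn u v huv
    clear huv
    induction this with
    | refl => rfl
    | tail _ hj ih =>
      obtain ⟨e, he, b, rfl, rfl⟩ := hj
      exact ih.trans (f'.contract e (hr ▸ he) _ _)
  have hconst' : ∀ u v, f'.onV u = f'.onV v → f.onV u = f.onV v := by
    intro u v huv
    have := f'.conn u v huv
    clear huv
    induction this with
    | refl => rfl
    | tail _ hj ih =>
      obtain ⟨e, he, b, rfl, rfl⟩ := hj
      exact ih.trans (f.contract e (hr ▸ he) _ _)
  have hsec := Function.surjInv_eq f.onV_surj
  set s := Function.surjInv f.onV_surj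
  have hV : ∀ u, f'.onV (s (f.onV u)) = f'.onV u := fun u => hconst _ _ (hsec _)
  have hE : ∀ e, ∃ x, f.onE x = f'.onE e := fun e => by
    have : f'.onE e ∈ Set.range f.onE := hr ▸ ⟨e, rfl⟩
    exact this
  choose t ht using hE
  have hVi : Function.Injective (fun x => f'.onV (s x)) := by
    intro x y hxy
    have := hconst' _ _ hxy
    rwa [hsec, hsec] at this
  have tinj : Function.Injective t := by
    intro a b hab
    exact f'.onE_inj (by rw [← ht, ← ht, hab])
  have tsurj : Function.Surjective t := by
    intro x
    have : f.onE x ∈ Set.range f'.onE := hr ▸ ⟨x, rfl⟩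
    obtain ⟨e, he⟩ := this
    exact ⟨e, f.onE_inj ((ht e).trans he)⟩
  refine ⟨{ onV := fun x => f'.onV (s x), onE := t, flip := fun e => xor (f'.flip e) (f.flip (t e)),
            onL := f'.onL.trans f.onL.symm, onE_inj := tinj, onV_surj := ?_, vert_leg := ?_,
            vert_edge := ?_, contract := ?_, conn := ?_, genus_eq := ?_ }, ?_, ?_, ⟨tinj, tsurj⟩⟩
  · intro y
    obtain ⟨u, rfl⟩ := f'.onV_surj y
    exact ⟨f.onV u, hV u⟩
  · intro l
    rw [← f.vert_leg, hV, ← f'.vert_leg]; simp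
  · intro e b
    rw [← f.vert_edge, hV, ← f'.vert_edge, ht]; simp
  · intro e he
    exact absurd (tsurj e) he
  · intro x y hxy
    rw [hVi hxy]
  · intro y
    obtain ⟨u, rfl⟩ := f'.onV_surj y
    have h1 := f.genus_eq (f.onV u)
    have h2 := f'.genus_eq (f'.onV u)
    have h3 : ∀ v, f'.onV v = f'.onV u ↔ f.onV v = f.onV u := fun v => ⟨hconst' _ _, hconst _ _⟩
    simp only [h3, ← hr] at h2
    have h4 : (Finset.univ.filter fun x => f'.onV (s x) = f'.onV u) = {f.onV u} := by
      ext x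
      simp only [Finset.mem_filter, Finset.mem_univ, true_and, Finset.mem_singleton]
      rw [← hV u]
      exact hVi.eq_iff
    rw [h4]
    have h5 : (Finset.univ.filter fun e => e ∉ Set.range t ∧
        f'.onV (s (H.vert (inr (e, false)))) = f'.onV u) = ∅ := by
      ext e; simpa using fun h => absurd (tsurj e) (by simpa using h)
    rw [h5]
    simp
    omega
  · refine ext' ?_ ?_ ?_ ?_
    · funext u; exact hV u
    · funext e; exact ht e
    · funext e; simp [comp]
    · ext l; simp [comp]
  · refine ⟨hVi, fun y => ?_⟩
    obtain ⟨u, rfl⟩ := f'.onV_surj y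
    exact ⟨f.onV u, hV u⟩

end Hom

/-- The vertices of `G / e`: the end `(e, true)` is removed if the two ends are distinct. -/
abbrev contrV (G : Graph) (e : G.E) : Type :=
  {v : G.V // v = G.vert (inr (e, false)) ∨ v ≠ G.vert (inr (e, true))}

/-- The projection from the vertices of `G` to those of `G / e`. -/
def contrMap (G : Graph) (e : G.E) (v : G.V) : G.contrV e :=
  if h : v = G.vert (inr (e, true)) then ⟨G.vert (inr (e, false)), Or.inl rfl⟩ else ⟨v, Or.inr h⟩

/-- The genus of the vertices of `G / e`: the genera of two ends that are merged are added, and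
contracting a loop adds one to the genus. -/
def contrGenus (G : Graph) (e : G.E) (v : G.contrV e) : ℕ :=
  if v.1 = G.vert (inr (e, false)) then
    if G.vert (inr (e, false)) = G.vert (inr (e, true)) then G.genus v.1 + 1
    else G.genus (G.vert (inr (e, false))) + G.genus (G.vert (inr (e, true)))
  else G.genus v.1

/-- The graph `G / e` obtained by contracting the edge `e`. -/
def contr (G : Graph) (e : G.E) : Graph where
  V := G.contrV e
  E := {x : G.E // x ≠ e}
  L := G.L
  vert := Sum.elim (fun l => G.contrMap e (G.vert (inl l)))
    (fun x => G.contrMap e (G.vert (inr (x.1.1, x.2))))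
  genus := G.contrGenus e

theorem contrMap_val (G : Graph) (e : G.E) (v : G.contrV e) : G.contrMap e v.1 = v := by
  apply Subtype.ext
  unfold contrMap
  split_ifs with h
  · rcases v.2 with h' | h'
    · exact h'.symm
    · exact absurd h h'
  · rfl

theorem contrMap_eq_iff (G : Graph) (e : G.E) (u v : G.V) :
    G.contrMap e u = G.contrMap e v ↔ u = v ∨
      (u = G.vert (inr (e, false)) ∧ v = G.vert (inr (e, true))) ∨
      (u = G.vert (inr (e, true)) ∧ v = G.vert (inr (e, false))) := by
  unfold contrMap
  grind

open Classical in
theorem contr_genus_eq (G : Graph) (e : G.E) (v : G.contrV e) :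
    ∑ u with G.contrMap e u = v, G.genus u
      + Finset.card {x | x ∉ Set.range (Subtype.val : {x : G.E // x ≠ e} → G.E) ∧
          G.contrMap e (G.vert (inr (x, false))) = v} + 1
    = G.contrGenus e v + Finset.card {u | G.contrMap e u = v} := by
  obtain ⟨u, rfl⟩ : ∃ u, G.contrMap e u = v := ⟨v.1, G.contrMap_val e v⟩
  have h1 : (Finset.univ.filter fun x => x ∉ Set.range (Subtype.val : {x : G.E // x ≠ e} → G.E) ∧
      G.contrMap e (G.vert (inr (x, false))) = G.contrMap e u)
      = if G.contrMap e (G.vert (inr (e, false))) = G.contrMap e u then {e} else ∅ := by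
    ext x; split_ifs with h <;> simp <;> grind
  have h0 : G.contrMap e (G.vert (inr (e, false))) = G.contrMap e (G.vert (inr (e, true))) := by
    rw [contrMap_eq_iff]; simp
  rw [h1]
  by_cases hu : G.contrMap e (G.vert (inr (e, false))) = G.contrMap e u
  · rw [if_pos hu]
    have h2 : (Finset.univ.filter fun x => G.contrMap e x = G.contrMap e u)
        = {G.vert (inr (e, false)), G.vert (inr (e, true))} := by
      ext x
      simp only [← hu, Finset.mem_filter, Finset.mem_univ, true_and, Finset.mem_insert,
        Finset.mem_singleton, contrMap_eq_iff]
      grind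
    rw [h2, ← hu]
    have h3 : (G.contrMap e (G.vert (inr (e, false)))).1 = G.vert (inr (e, false)) := by
      unfold contrMap; grind
    simp only [contrGenus, h3, if_true]
    by_cases hst : G.vert (inr (e, false)) = G.vert (inr (e, true))
    · simp [← hst]
    · simp [hst]
  · rw [if_neg hu]
    have h2 : (Finset.univ.filter fun x => G.contrMap e x = G.contrMap e u) = {u} := by
      ext x
      rw [h0] at hu
      simp only [Finset.mem_filter, Finset.mem_univ, true_and,
        Finset.mem_singleton, contrMap_eq_iff] at hu ⊢
      grind
    have h3 : (G.contrMap e u).1 = u ∧ u ≠ G.vert (inr (e, false)) := by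
      constructor
      · rw [h0] at hu; unfold contrMap; grind
      · rintro rfl; exact hu rfl
    simp only [contrGenus, h3.1, if_neg h3.2]
    rw [h2]
    simp

/-- The morphism `G → G / e`. -/
def contrHom (G : Graph) (e : G.E) : Hom G (G.contr e) where
  onV := G.contrMap e
  onE := Subtype.val
  flip _ := false
  onL := Equiv.refl _
  onE_inj := Subtype.val_injective
  onV_surj v := ⟨v.1, G.contrMap_val e v⟩
  vert_leg _ := rfl
  vert_edge e' b := by rw [Bool.xor_false]; rfl
  contract x hx b b' := by
    have hx : x = e := by
      by_contra h; exact hx ⟨⟨x, h⟩, rfl⟩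
    subst hx
    refine (G.contrMap_eq_iff x _ _).2 ?_
    cases b <;> cases b' <;> simp
  conn u v huv := by
    have he : e ∉ Set.range (Subtype.val : {x : G.E // x ≠ e} → G.E) := by simp
    rcases (G.contrMap_eq_iff e _ _).1 huv with rfl | ⟨rfl, rfl⟩ | ⟨rfl, rfl⟩
    · exact .refl
    · exact .single ⟨e, he, false, rfl, rfl⟩
    · exact .single ⟨e, he, true, rfl, rfl⟩
  genus_eq v := by convert G.contr_genus_eq e v <;> rfl

namespace Hom
variable {G H K : Graph}

/-- The inclusion of the flags of `H` in those of `G`. -/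
def onF (f : Hom G H) : H.Flag → G.Flag :=
  Sum.map f.onL (fun x => (f.onE x.1, xor x.2 (f.flip x.1)))

theorem vert_onF (f : Hom G H) (a : H.Flag) : f.onV (G.vert (f.onF a)) = H.vert a := by
  rcases a with l | ⟨e, b⟩
  · exact f.vert_leg l
  · exact f.vert_edge e b

theorem onF_inj (f : Hom G H) : Function.Injective f.onF := by
  refine Function.Injective.sumMap f.onL.injective ?_
  rintro ⟨e, b⟩ ⟨e', b'⟩ h
  simp only [Prod.mk.injEq] at h
  obtain rfl := f.onE_inj h.1
  simpa using h.2

open Classical in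
/-- The graph `f⁻¹(v)`: the vertices over `v`, the contracted edges over `v`, and as legs the flags
at `v`. -/
def fibre (f : Hom G H) (v : H.V) : Graph where
  V := {u : G.V // f.onV u = v}
  E := {e : G.E // e ∉ Set.range f.onE ∧ f.onV (G.vert (inr (e, false))) = v}
  L := H.Star v
  vert := Sum.elim
    (fun a => ⟨G.vert (f.onF a.1), (f.vert_onF a.1).trans a.2⟩)
    (fun x => ⟨G.vert (inr (x.1.1, x.2)), (f.contract x.1.1 x.1.2.1 _ _).trans x.1.2.2⟩)
  genus u := G.genus u.1

theorem fibre_connected (f : Hom G H) (v : H.V) : (f.fibre v).Connected := by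
  obtain ⟨u, hu⟩ := f.onV_surj v
  refine ⟨⟨⟨u, hu⟩⟩, ?_⟩
  rintro ⟨x, hx⟩ ⟨y, hy⟩
  have := f.conn x y (hx.trans hy.symm)
  induction this with
  | refl => exact .refl
  | @tail a b hab hj ih =>
    obtain ⟨e, he, b, rfl, rfl⟩ := hj
    have hv : f.onV (G.vert (inr (e, b))) = v := (f.contract e he _ _).trans hy
    refine (ih hv).tail ?_
    exact ⟨⟨e, he, (f.contract e he _ _).trans hv⟩, trivial, b, rfl, rfl⟩

theorem fibre_genus (f : Hom G H) (v : H.V) : (f.fibre v).HasGenus (H.genus v) := by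
  classical
  have h := f.genus_eq v
  have e1 : Fintype.card (f.fibre v).V = Finset.card {u | f.onV u = v} :=
    Fintype.card_subtype _
  have e2 : Fintype.card (f.fibre v).E
      = Finset.card {e | e ∉ Set.range f.onE ∧ f.onV (G.vert (inr (e, false))) = v} :=
    Fintype.card_subtype _
  have e3 : ∑ u, (f.fibre v).genus u = ∑ u with f.onV u = v, G.genus u :=
    (Finset.sum_subtype _ (by simp) _).symm
  unfold HasGenus
  rw [e1, e2, e3]
  exact h

/-- A vertex of `f⁻¹(v)` has the same flags in `f⁻¹(v)` as in `G`. -/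
noncomputable def starEquiv (f : Hom G H) (v : H.V) (u : (f.fibre v).V) :
    (f.fibre v).Star u ≃ G.Star u.1 :=
  Equiv.ofBijective
    (fun a => ⟨Sum.elim (fun b => f.onF b.1) (fun x => inr (x.1.1, x.2)) a.1, by
      obtain ⟨a, rfl⟩ := a
      rcases a with a | a <;> rfl⟩)
    (by
      constructor
      · rintro ⟨a, ha⟩ ⟨b, hb⟩ hab
        have hab := congrArg Subtype.val hab
        have key : ∀ (c : H.Star v) (x : (f.fibre v).E × Bool), f.onF c.1 ≠ inr (x.1.1, x.2) := by
          rintro ⟨l | ⟨e, b⟩, hc⟩ ⟨⟨e', he'⟩, b'⟩ h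
          · cases h
          · simp only [onF, Sum.map_inr, Sum.inr.injEq, Prod.mk.injEq] at h
            exact he'.1 ⟨e, h.1⟩
        apply Subtype.ext
        rcases a with a | a <;> rcases b with b | b
        · simp only [Sum.elim_inl] at hab
          exact congrArg inl (Subtype.ext (f.onF_inj hab))
        · exact absurd hab (key a b)
        · exact absurd hab.symm (key b a)
        · simp only [Sum.elim_inr, Sum.inr.injEq, Prod.mk.injEq] at hab
          exact congrArg inr (Prod.ext (Subtype.ext hab.1) hab.2)
      · rintro ⟨a, ha⟩
        by_cases hr : ∃ c, f.onF c = a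
        · obtain ⟨c, rfl⟩ := hr
          have hc : H.vert c = v := by rw [← f.vert_onF, ha]; exact u.2
          exact ⟨⟨inl ⟨c, hc⟩, Subtype.ext ha⟩, rfl⟩
        · rcases a with l | ⟨e, b⟩
          · exact absurd ⟨inl (f.onL.symm l), by simp [onF]⟩ hr
          · have he : e ∉ Set.range f.onE := by
              rintro ⟨x, rfl⟩
              exact hr ⟨inr (x, xor b (f.flip x)), by simp [onF]⟩
            have hv : f.onV (G.vert (inr (e, false))) = v := by
              rw [f.contract e he false b, ha]; exact u.2
            exact ⟨⟨inr (⟨e, he, hv⟩, b), Subtype.ext ha⟩, rfl⟩)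

end Hom

/-- The flags at the only vertex of a graph without edges are the legs. -/
noncomputable def starEquivL (G : Graph) (v : G.V) (hV : ∀ u, u = v) (hE : IsEmpty G.E) :
    G.Star v ≃ G.L :=
  (Equiv.ofBijective (fun l => ⟨inl l, hV _⟩)
    ⟨fun a b h => by simpa using h, by
      rintro ⟨l | ⟨e, b⟩, h⟩
      · exact ⟨l, rfl⟩
      · exact (hE.false e).elim⟩).symm

/-- A connected graph whose genus and legs are unstable has an unstable vertex. -/
theorem exists_unstable (G : Graph) (g : ℕ) (hc : G.Connected) (hg : G.HasGenus g)
    (h : 2 * g + Nat.card G.L ≤ 2) : ∃ v, 2 * G.genus v + Nat.card (G.Star v) ≤ 2 := by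
  classical
  by_contra hcon
  push Not at hcon
  have := Fintype.ofFinite G.L
  have h1 : ∑ v, Nat.card (G.Star v) = Nat.card G.L + 2 * Fintype.card G.E := by
    have := Fintype.card_congr (Equiv.sigmaFiberEquiv G.vert)
    rw [Fintype.card_sigma] at this
    simp only [Nat.card_eq_fintype_card]
    rw [this]
    simp [Fintype.card_sum, Fintype.card_prod]
    ring
  obtain ⟨⟨v0⟩, -⟩ := hc
  have h2 : ∑ v : G.V, 2 < ∑ v, (2 * G.genus v + Nat.card (G.Star v)) :=
    Finset.sum_lt_sum_of_nonempty ⟨v0, Finset.mem_univ _⟩ fun v _ => hcon v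
  rw [Finset.sum_add_distrib, ← Finset.mul_sum, h1] at h2
  unfold HasGenus at hg
  rw [Finset.sum_const, Finset.card_univ, smul_eq_mul] at h2
  omega

end Graph

open Sum DirectSum
open scoped TensorProduct

/-- A stable `𝕊`-module `V` of chain complexes over `k`, in the form of a functor on finite sets and
bijections: `obj g I i` is the component of degree `i` of `V((g, I))`, `d` the differential (of degree
`-1`), `map` the action of bijections, and `V((g, I)) = 0` if `2 g - 2 + |I| ≤ 0`. The representation
`V((g, n))` of `Sₙ` is `V((g, I))` for `I = Fin n`. -/
structure StableSModule (k : Type u) [Field k] where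
  obj : ℕ → (I : Type) → [Finite I] → ℤ → Type w
  [addCommGroup : ∀ (g : ℕ) (I : Type) [Finite I] (i : ℤ), AddCommGroup (obj g I i)]
  [module : ∀ (g : ℕ) (I : Type) [Finite I] (i : ℤ), Module k (obj g I i)]
  d : ∀ {g : ℕ} {I : Type} [Finite I] (i : ℤ), obj g I i →ₗ[k] obj g I (i - 1)
  d_comp_d : ∀ {g : ℕ} {I : Type} [Finite I] (i : ℤ) (x : obj g I i), d (i - 1) (d i x) = 0
  map : ∀ {g : ℕ} {I J : Type} [Finite I] [Finite J] (_ : I ≃ J) (i : ℤ),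
    obj g I i →ₗ[k] obj g J i
  map_refl : ∀ {g : ℕ} {I : Type} [Finite I] (i : ℤ) (x : obj g I i), map (Equiv.refl I) i x = x
  map_trans : ∀ {g : ℕ} {I J K : Type} [Finite I] [Finite J] [Finite K] (e : I ≃ J) (f : J ≃ K)
    (i : ℤ) (x : obj g I i), map (e.trans f) i x = map f i (map e i x)
  map_d : ∀ {g : ℕ} {I J : Type} [Finite I] [Finite J] (e : I ≃ J) (i : ℤ) (x : obj g I i),
    map e (i - 1) (d i x) = d i (map e i x)
  stable : ∀ (g : ℕ) (I : Type) [Finite I] (i : ℤ), 2 * g + Nat.card I ≤ 2 →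
    Subsingleton (obj g I i)

attribute [instance] StableSModule.addCommGroup StableSModule.module

namespace StableSModule

variable {k : Type u} [Field k] (A : StableSModule.{u, w} k)

/-- The underlying vector space `⨁ i, V((g, I))ᵢ`. -/
def tot (g : ℕ) (I : Type) [Finite I] : Type w := ⨁ i, A.obj g I i

noncomputable instance (g : ℕ) (I : Type) [Finite I] : AddCommGroup (A.tot g I) :=
  inferInstanceAs (AddCommGroup (⨁ i, A.obj g I i))

noncomputable instance (g : ℕ) (I : Type) [Finite I] : Module k (A.tot g I) :=
  inferInstanceAs (Module k (⨁ i, A.obj g I i))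

/-- The inclusion of the component of degree `i`. -/
noncomputable def incl (g : ℕ) (I : Type) [Finite I] (i : ℤ) : A.obj g I i →ₗ[k] A.tot g I :=
  DirectSum.lof k ℤ (A.obj g I) i

/-- The linear map on `V((g, I))` given by its values on all components. -/
noncomputable def totLift {g : ℕ} {I : Type} [Finite I] {M : Type*} [AddCommGroup M] [Module k M]
    (f : ∀ i, A.obj g I i →ₗ[k] M) : A.tot g I →ₗ[k] M :=
  DirectSum.toModule k ℤ M f

theorem totLift_incl {g : ℕ} {I : Type} [Finite I] {M : Type*} [AddCommGroup M] [Module k M]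
    (f : ∀ i, A.obj g I i →ₗ[k] M) (i : ℤ) (x : A.obj g I i) :
    A.totLift f (A.incl g I i x) = f i x :=
  DirectSum.toModule_lof k i x

/-- The differential of `V((g, I))`. -/
noncomputable def totD (g : ℕ) (I : Type) [Finite I] : A.tot g I →ₗ[k] A.tot g I :=
  A.totLift fun i => A.incl g I (i - 1) ∘ₗ A.d i

/-- The map `x ↦ (-1) ^ |x| x`. -/
noncomputable def totSign (g : ℕ) (I : Type) [Finite I] : A.tot g I →ₗ[k] A.tot g I :=
  A.totLift fun i => if Odd i then -A.incl g I i else A.incl g I i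

/-- The projection to the part of odd degree (`s = true`) or of even degree (`s = false`). -/
noncomputable def totParity (g : ℕ) (I : Type) [Finite I] (s : Bool) : A.tot g I →ₗ[k] A.tot g I :=
  A.totLift fun i => if s = decide (Odd i) then A.incl g I i else 0

/-- The action of a bijection. -/
noncomputable def totMap {g : ℕ} {I J : Type} [Finite I] [Finite J] (e : I ≃ J) :
    A.tot g I →ₗ[k] A.tot g J :=
  A.totLift fun i => A.incl g J i ∘ₗ A.map e i

theorem totD_incl {g : ℕ} {I : Type} [Finite I] (i : ℤ) (x : A.obj g I i) :
    A.totD g I (A.incl g I i x) = A.incl g I (i - 1) (A.d i x) :=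
  A.totLift_incl _ i x

theorem totSign_incl {g : ℕ} {I : Type} [Finite I] (i : ℤ) (x : A.obj g I i) :
    A.totSign g I (A.incl g I i x) = if Odd i then -A.incl g I i x else A.incl g I i x := by
  refine (A.totLift_incl _ i x).trans ?_
  split_ifs <;> rfl

theorem totParity_incl {g : ℕ} {I : Type} [Finite I] (s : Bool) (i : ℤ) (x : A.obj g I i) :
    A.totParity g I s (A.incl g I i x) = if s = decide (Odd i) then A.incl g I i x else 0 := by
  refine (A.totLift_incl _ i x).trans ?_
  split_ifs <;> rfl

theorem totMap_incl {g : ℕ} {I J : Type} [Finite I] [Finite J] (e : I ≃ J) (i : ℤ)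
    (x : A.obj g I i) : A.totMap e (A.incl g I i x) = A.incl g J i (A.map e i x) :=
  A.totLift_incl _ i x

theorem tot_ext {g : ℕ} {I : Type} [Finite I] {M : Type*} [AddCommGroup M] [Module k M]
    {f f' : A.tot g I →ₗ[k] M} (h : ∀ i x, f (A.incl g I i x) = f' (A.incl g I i x)) : f = f' :=
  DirectSum.linearMap_ext k fun i => LinearMap.ext fun x => h i x

theorem totD_totD (g : ℕ) (I : Type) [Finite I] : A.totD g I ∘ₗ A.totD g I = 0 := by
  refine A.tot_ext fun i x => ?_
  simp [totD_incl, A.d_comp_d]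

theorem totSign_totD (g : ℕ) (I : Type) [Finite I] :
    A.totSign g I ∘ₗ A.totD g I = -(A.totD g I ∘ₗ A.totSign g I) := by
  refine A.tot_ext fun i x => ?_
  simp only [LinearMap.comp_apply, LinearMap.neg_apply, totD_incl, totSign_incl]
  by_cases h : Odd i
  · have : ¬ Odd (i - 1) := by
      rw [Int.not_odd_iff_even]; exact h.sub_odd odd_one
    simp [h, this, totD_incl]
  · have : Odd (i - 1) := by
      rw [Int.not_odd_iff_even] at h; exact h.sub_odd odd_one
    simp [h, this, totD_incl]

/-- `V((G)) = ⨂ V((g(v), Star(v)))`, the tensor product over the vertices `v` of `G`. -/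
abbrev tens (G : Graph) : Type (max u w) := ⨂[k] v : G.V, A.tot (G.genus v) (G.Star v)

/-- The tensor `⨂ x(v)` of homogeneous elements `x(v)` of degree `deg v`. -/
noncomputable def pureTens (G : Graph) (deg : G.V → ℤ)
    (x : ∀ v, A.obj (G.genus v) (G.Star v) (deg v)) : A.tens G :=
  PiTensorProduct.tprod k fun v => A.incl _ _ _ (x v)

/-- The factor at `u` of the term of the differential of `V((G))` in which `d` acts at the vertex `v`:
the sign is that of moving `d` past the factors at the vertices `u < v`. -/
noncomputable def tensDAt (G : Graph) (v u : G.V) :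
    A.tot (G.genus u) (G.Star u) →ₗ[k] A.tot (G.genus u) (G.Star u) :=
  if u < v then A.totSign _ _ else if u = v then A.totD _ _ else LinearMap.id

/-- The differential of the tensor product `V((G))`, with the usual signs, the factors being ordered by
the order of the vertices. -/
noncomputable def tensD (G : Graph) : A.tens G →ₗ[k] A.tens G :=
  ∑ v, PiTensorProduct.map (A.tensDAt G v)

theorem tensDAt_anti (G : Graph) {v w : G.V} (h : v < w) :
    PiTensorProduct.map (A.tensDAt G v) ∘ₗ PiTensorProduct.map (A.tensDAt G w)
      + PiTensorProduct.map (A.tensDAt G w) ∘ₗ PiTensorProduct.map (A.tensDAt G v) = 0 := by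
  rw [← PiTensorProduct.map_comp, ← PiTensorProduct.map_comp]
  have : (fun u => A.tensDAt G w u ∘ₗ A.tensDAt G v u)
      = Function.update (fun u => A.tensDAt G v u ∘ₗ A.tensDAt G w u) v
        ((-1 : k) • (A.tensDAt G v v ∘ₗ A.tensDAt G w v)) := by
    funext u
    by_cases hu : u = v
    · subst hu
      rw [Function.update_self, neg_one_smul]
      simp [tensDAt, h, totSign_totD]
    · rw [Function.update_of_ne hu]
      unfold tensDAt
      by_cases h1 : u < v
      · simp [h1, h1.trans h]
      · by_cases h2 : u < w
        · simp [h1, hu, h2]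
        · by_cases h3 : u = w
          · subst h3; simp [hu, h1]
          · simp [h1, hu, h2, h3]
  rw [this, PiTensorProduct.map_update_smul, Function.update_eq_self]
  have h := add_smul (1 : k) (-1) (PiTensorProduct.map
    fun u => A.tensDAt G v u ∘ₗ A.tensDAt G w u)
  rw [one_smul, add_neg_cancel, zero_smul] at h
  exact h.symm

theorem tensD_tensD (G : Graph) : A.tensD G ∘ₗ A.tensD G = 0 := by
  unfold tensD
  have h0 : (∑ v, PiTensorProduct.map (A.tensDAt G v)) ∘ₗ (∑ v, PiTensorProduct.map (A.tensDAt G v))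
      = ∑ p : G.V × G.V, PiTensorProduct.map (A.tensDAt G p.1) ∘ₗ
          PiTensorProduct.map (A.tensDAt G p.2) :=
    (Finset.sum_mul_sum (R := Module.End k (A.tens G)) _ _ _ _).trans
      (Finset.sum_product' _ _ _).symm
  rw [h0]
  refine Finset.sum_involution (fun p _ => (p.2, p.1)) ?_ ?_ (by simp) (by simp)
  · rintro ⟨v, w⟩ -
    rcases lt_trichotomy v w with h | h | h
    · exact A.tensDAt_anti G h
    · subst h
      have : PiTensorProduct.map (A.tensDAt G v) ∘ₗ PiTensorProduct.map (A.tensDAt G v) = 0 := by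
        rw [← PiTensorProduct.map_comp]
        refine PiTensorProduct.ext (MultilinearMap.ext fun x => ?_)
        simp only [LinearMap.compMultilinearMap_apply, PiTensorProduct.map_tprod]
        refine MultilinearMap.map_coord_zero _ v ?_
        simp only [tensDAt, lt_irrefl, if_false, if_true]
        rw [totD_totD]; rfl
      simp [this]
    · rw [add_comm]; exact A.tensDAt_anti G h
  · rintro ⟨v, w⟩ - hne heq
    simp only [Prod.mk.injEq] at heq
    obtain ⟨rfl, -⟩ := heq
    apply hne
    rw [← PiTensorProduct.map_comp]
    refine PiTensorProduct.ext (MultilinearMap.ext fun x => ?_)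
    simp only [LinearMap.compMultilinearMap_apply, PiTensorProduct.map_tprod]
    refine MultilinearMap.map_coord_zero _ w ?_
    simp only [tensDAt, lt_irrefl, if_false, if_true]
    rw [totD_totD]; rfl

theorem tensD_pureTens (G : Graph) (deg : G.V → ℤ)
    (x : ∀ v, A.obj (G.genus v) (G.Star v) (deg v)) :
    A.tensD G (A.pureTens G deg x) ∈ Submodule.span k
      {t | ∃ deg' x', ∑ v, deg' v = ∑ v, deg v - 1 ∧ A.pureTens G deg' x' = t} := by
  unfold tensD
  rw [LinearMap.sum_apply]
  refine Submodule.sum_mem _ fun v _ => ?_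
  unfold pureTens
  rw [PiTensorProduct.map_tprod]
  have key : ∀ u, ∃ y : A.obj (G.genus u) (G.Star u) (if u = v then deg u - 1 else deg u),
      A.tensDAt G v u (A.incl _ _ _ (x u)) = A.incl _ _ _ y := by
    intro u
    unfold tensDAt
    by_cases h : u = v
    · subst h
      rw [if_pos rfl, if_neg (lt_irrefl _), if_pos rfl]
      exact ⟨_, A.totD_incl _ _⟩
    · rw [if_neg h]
      split_ifs
      · rw [totSign_incl]
        split_ifs
        · exact ⟨-x u, by simp⟩
        · exact ⟨x u, rfl⟩
      · exact ⟨x u, rfl⟩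
  choose y hy using key
  simp only [hy]
  refine Submodule.subset_span ⟨_, y, ?_, rfl⟩
  have : ∀ u, (if u = v then deg u - 1 else deg u) = deg u - if u = v then 1 else 0 := by
    intro u; split_ifs <;> simp
  simp [this, Finset.sum_sub_distrib]

/-- The part of degree `j` of `V((G))`. -/
noncomputable def degSub (G : Graph) (j : ℤ) : Submodule k (A.tens G) :=
  Submodule.span k {t | ∃ deg x, ∑ v, deg v = j ∧ A.pureTens G deg x = t}

theorem tensD_degSub (G : Graph) (j : ℤ) {t : A.tens G} (ht : t ∈ A.degSub G j) :
    A.tensD G t ∈ A.degSub G (j - 1) := by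
  induction ht using Submodule.span_induction with
  | mem t h => obtain ⟨deg, x, rfl, rfl⟩ := h; exact A.tensD_pureTens G deg x
  | zero => rw [map_zero]; exact Submodule.zero_mem _
  | add a b _ _ ha hb => rw [map_add]; exact Submodule.add_mem _ ha hb
  | smul c a _ ha => rw [map_smul]; exact Submodule.smul_mem _ c ha

/-- The Koszul sign of the rearrangement of the factors of `V((G))` which groups them by the fibres of
`f`, if `s` tells which factors are odd. -/
noncomputable def koszulSign {G H : Graph} (f : G.Hom H) (s : G.V → Bool) : k :=
  (-1) ^ Finset.card {p : G.V × G.V | p.1 < p.2 ∧ f.onV p.2 < f.onV p.1 ∧ s p.1 ∧ s p.2}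

/-- Multiplication by the Koszul sign on tensors of homogeneous elements. -/
noncomputable def koszul {G H : Graph} (f : G.Hom H) : A.tens G →ₗ[k] A.tens G :=
  ∑ s : G.V → Bool, koszulSign (k := k) f s • PiTensorProduct.map fun v => A.totParity _ _ (s v)

theorem koszul_degSub {G H : Graph} (f : G.Hom H) (j : ℤ) {t : A.tens G} (ht : t ∈ A.degSub G j) :
    A.koszul f t ∈ A.degSub G j := by
  induction ht using Submodule.span_induction with
  | mem t h =>
    obtain ⟨deg, x, rfl, rfl⟩ := h
    unfold koszul
    rw [LinearMap.sum_apply]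
    refine Submodule.sum_mem _ fun s _ => ?_
    rw [LinearMap.smul_apply]
    refine Submodule.smul_mem _ _ (Submodule.subset_span ?_)
    refine ⟨deg, fun v => if s v = decide (Odd (deg v)) then x v else 0, rfl, ?_⟩
    unfold pureTens
    rw [PiTensorProduct.map_tprod]
    congr 1
    funext v
    rw [totParity_incl]
    by_cases h : s v = decide (Odd (deg v))
    · beta_reduce
      rw [if_pos h, if_pos h]
    · beta_reduce
      rw [if_neg h, if_neg h, map_zero]
  | zero => rw [map_zero]; exact Submodule.zero_mem _
  | add a b _ _ ha hb => rw [map_add]; exact Submodule.add_mem _ ha hb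
  | smul c a _ ha => rw [map_smul]; exact Submodule.smul_mem _ c ha

end StableSModule

/-- The multilinear map `x ↦ ⨂ F w (x restricted to the fibre over w)`. -/
noncomputable def tprodFibres {k : Type*} [Field k] {V W : Type} [DecidableEq W] (p : V → W)
    {M : V → Type*} {N : W → Type*} [∀ v, AddCommGroup (M v)] [∀ v, Module k (M v)]
    [∀ w, AddCommGroup (N w)] [∀ w, Module k (N w)]
    (F : ∀ w, MultilinearMap k (fun u : {u : V // p u = w} => M u.1) (N w)) :
    MultilinearMap k M (⨂[k] w, N w) where
  toFun x := PiTensorProduct.tprod k fun w => F w fun u => x u.1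
  map_update_add' := by
    intro _ m i a b
    have h1 : ∀ c, (fun w => F w fun u : {u : V // p u = w} => Function.update m i c u.1)
        = Function.update (fun w => F w fun u => m u.1) (p i)
          (F (p i) (Function.update (fun u : {u : V // p u = p i} => m u.1) ⟨i, rfl⟩ c)) := by
      intro c
      funext w
      by_cases hw : w = p i
      · subst hw
        rw [Function.update_self]
        congr 1
        funext u
        by_cases hu : u = ⟨i, rfl⟩
        · subst hu; simp
        · rw [Function.update_of_ne hu, Function.update_of_ne (fun h => hu (Subtype.ext h))]
      · rw [Function.update_of_ne hw]
        congr 1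
        funext u
        rw [Function.update_of_ne]
        rintro h
        exact hw (by rw [← u.2, h])
    simp only [h1, MultilinearMap.map_update_add]
  map_update_smul' := by
    intro _ m i a b
    have h1 : ∀ c, (fun w => F w fun u : {u : V // p u = w} => Function.update m i c u.1)
        = Function.update (fun w => F w fun u => m u.1) (p i)
          (F (p i) (Function.update (fun u : {u : V // p u = p i} => m u.1) ⟨i, rfl⟩ c)) := by
      intro c
      funext w
      by_cases hw : w = p i
      · subst hw
        rw [Function.update_self]
        congr 1
        funext u
        by_cases hu : u = ⟨i, rfl⟩
        · subst hu; simp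
        · rw [Function.update_of_ne hu, Function.update_of_ne (fun h => hu (Subtype.ext h))]
      · rw [Function.update_of_ne hw]
        congr 1
        funext u
        rw [Function.update_of_ne]
        rintro h
        exact hw (by rw [← u.2, h])
    simp only [h1, MultilinearMap.map_update_smul]

/-- A stable `𝕊`-module with compositions: to every connected graph `G` of genus `g` there is a linear map
`A((G)) → A((g, L))` of degree zero, where `L` is the set of legs. These graphs `G` are automatically
stable when `A((G))` is not zero. The compatibility with the other structure is part of
the definition of `ModularOperad`. -/
structure ModularPreOperad (k : Type u) [Field k] extends StableSModule.{u, w} k where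
  comp : ∀ (G : Graph) (g : ℕ), G.Connected → G.HasGenus g →
    (toStableSModule.tens G →ₗ[k] toStableSModule.tot g G.L)
  comp_degree : ∀ (G : Graph) (g : ℕ) (hc : G.Connected) (hg : G.HasGenus g) (j : ℤ),
    ∀ t ∈ toStableSModule.degSub G j, ∃ y, comp G g hc hg t = toStableSModule.incl g G.L j y

namespace ModularPreOperad

variable {k : Type u} [Field k] (A : ModularPreOperad.{u, w} k)

/-- `⨂ v, (composition along f⁻¹(v))`, without Koszul signs. -/
noncomputable def fibreTens {G H : Graph} (f : G.Hom H) : A.tens G →ₗ[k] A.tens H :=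
  PiTensorProduct.lift <| tprodFibres f.onV
    (M := fun u => A.tot (G.genus u) (G.Star u)) (N := fun v => A.tot (H.genus v) (H.Star v))
    fun v =>
      ((A.comp (f.fibre v) (H.genus v) (f.fibre_connected v) (f.fibre_genus v)).compMultilinearMap
        (PiTensorProduct.tprod k)).compLinearMap fun u => A.totMap (f.starEquiv v u).symm

/-- The map `A((f)) : A((G)) → A((H))` for a morphism `f : G → H`: the tensor product over the vertices
`v` of `H` of the compositions along the graphs `f⁻¹(v)`. -/
noncomputable def mapHom {G H : Graph} (f : G.Hom H) : A.tens G →ₗ[k] A.tens H :=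
  A.fibreTens f ∘ₗ A.koszul f

theorem fibreTens_degSub {G H : Graph} (f : G.Hom H) (j : ℤ) {t : A.tens G}
    (ht : t ∈ A.degSub G j) : A.fibreTens f t ∈ A.degSub H j := by
  induction ht using Submodule.span_induction with
  | mem t h =>
    obtain ⟨deg, x, rfl, rfl⟩ := h
    have key : ∀ v, ∃ y : A.obj (H.genus v) (H.Star v) (∑ u : (f.fibre v).V, deg u.1),
        A.comp (f.fibre v) (H.genus v) (f.fibre_connected v) (f.fibre_genus v)
          (A.pureTens (f.fibre v) (fun u => deg u.1)
            fun u => A.map (f.starEquiv v u).symm _ (x u.1)) = A.incl _ _ _ y :=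
      fun v => A.comp_degree (f.fibre v) (H.genus v) (f.fibre_connected v) (f.fibre_genus v)
        (∑ u : (f.fibre v).V, deg u.1) _ (Submodule.subset_span ⟨fun u => deg u.1,
          fun u => A.map (f.starEquiv v u).symm _ (x u.1), rfl, rfl⟩)
    choose y hy using key
    refine Submodule.subset_span ⟨fun v => ∑ u : (f.fibre v).V, deg u.1, y, ?_, ?_⟩
    · rw [← Fintype.sum_fiberwise f.onV deg]
      exact Finset.sum_congr rfl fun v _ => Fintype.sum_equiv (Equiv.refl _) _ _ fun _ => rfl
    · have : A.fibreTens f (A.pureTens G deg x) = PiTensorProduct.tprod k fun v =>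
          A.comp (f.fibre v) (H.genus v) (f.fibre_connected v) (f.fibre_genus v)
            (PiTensorProduct.tprod k fun u : (f.fibre v).V =>
              A.totMap (f.starEquiv v u).symm (A.incl _ _ _ (x u.1))) :=
        PiTensorProduct.lift.tprod _
      rw [this]
      unfold StableSModule.pureTens
      congr 1
      funext v
      rw [← hy]
      unfold StableSModule.pureTens
      congr 2
      funext u
      exact (A.totMap_incl _ _ _).symm
  | zero => rw [map_zero]; exact Submodule.zero_mem _
  | add a b _ _ ha hb => rw [map_add]; exact Submodule.add_mem _ ha hb
  | smul c a _ ha => rw [map_smul]; exact Submodule.smul_mem _ c ha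

theorem mapHom_degSub {G H : Graph} (f : G.Hom H) (j : ℤ) {t : A.tens G}
    (ht : t ∈ A.degSub G j) : A.mapHom f t ∈ A.degSub H j :=
  A.fibreTens_degSub f j (A.koszul_degSub f j ht)

end ModularPreOperad

/-- A modular operad over `k`: the composition along a graph with one vertex and no edges is the identity
(`comp_corolla`), composition is compatible with morphisms of graphs, that is, it is associative
and natural for isomorphisms (`comp_mapHom`), `G ↦ A((G))` is a functor on graphs
(`mapHom_comp`), and the compositions are morphisms of chain complexes (`mapHom_tensD`). -/
structure ModularOperad (k : Type u) [Field k] extends ModularPreOperad.{u, w} k where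
  comp_corolla : ∀ (G : Graph) (v : G.V) (hV : ∀ u, u = v) (hE : IsEmpty G.E)
    (hc : G.Connected) (hg : G.HasGenus (G.genus v))
    (x : ∀ u, toModularPreOperad.tot (G.genus u) (G.Star u)),
    comp G (G.genus v) hc hg (PiTensorProduct.tprod k x)
      = toModularPreOperad.totMap (G.starEquivL v hV hE) (x v)
  comp_mapHom : ∀ {G H : Graph} (f : G.Hom H) (g : ℕ) (hG : G.Connected) (hg : G.HasGenus g)
    (hH : H.Connected) (hg' : H.HasGenus g) (t : toModularPreOperad.tens G),
    comp H g hH hg' (toModularPreOperad.mapHom f t)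
      = toModularPreOperad.totMap f.onL.symm (comp G g hG hg t)
  mapHom_comp : ∀ {G H K : Graph} (f : G.Hom H) (h : H.Hom K) (t : toModularPreOperad.tens G),
    toModularPreOperad.mapHom (h.comp f) t
      = toModularPreOperad.mapHom h (toModularPreOperad.mapHom f t)
  mapHom_tensD : ∀ {G H : Graph} (f : G.Hom H) (t : toModularPreOperad.tens G),
    toModularPreOperad.mapHom f (toModularPreOperad.tensD G t)
      = toModularPreOperad.tensD H (toModularPreOperad.mapHom f t)

namespace Graph

/-- The number of edges before `e`. -/
def position (G : Graph) (e : G.E) : ℕ := Finset.card {x : G.E | x < e}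

theorem mem_below (G : Graph) (e y : G.E) : y ∈ Finset.univ.filter (fun x => x < e) ↔ y < e := by
  simp

/-- The sign in `e ∧ (the other edges in order) = ± (all edges in order)`. -/
def edgeSign (k : Type u) [Field k] (G : Graph) (e : G.E) : k := (-1) ^ G.position e

/-- The sign of the map that an isomorphism `h` of graphs induces on `Det(Edge)`, with respect to the
generators given by the orders of the edges. -/
def Hom.edgeSign (k : Type u) [Field k] {G H : Graph} (h : G.Hom H) : k :=
  (-1) ^ Finset.card {p : H.E × H.E | p.1 < p.2 ∧ h.onE p.2 < h.onE p.1}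

theorem card_inversions {α β : Type} [Fintype α] [LinearOrder α] [Fintype β] [LinearOrder β]
    (f : α → β) (hf : Function.Bijective f) (e : α) :
    ∃ m, Finset.card {p : α × α | p.1 < p.2 ∧ f p.2 < f p.1} + Finset.card {y | y < f e}
      = Finset.card {p : {x : α // x ≠ e} × {x : α // x ≠ e} |
          p.1.1 < p.2.1 ∧ f p.2.1 < f p.1.1} + Finset.card {x | x < e} + 2 * m := by
  classical
  have h1 : Finset.card {p : {x : α // x ≠ e} × {x : α // x ≠ e} |
          p.1.1 < p.2.1 ∧ f p.2.1 < f p.1.1}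
      = Finset.card {p : α × α | p.1 ≠ e ∧ p.2 ≠ e ∧ p.1 < p.2 ∧ f p.2 < f p.1} := by
    refine Finset.card_bij (fun p _ => (p.1.1, p.2.1)) ?_ ?_ ?_
    · rintro ⟨a, b⟩ h
      simp only [Finset.mem_filter, Finset.mem_univ, true_and] at h ⊢
      exact ⟨a.2, b.2, h⟩
    · rintro ⟨a, b⟩ _ ⟨a', b'⟩ _ h
      simp only [Prod.mk.injEq] at h
      exact Prod.ext (Subtype.ext h.1) (Subtype.ext h.2)
    · rintro ⟨a, b⟩ h
      simp only [Finset.mem_filter, Finset.mem_univ, true_and] at h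
      exact ⟨(⟨a, h.1⟩, ⟨b, h.2.1⟩), by simpa using h.2.2, rfl⟩
  have h2 : Finset.card {p : α × α | p.1 < p.2 ∧ f p.2 < f p.1}
      = Finset.card {p : α × α | p.1 ≠ e ∧ p.2 ≠ e ∧ p.1 < p.2 ∧ f p.2 < f p.1}
        + Finset.card {x : α | x < e ∧ f e < f x} + Finset.card {x : α | e < x ∧ f x < f e} := by
    rw [← Finset.card_map ⟨fun x : α => (x, e), fun a b h => (Prod.mk.inj h).1⟩
        (s := {x : α | x < e ∧ f e < f x}),
      ← Finset.card_map ⟨fun x : α => (e, x), fun a b h => (Prod.mk.inj h).2⟩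
        (s := {x : α | e < x ∧ f x < f e}),
      ← Finset.card_union_of_disjoint, ← Finset.card_union_of_disjoint]
    · congr 1
      ext ⟨a, b⟩
      simp only [Finset.mem_filter, Finset.mem_univ, true_and, Finset.mem_union, Finset.mem_map]
      constructor
      · intro h
        by_cases hb : b = e
        · subst hb; exact Or.inl (Or.inr ⟨a, h, rfl⟩)
        · by_cases ha : a = e
          · subst ha; exact Or.inr ⟨b, h, rfl⟩
          · exact Or.inl (Or.inl ⟨ha, hb, h⟩)
      · rintro ((h | ⟨x, h, rfl, rfl⟩) | ⟨x, h, rfl, rfl⟩)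
        · exact h.2.2
        · exact h
        · exact h
    · rw [Finset.disjoint_left]
      rintro ⟨a, b⟩ h h'
      simp only [Finset.mem_filter, Finset.mem_univ, true_and, Finset.mem_union, Finset.mem_map] at h h'
      obtain ⟨x, hx, rfl, rfl⟩ := h'
      rcases h with h | ⟨y, hy, rfl, rfl⟩
      · exact h.1 rfl
      · exact lt_irrefl _ hy.1
    · rw [Finset.disjoint_left]
      rintro ⟨a, b⟩ h h'
      simp only [Finset.mem_filter, Finset.mem_univ, true_and, Finset.mem_map] at h h'
      obtain ⟨x, hx, rfl, rfl⟩ := h'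
      exact h.2.1 rfl
  have h3 : Finset.card {y | y < f e} = Finset.card {x : α | e < x ∧ f x < f e}
      + Finset.card {x : α | x < e ∧ f x < f e} := by
    have : (Finset.univ.filter fun y => y < f e)
        = (Finset.univ.filter fun x => f x < f e).map ⟨f, hf.1⟩ := by
      ext y
      obtain ⟨x, rfl⟩ := hf.2 y
      simp
    rw [this, Finset.card_map, ← Finset.card_union_of_disjoint]
    · congr 1
      ext x
      simp only [Finset.mem_filter, Finset.mem_univ, true_and, Finset.mem_union]
      constructor
      · intro h
        rcases lt_trichotomy x e with h' | h' | h'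
        · exact Or.inr ⟨h', h⟩
        · subst h'; exact absurd h (lt_irrefl _)
        · exact Or.inl ⟨h', h⟩
      · rintro (h | h) <;> exact h.2
    · rw [Finset.disjoint_left]
      intro x h h'
      simp only [Finset.mem_filter, Finset.mem_univ, true_and] at h h'
      exact lt_asymm h.1 h'.1
  have h4 : Finset.card {x | x < e} = Finset.card {x : α | x < e ∧ f e < f x}
      + Finset.card {x : α | x < e ∧ f x < f e} := by
    rw [← Finset.card_union_of_disjoint]
    · congr 1
      ext x
      simp only [Finset.mem_filter, Finset.mem_univ, true_and, Finset.mem_union]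
      constructor
      · intro h
        rcases lt_trichotomy (f x) (f e) with h' | h' | h'
        · exact Or.inr ⟨h, h'⟩
        · exact absurd (hf.1 h') h.ne
        · exact Or.inl ⟨h, h'⟩
      · rintro (h | h) <;> exact h.1
    · rw [Finset.disjoint_left]
      intro x h h'
      simp only [Finset.mem_filter, Finset.mem_univ, true_and] at h h'
      exact lt_asymm h.2 h'.2
  refine ⟨Finset.card {x : α | e < x ∧ f x < f e}, ?_⟩
  rw [h1, h2, h3, h4]
  ring

theorem exists_contr_iso {G H : Graph} (h : G.Hom H) (hE : Function.Bijective h.onE) (e : H.E) :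
    ∃ h' : (G.contr (h.onE e)).Hom (H.contr e),
      h'.comp (G.contrHom (h.onE e)) = (H.contrHom e).comp h ∧
      Function.Bijective h'.onV ∧ Function.Bijective h'.onE := by
  refine Hom.exists_comp_eq _ _ ?_
  ext x
  obtain ⟨x, rfl⟩ := hE.2 x
  have : ∀ y : H.E, (∃ z : (H.contr e).E, z.1 = y) ↔ y ≠ e :=
    fun y => ⟨by rintro ⟨z, rfl⟩; exact z.2, fun h => ⟨⟨y, h⟩, rfl⟩⟩
  have h2 : ∀ y : G.E, (∃ z : (G.contr (h.onE e)).E, z.1 = y) ↔ y ≠ h.onE e :=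
    fun y => ⟨by rintro ⟨z, rfl⟩; exact z.2, fun h => ⟨⟨y, h⟩, rfl⟩⟩
  constructor
  · rintro ⟨z, hz⟩
    have : h.onE x ≠ h.onE e := (h2 _).1 ⟨z, hz⟩
    exact ⟨⟨x, fun hx => this (congrArg _ hx)⟩, rfl⟩
  · rintro ⟨z, hz⟩
    refine (h2 _).2 fun hx => z.2 (hE.1 ?_)
    exact hz.trans hx

theorem edgeSign_contr_iso (k : Type u) [Field k] {G H : Graph} (h : G.Hom H)
    (hE : Function.Bijective h.onE) (e : H.E) (h' : (G.contr (h.onE e)).Hom (H.contr e))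
    (hh : h'.comp (G.contrHom (h.onE e)) = (H.contrHom e).comp h) :
    H.edgeSign k e * h'.edgeSign k = h.edgeSign k * G.edgeSign k (h.onE e) := by
  obtain ⟨m, hm⟩ := card_inversions h.onE hE e
  have h1 : ∀ x : (H.contr e).E, (h'.onE x).1 = h.onE x.1 :=
    fun x => congrFun (congrArg Hom.onE hh) x
  have h2 : Finset.card {p : (H.contr e).E × (H.contr e).E | p.1 < p.2 ∧ h'.onE p.2 < h'.onE p.1}
      = Finset.card {p : {x : H.E // x ≠ e} × {x : H.E // x ≠ e} |
          p.1.1 < p.2.1 ∧ h.onE p.2.1 < h.onE p.1.1} := by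
    refine Finset.card_equiv (Equiv.refl _) ?_
    rintro ⟨a, b⟩
    simp only [Finset.mem_filter, Finset.mem_univ, true_and]
    change _ ↔ a.1 < b.1 ∧ h.onE b.1 < h.onE a.1
    rw [← h1, ← h1]
    exact Iff.rfl
  unfold edgeSign position Hom.edgeSign
  rw [h2, ← pow_add, ← pow_add, hm, pow_add _ _ (2 * m), pow_mul]
  simp [add_comm]

theorem edgeSign_mul_edgeSign (k : Type u) [Field k] (G : Graph) (e x : G.E) (h : x ≠ e) :
    G.edgeSign k e * (G.contr e).edgeSign k ⟨x, h⟩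
      = -(G.edgeSign k x * (G.contr x).edgeSign k ⟨e, h.symm⟩) := by
  have key : ∀ (e x : G.E) (h : x ≠ e),
      (G.contr e).position ⟨x, h⟩ = Finset.card {y : G.E | y ≠ e ∧ y < x} := by
    intro e x h
    refine Finset.card_bij (fun y _ => y.1) ?_ (fun a _ b _ h => Subtype.ext h) ?_
    · intro y hy
      simp only [Finset.mem_filter, Finset.mem_univ, true_and] at hy ⊢
      exact ⟨y.2, hy⟩
    · intro y hy
      simp only [Finset.mem_filter, Finset.mem_univ, true_and] at hy
      exact ⟨⟨y, hy.1⟩, ((G.contr e).mem_below ⟨x, h⟩ ⟨y, hy.1⟩).2 hy.2, rfl⟩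
  have lt_case : ∀ (e x : G.E) (h : x ≠ e), e < x →
      G.edgeSign k e * (G.contr e).edgeSign k ⟨x, h⟩
      = -(G.edgeSign k x * (G.contr x).edgeSign k ⟨e, h.symm⟩) := by
    intro e x h hlt
    unfold edgeSign
    rw [key e x h, key x e h.symm]
    unfold position
    have h1 : (Finset.univ.filter fun y => y ≠ x ∧ y < e) = Finset.univ.filter fun y => y < e := by
      ext y
      simp only [Finset.mem_filter, Finset.mem_univ, true_and, and_iff_right_iff_imp]
      intro hy
      exact (hy.trans hlt).ne
    have h2 : (Finset.univ.filter fun y => y ≠ e ∧ y < x)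
        = (Finset.univ.filter fun y => y < x).erase e := by
      ext y; simp
    have h3 : Finset.card {y : G.E | y ≠ e ∧ y < x} + 1 = Finset.card {y : G.E | y < x} := by
      rw [h2]
      exact Finset.card_erase_add_one (by simpa using hlt)
    rw [h1, ← h3, pow_succ]
    ring
  rcases lt_or_gt_of_ne h with h' | h'
  · rw [lt_case x e h.symm h', neg_neg]
  · exact lt_case e x h h'

theorem exists_contr_swap (k : Type u) [Field k] (G : Graph) (e x : G.E) (h : x ≠ e) :
    ∃ h' : ((G.contr e).contr ⟨x, h⟩).Hom ((G.contr x).contr ⟨e, h.symm⟩),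
      h'.comp (((G.contr e).contrHom ⟨x, h⟩).comp (G.contrHom e))
        = ((G.contr x).contrHom ⟨e, h.symm⟩).comp (G.contrHom x) ∧
      Function.Bijective h'.onV ∧ Function.Bijective h'.onE ∧
      h'.edgeSign k = 1 ∧ h'.onL = Equiv.refl G.L := by
  obtain ⟨h', hh, hV, hE⟩ := Hom.exists_comp_eq
    (((G.contr e).contrHom ⟨x, h⟩).comp (G.contrHom e))
    (((G.contr x).contrHom ⟨e, h.symm⟩).comp (G.contrHom x)) (by
      have : ∀ (e x : G.E) (h : x ≠ e) (y : G.E),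
          y ∈ Set.range (((G.contr e).contrHom ⟨x, h⟩).comp (G.contrHom e)).onE
            ↔ y ≠ e ∧ y ≠ x := by
        intro e x h y
        constructor
        · rintro ⟨z, rfl⟩
          exact ⟨z.1.2, fun hz => z.2 (Subtype.ext hz)⟩
        · rintro ⟨h1, h2⟩
          exact ⟨⟨⟨y, h1⟩, fun hz => h2 (congrArg Subtype.val hz)⟩, rfl⟩
      ext y
      rw [this, this, and_comm])
  refine ⟨h', hh, hV, hE, ?_, ?_⟩
  · have h1 : ∀ z, (h'.onE z).1.1 = z.1.1 := fun z => congrFun (congrArg Hom.onE hh) z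
    have : Finset.card {p : ((G.contr x).contr ⟨e, h.symm⟩).E × ((G.contr x).contr ⟨e, h.symm⟩).E |
        p.1 < p.2 ∧ h'.onE p.2 < h'.onE p.1} = 0 := by
      rw [Finset.card_eq_zero, Finset.filter_eq_empty_iff]
      rintro ⟨a, b⟩ - ⟨hab, hba⟩
      have h2 : (h'.onE b).1.1 < (h'.onE a).1.1 := hba
      rw [h1, h1] at h2
      exact lt_asymm (show a.1.1 < b.1.1 from hab) h2
    unfold Hom.edgeSign
    rw [this, pow_zero]
  · exact congrArg Hom.onL hh

end Graph

namespace ModularOperad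

variable {k : Type u} [Field k] (A : ModularOperad.{u, w} k)

/-- A linear form on `A((G))` for every graph `G` whose legs are labelled by `I`. By means of the order of
the edges, the linear forms on `A((G))` are identified with `Det(Edge(G)) ⊗ A((G))*`. -/
abbrev Family (I : Type) : Type (max 1 u w) :=
  ∀ G : Graph, (G.L ≃ I) → Module.Dual k (A.tens G)

/-- The families which are the elements of degree `i` of the Feynman transform
`FA((g, I)) = colim 𝔎(G) ⊗ A((G))*`, where `G` runs over the connected graphs of genus `g` with legs
labelled by `I` and their isomorphisms, and `𝔎(G) = Det(Edge(G))` is in degree `-|Edge(G)|`.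
In characteristic zero, the colimit over this groupoid is identified with the limit, that is, with
the families which are natural with respect to isomorphisms; on a class of graphs the
coinvariants of `Aut(G)` are identified with the invariants. -/
structure IsCochain (g : ℕ) (I : Type) (i : ℤ) (φ : A.Family I) : Prop where
  genus : ∀ G ρ, ¬(G.Connected ∧ G.HasGenus g) → φ G ρ = 0
  degree : ∀ G ρ, ∀ j : ℤ, j + Fintype.card G.E ≠ -i → ∀ t ∈ A.degSub G j, φ G ρ t = 0
  natural : ∀ {G H : Graph} (h : G.Hom H), Function.Bijective h.onV → Function.Bijective h.onE →
    ∀ (ρ : G.L ≃ I) (t : A.tens G), φ H (h.onL.trans ρ) (A.mapHom h t) = h.edgeSign k * φ G ρ t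

/-- The component of degree `i` of `FA((g, I))`. -/
def cochain (g : ℕ) (I : Type) (i : ℤ) : Submodule k (A.Family I) where
  carrier := {φ | A.IsCochain g I i φ}
  zero_mem' := ⟨fun _ _ _ => rfl, fun _ _ _ _ _ _ => rfl, fun h _ _ ρ t => by simp⟩
  add_mem' {φ ψ} hφ hψ := by
    refine ⟨fun G ρ h => ?_, fun G ρ j hj t ht => ?_, fun h hV hE ρ t => ?_⟩
    · rw [Pi.add_apply, Pi.add_apply, hφ.genus G ρ h, hψ.genus G ρ h, add_zero]
    · rw [Pi.add_apply, Pi.add_apply, LinearMap.add_apply, hφ.degree G ρ j hj t ht,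
        hψ.degree G ρ j hj t ht, add_zero]
    · simp only [Pi.add_apply, LinearMap.add_apply, hφ.natural h hV hE, hψ.natural h hV hE,
        mul_add]
  smul_mem' c {φ} hφ := by
    refine ⟨fun G ρ h => ?_, fun G ρ j hj t ht => ?_, fun h hV hE ρ t => ?_⟩
    · rw [Pi.smul_apply, Pi.smul_apply, hφ.genus G ρ h, smul_zero]
    · rw [Pi.smul_apply, Pi.smul_apply, LinearMap.smul_apply, hφ.degree G ρ j hj t ht, smul_zero]
    · simp only [Pi.smul_apply, LinearMap.smul_apply, hφ.natural h hV hE, smul_eq_mul]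
      ring

/-- The differential of the Feynman transform: the sum of the differential of `A*` and of the map `∂`
whose components are `(e ∧ -) ⊗ A((G → G / e))*`, where `e` runs over the edges of `G`. -/
noncomputable def famD (I : Type) : A.Family I →ₗ[k] A.Family I where
  toFun φ G ρ := ∑ e, G.edgeSign k e • φ (G.contr e) ρ ∘ₗ A.mapHom (G.contrHom e)
    + (-1 : k) ^ Fintype.card G.E • φ G ρ ∘ₗ A.tensD G
  map_add' φ ψ := by
    funext G ρ
    refine LinearMap.ext fun t => ?_
    have h : ∀ e, (φ + ψ) (G.contr e) ρ = φ (G.contr e) ρ + ψ (G.contr e) ρ := fun _ => rfl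
    simp only [h, Pi.add_apply, LinearMap.add_apply, LinearMap.sum_apply, LinearMap.smul_apply,
      LinearMap.comp_apply, smul_add, Finset.sum_add_distrib]
    exact add_add_add_comm _ _ _ _
  map_smul' c φ := by
    funext G ρ
    refine LinearMap.ext fun t => ?_
    have h : ∀ e, (c • φ) (G.contr e) ρ = c • φ (G.contr e) ρ := fun _ => rfl
    simp only [h, Pi.smul_apply, LinearMap.add_apply, LinearMap.sum_apply, LinearMap.smul_apply,
      LinearMap.comp_apply, smul_add, Finset.smul_sum, smul_comm c, RingHom.id_apply]

theorem famD_apply (I : Type) (φ : A.Family I) (G : Graph) (ρ : G.L ≃ I) (t : A.tens G) :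
    A.famD I φ G ρ t
      = ∑ e, G.edgeSign k e * φ (G.contr e) ρ (A.mapHom (G.contrHom e) t)
        + (-1 : k) ^ Fintype.card G.E * φ G ρ (A.tensD G t) := by
  simp [famD]

theorem card_contr_E (G : Graph) (e : G.E) :
    Fintype.card (G.contr e).E + 1 = Fintype.card G.E := by
  have h : Fintype.card (G.contr e).E = Fintype.card G.E - 1 := by
    refine (Fintype.card_congr (Equiv.refl _)).trans (Set.card_ne_eq e)
  have := Fintype.card_pos_iff.2 ⟨e⟩
  omega

theorem famD_mem {g : ℕ} {I : Type} {i : ℤ} {φ : A.Family I} (hφ : A.IsCochain g I i φ) :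
    A.IsCochain g I (i - 1) (A.famD I φ) := by
  refine ⟨fun G ρ h => ?_, fun G ρ j hj t ht => ?_, fun {G H} h hV hE ρ t => ?_⟩
  · refine LinearMap.ext fun t => ?_
    rw [famD_apply, hφ.genus G ρ h, LinearMap.zero_apply, mul_zero, add_zero]
    refine Finset.sum_eq_zero fun e _ => ?_
    rw [hφ.genus (G.contr e) ρ, LinearMap.zero_apply, mul_zero]
    rw [← (G.contrHom e).connected_iff, ← (G.contrHom e).hasGenus_iff]
    exact h
  · rw [famD_apply, hφ.degree G ρ (j - 1) (fun h => hj (by omega)) _ (A.tensD_degSub G j ht),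
      mul_zero, add_zero]
    refine Finset.sum_eq_zero fun e _ => ?_
    rw [hφ.degree (G.contr e) ρ j ?_ _ (A.mapHom_degSub (G.contrHom e) j ht), mul_zero]
    intro h
    have := card_contr_E G e
    exact hj (by omega)
  · rw [famD_apply, famD_apply, ← A.mapHom_tensD, hφ.natural h hV hE, mul_add, Finset.mul_sum,
      Fintype.card_congr (Equiv.ofBijective _ hE)]
    congr 1
    · refine Fintype.sum_bijective h.onE hE _ _ fun e => ?_
      obtain ⟨h', hh, hV', hE'⟩ := Graph.exists_contr_iso h hE e
      have hL : h'.onL = h.onL := congrArg Graph.Hom.onL hh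
      have := hφ.natural h' hV' hE' ρ (A.mapHom (G.contrHom (h.onE e)) t)
      rw [hL, ← A.mapHom_comp, hh, A.mapHom_comp] at this
      rw [← mul_assoc, ← Graph.edgeSign_contr_iso k h hE e h' hh, mul_assoc, ← this]
      rfl
    · ring

theorem famD_famD {g : ℕ} {I : Type} {i : ℤ} {φ : A.Family I} (hφ : A.IsCochain g I i φ) :
    A.famD I (A.famD I φ) = 0 := by
  funext G ρ
  refine LinearMap.ext fun t => ?_
  have hDD : A.tensD G (A.tensD G t) = 0 := LinearMap.congr_fun (A.tensD_tensD G) t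
  rw [famD_apply, famD_apply, hDD, map_zero, mul_zero, add_zero]
  have h0 : ∀ e, G.edgeSign k e * A.famD I φ (G.contr e) ρ (A.mapHom (G.contrHom e) t)
      = ∑ x, G.edgeSign k e * ((G.contr e).edgeSign k x * φ ((G.contr e).contr x) ρ
          (A.mapHom ((G.contr e).contrHom x) (A.mapHom (G.contrHom e) t)))
        + G.edgeSign k e * ((-1) ^ Fintype.card (G.contr e).E *
        φ (G.contr e) ρ (A.tensD (G.contr e) (A.mapHom (G.contrHom e) t))) := fun e => by
    rw [← Finset.mul_sum, ← mul_add]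
    exact congrArg _ (A.famD_apply I φ (G.contr e) ρ _)
  rw [Finset.sum_congr rfl fun e _ => h0 e, Finset.sum_add_distrib]
  have h1 : ∑ e, G.edgeSign k e * ((-1) ^ Fintype.card (G.contr e).E *
        φ (G.contr e) ρ (A.tensD (G.contr e) (A.mapHom (G.contrHom e) t)))
      = -((-1) ^ Fintype.card G.E * ∑ e, G.edgeSign k e *
        φ (G.contr e) ρ (A.mapHom (G.contrHom e) (A.tensD G t))) := by
    rw [Finset.mul_sum, ← Finset.sum_neg_distrib]
    refine Finset.sum_congr rfl fun e _ => ?_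
    rw [A.mapHom_tensD, ← card_contr_E G e, pow_succ]
    ring
  rw [h1, neg_add_cancel_right]
  rw [Finset.sum_sigma']
  refine Finset.sum_involution
    (fun (p : (e : G.E) × (G.contr e).E) _ => ⟨p.2.1, ⟨p.1, p.2.2.symm⟩⟩) ?_ ?_ (by simp) (by
      rintro ⟨e, x⟩ _; rfl)
  · rintro ⟨e, x⟩ -
    have aux : ∀ a b c d p q : k, a * b = -(c * d) → q = p → a * (b * p) + c * (d * q) = 0 := by
      rintro a b c d p q h rfl
      rw [← mul_assoc, h, ← mul_assoc, neg_mul, neg_add_cancel]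
    refine aux _ _ _ _ _ _ (Graph.edgeSign_mul_edgeSign k G e x.1 x.2) ?_
    obtain ⟨h', hh, hV, hE, hs, hL⟩ := Graph.exists_contr_swap k G e x.1 x.2
    have h2 := hφ.natural h' hV hE ρ
      (A.mapHom (((G.contr e).contrHom ⟨x.1, x.2⟩).comp (G.contrHom e)) t)
    rw [hs, one_mul, hL, ← A.mapHom_comp, hh, A.mapHom_comp] at h2
    exact h2.trans (congrArg _ (A.mapHom_comp _ _ t))
  · rintro ⟨e, x⟩ - - h
    exact x.2 (congrArg Sigma.fst h)

/-- The maps on families induced by a bijection. -/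
def famMap {I J : Type} (e : I ≃ J) : A.Family I →ₗ[k] A.Family J where
  toFun φ G ρ := φ G (ρ.trans e.symm)
  map_add' _ _ := rfl
  map_smul' _ _ := rfl

theorem famMap_mem {g : ℕ} {I J : Type} (e : I ≃ J) {i : ℤ} {φ : A.Family I}
    (hφ : A.IsCochain g I i φ) : A.IsCochain g J i (A.famMap e φ) :=
  ⟨fun G _ h => hφ.genus G _ h, fun G _ j hj t ht => hφ.degree G _ j hj t ht,
    fun h hV hE ρ t => hφ.natural h hV hE (ρ.trans e.symm) t⟩

theorem cochain_stable (g : ℕ) (I : Type) (i : ℤ) (h : 2 * g + Nat.card I ≤ 2) :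
    Subsingleton (A.cochain g I i) := by
  refine subsingleton_of_forall_eq 0 ?_
  rintro ⟨φ, hφ⟩
  refine Subtype.ext ?_
  funext G ρ
  change φ G ρ = 0
  by_cases hG : G.Connected ∧ G.HasGenus g
  · obtain ⟨v, hv⟩ := G.exists_unstable g hG.1 hG.2 (by rwa [Nat.card_congr ρ])
    refine PiTensorProduct.ext (MultilinearMap.ext fun x => ?_)
    refine MultilinearMap.map_coord_zero _ v ?_
    have := A.stable (G.genus v) (G.Star v)
    exact DFinsupp.ext fun j => (this j hv).elim _ _
  · exact hφ.genus G ρ hG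

/-- The Feynman transform `FA` (for the trivial twist) of a modular operad, as a stable `𝕊`-module of chain
complexes. -/
noncomputable def feynman : StableSModule.{u, max 1 u w} k where
  obj g I _ i := A.cochain g I i
  d {g I} _ i := ((A.famD I).domRestrict (A.cochain g I i)).codRestrict (A.cochain g I (i - 1))
    fun φ => A.famD_mem φ.2
  d_comp_d _ φ := Subtype.ext (A.famD_famD φ.2)
  map {g I J} _ _ e i := ((A.famMap e).domRestrict (A.cochain g I i)).codRestrict (A.cochain g J i)
    fun φ => A.famMap_mem e φ.2
  map_refl _ _ := rfl
  map_trans _ _ _ _ := rfl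
  map_d _ _ _ := rfl
  stable g I _ i h := A.cochain_stable g I i h

end ModularOperad

/-- The ring `k[ħ, ħ⁻¹][p₁, p₂, …]` of symmetric functions with coefficients Laurent polynomials in `ħ`.
The variable `X n` is the power sum `pₙ`. -/
abbrev LambdaPoly (k : Type u) [Field k] : Type u := MvPolynomial ℕ+ (LaurentPolynomial k)

/-- The completion of the ring of symmetric functions over `k((ħ))` with respect to its weight filtration,
where `ħ` has weight `2` and `pₙ` has weight `n`: an element is the series `∑ f_w` of its homogeneous
components `f_w`, and it is represented by the power series `∑ f_w t ^ w`, where the variable `t`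
records the weight. -/
abbrev LambdaSeries (k : Type u) [Field k] : Type u := PowerSeries (LambdaPoly k)

/-- The power `ħ ^ a`. -/
noncomputable def hbar {k : Type u} [Field k] (a : ℤ) : LambdaPoly k :=
  MvPolynomial.C (LaurentPolynomial.T a)

/-- The substitution `f(ħ, p₁, p₂, …) ↦ pₙ ∘ f = f(ħⁿ, pₙ, p₂ₙ, …)`. -/
noncomputable def plethPoly {k : Type u} [Field k] (n : ℕ+) : LambdaPoly k →+* LambdaPoly k :=
  MvPolynomial.eval₂Hom
    (MvPolynomial.C.comp (AddMonoidAlgebra.mapDomainRingHom k (AddMonoidHom.mulLeft (n : ℤ))))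
    fun m => MvPolynomial.X (n * m)

/-- The substitution `f ↦ pₙ ∘ f` on series; it multiplies weights by `n`. -/
noncomputable def pleth {k : Type u} [Field k] (n : ℕ+) (f : LambdaSeries k) : LambdaSeries k :=
  PowerSeries.expand n n.ne_zero (PowerSeries.map (plethPoly n) f)

/-- `Exp(f) = exp(∑ₙ (pₙ / n) ∘ f)`, for `f` of positive weight. In the sum over `n ≥ 1` only `n ≤ w` can
contribute to the component of weight `w`. -/
noncomputable def Exp {k : Type u} [Field k] [CharZero k] (f : LambdaSeries k) : LambdaSeries k :=
  PowerSeries.subst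
    (PowerSeries.mk fun w => ∑ n ∈ Finset.range w,
      ((n + 1 : ℕ) : k)⁻¹ • PowerSeries.coeff w (pleth n.succPNat f))
    (PowerSeries.exp (LambdaPoly k))

/-- `Log(f) = ∑ₙ (μ(n) / n) log(pₙ ∘ f)`, for `f` of the form `1 +` (terms of positive weight). In the sum
over `n ≥ 1` only `n ≤ w` can contribute to the component of weight `w`. -/
noncomputable def Log {k : Type u} [Field k] [CharZero k] (f : LambdaSeries k) : LambdaSeries k :=
  PowerSeries.mk fun w => ∑ n ∈ Finset.range w,
    ((ArithmeticFunction.moebius (n + 1) : k) / ((n + 1 : ℕ) : k)) •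
      PowerSeries.coeff w (PowerSeries.logOf (pleth n.succPNat f))

/-- `Δ = ∑ₙ ħⁿ ((n / 2) ∂² / ∂pₙ² + ∂ / ∂p₂ₙ)`, an operator that preserves the weight; the sum is finite on
each polynomial. -/
noncomputable def Delta {k : Type u} [Field k] (f : LambdaPoly k) : LambdaPoly k :=
  ∑ᶠ n : ℕ+, hbar n * (((n : ℕ) / 2 : k) • MvPolynomial.pderiv n (MvPolynomial.pderiv n f)
    + MvPolynomial.pderiv (2 * n) f)

/-- `exp(-Δ)`; the exponential series is finite on each polynomial, since `Δ` lowers the degree in the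
`pₙ`. -/
noncomputable def expNegDelta {k : Type u} [Field k] (f : LambdaSeries k) : LambdaSeries k :=
  PowerSeries.mk fun w => ∑ᶠ j : ℕ, ((-1) ^ j / (j.factorial : k)) •
    Delta^[j] (PowerSeries.coeff w f)

/-- `p_{a₁} p_{a₂} ⋯`, where `a₁, a₂, …` are the lengths of the cycles of `σ` (with the fixed points). -/
noncomputable def cycleMonomial {k : Type u} [Field k] {n : ℕ} (σ : Equiv.Perm (Fin n)) :
    LambdaPoly k :=
  (σ.partition.parts.map fun a => MvPolynomial.X a.toPNat').prod

namespace StableSModule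

/-- The Frobenius characteristic of `A((g, n))`: `(1 / n!) ∑ Tr(σ) p_{a₁} p_{a₂} ⋯`, where the trace is the
alternating sum of the traces on the components. -/
noncomputable def ch {k : Type u} [Field k] (A : StableSModule.{u, w} k) (g n : ℕ) : LambdaPoly k :=
  (n.factorial : k)⁻¹ • ∑ σ : Equiv.Perm (Fin n),
    (∑ᶠ i : ℤ, (-1) ^ i * LinearMap.trace k (A.obj g (Fin n) i) (A.map σ i)) • cycleMonomial σ

/-- `∑ ħ ^ (g - 1) ch(A((g, n)))` over `2 (g - 1) + n > 0`; the summand for `(g, n)` has weight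
`w = 2 (g - 1) + n`. -/
noncomputable def CCh {k : Type u} [Field k] (A : StableSModule.{u, w} k) : LambdaSeries k :=
  PowerSeries.mk fun w =>
    ∑ p ∈ Finset.range (w + 3) ×ˢ Finset.range (w + 3) with 2 * p.1 + p.2 = w + 2 ∧ 0 < w,
      hbar ((p.1 : ℤ) - 1) * A.ch p.1 p.2

end StableSModule

end ModularOperads

/-! Both sides count finite graphs that carry an automorphism. Let `c` be the alternating character
of `A`. A stable graph with an automorphism `π`, given as a structure on the set of its vertices and
flags (`ZGraph`), gets a weight. Every orbit of vertices contributes `c` of the first-return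
permutation of the flags at one of its vertices, times `ħ ^ (g - 1)` for each vertex in it. Every
cycle of legs of length `l` contributes `p_l`. Every orbit of edges contributes `x ħ ^ (number of
edges)`, with a scalar parameter `x`. `ZGraph.series` adds these weights over all structures on `Fin
N` with the factor `1 / N!`; by stability the weight `2 (g - 1) + n` bounds the number of cells, so
each coefficient is a finite sum.

Four facts give the theorem.

For `x = 0` only graphs without edges count. The connected ones are corollas with a permutation of
their legs, so the connected series is the characteristic of `A` (`StableSModule.CCh_eq_series`).

For every `x` the series of all graphs is `Exp` of the series of connected graphs (`series_eq_Exp`).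
An automorphism permutes the components. An orbit of `d` components is one connected graph with the
automorphism `π ^ d`, and passing to the whole orbit multiplies all cycle lengths and all exponents
of `ħ` by `d`, which is the substitution `p_d ∘ -`. The proof marks a cell and splits off the orbit
of its component; this is the recursion that characterizes `Exp` (`eq_Exp`).

The operator `exp(-Δ)` turns `x = 0` into `x = -1` (`ZGraph.expNegDelta_series`). This is Wick's
theorem (`expDelta_cycleProd`): the term `(n / 2) ∂² / ∂p_n²` joins two cycles of flags of length
`n`, in `n` ways, making `n` edges; the term `∂ / ∂p_{2n}` joins a cycle of length `2n` with itself
by the half turn `π ^ n`, again making `n` edges.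

For `x = -1` the connected series is the characteristic of the Feynman transform
(`ModularOperad.CCh_feynman`). Averaging over isomorphisms makes the natural families of given
degree a retract of a finite product of duals of the spaces `A((G))`. Hence the trace of `σ` is a
sum over graphs `G` and automorphisms inducing `σ` on the legs. The summand is the sign on
`Det(Edge(G))`, times `(-1) ^ |Edge(G)|` from the degree, times the supertrace on `A((G))`. In the
supertrace the Koszul sign is exactly what makes it a product of characters over the cycles of
vertices (`ModularOperad.trace_mapHom_totSign`). A cycle of `l` edges has sign `-(-1) ^ l` and
degree sign `(-1) ^ l`, so each orbit of edges contributes `-1`, which is the value of `x`.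

Since `Log` inverts `Exp` (`Log_Exp`, by Möbius inversion), the formula follows. -/

namespace ModularOperads

open PowerSeries

/-! ### Plethysm, `Exp` and `Log` -/

section Plethysm

variable {k : Type u} [Field k]

/-- The substitution `f ↦ pₙ ∘ f` for a natural number `n` (which should be positive). -/
noncomputable abbrev plethNat (n : ℕ) : LambdaPoly k →+* LambdaPoly k := plethPoly n.toPNat'

theorem plethPoly_X (n m : ℕ+) : plethPoly (k := k) n (MvPolynomial.X m) = MvPolynomial.X (n * m) := by
  simp [plethPoly]

theorem plethPoly_hbar (n : ℕ+) (a : ℤ) : plethPoly (k := k) n (hbar a) = hbar (n * a) := by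
  simp only [plethPoly, hbar, MvPolynomial.coe_eval₂Hom, MvPolynomial.eval₂_C, RingHom.comp_apply]
  congr 1
  exact AddMonoidAlgebra.mapDomain_single

theorem plethPoly_algebraMap (n : ℕ+) (c : k) :
    plethPoly n (algebraMap k (LambdaPoly k) c) = algebraMap k (LambdaPoly k) c := by
  have : algebraMap k (LambdaPoly k) c = MvPolynomial.C (LaurentPolynomial.C c) := rfl
  rw [this]
  simp only [plethPoly, MvPolynomial.coe_eval₂Hom, MvPolynomial.eval₂_C, RingHom.comp_apply]
  congr 1
  refine AddMonoidAlgebra.mapDomain_single.trans ?_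
  simp

theorem plethPoly_smul (n : ℕ+) (c : k) (f : LambdaPoly k) :
    plethPoly n (c • f) = c • plethPoly n f := by
  rw [Algebra.smul_def, map_mul, plethPoly_algebraMap, ← Algebra.smul_def]

theorem lambdaPoly_ringHom_ext {φ ψ : LambdaPoly k →+* LambdaPoly k}
    (h1 : ∀ c, φ (algebraMap k _ c) = ψ (algebraMap k _ c)) (h2 : ∀ a, φ (hbar a) = ψ (hbar a))
    (h3 : ∀ n, φ (MvPolynomial.X n) = ψ (MvPolynomial.X n)) : φ = ψ := by
  refine MvPolynomial.ringHom_ext (fun p => ?_) h3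
  induction p using LaurentPolynomial.induction_on' with
  | add p q hp hq => simp only [map_add, hp, hq]
  | C_mul_T n a =>
    simp only [map_mul]
    exact congrArg₂ _ (h1 a) (h2 n)

theorem plethPoly_plethPoly (m n : ℕ+) (f : LambdaPoly k) :
    plethPoly m (plethPoly n f) = plethPoly (m * n) f := by
  refine RingHom.congr_fun (f := (plethPoly m).comp (plethPoly n)) (g := plethPoly (m * n))
    (lambdaPoly_ringHom_ext (fun c => ?_) (fun a => ?_) fun n => ?_) f
  · simp only [RingHom.comp_apply, plethPoly_algebraMap]
  · simp only [RingHom.comp_apply, plethPoly_hbar, PNat.mul_coe]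
    congr 1; push_cast; ring
  · simp only [RingHom.comp_apply, plethPoly_X, mul_assoc]

theorem plethPoly_one (f : LambdaPoly k) : plethPoly 1 f = f := by
  refine RingHom.congr_fun (f := plethPoly 1) (g := RingHom.id _)
    (lambdaPoly_ringHom_ext (fun c => ?_) (fun a => ?_) fun n => ?_) f
  · simp only [RingHom.id_apply, plethPoly_algebraMap]
  · simp only [RingHom.id_apply, plethPoly_hbar, PNat.one_coe, Nat.cast_one, one_mul]
  · simp only [RingHom.id_apply, plethPoly_X, one_mul]

theorem coeff_pleth (n : ℕ+) (f : LambdaSeries k) (w : ℕ) :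
    coeff w (pleth n f) = if (n : ℕ) ∣ w then plethPoly n (coeff (w / n) f) else 0 := by
  rw [pleth, coeff_expand]
  split_ifs <;> simp

theorem sum_range_succ_dvd {M : Type*} [AddCommMonoid M] (w : ℕ) (F : ℕ → M) :
    ∑ n ∈ Finset.range w, (if n + 1 ∣ w then F (n + 1) else 0) = ∑ d ∈ w.divisors, F d := by
  rw [← Finset.sum_filter]
  refine Finset.sum_bij (fun n _ => n + 1) ?_ ?_ ?_ ?_
  · intro n hn
    simp only [Finset.mem_filter, Finset.mem_range] at hn
    exact Nat.mem_divisors.2 ⟨hn.2, by omega⟩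
  · intro a _ b _ h; omega
  · intro d hd
    have h1 := Nat.pos_of_mem_divisors hd
    have h2 := Nat.divisor_le hd
    exact ⟨d - 1, by
      simp only [Finset.mem_filter, Finset.mem_range]
      exact ⟨by omega, by rw [Nat.sub_add_cancel h1]; exact Nat.dvd_of_mem_divisors hd⟩, by omega⟩
  · intro _ _; rfl

/-- The coefficients of `∑ₙ (a n) pₙ ∘ f`. -/
theorem sum_coeff_pleth (a : ℕ → k) (f : LambdaSeries k) (w : ℕ) :
    ∑ n ∈ Finset.range w, a (n + 1) • coeff w (pleth n.succPNat f)
      = ∑ d ∈ w.divisors, a d • plethNat d (coeff (w / d) f) := by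
  rw [← sum_range_succ_dvd w fun d => a d • plethNat d (coeff (w / d) f)]
  refine Finset.sum_congr rfl fun n _ => ?_
  have h : n.succPNat = (n + 1).toPNat' := rfl
  rw [coeff_pleth, Nat.succPNat_coe, h]
  split_ifs <;> simp

/-- The exponent `∑ₙ (pₙ / n) ∘ f` in the definition of `Exp`. -/
noncomputable def expExponent (f : LambdaSeries k) : LambdaSeries k :=
  mk fun w => ∑ n ∈ Finset.range w, ((n + 1 : ℕ) : k)⁻¹ • coeff w (pleth n.succPNat f)

theorem coeff_expExponent (f : LambdaSeries k) (w : ℕ) :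
    coeff w (expExponent f) = ∑ d ∈ w.divisors, (d : k)⁻¹ • plethNat d (coeff (w / d) f) := by
  rw [expExponent, coeff_mk]
  exact sum_coeff_pleth (fun n => (n : k)⁻¹) f w

theorem constantCoeff_expExponent (f : LambdaSeries k) : constantCoeff (expExponent f) = 0 := by
  rw [← coeff_zero_eq_constantCoeff_apply, coeff_expExponent]
  simp

theorem hasSubst_expExponent (f : LambdaSeries k) : HasSubst (expExponent f) :=
  HasSubst.of_constantCoeff_zero' (constantCoeff_expExponent f)

theorem Exp_eq [CharZero k] (f : LambdaSeries k) : Exp f = (PowerSeries.exp (LambdaPoly k)).subst (expExponent f) :=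
  rfl

section Series

variable {R : Type*} [CommRing R] [Algebra ℚ R]

theorem constantCoeff_exp_subst {c : R⟦X⟧} (hc : constantCoeff c = 0) :
    constantCoeff ((PowerSeries.exp R).subst c) = 1 := by
  have h : (PowerSeries.exp R) = C 1 + (PowerSeries.exp R - C 1) := by ring
  have hs := HasSubst.of_constantCoeff_zero' hc
  rw [h, subst_add hs, map_add]
  have h1 : (C (1 : R)).subst c = (C (1 : R) : R⟦X⟧) := subst_C (1 : R)
  rw [h1]
  have := constantCoeff_subst_eq_zero (a := c) hc (PowerSeries.exp R - C 1) (by simp)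
  have h2 : constantCoeff (subst c (PowerSeries.exp R - C 1)) = 0 := this
  rw [h2]; simp

theorem derivative_exp_subst {c : R⟦X⟧} (hc : HasSubst c) :
    d⁄dX R ((PowerSeries.exp R).subst c) = (PowerSeries.exp R).subst c * d⁄dX R c := by
  rw [derivative_subst hc, derivative_exp]

/-- The two sides have the same constant coefficient and, by the chain rule, the same derivative. -/
theorem logOf_exp_subst {c : R⟦X⟧} (hc : constantCoeff c = 0) :
    logOf ((PowerSeries.exp R).subst c) = c := by
  set f := (PowerSeries.exp R).subst c with hf
  have hs := HasSubst.of_constantCoeff_zero' hc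
  have hf1 : constantCoeff f = 1 := constantCoeff_exp_subst hc
  have hsf : HasSubst (f - 1) := HasSubst.of_constantCoeff_zero' (by simp [hf1])
  -- The derivative of `log (1 + X)` is the alternating geometric series.
  have h1 : d⁄dX R (log R) * (1 + X) = 1 := by
    rw [deriv_log]
    ext n
    rw [mul_add, mul_one, map_add, coeff_mk]
    cases n with
    | zero => simp
    | succ n => rw [coeff_succ_mul_X, coeff_mk, coeff_one]; simp [pow_succ]
  have h2 : (d⁄dX R (log R)).subst (f - 1) * f = 1 := by
    have := congrArg (subst (f - 1)) h1
    rw [subst_mul hsf, subst_add hsf, subst_X hsf] at this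
    have h3 : (1 : R⟦X⟧).subst (f - 1) = (1 : R⟦X⟧) := by
      rw [← coe_substAlgHom hsf, map_one]
    rwa [h3, add_sub_cancel] at this
  -- Without torsion a series is determined by its derivative and its constant coefficient.
  have : IsAddTorsionFree R := .of_module_rat _
  refine derivative.ext ?_ ?_
  · rw [logOf_eq, derivative_subst hsf, map_sub, Derivation.map_one_eq_zero, sub_zero, derivative_exp_subst hs, ← mul_assoc, h2,
      one_mul]
  · rw [constantCoeff_logOf hf1, hc]

end Series

/-- The operation `pₙ ∘ -` is a ring homomorphism on coefficients followed by `t ↦ t ^ n`; both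
commute with substitution into `exp`, whose coefficients are rational. -/
theorem pleth_Exp [CharZero k] (n : ℕ+) (f : LambdaSeries k) :
    pleth n (Exp f) = (PowerSeries.exp (LambdaPoly k)).subst (pleth n (expExponent f)) := by
  have hs := hasSubst_expExponent f
  have hs' : HasSubst (PowerSeries.map (plethPoly n) (expExponent f)) :=
    HasSubst.of_constantCoeff_zero' (by
      rw [← coeff_zero_eq_constantCoeff_apply, coeff_map, coeff_zero_eq_constantCoeff_apply,
        constantCoeff_expExponent, map_zero])
  rw [Exp_eq, pleth, pleth]
  have h1 : PowerSeries.map (plethPoly n) ((PowerSeries.exp (LambdaPoly k)).subst (expExponent f))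
      = (PowerSeries.map (plethPoly n) (PowerSeries.exp (LambdaPoly k))).subst
        (PowerSeries.map (plethPoly n) (expExponent f)) := map_subst hs _
  rw [h1, map_exp, expand_apply, subst_comp_subst_apply hs' (HasSubst.X_pow n.ne_zero), expand_apply]

/-- Reindexing by `D = d e`: the conditions `d ∣ w`, `e ∣ w / d` become `d ∣ D ∣ w`. -/
theorem sum_divisors_sum_divisors {M : Type*} [AddCommMonoid M] (w : ℕ) (G : ℕ → ℕ → M) :
    ∑ d ∈ w.divisors, ∑ e ∈ (w / d).divisors, G d e
      = ∑ D ∈ w.divisors, ∑ d ∈ D.divisors, G d (D / d) := by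
  rw [Finset.sum_sigma', Finset.sum_sigma']
  refine Finset.sum_nbij' (fun p => ⟨p.1 * p.2, p.1⟩) (fun p => ⟨p.2, p.1 / p.2⟩) ?_ ?_ ?_ ?_ ?_
  · rintro ⟨d, e⟩ h
    simp only [Finset.mem_sigma, Nat.mem_divisors] at h ⊢
    obtain ⟨⟨hd, hw⟩, he, hwd⟩ := h
    have : d * e ∣ w := by
      have := Nat.mul_dvd_mul_left d he
      rwa [Nat.mul_div_cancel' hd] at this
    exact ⟨⟨this, hw⟩, ⟨e, rfl⟩, fun h => hw (by rw [h] at this; exact Nat.eq_zero_of_zero_dvd this)⟩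
  · rintro ⟨D, d⟩ h
    simp only [Finset.mem_sigma, Nat.mem_divisors] at h ⊢
    obtain ⟨⟨hD, hw⟩, hd, hD0⟩ := h
    have hdw := hd.trans hD
    exact ⟨⟨hdw, hw⟩, Nat.div_dvd_div hd hD, fun h => hw (Nat.eq_zero_of_dvd_of_div_eq_zero hdw h)⟩
  · rintro ⟨d, e⟩ h
    simp only [Finset.mem_sigma, Nat.mem_divisors] at h
    have : 0 < d := Nat.pos_of_ne_zero (by rintro rfl; simp at h)
    simp [this]
  · rintro ⟨D, d⟩ h
    simp only [Finset.mem_sigma, Nat.mem_divisors] at h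
    simp [Nat.mul_div_cancel' h.2.1]
  · rintro ⟨d, e⟩ h
    simp only [Finset.mem_sigma, Nat.mem_divisors] at h
    have : 0 < d := Nat.pos_of_ne_zero (by rintro rfl; simp at h)
    simp [this]

theorem plethNat_one (f : LambdaPoly k) : plethNat 1 f = f := plethPoly_one f

theorem plethNat_plethNat {m n : ℕ} (hm : 0 < m) (hn : 0 < n) (f : LambdaPoly k) :
    plethNat m (plethNat n f) = plethNat (m * n) f := by
  rw [plethNat, plethNat, plethPoly_plethPoly]
  congr 2
  refine PNat.coe_injective ?_
  rw [PNat.mul_coe]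
  have h : ∀ j : ℕ, 0 < j → ((j.toPNat' : ℕ+) : ℕ) = j := fun j hj => Nat.succ_pred_eq_of_pos hj
  rw [h m hm, h n hn, h _ (Nat.mul_pos hm hn)]

/-- The logarithm of `pₙ ∘ Exp f` is `pₙ` applied to the exponent, so what remains is the sum of
`μ(d) / (d e)` times `p_{de} ∘ f`. Collecting the terms with `d e = D` leaves the factor `(1 / D)
∑_{d ∣ D} μ(d)`, which is zero unless `D = 1`. -/
theorem Log_Exp [CharZero k] (f : LambdaSeries k) (hf : constantCoeff f = 0) : Log (Exp f) = f := by
  ext1 w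
  rw [Log, coeff_mk]
  have h1 : ∀ n : ℕ+, logOf (pleth n (Exp f)) = pleth n (expExponent f) := by
    intro n
    rw [pleth_Exp, logOf_exp_subst]
    rw [← coeff_zero_eq_constantCoeff_apply, coeff_pleth]
    simp [constantCoeff_expExponent]
  simp only [h1]
  rw [sum_coeff_pleth (fun n => (ArithmeticFunction.moebius n : k) / (n : k))]
  simp only [coeff_expExponent, map_sum, plethPoly_smul, Finset.smul_sum, smul_smul]
  rw [sum_divisors_sum_divisors w fun d e => ((ArithmeticFunction.moebius d : k) / (d : k)
    * (e : k)⁻¹) • plethNat d (plethNat e (coeff (w / d / e) f))]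
  have h2 : ∀ D ∈ w.divisors, ∑ d ∈ D.divisors, ((ArithmeticFunction.moebius d : k) / (d : k)
      * ((D / d : ℕ) : k)⁻¹) • plethNat d (plethNat (D / d) (coeff (w / d / (D / d)) f))
      = if D = 1 then coeff w f else 0 := by
    intro D hD
    have hD0 := Nat.pos_of_mem_divisors hD
    have h3 : ∀ d ∈ D.divisors, ((ArithmeticFunction.moebius d : k) / (d : k)
      * ((D / d : ℕ) : k)⁻¹) • plethNat d (plethNat (D / d) (coeff (w / d / (D / d)) f))
        = (ArithmeticFunction.moebius d : k) • ((D : k)⁻¹ • plethNat D (coeff (w / D) f)) := by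
      intro d hd
      have hd0 := Nat.pos_of_mem_divisors hd
      obtain ⟨e, rfl⟩ := Nat.dvd_of_mem_divisors hd
      have he0 : 0 < e := Nat.pos_of_ne_zero (by rintro rfl; simp at hD0)
      rw [Nat.mul_div_cancel_left _ hd0, plethNat_plethNat hd0 he0, Nat.div_div_eq_div_mul, smul_smul]
      congr 1
      push_cast
      field_simp
    rw [Finset.sum_congr rfl h3, ← Finset.sum_smul]
    -- Möbius inversion in the form `μ * ζ = 1`.
    have h4 : ∑ d ∈ D.divisors, (ArithmeticFunction.moebius d : k) = if D = 1 then 1 else 0 := by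
      have := congrArg (fun g => g D) (ArithmeticFunction.coe_moebius_mul_coe_zeta (R := k))
      simp only [ArithmeticFunction.coe_mul_zeta_apply, ArithmeticFunction.one_apply] at this
      simpa using this
    rw [h4]
    split_ifs with h
    · subst h; simp [plethNat_one]
    · rw [zero_smul]
  rw [Finset.sum_congr rfl h2, Finset.sum_ite_eq']
  split_ifs with h
  · rfl
  -- The set `Nat.divisors 0` is empty, so weight zero is the exceptional case, where `hf` enters.
  · have : w = 0 := by simpa using h
    subst this
    rw [coeff_zero_eq_constantCoeff_apply, hf]

/-- The hypothesis `h` is the differential equation `t T' = t E' T` in coefficients, where `E` is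
the exponent of `Exp f`. In characteristic zero it determines all coefficients of `T` from the one
of weight zero. -/
theorem eq_Exp [CharZero k] {T f : LambdaSeries k} (h0 : coeff 0 T = 1)
    (h : ∀ w : ℕ, (w : k) • coeff w T = ∑ p ∈ Finset.HasAntidiagonal.antidiagonal w,
      (∑ d ∈ p.1.divisors, ((p.1 / d : ℕ) : k) • plethNat d (coeff (p.1 / d) f)) * coeff p.2 T) :
    T = Exp f := by
  -- The operator `t d/dt` multiplies the coefficient of weight `n = d e` by `n`, which turns the
  -- factor `1 / d` of the exponent into `e = n / d`.
  have hc : ∀ n : ℕ, (∑ d ∈ n.divisors, ((n / d : ℕ) : k) • plethNat d (coeff (n / d) f))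
      = (n : k) • coeff n (expExponent f) := by
    intro n
    rw [coeff_expExponent, Finset.smul_sum]
    refine Finset.sum_congr rfl fun d hd => ?_
    have hd0 := Nat.pos_of_mem_divisors hd
    obtain ⟨e, rfl⟩ := Nat.dvd_of_mem_divisors hd
    rw [Nat.mul_div_cancel_left _ hd0, smul_smul]
    congr 1
    have : (d : k) ≠ 0 := by exact_mod_cast hd0.ne'
    push_cast
    field_simp
  simp only [hc] at h
  -- `Exp f` satisfies the same recursion, by the chain rule for `exp`.
  have hE : ∀ w : ℕ, (w : k) • coeff w (Exp f) = ∑ p ∈ Finset.HasAntidiagonal.antidiagonal w,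
      ((p.1 : k) • coeff p.1 (expExponent f)) * coeff p.2 (Exp f) := by
    intro w
    cases w with
    | zero => simp
    | succ w =>
      have h1 := congrArg (coeff w) (derivative_exp_subst (hasSubst_expExponent f))
      rw [← Exp_eq, coeff_derivative, coeff_mul] at h1
      rw [Finset.Nat.sum_antidiagonal_succ]
      simp only [Nat.cast_zero, zero_smul, zero_mul, zero_add]
      rw [← Finset.Nat.sum_antidiagonal_swap] at h1
      calc ((w + 1 : ℕ) : k) • coeff (w + 1) (Exp f)
          = coeff (w + 1) (Exp f) * ((w : LambdaPoly k) + 1) := by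
            rw [Algebra.smul_def, mul_comm]; simp
        _ = _ := h1
        _ = _ := by
          refine Finset.sum_congr rfl fun p _ => ?_
          change coeff p.2 (Exp f) * coeff p.1 (d⁄dX (LambdaPoly k) (expExponent f)) = _
          rw [coeff_derivative, Algebra.smul_def]
          push_cast
          ring
  ext1 w
  induction w using Nat.strong_induction_on with
  | _ w ih =>
    rcases Nat.eq_zero_or_pos w with rfl | hw
    · rw [h0, Exp_eq, coeff_zero_eq_constantCoeff_apply,
        constantCoeff_exp_subst (constantCoeff_expExponent f)]
    · have hw' : (w : k) ≠ 0 := by exact_mod_cast hw.ne'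
      have : (w : k) • coeff w T = (w : k) • coeff w (Exp f) := by
        rw [h, hE]
        refine Finset.sum_congr rfl fun p hp => ?_
        have hp := Finset.HasAntidiagonal.mem_antidiagonal.1 hp
        -- The term with `p.1 = 0` has the factor zero, so only coefficients of smaller weight
        -- enter.
        rcases Nat.eq_zero_or_pos p.1 with h1 | h1
        · simp [h1]
        · rw [ih p.2 (by omega)]
      have := congrArg (fun x => (w : k)⁻¹ • x) this
      simpa [smul_smul, inv_mul_cancel₀ hw'] using this

end Plethysm

end ModularOperads

namespace ModularOperads

/-! ### The operators `Δ` and `exp(-Δ)` and their commutators with `p_l` -/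

section ExpDelta

variable {k : Type u} [Field k]

open MvPolynomial

/-- The summand of index `n` of `Δ`. -/
noncomputable def deltaTerm (n : ℕ+) : LambdaPoly k →ₗ[LaurentPolynomial k] LambdaPoly k :=
  LinearMap.mulLeft _ (hbar n) ∘ₗ (LinearMap.mulLeft _ (algebraMap k (LambdaPoly k) ((n : ℕ) / 2)) ∘ₗ
    (pderiv n).toLinearMap ∘ₗ (pderiv n).toLinearMap + (pderiv (2 * n)).toLinearMap)

theorem deltaTerm_apply (n : ℕ+) (f : LambdaPoly k) :
    deltaTerm n f = hbar n * (algebraMap k (LambdaPoly k) ((n : ℕ) / 2) * pderiv n (pderiv n f)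
      + pderiv (2 * n) f) := rfl

theorem finite_support_deltaTerm (f : LambdaPoly k) :
    (Function.support fun n => deltaTerm n f).Finite := by
  refine Set.Finite.subset ((f.vars.finite_toSet).union
    ((f.vars.finite_toSet).preimage (f := fun n : ℕ+ => 2 * n)
      (fun a _ b _ h => mul_left_cancel h))) ?_
  intro n hn
  by_contra h
  simp only [Set.mem_union, Finset.mem_coe, Set.mem_preimage, not_or] at h
  refine hn ?_
  change deltaTerm n f = 0
  rw [deltaTerm_apply, pderiv_eq_zero_of_notMem_vars h.1, pderiv_eq_zero_of_notMem_vars h.2]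
  simp

theorem Delta_eq (f : LambdaPoly k) : Delta f = ∑ᶠ n, deltaTerm n f :=
  finsum_congr fun n => by rw [deltaTerm_apply, Algebra.smul_def]

/-- The operator `Δ` as a linear map. -/
noncomputable def deltaLin : LambdaPoly k →ₗ[LaurentPolynomial k] LambdaPoly k where
  toFun := Delta
  map_add' f g := by
    simp only [Delta_eq, map_add]
    exact finsum_add_distrib (finite_support_deltaTerm f) (finite_support_deltaTerm g)
  map_smul' c f := by
    simp only [Delta_eq, map_smul, RingHom.id_apply]
    exact (smul_finsum' (M := LambdaPoly k) c (finite_support_deltaTerm f)).symm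

theorem deltaLin_apply (f : LambdaPoly k) : deltaLin f = Delta f := rfl

/-- The commutator of two derivations is a derivation, and this one vanishes on the variables. -/
theorem pderiv_comm (m n : ℕ+) (f : LambdaPoly k) :
    pderiv m (pderiv n f) = pderiv n (pderiv m f) := by
  have h : (⁅(pderiv m : Derivation (LaurentPolynomial k) (LambdaPoly k) (LambdaPoly k)), pderiv n⁆ : Derivation (LaurentPolynomial k) (LambdaPoly k) (LambdaPoly k)) = 0 := by
    refine MvPolynomial.derivation_ext fun i => ?_
    rw [Derivation.commutator_apply]
    simp [pderiv_X, Pi.single_apply, apply_ite]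
  have := congrArg (fun D : Derivation _ _ _ => D f) h
  simpa [Derivation.commutator_apply, sub_eq_zero] using this

theorem pderiv_hbar_mul (m : ℕ+) (a : ℤ) (f : LambdaPoly k) :
    pderiv m (hbar a * f) = hbar a * pderiv m f := by
  rw [hbar, pderiv_C_mul, MvPolynomial.C_mul']

theorem pderiv_deltaLin (m : ℕ+) (f : LambdaPoly k) :
    pderiv m (deltaLin f) = deltaLin (pderiv m f) := by
  rw [deltaLin_apply, deltaLin_apply, Delta_eq, Delta_eq]
  change (pderiv m).toLinearMap _ = _
  rw [map_finsum (pderiv m).toLinearMap (finite_support_deltaTerm f)]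
  refine finsum_congr fun n => ?_
  rw [deltaTerm_apply, deltaTerm_apply]
  have : algebraMap k (LambdaPoly k) ((n : ℕ) / 2) = C (algebraMap k (LaurentPolynomial k) ((n : ℕ) / 2)) := rfl
  rw [this]
  change pderiv m _ = _
  rw [pderiv_hbar_mul, map_add, pderiv_C_mul, pderiv_comm m n,
    pderiv_comm m n, pderiv_comm m (2 * n)]

/-- The contribution of a `Z`-orbit of length `l` of flags that are joined among themselves. -/
noncomputable def hbarHalf (k : Type u) [Field k] (l : ℕ) : LambdaPoly k :=
  if 2 ∣ l then hbar ((l / 2 : ℕ) : ℤ) else 0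

/-- The commutator of `Δ` with the multiplication by `p_l`. -/
noncomputable def deltaComm (l : ℕ+) : LambdaPoly k →ₗ[LaurentPolynomial k] LambdaPoly k :=
  LinearMap.mulLeft _ (hbar l * ((l : ℕ) : LambdaPoly k)) ∘ₗ (pderiv l).toLinearMap
    + LinearMap.mulLeft _ (hbarHalf k l)

theorem deltaComm_apply (l : ℕ+) (f : LambdaPoly k) :
    deltaComm l f = hbar l * ((l : ℕ) : LambdaPoly k) * pderiv l f + hbarHalf k l * f := rfl

/-- The commutator `[Δ, p_l]` has two sources: the second-order term with `n = l`, giving `l ħ ^ l ∂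
/ ∂p_l`, and the first-order term with `2 n = l`, giving the scalar `ħ ^ (l / 2)` when `l` is even.
-/
theorem deltaLin_X_mul [CharZero k] (l : ℕ+) (f : LambdaPoly k) :
    deltaLin (X l * f) = X l * deltaLin f + deltaComm l f := by
  have h1 : ∀ n : ℕ+, deltaTerm n (X l * f) = X l * deltaTerm n f
      + ((if n = l then hbar l * ((l : ℕ) : LambdaPoly k) * pderiv l f else 0)
      + if 2 * n = l then hbar n * f else 0) := by
    intro n
    rw [deltaTerm_apply, deltaTerm_apply]
    have hp : ∀ m : ℕ+, ∀ q : LambdaPoly k, pderiv m (X l * q) = X l * pderiv m q + if m = l then q else 0 := by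
      intro m q
      rw [pderiv_mul, pderiv_X, Pi.single_apply]
      by_cases h : m = l
      · subst h; simp [add_comm]
      · rw [if_neg h, if_neg (fun h' => h h'.symm)]; simp
    have h2 : pderiv n (pderiv n (X l * f)) = X l * pderiv n (pderiv n f)
        + if n = l then 2 * pderiv l f else 0 := by
      rw [hp, map_add, hp]
      split_ifs with h
      · subst h; ring
      · simp
    rw [h2, hp (2 * n) f]
    -- The two cross terms of the Leibniz rule cancel the denominator of `n / 2`.
    have h3 : algebraMap k (LambdaPoly k) ((n : ℕ) / 2) * (if n = l then 2 * pderiv l f else 0)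
        = if n = l then ((l : ℕ) : LambdaPoly k) * pderiv l f else 0 := by
      split_ifs with h
      · subst h
        rw [← mul_assoc]
        congr 1
        have : (2 : LambdaPoly k) = algebraMap k _ 2 := (map_ofNat _ 2).symm
        rw [this, ← map_mul, div_mul_cancel₀ _ (two_ne_zero)]
        simp
      · simp
    rw [mul_add (algebraMap k (LambdaPoly k) _), h3]
    split_ifs with h h' h'
    · subst h; ring
    · subst h; ring
    · ring
    · ring
  have hfin1 : (Function.support fun n => X l * deltaTerm n f).Finite :=
    (finite_support_deltaTerm f).subset fun n hn h => hn (by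
      change X l * deltaTerm n f = 0
      have h : deltaTerm n f = 0 := h
      rw [h, mul_zero])
  have hfin2 : (Function.support fun n : ℕ+ =>
      if n = l then hbar l * ((l : ℕ) : LambdaPoly k) * pderiv l f else 0).Finite :=
    (Set.finite_singleton l).subset fun n hn => by
      by_contra h; exact hn (if_neg h)
  have hfin3 : (Function.support fun n : ℕ+ => if 2 * n = l then hbar n * f else 0).Finite :=
    ((Set.finite_singleton l).preimage (f := fun n : ℕ+ => 2 * n)
      (fun a _ b _ h => mul_left_cancel h)).subset fun n hn => by
      by_contra h; exact hn (if_neg h)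
  rw [deltaLin_apply, Delta_eq, finsum_congr h1, finsum_add_distrib hfin1
    ((hfin2.union hfin3).subset (Function.support_add _ _)), finsum_add_distrib hfin2 hfin3,
    deltaComm_apply, deltaLin_apply, Delta_eq,
    mul_finsum' (fun n => deltaTerm n f) (X l) (finite_support_deltaTerm f)]
  congr 2
  · rw [finsum_eq_single _ l (fun n hn => if_neg hn), if_pos rfl]
  · unfold hbarHalf
    split_ifs with h
    · obtain ⟨m, hm⟩ := h
      have hm0 : 0 < m := by have := l.pos; omega
      obtain ⟨q, rfl⟩ : ∃ q : ℕ+, (q : ℕ) = m := ⟨⟨m, hm0⟩, rfl⟩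
      have h2 : 2 * q = l := PNat.eq hm.symm
      rw [finsum_eq_single _ q, if_pos h2]
      · rw [hm]; simp
      · intro n hn
        refine if_neg fun h => hn (mul_left_cancel (h.trans h2.symm))
    · rw [zero_mul]
      refine finsum_eq_zero_of_forall_eq_zero fun n => if_neg ?_
      rintro rfl
      exact h ⟨n, by simp⟩

/-- Both operators have coefficients free of the variables `p_n`, hence commute; so `[Δ, [Δ, p_l]] =
0`. -/
theorem deltaLin_deltaComm (l : ℕ+) (f : LambdaPoly k) :
    deltaLin (deltaComm l f) = deltaComm l (deltaLin f) := by
  have hh : ∀ a, ∀ q : LambdaPoly k, deltaLin (hbar a * q) = hbar a * deltaLin q := by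
    intro a q
    rw [hbar, ← smul_eq_C_mul, map_smul, smul_eq_C_mul]
  have hn : ∀ n : ℕ, ∀ q : LambdaPoly k, deltaLin ((n : LambdaPoly k) * q) = n * deltaLin q := by
    intro a q
    rw [← nsmul_eq_mul, map_nsmul, nsmul_eq_mul]
  rw [deltaComm_apply, deltaComm_apply, map_add, mul_assoc, hh, hn, pderiv_deltaLin, mul_assoc]
  congr 1
  unfold hbarHalf
  split_ifs
  · rw [hh]
  · simp

theorem deltaLin_pow_deltaComm (l : ℕ+) (j : ℕ) (f : LambdaPoly k) :
    (deltaLin ^ j) (deltaComm l f) = deltaComm l ((deltaLin ^ j) f) := by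
  induction j generalizing f with
  | zero => rfl
  | succ j ih => rw [pow_succ, Module.End.mul_apply, Module.End.mul_apply, deltaLin_deltaComm, ih]

/-- Since `Δ` commutes with its commutator with `p_l`, each of the `j + 1` factors contributes the
same term. -/
theorem deltaLin_pow_X_mul [CharZero k] (l : ℕ+) (j : ℕ) (f : LambdaPoly k) :
    (deltaLin ^ (j + 1)) (X l * f) = X l * (deltaLin ^ (j + 1)) f
      + ((j + 1 : ℕ) : LambdaPoly k) * deltaComm l ((deltaLin ^ j) f) := by
  induction j with
  | zero => simp [deltaLin_X_mul]
  | succ j ih =>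
    have h : ∀ i, deltaLin ((deltaLin ^ i) f) = (deltaLin ^ (i + 1)) f := fun i => by
      rw [pow_succ', Module.End.mul_apply]
    rw [pow_succ' _ (j + 1), Module.End.mul_apply, ih, map_add, deltaLin_X_mul, ← nsmul_eq_mul, map_nsmul,
      deltaLin_deltaComm, h, h, nsmul_eq_mul, ← Module.End.mul_apply, ← pow_succ']
    push_cast
    ring

/-- By the previous formula a multiplication by `p_l` raises the order of nilpotency by at most one,
and constants are killed by `Δ`. -/
theorem exists_deltaLin_pow_eq_zero [CharZero k] (f : LambdaPoly k) :
    ∃ n, ∀ j, n ≤ j → (deltaLin ^ j) f = 0 := by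
  have mono : ∀ (f : LambdaPoly k) (n j : ℕ), (deltaLin ^ n) f = 0 → n ≤ j → (deltaLin ^ j) f = 0 := by
    intro f n j h hj
    obtain ⟨i, rfl⟩ := Nat.exists_eq_add_of_le' hj
    rw [pow_add, Module.End.mul_apply, h, map_zero]
  suffices h : ∃ n, (deltaLin ^ n) f = 0 from ⟨h.choose, fun j => mono f _ j h.choose_spec⟩
  induction f using MvPolynomial.induction_on with
  | C a =>
    refine ⟨1, ?_⟩
    rw [pow_one, deltaLin_apply, Delta_eq]
    refine finsum_eq_zero_of_forall_eq_zero fun n => ?_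
    rw [deltaTerm_apply, pderiv_C, pderiv_C, map_zero, mul_zero, add_zero, mul_zero]
  | add f g hf hg =>
    obtain ⟨m, hm⟩ := hf
    obtain ⟨n, hn⟩ := hg
    exact ⟨m + n, by rw [map_add, mono f m _ hm (by omega), mono g n _ hn (by omega), add_zero]⟩
  | mul_X f l hf =>
    obtain ⟨m, hm⟩ := hf
    refine ⟨m + 1, ?_⟩
    rw [mul_comm, deltaLin_pow_X_mul, mono f m _ hm (by omega), hm]
    simp

theorem iterate_Delta (j : ℕ) (f : LambdaPoly k) : Delta^[j] f = (deltaLin ^ j) f := by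
  rw [Module.End.pow_apply]; rfl

theorem finite_support_expDelta [CharZero k] (f : LambdaPoly k) :
    (Function.support fun j : ℕ => ((-1) ^ j / (j.factorial : k)) • (deltaLin ^ j) f).Finite := by
  obtain ⟨n, hn⟩ := exists_deltaLin_pow_eq_zero f
  refine (Set.finite_lt_nat n).subset fun j hj => ?_
  by_contra h
  refine hj ?_
  change _ • _ = _
  rw [hn j (not_lt.1 h), smul_zero]

/-- The operator `exp(-Δ)` on polynomials. -/
noncomputable def expDelta [CharZero k] : LambdaPoly k →ₗ[LaurentPolynomial k] LambdaPoly k where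
  toFun f := ∑ᶠ j : ℕ, ((-1) ^ j / (j.factorial : k)) • (deltaLin ^ j) f
  map_add' f g := by
    simp only [map_add, smul_add]
    exact finsum_add_distrib (finite_support_expDelta f) (finite_support_expDelta g)
  map_smul' c f := by
    simp only [map_smul, RingHom.id_apply]
    rw [smul_finsum' c (finite_support_expDelta f)]
    exact finsum_congr fun j => smul_comm _ _ _

theorem coeff_expNegDelta [CharZero k] (f : LambdaSeries k) (w : ℕ) :
    PowerSeries.coeff w (expNegDelta f) = expDelta (PowerSeries.coeff w f) := by
  rw [expNegDelta, PowerSeries.coeff_mk]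
  exact finsum_congr fun j => by rw [iterate_Delta]

theorem expDelta_eq_sum [CharZero k] {f : LambdaPoly k} {n : ℕ} (hn : ∀ j, n ≤ j → (deltaLin ^ j) f = 0) :
    expDelta f = ∑ j ∈ Finset.range n, ((-1) ^ j / (j.factorial : k)) • (deltaLin ^ j) f := by
  refine finsum_eq_sum_of_support_subset _ fun j hj => ?_
  rw [Finset.coe_range, Set.mem_Iio]
  by_contra h
  refine hj ?_
  change _ • _ = _
  rw [hn j (not_lt.1 h), smul_zero]

theorem expDelta_one [CharZero k] : expDelta (1 : LambdaPoly k) = 1 := by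
  have h1 : deltaLin (1 : LambdaPoly k) = 0 := by
    rw [deltaLin_apply, Delta_eq]
    refine finsum_eq_zero_of_forall_eq_zero fun n => ?_
    rw [deltaTerm_apply, pderiv_one, pderiv_one, map_zero, mul_zero, add_zero, mul_zero]
  rw [expDelta_eq_sum (n := 1)]
  · simp
  · intro j hj
    obtain ⟨i, rfl⟩ := Nat.exists_eq_add_of_le' hj
    rw [pow_add, Module.End.mul_apply, pow_one, h1, map_zero]

/-- This is `exp(-Δ) p_l exp(Δ) = p_l - [Δ, p_l]`, the higher commutators being zero. Termwise, the
factor `j + 1` of `deltaLin_pow_X_mul` reduces `(j + 1)!` to `j!`, and the shift of `j` gives the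
minus sign. -/
theorem expDelta_X_mul [CharZero k] (l : ℕ+) (f : LambdaPoly k) :
    expDelta (X l * f) = X l * expDelta f - expDelta (deltaComm l f) := by
  obtain ⟨n, hn⟩ := exists_deltaLin_pow_eq_zero f
  have h1 : ∀ j, n + 1 ≤ j → (deltaLin ^ j) (X l * f) = 0 := by
    intro j hj
    obtain ⟨i, rfl⟩ := Nat.exists_eq_add_of_le' (show 1 ≤ j by omega)
    rw [deltaLin_pow_X_mul, hn _ (by omega), hn _ (by omega)]
    simp
  have h2 : ∀ j, n ≤ j → (deltaLin ^ j) (deltaComm l f) = 0 := by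
    intro j hj
    rw [deltaLin_pow_deltaComm, hn j hj, map_zero]
  rw [expDelta_eq_sum h1, expDelta_eq_sum (n := n + 1) (f := f) (fun j hj => hn j (by omega)), expDelta_eq_sum h2,
    Finset.sum_range_succ', Finset.sum_range_succ' _ n]
  have h3 : ∀ j : ℕ, ((-1) ^ (j + 1) / ((j + 1).factorial : k)) • (deltaLin ^ (j + 1)) (X l * f)
      = X l * (((-1) ^ (j + 1) / ((j + 1).factorial : k)) • (deltaLin ^ (j + 1)) f)
        - ((-1) ^ j / (j.factorial : k)) • (deltaLin ^ j) (deltaComm l f) := by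
    intro j
    rw [deltaLin_pow_X_mul, smul_add, mul_smul_comm, deltaLin_pow_deltaComm, sub_eq_add_neg]
    congr 1
    have : ((j + 1 : ℕ) : LambdaPoly k) = algebraMap k _ ((j + 1 : ℕ) : k) := by simp
    rw [this, ← Algebra.smul_def, smul_smul, ← neg_smul]
    congr 1
    have h4 : ((j + 1 : ℕ) : k) ≠ 0 := by exact_mod_cast Nat.succ_ne_zero j
    rw [Nat.factorial_succ, pow_succ]
    push_cast at h4 ⊢
    field_simp
  simp only [h3, Finset.sum_sub_distrib, ← Finset.mul_sum]
  simp [mul_add]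
  ring

end ExpDelta

end ModularOperads

namespace ModularOperads

/-! ### Products over the classes of an equivalence relation -/

section OrbitProduct

/-- The product over the classes of an equivalence relation of the values of `u` (which should be
constant on the classes). -/
noncomputable def classProd {X M : Type*} [CommMonoid M] (R : Setoid X) (u : X → M) : M :=
  ∏ᶠ q : Quotient R, u q.out

variable {X Y Z M : Type*} [CommMonoid M] {R : Setoid X} {S : Setoid Y}

theorem classProd_congr {u v : X → M} (h : ∀ x, u x = v x) : classProd R u = classProd R v :=
  finprod_congr fun _ => h _

theorem classProd_one : classProd R (fun _ => (1 : M)) = 1 := finprod_one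

theorem classProd_mul [Finite X] (u v : X → M) :
    classProd R (fun x => u x * v x) = classProd R u * classProd R v :=
  finprod_mul_distrib (Set.toFinite _) (Set.toFinite _)

theorem map_classProd {N : Type*} [CommMonoid N] [Finite X] (φ : M →* N) (u : X → M) :
    φ (classProd R u) = classProd R (fun x => φ (u x)) :=
  φ.map_finprod (Set.toFinite _)

/-- The map `φ` induces a bijection of classes; `u` is constant on classes, so the representatives
chosen on the two sides need not correspond. -/
theorem classProd_comp (φ : X → Y) (h1 : ∀ x x', R x x' ↔ S (φ x) (φ x')) (h2 : ∀ y, ∃ x, S (φ x) y)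
    {u : Y → M} (hu : ∀ y y', S y y' → u y = u y') :
    classProd S u = classProd R (fun x => u (φ x)) := by
  have hb : Function.Bijective (Quotient.map (sa := R) (sb := S) φ fun x x' h => (h1 x x').1 h) := by
    constructor
    · rintro ⟨x⟩ ⟨x'⟩ h
      exact Quotient.sound ((h1 x x').2 (Quotient.exact h))
    · rintro ⟨y⟩
      obtain ⟨x, hx⟩ := h2 y
      exact ⟨Quotient.mk R x, Quotient.sound hx⟩
  rw [classProd, ← finprod_comp _ hb]
  refine finprod_congr fun q => hu _ _ ?_
  conv_lhs => rw [← Quotient.out_eq q]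
  exact Quotient.mk_out (s := S) (φ q.out)

theorem classProd_sum [Finite X] [Finite Y] {T : Setoid Z} (φ : X → Z) (ψ : Y → Z)
    (hφ : ∀ x x', R x x' ↔ T (φ x) (φ x')) (hψ : ∀ y y', S y y' ↔ T (ψ y) (ψ y'))
    (hd : ∀ x y, ¬ T (φ x) (ψ y)) (hs : ∀ z, (∃ x, T (φ x) z) ∨ ∃ y, T (ψ y) z)
    {u : Z → M} (hu : ∀ z z', T z z' → u z = u z') :
    classProd T u = classProd R (fun x => u (φ x)) * classProd S (fun y => u (ψ y)) := by
  classical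
  have hb : Function.Bijective (Sum.elim
      (Quotient.map (sa := R) (sb := T) φ fun x x' h => (hφ x x').1 h)
      (Quotient.map (sa := S) (sb := T) ψ fun x x' h => (hψ x x').1 h)) := by
    constructor
    · rintro (x | x) (x' | x') h <;> induction x using Quotient.inductionOn with | _ x <;>
        induction x' using Quotient.inductionOn with | _ x'
      · exact congrArg Sum.inl (Quotient.sound ((hφ x x').2 (Quotient.exact h)))
      · exact absurd (Quotient.exact h) (hd x x')
      · exact absurd (Quotient.exact h.symm) (hd x' x)
      · exact congrArg Sum.inr (Quotient.sound ((hψ x x').2 (Quotient.exact h)))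
    · rintro ⟨z⟩
      rcases hs z with ⟨x, hx⟩ | ⟨y, hy⟩
      · exact ⟨Sum.inl (Quotient.mk R x), Quotient.sound hx⟩
      · exact ⟨Sum.inr (Quotient.mk S y), Quotient.sound hy⟩
  have := Fintype.ofFinite (Quotient R)
  have := Fintype.ofFinite (Quotient S)
  rw [classProd, ← finprod_comp _ hb, finprod_eq_prod_of_fintype, Fintype.prod_sum_type, classProd, classProd,
    finprod_eq_prod_of_fintype, finprod_eq_prod_of_fintype]
  congr 1
  · refine Finset.prod_congr rfl fun q _ => hu _ _ ?_
    conv_lhs => rw [← Quotient.out_eq q]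
    exact Quotient.mk_out (s := T) (φ q.out)
  · refine Finset.prod_congr rfl fun q _ => hu _ _ ?_
    conv_lhs => rw [← Quotient.out_eq q]
    exact Quotient.mk_out (s := T) (ψ q.out)

open Classical in
theorem classProd_remove [Finite X] {u : X → M} (hu : ∀ x x', R x x' → u x = u x') (c : X) :
    classProd R u = u c * classProd R (fun x => if R c x then 1 else u x) := by
  have h1 : ∀ x, u x = (if R c x then u c else 1) * (if R c x then 1 else u x) := by
    intro x
    split_ifs with h
    · rw [mul_one, hu c x h]
    · rw [one_mul]
  rw [classProd_congr h1, classProd_mul]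
  congr 1
  rw [classProd, finprod_eq_single _ (Quotient.mk R c)]
  · exact if_pos (Setoid.symm' R (Quotient.mk_out (s := R) c))
  · intro q hq
    refine if_neg fun h => hq ?_
    rw [← Quotient.out_eq q]
    exact (Quotient.sound h).symm

/-- Only classes on which `u` is not `1` contribute, so the relations may differ elsewhere. This
allows an involution to be altered on flags that have been taken out. -/
theorem classProd_setoid_congr {R' : Setoid X} {u : X → M} (hu : ∀ x x', R x x' → u x = u x')
    (hu' : ∀ x x', R' x x' → u x = u x') (h : ∀ x y, u x ≠ 1 → (R x y ↔ R' x y)) :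
    classProd R u = classProd R' u := by
  rw [classProd, classProd, ← finprod_mem_mulSupport (fun q : Quotient R => u q.out),
    ← finprod_mem_mulSupport (fun q : Quotient R' => u q.out)]
  refine finprod_mem_eq_of_bijOn (f := fun q : Quotient R => u q.out)
    (g := fun q : Quotient R' => u q.out) (fun q : Quotient R => Quotient.mk R' q.out) ⟨?_, ?_, ?_⟩ ?_
  · intro q hq
    rw [Function.mem_mulSupport] at hq ⊢
    rwa [hu' _ _ (Quotient.mk_out (s := R') q.out)]
  · intro q hq q' hq' hqq
    rw [← Quotient.out_eq q, ← Quotient.out_eq q']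
    exact Quotient.sound ((h _ _ hq).2 (Quotient.exact hqq))
  · intro q hq
    have h0 := Quotient.mk_out (s := R) q.out
    have h1 : u (Quotient.mk R q.out).out ≠ 1 := by
      rw [hu _ _ h0]; exact hq
    refine ⟨Quotient.mk R q.out, h1, ?_⟩
    conv_rhs => rw [← Quotient.out_eq q]
    exact Quotient.sound ((h _ _ h1).1 h0)
  · intro q _
    exact (hu' _ _ (Quotient.mk_out (s := R') q.out)).symm

end OrbitProduct

/-! ### Lengths of cycles -/

section Period

open Equiv.Perm

variable {X Y : Type*}

/-- The length of the cycle of `x`. -/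
noncomputable def period (π : Equiv.Perm X) (x : X) : ℕ := Function.minimalPeriod π x

theorem pow_apply_eq_self_iff (π : Equiv.Perm X) (x : X) (n : ℕ) :
    (π ^ n) x = x ↔ period π x ∣ n := by
  rw [period, ← Function.isPeriodicPt_iff_minimalPeriod_dvd, Function.IsPeriodicPt, Function.IsFixedPt,
    Equiv.Perm.iterate_eq_pow]

theorem pow_period (π : Equiv.Perm X) (x : X) : (π ^ period π x) x = x :=
  (pow_apply_eq_self_iff π x _).2 dvd_rfl

theorem period_pos [Finite X] (π : Equiv.Perm X) (x : X) : 0 < period π x := by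
  refine Nat.pos_of_dvd_of_pos ((pow_apply_eq_self_iff π x _).1 ?_) (orderOf_pos π)
  rw [pow_orderOf_eq_one]; rfl

theorem zpow_apply_eq_self_iff (π : Equiv.Perm X) (x : X) (n : ℤ) :
    (π ^ n) x = x ↔ (period π x : ℤ) ∣ n := by
  obtain ⟨m, rfl | rfl⟩ := n.eq_nat_or_neg
  · rw [zpow_natCast, pow_apply_eq_self_iff, Int.natCast_dvd_natCast]
  · rw [zpow_neg, Int.dvd_neg, zpow_natCast, Equiv.Perm.inv_eq_iff_eq, eq_comm, pow_apply_eq_self_iff,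
      Int.natCast_dvd_natCast]

theorem zpow_apply_eq_zpow_iff (π : Equiv.Perm X) (x : X) (m n : ℤ) :
    (π ^ m) x = (π ^ n) x ↔ (period π x : ℤ) ∣ m - n := by
  rw [← zpow_apply_eq_self_iff, sub_eq_neg_add, zpow_add, zpow_neg, Equiv.Perm.mul_apply,
    Equiv.Perm.inv_eq_iff_eq]

theorem pow_apply_eq_pow_iff (π : Equiv.Perm X) (x : X) (m n : ℕ) :
    (π ^ m) x = (π ^ n) x ↔ m ≡ n [MOD period π x] := by
  rw [← zpow_natCast, ← zpow_natCast, zpow_apply_eq_zpow_iff, Nat.modEq_iff_dvd, ← Int.dvd_neg, neg_sub]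

theorem period_eq_of_forall {π : Equiv.Perm X} {x : X} {σ : Equiv.Perm Y} {y : Y}
    (h : ∀ n : ℕ, (π ^ n) x = x ↔ (σ ^ n) y = y) : period π x = period σ y := by
  refine Nat.dvd_antisymm ?_ ?_
  · rw [← pow_apply_eq_self_iff, h, pow_apply_eq_self_iff]
  · rw [← pow_apply_eq_self_iff, ← h, pow_apply_eq_self_iff]

theorem period_comp (φ : X → Y) (hφ : Function.Injective φ) {π : Equiv.Perm X} {σ : Equiv.Perm Y}
    (h : ∀ x, φ (π x) = σ (φ x)) (x : X) : period σ (φ x) = period π x := by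
  have h1 : ∀ n : ℕ, ∀ x, φ ((π ^ n) x) = (σ ^ n) (φ x) := by
    intro n
    induction n with
    | zero => intro x; rfl
    | succ n ih => intro x; rw [pow_succ, pow_succ, Equiv.Perm.mul_apply, Equiv.Perm.mul_apply, ih, h]
  refine period_eq_of_forall fun n => ?_
  rw [← h1, hφ.eq_iff]

theorem period_sameCycle {π : Equiv.Perm X} {x y : X} (h : SameCycle π x y) :
    period π x = period π y := by
  obtain ⟨i, rfl⟩ := h
  refine (period_comp (π ^ i) (Equiv.injective _) (fun z => ?_) x).symm
  rw [← Equiv.Perm.mul_apply, ← Equiv.Perm.mul_apply, ← zpow_add_one, ← zpow_one_add, add_comm]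

theorem card_cycle [Fintype X] (π : Equiv.Perm X) (x : X) [DecidablePred (SameCycle π x)] :
    Finset.card {y | SameCycle π x y} = period π x := by
  rw [← Finset.card_range (period π x)]
  symm
  refine Finset.card_bij (fun i _ => (π ^ i) x) ?_ ?_ ?_
  · intro i _
    simp only [Finset.mem_filter, Finset.mem_univ, true_and]
    exact ⟨i, by rw [zpow_natCast]⟩
  · intro i hi j hj h
    rw [pow_apply_eq_pow_iff] at h
    exact Nat.ModEq.eq_of_lt_of_lt h (Finset.mem_range.1 hi) (Finset.mem_range.1 hj)
  · intro y hy
    simp only [Finset.mem_filter, Finset.mem_univ, true_and] at hy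
    obtain ⟨i, rfl⟩ := hy.exists_nat_pow_eq
    refine ⟨i % period π x, Finset.mem_range.2 (Nat.mod_lt _ (period_pos π x)), ?_⟩
    rw [pow_apply_eq_pow_iff]
    exact Nat.mod_modEq _ _

end Period

end ModularOperads

namespace ModularOperads

open Equiv.Perm

/-! ### Involutions that commute with a permutation -/

section Pairing

theorem perm_apply_inv_self {X : Type*} (π : Equiv.Perm X) (x : X) : π (π⁻¹ x) = x :=
  Equiv.apply_symm_apply π x

variable {X : Type*}

/-- The equivalence relation generated by a permutation and a map. -/
def glue (π : Equiv.Perm X) (ι : X → X) : Setoid X :=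
  Relation.EqvGen.setoid fun x y => π x = y ∨ ι x = y

/-- `ι` is an involution which commutes with `π` and whose support is contained in `F`. -/
structure IsPairing (π : Equiv.Perm X) (F : Set X) (ι : X → X) : Prop where
  invol : ∀ y, ι (ι y) = y
  comm : ∀ y, ι (π y) = π (ι y)
  fix : ∀ y, y ∉ F → ι y = y

namespace IsPairing

variable {π : Equiv.Perm X} {F : Set X} {ι : X → X}

theorem comm_zpow (h : IsPairing π F ι) (i : ℤ) (y : X) : ι ((π ^ i) y) = (π ^ i) (ι y) := by
  have hn : ∀ n : ℕ, ∀ y, ι ((π ^ n) y) = (π ^ n) (ι y) := by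
    intro n
    induction n with
    | zero => intro y; rfl
    | succ n ih => intro y; rw [pow_succ, Equiv.Perm.mul_apply, Equiv.Perm.mul_apply, ih, h.comm]
  obtain ⟨m, rfl | rfl⟩ := i.eq_nat_or_neg
  · rw [zpow_natCast, hn]
  · rw [zpow_neg, zpow_natCast, eq_comm, Equiv.Perm.inv_eq_iff_eq, ← hn, perm_apply_inv_self]

theorem sameCycle (h : IsPairing π F ι) {x y : X} (hxy : SameCycle π x y) :
    SameCycle π (ι x) (ι y) := by
  obtain ⟨i, rfl⟩ := hxy
  exact ⟨i, (h.comm_zpow i x).symm⟩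

theorem sameCycle_iff (h : IsPairing π F ι) {x y : X} : SameCycle π (ι x) (ι y) ↔ SameCycle π x y := by
  refine ⟨fun hh => ?_, h.sameCycle⟩
  have := h.sameCycle hh
  rwa [h.invol, h.invol] at this

theorem sameCycle_swap (h : IsPairing π F ι) {x y : X} : SameCycle π (ι x) y ↔ SameCycle π x (ι y) := by
  rw [← h.sameCycle_iff, h.invol]

/-- Because `ι` is an involution commuting with `π`, it permutes the cycles, and a class is a cycle
together with its image under `ι`. -/
theorem glue_iff (h : IsPairing π F ι) {x y : X} :
    glue π ι x y ↔ SameCycle π x y ∨ SameCycle π (ι x) y := by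
  constructor
  · intro hg
    induction hg with
    | rel x y hxy =>
      rcases hxy with rfl | rfl
      · exact Or.inl (sameCycle_apply_right.2 SameCycle.rfl)
      · exact Or.inr SameCycle.rfl
    | refl x => exact Or.inl SameCycle.rfl
    | symm x y _ ih =>
      rcases ih with ih | ih
      · exact Or.inl ih.symm
      · exact Or.inr (h.sameCycle_swap.1 ih).symm
    | trans x y z _ _ ih1 ih2 =>
      rcases ih1 with ih1 | ih1 <;> rcases ih2 with ih2 | ih2
      · exact Or.inl (ih1.trans ih2)
      · exact Or.inr ((h.sameCycle ih1).trans ih2)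
      · exact Or.inr (ih1.trans ih2)
      · exact Or.inl ((h.sameCycle_swap.1 ih1).trans ih2)
  · have key : ∀ x y, SameCycle π x y → glue π ι x y := by
      rintro x _ ⟨i, rfl⟩
      have hn : ∀ n : ℕ, ∀ x, glue π ι x ((π ^ n) x) := by
        intro n
        induction n with
        | zero => intro x; exact Setoid.refl' _ x
        | succ n ih =>
          intro x
          rw [pow_succ', Equiv.Perm.mul_apply]
          exact Setoid.trans' _ (ih x) (.rel _ _ (Or.inl rfl))
      obtain ⟨m, rfl | rfl⟩ := i.eq_nat_or_neg
      · exact hn m x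
      · have := hn m ((π ^ (-(m : ℤ))) x)
        rw [zpow_neg, zpow_natCast, perm_apply_inv_self] at this
        rw [zpow_neg, zpow_natCast]
        exact Setoid.symm' _ this
    rintro (hxy | hxy)
    · exact key x y hxy
    · exact Setoid.trans' _ (.rel _ _ (Or.inr rfl)) (key _ _ hxy)

theorem period_eq (h : IsPairing π F ι) (y : X) : period π (ι y) = period π y :=
  period_comp ι (Function.LeftInverse.injective h.invol) h.comm y

theorem apply_mem_iff (h : IsPairing π F ι) {y : X} : ι y ∈ F ↔ y ∈ F := by
  constructor
  · intro hy
    by_contra hn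
    rw [h.fix y hn] at hy
    exact hn hy
  · intro hy
    by_contra hn
    have := h.fix _ hn
    rw [h.invol] at this
    rw [← this] at hn
    exact hn hy

end IsPairing

theorem mem_iff_of_sameCycle {π : Equiv.Perm X} {F : Set X} (hF : ∀ y, π y ∈ F ↔ y ∈ F) {x y : X}
    (h : SameCycle π x y) : x ∈ F ↔ y ∈ F := by
  obtain ⟨i, rfl⟩ := h
  have hn : ∀ n : ℕ, ∀ y, (π ^ n) y ∈ F ↔ y ∈ F := by
    intro n
    induction n with
    | zero => intro y; exact Iff.rfl
    | succ n ih => intro y; rw [pow_succ, Equiv.Perm.mul_apply, ih, hF]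
  obtain ⟨m, rfl | rfl⟩ := i.eq_nat_or_neg
  · rw [zpow_natCast, hn]
  · rw [zpow_neg, zpow_natCast, ← hn m ((π ^ m)⁻¹ x), perm_apply_inv_self]

end Pairing

/-! ### Sums over equivariant pairings of flags -/

section Wick

variable {k : Type u} [Field k] {X : Type*}

/-- The power sum attached to the cycle of `y`. -/
noncomputable def cycleVar (k : Type u) [Field k] (π : Equiv.Perm X) (y : X) : LambdaPoly k :=
  MvPolynomial.X (period π y).toPNat'

open Classical in
/-- The number of edges in the class of the flag `y` (half the number of flags in it). -/
noncomputable def edgeCount (π : Equiv.Perm X) (ι : X → X) (y : X) : ℕ :=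
  if SameCycle π y (ι y) then period π y / 2 else period π y

open Classical in
/-- The weight of the class of a flag: a power sum for legs, and `x ħ ^ (number of edges)` for edges. -/
noncomputable def flagWeight (x : k) (π : Equiv.Perm X) (F : Set X) (ι : X → X) (y : X) : LambdaPoly k :=
  if y ∈ F then if ι y = y then cycleVar k π y else x • hbar (edgeCount π ι y) else 1

theorem flagWeight_congr {x : k} {Y : Type*} {π : Equiv.Perm X} {π' : Equiv.Perm Y} {F : Set X} {F' : Set Y} {ι : X → X} {ι' : Y → Y} {y : X} {z : Y}
    (h1 : y ∈ F ↔ z ∈ F') (h2 : ι y = y ↔ ι' z = z) (h3 : period π y = period π' z)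
    (h4 : SameCycle π y (ι y) ↔ SameCycle π' z (ι' z)) :
    flagWeight x π F ι y = flagWeight x π' F' ι' z := by
  unfold flagWeight edgeCount cycleVar
  rw [h3]
  by_cases h5 : y ∈ F
  · rw [if_pos h5, if_pos (h1.1 h5)]
    by_cases h6 : ι y = y
    · rw [if_pos h6, if_pos (h2.1 h6)]
    · rw [if_neg h6, if_neg (mt h2.2 h6)]
      by_cases h7 : SameCycle π y (ι y)
      · rw [if_pos h7, if_pos (h4.1 h7)]
      · rw [if_neg h7, if_neg (mt h4.2 h7)]
  · rw [if_neg h5, if_neg (mt h1.2 h5)]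

theorem flagWeight_of_sameCycle {x : k} {π : Equiv.Perm X} {F : Set X} {ι : X → X}
    (hF : ∀ y, π y ∈ F ↔ y ∈ F) (h : IsPairing π F ι) {y z : X} (hyz : SameCycle π y z) :
    flagWeight x π F ι y = flagWeight x π F ι z := by
  have h3 : (ι y = y) ↔ ι z = z := by
    obtain ⟨i, rfl⟩ := hyz
    rw [h.comm_zpow, (Equiv.injective _).eq_iff]
  have h4 : SameCycle π y (ι y) ↔ SameCycle π z (ι z) :=
    ⟨fun hh => hyz.symm.trans (hh.trans (h.sameCycle hyz)),
      fun hh => hyz.trans (hh.trans (h.sameCycle hyz).symm)⟩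
  exact flagWeight_congr (mem_iff_of_sameCycle hF hyz) h3 (period_sameCycle hyz) h4

/-- Makes the product of the flag weights over the glued classes independent of representatives. -/
theorem flagWeight_of_glue {x : k} {π : Equiv.Perm X} {F : Set X} {ι : X → X}
    (hF : ∀ y, π y ∈ F ↔ y ∈ F) (h : IsPairing π F ι) (y z : X) (hyz : glue π ι y z) :
    flagWeight x π F ι y = flagWeight x π F ι z := by
  have h1 : flagWeight x π F ι y = flagWeight x π F ι (ι y) := by
    refine flagWeight_congr h.apply_mem_iff.symm ?_ (h.period_eq y).symm ?_
    · rw [h.invol, eq_comm]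
    · rw [h.invol, sameCycle_comm]
  rcases h.glue_iff.1 hyz with hh | hh
  · exact flagWeight_of_sameCycle hF h hh
  · rw [h1]; exact flagWeight_of_sameCycle hF h hh

variable [Fintype X]

open Classical in
/-- The sum over all pairings of flags in `F`. -/
noncomputable def pairSum (x : k) (π : Equiv.Perm X) (F : Set X) : LambdaPoly k :=
  ∑ ι : X → X with IsPairing π F ι, classProd (glue π ι) (flagWeight x π F ι)

open Classical in
-- Once the partner of `c` is prescribed, equivariance fixes the pairing on the cycles of `c` and of
-- its partner. These form one class, which contributes its weight; the pairing of the remaining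
-- flags is arbitrary.
theorem sum_pairing_apply_eq {x : k} {π : Equiv.Perm X} {F : Set X} {κ : X → X}
    (hF : ∀ y, π y ∈ F ↔ y ∈ F) (hκ : IsPairing π F κ) {c : X} (hc : c ∈ F) :
    ∑ ι : X → X with IsPairing π F ι ∧ ι c = κ c, classProd (glue π ι) (flagWeight x π F ι)
      = flagWeight x π F κ c
        * pairSum x π {z | z ∈ F ∧ ¬ (SameCycle π c z ∨ SameCycle π (κ c) z)} := by
  -- The class of `c`, for every pairing that agrees with `κ` at `c`.
  set D : Set X := {z | SameCycle π c z ∨ SameCycle π (κ c) z} with hD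
  have hD1 : ∀ z, π z ∈ D ↔ z ∈ D := fun z => by
    simp only [hD, Set.mem_ofPred_eq, sameCycle_apply_right]
  have hD2 : ∀ ι, IsPairing π F ι → ι c = κ c → ∀ z, ι z ∈ D ↔ z ∈ D := fun ι h hc z => by
    simp only [hD, Set.mem_ofPred_eq, ← hc]
    rw [h.sameCycle_iff, or_comm, ← h.sameCycle_swap]
  have hD3 : ∀ ι, IsPairing π F ι → ι c = κ c → ∀ z ∈ D, ι z = κ z := by
    rintro ι h hc z (⟨i, rfl⟩ | ⟨i, rfl⟩)
    · rw [h.comm_zpow, hκ.comm_zpow, hc]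
    · rw [h.comm_zpow, hκ.comm_zpow, hκ.invol, ← hc, h.invol]
  have hDF : ∀ z ∈ D, z ∈ F := by
    rintro z (h | h)
    · exact (mem_iff_of_sameCycle hF h).1 hc
    · exact (mem_iff_of_sameCycle hF h).1 (hκ.apply_mem_iff.2 hc)
  have hD4 : ∀ ι, IsPairing π {z | z ∈ F ∧ ¬ (SameCycle π c z ∨ SameCycle π (κ c) z)} ι →
      ∀ z ∈ D, ι z = z := fun ι h z hz => h.fix z fun hh => hh.2 hz
  have hD5 : ∀ ι, IsPairing π {z | z ∈ F ∧ ¬ (SameCycle π c z ∨ SameCycle π (κ c) z)} ι →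
      ∀ z, ι z ∈ D ↔ z ∈ D := fun ι h z => by
    constructor
    · intro hz
      have := hD4 ι h _ hz
      rw [h.invol] at this
      rwa [this]
    · intro hz; rwa [hD4 ι h z hz]
  rw [pairSum, Finset.mul_sum]
  -- The pairing is undone on `D`; conversely `κ` is put back on `D`.
  refine Finset.sum_bij' (fun ι _ z => if z ∈ D then z else ι z)
    (fun ι _ z => if z ∈ D then κ z else ι z) ?_ ?_ ?_ ?_ ?_
  · intro ι hι
    simp only [Finset.mem_filter, Finset.mem_univ, true_and] at hι ⊢
    obtain ⟨h, hc'⟩ := hι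
    refine ⟨fun z => ?_, fun z => ?_, fun z hz => ?_⟩
    · by_cases hz : z ∈ D
      · simp [hz]
      · simp [hz, hD2 ι h hc' z, h.invol]
    · simp only [hD1, h.comm]
      split_ifs <;> rfl
    · split_ifs with hz'
      · rfl
      · exact h.fix z fun hh => hz ⟨hh, hz'⟩
  · intro ι h
    simp only [Finset.mem_filter, Finset.mem_univ, true_and] at h ⊢
    refine ⟨⟨fun z => ?_, fun z => ?_, fun z hz => ?_⟩, if_pos (Or.inl SameCycle.rfl)⟩
    · by_cases hz : z ∈ D
      · simp [hz, hD2 κ hκ rfl z, hκ.invol]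
      · simp [hz, hD5 ι h z, h.invol]
    · simp only [hD1, h.comm, hκ.comm]
      split_ifs <;> rfl
    · rw [if_neg fun hz' => hz (hDF z hz')]
      exact h.fix z fun hh => hz hh.1
  · intro ι hι
    simp only [Finset.mem_filter, Finset.mem_univ, true_and] at hι
    funext z
    by_cases hz : z ∈ D
    · simp [hz, hD3 ι hι.1 hι.2 z hz]
    · simp [hz]
  · intro ι h
    simp only [Finset.mem_filter, Finset.mem_univ, true_and] at h
    funext z
    by_cases hz : z ∈ D
    · simp [hz, hD4 ι h z hz]
    · simp [hz]
  · intro ι hι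
    have hι0 := hι
    simp only [Finset.mem_filter, Finset.mem_univ, true_and] at hι
    obtain ⟨h, hc'⟩ := hι
    set ι' : X → X := fun z => if z ∈ D then z else ι z with hι'
    have h' : IsPairing π {z | z ∈ F ∧ ¬ (SameCycle π c z ∨ SameCycle π (κ c) z)} ι' := by
      refine ⟨fun z => ?_, fun z => ?_, fun z hz => ?_⟩
      · by_cases hz : z ∈ D
        · simp [hι', hz]
        · simp [hι', hz, hD2 ι h hc' z, h.invol]
      · simp only [hι', hD1, h.comm]
        split_ifs <;> rfl
      · simp only [hι']
        split_ifs with hz'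
        · rfl
        · exact h.fix z fun hh => hz ⟨hh, hz'⟩
    have hF' : ∀ y, π y ∈ {z | z ∈ F ∧ ¬ (SameCycle π c z ∨ SameCycle π (κ c) z)} ↔
        y ∈ {z | z ∈ F ∧ ¬ (SameCycle π c z ∨ SameCycle π (κ c) z)} := fun y => by
      simp only [Set.mem_ofPred_eq, hF, sameCycle_apply_right]
    rw [classProd_remove (flagWeight_of_glue hF h) c]
    have h1 : ∀ z, glue π ι c z ↔ z ∈ D := fun z => by rw [h.glue_iff, hc']; rfl
    have h2 : ∀ z, (if glue π ι c z then 1 else flagWeight x π F ι z)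
        = flagWeight x π {z | z ∈ F ∧ ¬ (SameCycle π c z ∨ SameCycle π (κ c) z)} ι' z := by
      intro z
      by_cases hz : z ∈ D
      · rw [if_pos ((h1 z).2 hz), flagWeight, if_neg fun hh => hh.2 hz]
      · rw [if_neg fun hh => hz ((h1 z).1 hh)]
        have h3 : ι' z = ι z := if_neg hz
        have h4 : z ∈ {z | z ∈ F ∧ ¬ (SameCycle π c z ∨ SameCycle π (κ c) z)} ↔ z ∈ F :=
          ⟨fun hh => hh.1, fun hh => ⟨hh, hz⟩⟩
        exact flagWeight_congr h4.symm (by rw [h3]) rfl (by rw [h3])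
    rw [classProd_congr h2]
    congr 1
    · exact flagWeight_congr Iff.rfl (by rw [hc']) rfl (by rw [hc'])
    -- The relations glued by the old and the new involution differ only on `D`, where the weight is
    -- now `1`.
    · refine classProd_setoid_congr (fun y z hyz => ?_) (flagWeight_of_glue hF' h') fun y z hy => ?_
      · rw [← h2, ← h2]
        have : glue π ι c y ↔ glue π ι c z :=
          ⟨fun hh => Setoid.trans' _ hh hyz, fun hh => Setoid.trans' _ hh (Setoid.symm' _ hyz)⟩
        rw [if_congr this rfl (flagWeight_of_glue hF h y z hyz)]
      · have hyD : y ∉ D := fun hh => hy (if_neg fun h3 => h3.2 hh)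
        have h3 : ι' y = ι y := if_neg hyD
        rw [h.glue_iff, h'.glue_iff, h3]

end Wick

end ModularOperads

set_option linter.unusedSimpArgs false

namespace ModularOperads

open Equiv.Perm

/-! ### Wick's theorem -/

section Wick

variable {k : Type u} [Field k] {X : Type*}

/-- The half turn `π ^ h` on the cycle of `c`, and the identity elsewhere. -/
theorem exists_pairing_same {π : Equiv.Perm X} {F : Set X} (hF : ∀ y, π y ∈ F ↔ y ∈ F) {c : X}
    (hc : c ∈ F) {h : ℕ} (hh : period π c = 2 * h) :
    ∃ κ, IsPairing π F κ ∧ κ c = (π ^ h) c := by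
  classical
  refine ⟨fun z => if SameCycle π c z then (π ^ h) z else z, ⟨fun z => ?_, fun z => ?_, fun z hz => ?_⟩,
    if_pos SameCycle.rfl⟩
  · by_cases hz : SameCycle π c z
    · simp only [hz, if_true, sameCycle_pow_right]
      rw [← Equiv.Perm.mul_apply, ← pow_add, ← two_mul, ← hh, period_sameCycle hz, pow_period]
    · simp only [hz, if_false]
  · simp only [sameCycle_apply_right]
    split_ifs
    · rw [← Equiv.Perm.mul_apply, ← Equiv.Perm.mul_apply, ← pow_succ, ← pow_succ']
    · rfl
  · exact if_neg fun h => hz ((mem_iff_of_sameCycle hF h).1 hc)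

/-- The pairing exchanges `π ^ i c` with `π ^ i y`. -/
theorem exists_pairing_diff {π : Equiv.Perm X} {F : Set X} (hF : ∀ y, π y ∈ F ↔ y ∈ F) {c y : X}
    (hc : c ∈ F) (hy : y ∈ F) (hcy : ¬ SameCycle π c y) (hp : period π y = period π c) :
    ∃ κ, IsPairing π F κ ∧ κ c = y := by
  classical
  -- The transport `π ^ i a ↦ π ^ i b` is well defined because the periods agree; it is used in both
  -- directions.
  have ex : ∀ a b : X, period π a = period π b → ∃ f : X → X, ∀ i : ℤ, f ((π ^ i) a) = (π ^ i) b := by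
    intro a b hab
    have hex : ∀ z, ∃ w, ∀ i : ℤ, (π ^ i) a = z → w = (π ^ i) b := by
      intro z
      by_cases h : SameCycle π a z
      · obtain ⟨j, rfl⟩ := h
        refine ⟨(π ^ j) b, fun i hi => ?_⟩
        rw [zpow_apply_eq_zpow_iff] at hi ⊢
        rw [← hab, ← Int.dvd_neg, neg_sub]
        exact hi
      · exact ⟨z, fun i hi => absurd ⟨i, hi⟩ h⟩
    choose f hf using hex
    exact ⟨f, fun i => hf _ i rfl⟩
  obtain ⟨f, hf⟩ := ex c y hp.symm
  obtain ⟨g, hg⟩ := ex y c hp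
  have h1 : ∀ i : ℤ, ¬ SameCycle π c ((π ^ i) y) := fun i => by rwa [sameCycle_zpow_right]
  have h2 : ∀ i : ℤ, SameCycle π c ((π ^ i) c) := fun i => ⟨i, rfl⟩
  have h3 : ∀ i : ℤ, SameCycle π y ((π ^ i) y) := fun i => ⟨i, rfl⟩
  have hs : ∀ (i : ℤ) a, π ((π ^ i) a) = (π ^ (1 + i)) a := fun i a => by
    rw [zpow_add, zpow_one, Equiv.Perm.mul_apply]
  refine ⟨fun z => if SameCycle π c z then f z else if SameCycle π y z then g z else z,
    ⟨fun z => ?_, fun z => ?_, fun z hz => ?_⟩, ?_⟩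
  · by_cases hz : SameCycle π c z
    · obtain ⟨i, rfl⟩ := hz
      simp only [h1, h2, h3, hf, hg, if_true, if_false]
    · by_cases hz' : SameCycle π y z
      · obtain ⟨i, rfl⟩ := hz'
        simp only [h1, h2, h3, hf, hg, if_true, if_false]
      · simp only [hz, hz', if_false]
  · by_cases hz : SameCycle π c z
    · obtain ⟨i, rfl⟩ := hz
      simp only [hs, h1, h2, h3, hf, hg, if_true, if_false]
    · by_cases hz' : SameCycle π y z
      · obtain ⟨i, rfl⟩ := hz'
        simp only [hs, h1, h2, h3, hf, hg, if_true, if_false]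
      · simp only [sameCycle_apply_right, hz, hz', if_false]
  · rw [if_neg fun h => hz ((mem_iff_of_sameCycle hF h).1 hc),
      if_neg fun h => hz ((mem_iff_of_sameCycle hF h).1 hy)]
  · exact (if_pos SameCycle.rfl).trans (by simpa using hf 0)

open Classical in
/-- The product of the power sums attached to the cycles in `F`. -/
noncomputable def cycleProd (k : Type u) [Field k] (π : Equiv.Perm X) (F : Set X) : LambdaPoly k :=
  classProd (SameCycle.setoid π) fun y => if y ∈ F then cycleVar k π y else 1

theorem cycleProd_empty (π : Equiv.Perm X) : cycleProd k π ∅ = 1 := by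
  refine (classProd_congr fun y => ?_).trans classProd_one
  exact if_neg (Set.notMem_empty y)

/-- `F` without the cycle of `c`. -/
def removeCycle (π : Equiv.Perm X) (F : Set X) (c : X) : Set X := {z | z ∈ F ∧ ¬ SameCycle π c z}

theorem removeCycle_invariant {π : Equiv.Perm X} {F : Set X} (hF : ∀ y, π y ∈ F ↔ y ∈ F) (c : X) (y : X) :
    π y ∈ removeCycle π F c ↔ y ∈ removeCycle π F c := by
  simp only [removeCycle, Set.mem_ofPred_eq, hF, sameCycle_apply_right]

theorem removeCycle_comm {π : Equiv.Perm X} {F : Set X} (c d : X) :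
    removeCycle π (removeCycle π F c) d = removeCycle π (removeCycle π F d) c := by
  ext z; simp only [removeCycle, Set.mem_ofPred_eq]; tauto

theorem removeCycle_congr {π : Equiv.Perm X} {F : Set X} {c d : X} (h : SameCycle π c d) :
    removeCycle π F c = removeCycle π F d := by
  ext z
  simp only [removeCycle, Set.mem_ofPred_eq]
  have : SameCycle π c z ↔ SameCycle π d z := ⟨fun hh => h.symm.trans hh, fun hh => h.trans hh⟩
  rw [this]

theorem flagWeight_of_fixed {x : k} {π : Equiv.Perm X} {F : Set X} {ι : X → X} {c : X} (hc : c ∈ F)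
    (h : ι c = c) : flagWeight x π F ι c = cycleVar k π c := by
  rw [flagWeight, if_pos hc, if_pos h]

variable [Fintype X]

theorem cycleProd_remove {π : Equiv.Perm X} {F : Set X} (hF : ∀ y, π y ∈ F ↔ y ∈ F) {c : X} (hc : c ∈ F) :
    cycleProd k π F = cycleVar k π c * cycleProd k π (removeCycle π F c) := by
  classical
  rw [cycleProd, classProd_remove (c := c)]
  · rw [if_pos hc]
    congr 1
    refine classProd_congr fun z => ?_
    by_cases hz : SameCycle π c z
    · rw [if_pos (show SameCycle.setoid π c z from hz), if_neg fun h : z ∈ removeCycle π F c => h.2 hz]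
    · rw [if_neg (show ¬ SameCycle.setoid π c z from hz)]
      exact if_congr ⟨fun h => ⟨h, hz⟩, fun h => h.1⟩ rfl rfl
  · intro y z hyz
    have hyz : SameCycle π y z := hyz
    refine if_congr (mem_iff_of_sameCycle hF hyz) ?_ rfl
    unfold cycleVar
    rw [period_sameCycle hyz]

theorem ncard_removeCycle_lt {π : Equiv.Perm X} {F : Set X} {c : X} (hc : c ∈ F) :
    (removeCycle π F c).ncard < F.ncard :=
  Set.ncard_lt_ncard ⟨fun _ h => h.1, fun h => (h hc).2 SameCycle.rfl⟩ (Set.toFinite _)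

open Classical in
-- Differentiating by `p_l` removes a cycle of length `l`, in turn for every such cycle; the factor
-- `l` counts the points of the removed cycle.
theorem pderiv_cycleProd {π : Equiv.Perm X} (l : ℕ+) (F : Set X) (hF : ∀ y, π y ∈ F ↔ y ∈ F) :
    ((l : ℕ) : LambdaPoly k) * MvPolynomial.pderiv l (cycleProd k π F)
      = ∑ y with y ∈ F ∧ period π y = l, cycleProd k π (removeCycle π F y) := by
  induction hn : F.ncard using Nat.strong_induction_on generalizing F with
  | _ n ih =>
    rcases F.eq_empty_or_nonempty with rfl | ⟨c, hc⟩
    · simp [cycleProd_empty]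
    · have hF' := removeCycle_invariant hF c
      have ih' := ih _ (hn ▸ ncard_removeCycle_lt hc) _ hF' rfl
      -- The points of the cycle of `c` account for the derivative of the factor of `c`, the others
      -- for that of the remaining product.
      have hsplit : (Finset.univ.filter fun y => y ∈ F ∧ period π y = l)
          = (Finset.univ.filter fun y => SameCycle π c y ∧ period π c = l)
            ∪ (Finset.univ.filter fun y => y ∈ removeCycle π F c ∧ period π y = l) := by
        ext y
        simp only [Finset.mem_filter, Finset.mem_univ, true_and, Finset.mem_union]
        by_cases hy : SameCycle π c y
        · have h1 := mem_iff_of_sameCycle hF hy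
          have h2 := period_sameCycle hy
          simp only [removeCycle, Set.mem_ofPred_eq]
          rw [h2]; tauto
        · simp only [removeCycle, Set.mem_ofPred_eq]; tauto
      rw [hsplit, Finset.sum_union, cycleProd_remove hF hc, MvPolynomial.pderiv_mul]
      · have h1 : ∑ y with SameCycle π c y ∧ period π c = l, cycleProd k π (removeCycle π F y)
            = ((l : ℕ) : LambdaPoly k) * (MvPolynomial.pderiv l (cycleVar k π c)
              * cycleProd k π (removeCycle π F c)) := by
          have h2 : ∀ y ∈ Finset.univ.filter (fun y => SameCycle π c y ∧ period π c = l),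
              cycleProd k π (removeCycle π F y) = cycleProd k π (removeCycle π F c) := by
            intro y hy
            simp only [Finset.mem_filter, Finset.mem_univ, true_and] at hy
            rw [removeCycle_congr hy.1]
          rw [Finset.sum_congr rfl h2, Finset.sum_const, cycleVar, MvPolynomial.pderiv_X, Pi.single_apply]
          by_cases hl : period π c = l
          · have : (period π c).toPNat' = l := by
              refine PNat.eq ?_
              rw [hl]; simp
            simp only [hl, and_true, card_cycle]
            rw [hl] at this
            rw [if_pos this, one_mul, nsmul_eq_mul]
          · have : (period π c).toPNat' ≠ l := by
              rintro rfl
              exact hl (by simp [period_pos])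
            simp [hl, this]
        have h3 : ∀ y ∈ Finset.univ.filter (fun y => y ∈ removeCycle π F c ∧ period π y = l),
            cycleProd k π (removeCycle π F y)
              = cycleVar k π c * cycleProd k π (removeCycle π (removeCycle π F c) y) := by
          intro y hy
          simp only [Finset.mem_filter, Finset.mem_univ, true_and] at hy
          rw [cycleProd_remove (removeCycle_invariant hF y) (c := c), removeCycle_comm]
          exact ⟨hc, fun h => hy.1.2 h.symm⟩
        rw [h1, Finset.sum_congr rfl h3, ← Finset.mul_sum, ← ih']
        ring
      · rw [Finset.disjoint_left]
        intro y hy hy'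
        simp only [Finset.mem_filter, Finset.mem_univ, true_and] at hy hy'
        exact hy'.1.2 hy.1

theorem pairSum_empty (x : k) (π : Equiv.Perm X) : pairSum x π ∅ = 1 := by
  classical
  have : (Finset.univ.filter fun ι : X → X => IsPairing π ∅ ι) = {id} := by
    ext ι
    simp only [Finset.mem_filter, Finset.mem_univ, true_and, Finset.mem_singleton]
    constructor
    · intro h; funext y; exact h.fix y (Set.notMem_empty y)
    · rintro rfl; exact ⟨fun _ => rfl, fun _ => rfl, fun _ _ => rfl⟩
  rw [pairSum, this, Finset.sum_singleton]
  refine (classProd_congr fun y => ?_).trans classProd_one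
  exact if_neg (Set.notMem_empty y)

open Classical in
-- The three terms are the possibilities for the partner of `c`: `c` itself (a leg), the opposite
-- point of its own cycle, or a point `y` of another cycle of the same length.
theorem pairSum_remove {x : k} {π : Equiv.Perm X} {F : Set X} (hF : ∀ y, π y ∈ F ↔ y ∈ F) {c : X}
    (hc : c ∈ F) :
    pairSum x π F = cycleVar k π c * pairSum x π (removeCycle π F c)
      + x • hbarHalf k (period π c) * pairSum x π (removeCycle π F c)
      + x • hbar (period π c) * ∑ y with y ∈ removeCycle π F c ∧ period π y = period π c,
          pairSum x π (removeCycle π (removeCycle π F c) y) := by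
  have hset : ∀ y, {z | z ∈ F ∧ ¬ (SameCycle π c z ∨ SameCycle π y z)}
      = removeCycle π (removeCycle π F c) y := by
    intro y; ext z; simp only [removeCycle, Set.mem_ofPred_eq]; tauto
  have hset' : ∀ y, SameCycle π c y → {z | z ∈ F ∧ ¬ (SameCycle π c z ∨ SameCycle π y z)}
      = removeCycle π F c := by
    intro y hy; ext z; simp only [removeCycle, Set.mem_ofPred_eq]
    have : SameCycle π c z ↔ SameCycle π y z := ⟨fun hh => hy.symm.trans hh, fun hh => hy.trans hh⟩
    tauto
  set S : X → LambdaPoly k := fun y => ∑ ι : X → X with IsPairing π F ι ∧ ι c = y,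
    classProd (glue π ι) (flagWeight x π F ι) with hS
  have hsum : pairSum x π F = ∑ y, S y := by
    rw [pairSum, ← Finset.sum_fiberwise _ (fun ι : X → X => ι c)]
    refine Finset.sum_congr rfl fun y _ => ?_
    rw [Finset.filter_filter]
  have hval : ∀ κ, IsPairing π F κ → S (κ c) = flagWeight x π F κ c
      * pairSum x π {z | z ∈ F ∧ ¬ (SameCycle π c z ∨ SameCycle π (κ c) z)} :=
    fun κ hκ => sum_pairing_apply_eq hF hκ hc
  have hzero : ∀ y, (∀ κ, IsPairing π F κ → κ c ≠ y) → S y = 0 := by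
    intro y hy
    refine Finset.sum_eq_zero fun ι hι => ?_
    simp only [Finset.mem_filter, Finset.mem_univ, true_and] at hι
    exact absurd hι.2 (hy ι hι.1)
  have hid : IsPairing π F id := ⟨fun _ => rfl, fun _ => rfl, fun _ _ => rfl⟩
  have hsplit : ∑ y, S y = S c + ∑ y with SameCycle π c y ∧ y ≠ c, S y
      + ∑ y with ¬ SameCycle π c y, S y := by
    rw [← Finset.sum_filter_add_sum_filter_not Finset.univ (fun y => SameCycle π c y)]
    congr 1
    rw [← Finset.add_sum_erase _ S (a := c)]
    · congr 2
      ext y; simp [and_comm]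
    · simpa using SameCycle.rfl
  rw [hsum, hsplit]
  congr 1
  congr 1
  · have := hval id hid
    rw [id, flagWeight_of_fixed hc rfl, hset' c SameCycle.rfl] at this
    exact this
  -- If `κ c = π ^ i c` with `0 < i < period`, then applying `κ` again gives `π ^ (2 i) c = c`, so
  -- `2 i` is the period: the partner can only be the opposite point.
  · have key : ∀ κ, IsPairing π F κ → SameCycle π c (κ c) → κ c ≠ c →
        2 ∣ period π c ∧ κ c = (π ^ (period π c / 2)) c := by
      intro κ hκ hs hne
      obtain ⟨i, hi, hic⟩ : ∃ i < period π c, (π ^ i) c = κ c := by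
        obtain ⟨j, hj⟩ := hs.exists_nat_pow_eq
        refine ⟨j % period π c, Nat.mod_lt _ (period_pos π c), ?_⟩
        rw [← hj, pow_apply_eq_pow_iff]
        exact Nat.mod_modEq _ _
      have h2 : (π ^ (i + i)) c = c := by
        rw [pow_add, Equiv.Perm.mul_apply, hic, ← zpow_natCast, ← hκ.comm_zpow, zpow_natCast, hic, hκ.invol]
      rw [pow_apply_eq_self_iff] at h2
      have hi0 : i ≠ 0 := by rintro rfl; exact hne hic.symm
      obtain ⟨q, hq⟩ := h2
      have : q = 1 := by
        have h3 : q < 2 := by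
          by_contra h
          have := Nat.mul_le_mul_left (period π c) (not_lt.1 h)
          omega
        have h4 : q ≠ 0 := by rintro rfl; omega
        omega
      subst this
      refine ⟨⟨i, by omega⟩, ?_⟩
      rw [← hic]
      congr 2
      omega
    unfold hbarHalf
    split_ifs with h2
    · obtain ⟨h, hh⟩ := h2
      have hpos := period_pos π c
      obtain ⟨κ, hκ, hκc⟩ := exists_pairing_same hF hc hh
      have hsc : SameCycle π c (κ c) := by rw [hκc, sameCycle_pow_right]
      have hne : κ c ≠ c := by
        rw [hκc, Ne, pow_apply_eq_self_iff]
        intro hd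
        have := Nat.le_of_dvd (by omega) hd
        omega
      rw [Finset.sum_eq_single (κ c)]
      · rw [hval κ hκ, hset' _ hsc, flagWeight, if_pos hc, if_neg hne, edgeCount, if_pos hsc]
      · intro y hy hyκ
        simp only [Finset.mem_filter, Finset.mem_univ, true_and] at hy
        refine hzero y ?_
        rintro κ' hκ' rfl
        refine hyκ ?_
        rw [(key κ' hκ' hy.1 hy.2).2, (key κ hκ hsc hne).2]
      · intro hn
        exact absurd (by simpa using ⟨hsc, hne⟩) hn
    · rw [smul_zero, zero_mul]
      refine Finset.sum_eq_zero fun y hy => hzero y ?_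
      simp only [Finset.mem_filter, Finset.mem_univ, true_and] at hy
      rintro κ' hκ' rfl
      exact h2 (key κ' hκ' hy.1 hy.2).1
  · rw [Finset.mul_sum]
    have hsub : (Finset.univ.filter fun y => y ∈ removeCycle π F c ∧ period π y = period π c)
        ⊆ Finset.univ.filter fun y => ¬ SameCycle π c y := by
      intro y hy
      simp only [Finset.mem_filter, Finset.mem_univ, true_and] at hy ⊢
      exact hy.1.2
    rw [← Finset.sum_subset hsub]
    · refine Finset.sum_congr rfl fun y hy => ?_
      simp only [Finset.mem_filter, Finset.mem_univ, true_and] at hy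
      obtain ⟨κ, hκ, rfl⟩ := exists_pairing_diff hF hc hy.1.1 hy.1.2 hy.2
      have hne : κ c ≠ c := fun h => hy.1.2 (by rw [h])
      rw [hval κ hκ, hset, flagWeight, if_pos hc, if_neg hne, edgeCount, if_neg hy.1.2]
    · intro y hy hy'
      simp only [Finset.mem_filter, Finset.mem_univ, true_and] at hy hy'
      refine hzero y ?_
      rintro κ hκ rfl
      exact hy' ⟨⟨hκ.apply_mem_iff.2 hc, hy⟩, hκ.period_eq c⟩

/-- Wick's theorem: `exp(-Δ)` sums over all ways to join some of the flags in pairs. -/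
theorem expDelta_cycleProd [CharZero k] {π : Equiv.Perm X} (F : Set X) (hF : ∀ y, π y ∈ F ↔ y ∈ F) :
    expDelta (cycleProd k π F) = pairSum (-1) π F := by
  classical
  induction hn : F.ncard using Nat.strong_induction_on generalizing F with
  | _ n ih =>
    rcases F.eq_empty_or_nonempty with rfl | ⟨c, hc⟩
    · rw [cycleProd_empty, pairSum_empty, expDelta_one]
    · have hF' := removeCycle_invariant hF c
      have hlt := ncard_removeCycle_lt (π := π) hc
      have ih' := ih _ (hn ▸ hlt) _ hF' rfl
      set l := (period π c).toPNat' with hl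
      have hl' : (l : ℕ) = period π c := by simp [hl, period_pos]
      rw [cycleProd_remove hF hc, pairSum_remove hF hc]
      have h1 : cycleVar k π c = MvPolynomial.X l := rfl
      -- The commutator recursion matches the recursion of `pairSum_remove` for `x = -1`: the scalar
      -- `hbarHalf` closes the cycle of `c` on itself, and `l ∂ / ∂p_l` runs over the points `y`
      -- with which `c` can be joined.
      rw [h1, expDelta_X_mul, ih', deltaComm_apply, mul_assoc, pderiv_cycleProd l _ hF']
      have h2 : ∀ a, ∀ q : LambdaPoly k, expDelta (hbar a * q) = hbar a * expDelta q := by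
        intro a q
        rw [hbar, ← MvPolynomial.smul_eq_C_mul, map_smul, MvPolynomial.smul_eq_C_mul]
      have h3 : ∀ a, ∀ q : LambdaPoly k, expDelta (hbarHalf k a * q) = hbarHalf k a * expDelta q := by
        intro a q
        unfold hbarHalf
        split_ifs
        · exact h2 _ _
        · simp
      rw [map_add, h2, h3, ih', map_sum, hl']
      have h4 : ∀ y ∈ Finset.univ.filter (fun y => y ∈ removeCycle π F c ∧ period π y = period π c),
          expDelta (cycleProd k π (removeCycle π (removeCycle π F c) y))
            = pairSum (-1) π (removeCycle π (removeCycle π F c) y) := by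
        intro y hy
        simp only [Finset.mem_filter, Finset.mem_univ, true_and] at hy
        exact ih _ (hn ▸ (ncard_removeCycle_lt hy.1).trans hlt) _ (removeCycle_invariant hF' y) rfl
      rw [Finset.sum_congr rfl h4]
      simp only [neg_smul, one_smul]
      ring

end Wick

end ModularOperads

set_option linter.unusedSimpArgs false

/-! ### Graphs with an automorphism, their weights, and embeddings of components -/

namespace ModularOperads

open Equiv.Perm

/-- A finite set `X` which is the disjoint union of a set of vertices (the fixed points of `r`) and of a
set of flags, where `r` sends a flag to its vertex, with a genus for every vertex, and with an
automorphism `π`. All vertices are stable. -/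
@[ext]
structure FlagSpace (X : Type) where
  r : X → X
  g : X → ℕ
  π : Equiv.Perm X
  r_r : ∀ x, r (r x) = r x
  g_flag : ∀ x, r x ≠ x → g x = 0
  r_π : ∀ x, r (π x) = π (r x)
  g_π : ∀ x, g (π x) = g x
  stable : ∀ v, r v = v → 3 ≤ 2 * g v + Nat.card {y // r y = v ∧ y ≠ v}

namespace FlagSpace

variable {X : Type} (s : FlagSpace X)

/-- The flags. -/
def flags : Set X := {y | s.r y ≠ y}

/-- The flags at `v`. -/
abbrev Star (v : X) : Type := {y // s.r y = v ∧ y ≠ v}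

theorem r_pow (n : ℕ) (x : X) : s.r ((s.π ^ n) x) = (s.π ^ n) (s.r x) := by
  induction n generalizing x with
  | zero => rfl
  | succ n ih => rw [pow_succ, Equiv.Perm.mul_apply, Equiv.Perm.mul_apply, ih, s.r_π]

theorem g_pow (n : ℕ) (x : X) : s.g ((s.π ^ n) x) = s.g x := by
  induction n generalizing x with
  | zero => rfl
  | succ n ih => rw [pow_succ, Equiv.Perm.mul_apply, ih, s.g_π]

theorem r_zpow (n : ℤ) (x : X) : s.r ((s.π ^ n) x) = (s.π ^ n) (s.r x) := by
  obtain ⟨m, rfl | rfl⟩ := n.eq_nat_or_neg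
  · rw [zpow_natCast, r_pow]
  · rw [zpow_neg, zpow_natCast, eq_comm, Equiv.Perm.inv_eq_iff_eq, ← r_pow, perm_apply_inv_self]

theorem π_mem_flags (x : X) : s.π x ∈ s.flags ↔ x ∈ s.flags := by
  change s.r (s.π x) ≠ s.π x ↔ s.r x ≠ x
  rw [s.r_π, (Equiv.injective _).ne_iff]

theorem pow_star (v : X) (y : X) :
    (s.r ((s.π ^ period s.π v) y) = v ∧ (s.π ^ period s.π v) y ≠ v) ↔ s.r y = v ∧ y ≠ v := by
  have h := pow_period s.π v
  have h1 : ∀ z, (s.π ^ period s.π v) z = v ↔ z = v := fun z => by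
    conv_lhs => rw [← h]
    rw [h]
    exact (s.π ^ period s.π v).injective.eq_iff' h
  rw [r_pow, Ne, Ne, h1, h1]

/-- The permutation of the flags at `v` by the first power of `π` that fixes `v`. -/
noncomputable def starPerm (v : X) : Equiv.Perm (s.Star v) :=
  (s.π ^ period s.π v).subtypePerm (s.pow_star v)

theorem starPerm_val (v : X) (y : s.Star v) : (s.starPerm v y).1 = (s.π ^ period s.π v) y.1 := rfl

open Classical in
/-- The weight of a vertex (and `0` for flags). -/
noncomputable def vwt (x : X) : ℕ :=
  if s.r x = x then 2 * s.g x + Nat.card (s.Star x) - 2 else 0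

/-- The total weight `2 (g - 1) + n`. -/
noncomputable def wt [Fintype X] : ℕ := ∑ x, s.vwt x

variable {k : Type u} [Field k] (c : ∀ (_ : ℕ) (I : Type) [Finite I], Equiv.Perm I → k)

open Classical in
/-- The local factor of a vertex. -/
noncomputable def vertWeight [Finite X] (v : X) : LambdaPoly k :=
  if s.r v = v then c (s.g v) (s.Star v) (s.starPerm v) • hbar (period s.π v * ((s.g v : ℤ) - 1)) else 1

/-- The product of the local factors over the orbits of vertices. -/
noncomputable def vertProd [Finite X] : LambdaPoly k :=
  classProd (SameCycle.setoid s.π) (s.vertWeight c)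

end FlagSpace

/-- `c` depends only on the isomorphism class of the set with a permutation. -/
def IsClassFunction {k : Type u} (c : ∀ (_ : ℕ) (I : Type) [Finite I], Equiv.Perm I → k) : Prop :=
  ∀ (g : ℕ) (I J : Type) [Finite I] [Finite J] (e : I ≃ J) (σ : Equiv.Perm I) (τ : Equiv.Perm J),
    (∀ x, e (σ x) = τ (e x)) → c g I σ = c g J τ

/-- A stable graph (not necessarily connected) with an automorphism: some of the flags of a flag space are
joined in pairs by the involution `ι`. -/
@[ext]
structure ZGraph (X : Type) extends FlagSpace X where
  ι : X → X
  pairing : IsPairing π toFlagSpace.flags ι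

namespace ZGraph

variable {X Y Z : Type} {k : Type u} [Field k]

/-- The local factor at a flag. -/
noncomputable def legWeight (x : k) (s : ZGraph X) : X → LambdaPoly k := flagWeight x s.π s.flags s.ι

/-- The weight of a graph with automorphism. -/
noncomputable def weight (c : ∀ (_ : ℕ) (I : Type) [Finite I], Equiv.Perm I → k) (x : k) [Finite X]
    (s : ZGraph X) : LambdaPoly k :=
  s.vertProd c * classProd (glue s.π s.ι) (s.legWeight x)

/-- `φ` embeds `s₀` in `s` as a union of components, the automorphism of `s₀` being the power `π ^ m`. -/
structure Embeds (m : ℕ) (s₀ : ZGraph X) (s : ZGraph Z) (φ : X → Z) : Prop where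
  inj : Function.Injective φ
  r : ∀ x, s.r (φ x) = φ (s₀.r x)
  ι : ∀ x, s.ι (φ x) = φ (s₀.ι x)
  g : ∀ x, s.g (φ x) = s₀.g x
  star : ∀ z x, s.r z = φ x → ∃ x', φ x' = z
  pow : ∀ x, (s.π ^ m) (φ x) = φ (s₀.π x)
  dvd : ∀ x x' (n : ℕ), (s.π ^ n) (φ x) = φ x' → m ∣ n

namespace Embeds

variable {m : ℕ} {s₀ : ZGraph X} {s : ZGraph Z} {φ : X → Z}

theorem pow_pow (h : Embeds m s₀ s φ) (n : ℕ) (x : X) :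
    (s.π ^ (m * n)) (φ x) = φ ((s₀.π ^ n) x) := by
  induction n generalizing x with
  | zero => rfl
  | succ n ih => rw [mul_add, mul_one, pow_add, Equiv.Perm.mul_apply, h.pow, ih, pow_succ, Equiv.Perm.mul_apply]

theorem sameCycle_iff [Finite X] [Finite Z] (h : Embeds m s₀ s φ) {x x' : X} :
    SameCycle s.π (φ x) (φ x') ↔ SameCycle s₀.π x x' := by
  constructor
  · intro hh
    obtain ⟨n, hn⟩ := hh.exists_nat_pow_eq
    obtain ⟨q, rfl⟩ := h.dvd _ _ _ hn
    rw [h.pow_pow] at hn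
    exact ⟨q, by rw [zpow_natCast]; exact h.inj hn⟩
  · intro hh
    obtain ⟨n, rfl⟩ := hh.exists_nat_pow_eq
    rw [← h.pow_pow]
    exact sameCycle_pow_right.2 SameCycle.rfl

theorem glue_iff [Finite X] [Finite Z] (h : Embeds m s₀ s φ) {x x' : X} :
    glue s.π s.ι (φ x) (φ x') ↔ glue s₀.π s₀.ι x x' := by
  rw [s.pairing.glue_iff, s₀.pairing.glue_iff, h.ι, h.sameCycle_iff, h.sameCycle_iff]

/-- A point of the image can be in the image again only after a multiple of `m` steps (field `dvd`),
and `m` steps are one step of `s₀`. -/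
theorem period_eq (h : Embeds m s₀ s φ) (x : X) : period s.π (φ x) = m * period s₀.π x := by
  refine Nat.dvd_antisymm ?_ ?_
  · rw [← pow_apply_eq_self_iff, h.pow_pow, pow_period]
  · have h1 := pow_period s.π (φ x)
    obtain ⟨q, hq⟩ := h.dvd _ _ _ h1
    rw [hq] at h1 ⊢
    rw [h.pow_pow] at h1
    exact Nat.mul_dvd_mul_left m ((pow_apply_eq_self_iff _ _ _).1 (h.inj h1))

theorem r_eq_iff (h : Embeds m s₀ s φ) (x : X) : s.r (φ x) = φ x ↔ s₀.r x = x := by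
  rw [h.r, h.inj.eq_iff]

/-- The bijection between the flags at `v` and those at `φ v`. -/
noncomputable def starEquiv (h : Embeds m s₀ s φ) (v : X) : s₀.Star v ≃ s.Star (φ v) :=
  Equiv.ofBijective (fun y => ⟨φ y.1, by rw [h.r, y.2.1], fun hh => y.2.2 (h.inj hh)⟩) (by
    constructor
    · intro y y' hy
      exact Subtype.ext (h.inj (congrArg Subtype.val hy))
    · rintro ⟨z, hz, hz'⟩
      obtain ⟨x, rfl⟩ := h.star z v hz
      rw [h.r] at hz
      exact ⟨⟨x, h.inj hz, fun hh => hz' (by rw [hh])⟩, rfl⟩)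

theorem starEquiv_val (h : Embeds m s₀ s φ) (v : X) (y : s₀.Star v) : (h.starEquiv v y).1 = φ y.1 := rfl

theorem vwt_eq (h : Embeds m s₀ s φ) (x : X) : s.vwt (φ x) = s₀.vwt x := by
  unfold FlagSpace.vwt
  rw [h.g, Nat.card_congr (h.starEquiv x)]
  classical
  exact if_congr (h.r_eq_iff x) rfl rfl

/-- The first-return permutation of the flags at a vertex is the same in `s₀` and `s`; only the
length of the orbit, hence the exponent of `ħ`, is multiplied by `m`. -/
theorem vertWeight_eq [Finite X] [Finite Z] (h : Embeds m s₀ s φ) (hm : 0 < m)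
    {c : ∀ (_ : ℕ) (I : Type) [Finite I], Equiv.Perm I → k} (hc : IsClassFunction c) (x : X) :
    s.vertWeight c (φ x) = plethNat m (s₀.vertWeight c x) := by
  unfold FlagSpace.vertWeight
  by_cases hx : s₀.r x = x
  · rw [if_pos hx, if_pos ((h.r_eq_iff x).2 hx), plethPoly_smul, plethPoly_hbar, h.g]
    congr 1
    · refine (hc _ _ _ (h.starEquiv x) _ _ fun y => Subtype.ext ?_).symm
      rw [FlagSpace.starPerm_val, starEquiv_val, starEquiv_val, FlagSpace.starPerm_val, h.period_eq,
        h.pow_pow]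
    · rw [h.period_eq]
      have : ((m.toPNat' : ℕ+) : ℕ) = m := by simp [hm]
      rw [this]
      push_cast
      congr 1
      ring
  · rw [if_neg hx, if_neg (mt (h.r_eq_iff x).1 hx), map_one]

/-- Cycle lengths and numbers of edges are multiplied by `m`, as the substitution `p_m ∘ -` does to
indices and exponents. The scalar `x` is unaffected. -/
theorem legWeight_eq [Finite X] [Finite Z] (h : Embeds m s₀ s φ) (hm : 0 < m) (x : k) (y : X) :
    s.legWeight x (φ y) = plethNat m (s₀.legWeight x y) := by
  have hm' : ((m.toPNat' : ℕ+) : ℕ) = m := by simp [hm]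
  unfold legWeight flagWeight
  have h1 : φ y ∈ s.flags ↔ y ∈ s₀.flags := not_congr (h.r_eq_iff y)
  have h2 : s.ι (φ y) = φ y ↔ s₀.ι y = y := by rw [h.ι, h.inj.eq_iff]
  by_cases hy : y ∈ s₀.flags
  · rw [if_pos hy, if_pos (h1.2 hy)]
    by_cases hy' : s₀.ι y = y
    · rw [if_pos hy', if_pos (h2.2 hy'), cycleVar, cycleVar, plethPoly_X, h.period_eq]
      congr 1
      refine PNat.eq ?_
      rw [PNat.mul_coe, hm']
      simp [hm, period_pos]
    · rw [if_neg hy', if_neg (mt h2.1 hy'), plethPoly_smul, plethPoly_hbar, hm']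
      congr 1
      unfold edgeCount
      rw [h.ι]
      by_cases h3 : SameCycle s₀.π y (s₀.ι y)
      · rw [if_pos h3, if_pos (h.sameCycle_iff.2 h3), h.period_eq]
        obtain ⟨n, hn⟩ := h3.exists_nat_pow_eq
        have h4 : (s₀.π ^ (n + n)) y = y := by
          rw [pow_add, Equiv.Perm.mul_apply, hn, ← zpow_natCast, ← s₀.pairing.comm_zpow, zpow_natCast, hn,
            s₀.pairing.invol]
        rw [pow_apply_eq_self_iff] at h4
        -- The division by two in `edgeCount` is that of natural numbers, so evenness is needed
        -- before the factor `m` can be taken out.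
        have h5 : 2 ∣ period s₀.π y := by
          by_contra h6
          have hcop : Nat.Coprime (period s₀.π y) 2 :=
            ((Nat.Prime.coprime_iff_not_dvd Nat.prime_two).2 h6).symm
          have : period s₀.π y ∣ n := hcop.dvd_of_dvd_mul_left (by rwa [two_mul])
          rw [← pow_apply_eq_self_iff, hn] at this
          exact hy' this
        obtain ⟨q, hq⟩ := h5
        rw [hq]
        have h7 : m * (2 * q) / 2 = m * q := by
          rw [mul_left_comm]; simp
        rw [h7]
        simp
      · rw [if_neg h3, if_neg (mt h.sameCycle_iff.1 h3), h.period_eq]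
        push_cast; rfl
  · rw [if_neg hy, if_neg (mt h1.1 hy), map_one]

end Embeds

/-- Conjugation by `π ^ n` identifies the first-return permutations at `x` and at `π ^ n x`, and `c`
is a class function. -/
theorem vertWeight_of_sameCycle [Finite X] (s : FlagSpace X)
    {c : ∀ (_ : ℕ) (I : Type) [Finite I], Equiv.Perm I → k} (hc : IsClassFunction c) (x y : X)
    (h : SameCycle s.π x y) : s.vertWeight c x = s.vertWeight c y := by
  obtain ⟨n, rfl⟩ := h.exists_nat_pow_eq
  have hp : period s.π ((s.π ^ n) x) = period s.π x := (period_sameCycle h).symm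
  have h1 : s.r ((s.π ^ n) x) = (s.π ^ n) x ↔ s.r x = x := by
    rw [s.r_pow, (Equiv.injective _).eq_iff]
  unfold FlagSpace.vertWeight
  by_cases hx : s.r x = x
  swap
  · rw [if_neg hx, if_neg (mt h1.1 hx)]
  rw [if_pos hx, if_pos (h1.2 hx), s.g_pow, hp]
  congr 1
  refine hc _ _ _ ((s.π ^ n).subtypeEquiv fun y => ?_) _ _ fun y => Subtype.ext ?_
  · rw [s.r_pow, (Equiv.injective _).eq_iff, (Equiv.injective _).ne_iff]
  · change (s.π ^ n) ((s.π ^ period s.π x) y.1) = (s.π ^ period s.π ((s.π ^ n) x)) ((s.π ^ n) y.1)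
    rw [hp, ← Equiv.Perm.mul_apply, ← Equiv.Perm.mul_apply, ← pow_add, ← pow_add, add_comm]

/-- The weight of a graph which is the union of an orbit of components and of other components. -/
theorem weight_eq_mul [Finite X] [Finite Y] [Finite Z] {m : ℕ} (hm : 0 < m) {s₁ : ZGraph X} {s₂ : ZGraph Y}
    {s : ZGraph Z} {φ : X → Z} {ψ : Y → Z} (h₁ : Embeds m s₁ s φ) (h₂ : Embeds 1 s₂ s ψ)
    (hd : ∀ x y (n : ℕ), (s.π ^ n) (φ x) ≠ ψ y)
    (hs : ∀ z, (∃ x, ∃ n : ℕ, (s.π ^ n) (φ x) = z) ∨ ∃ y, ψ y = z)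
    {c : ∀ (_ : ℕ) (I : Type) [Finite I], Equiv.Perm I → k} (hc : IsClassFunction c) (x : k) :
    s.weight c x = plethNat m (s₁.weight c x) * s₂.weight c x := by
  have hd1 : ∀ x y, ¬ SameCycle s.π (φ x) (ψ y) := fun x y h => by
    obtain ⟨n, hn⟩ := h.exists_nat_pow_eq
    exact hd x y n hn
  have hs1 : ∀ z, (∃ x, SameCycle s.π (φ x) z) ∨ ∃ y, SameCycle s.π (ψ y) z := fun z => by
    rcases hs z with ⟨x, n, rfl⟩ | ⟨y, rfl⟩
    · exact Or.inl ⟨x, sameCycle_pow_right.2 SameCycle.rfl⟩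
    · exact Or.inr ⟨y, SameCycle.rfl⟩
  have e1 : s.vertProd c = plethNat m (s₁.vertProd c) * s₂.vertProd c := by
    rw [FlagSpace.vertProd, classProd_sum (R := SameCycle.setoid s₁.π) (S := SameCycle.setoid s₂.π) φ ψ
      (fun x x' => h₁.sameCycle_iff.symm) (fun x x' => h₂.sameCycle_iff.symm) hd1 hs1
      (vertWeight_of_sameCycle s.toFlagSpace hc)]
    congr 1
    · rw [FlagSpace.vertProd]
      refine Eq.trans ?_ (map_classProd (plethNat m : LambdaPoly k →+* LambdaPoly k).toMonoidHom _).symm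
      exact classProd_congr fun x => h₁.vertWeight_eq hm hc x
    · exact classProd_congr fun y => (h₂.vertWeight_eq one_pos hc y).trans (plethNat_one _)
  have hu : ∀ z z', glue s.π s.ι z z' → s.legWeight x z = s.legWeight x z' :=
    flagWeight_of_glue s.π_mem_flags s.pairing
  have e2 : classProd (glue s.π s.ι) (s.legWeight x)
      = plethNat m (classProd (glue s₁.π s₁.ι) (s₁.legWeight x))
        * classProd (glue s₂.π s₂.ι) (s₂.legWeight x) := by
    rw [classProd_sum (R := glue s₁.π s₁.ι) (S := glue s₂.π s₂.ι) φ ψ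
      (fun x x' => h₁.glue_iff.symm) (fun x x' => h₂.glue_iff.symm) ?_ ?_ hu]
    · congr 1
      · refine Eq.trans ?_ (map_classProd (plethNat m : LambdaPoly k →+* LambdaPoly k).toMonoidHom _).symm
        exact classProd_congr fun y => h₁.legWeight_eq hm x y
      · exact classProd_congr fun y => (h₂.legWeight_eq one_pos x y).trans (plethNat_one _)
    · intro a b h
      rcases s.pairing.glue_iff.1 h with h | h
      · exact hd1 _ _ h
      · rw [h₁.ι] at h
        exact hd1 _ _ h
    · intro z
      rcases hs1 z with ⟨a, ha⟩ | ⟨b, hb⟩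
      · exact Or.inl ⟨a, s.pairing.glue_iff.2 (Or.inl ha)⟩
      · exact Or.inr ⟨b, s.pairing.glue_iff.2 (Or.inl hb)⟩
  rw [weight, weight, weight, e1, e2, map_mul]
  ring

end ZGraph

end ModularOperads

set_option linter.unusedSimpArgs false

/-! ### Components, and the splitting off of an orbit of components -/

namespace ModularOperads

open Equiv.Perm Sum

namespace FlagSpace

variable {X : Type} (s : FlagSpace X)

theorem vwt_pow (n : ℕ) (x : X) : s.vwt ((s.π ^ n) x) = s.vwt x := by
  unfold vwt
  have h1 : s.r ((s.π ^ n) x) = (s.π ^ n) x ↔ s.r x = x := by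
    rw [s.r_pow, (Equiv.injective _).eq_iff]
  have h2 : s.Star x ≃ s.Star ((s.π ^ n) x) := (s.π ^ n).subtypeEquiv fun y => by
    rw [s.r_pow, (Equiv.injective _).eq_iff, (Equiv.injective _).ne_iff]
  rw [s.g_pow, Nat.card_congr h2]
  classical
  exact if_congr h1 rfl rfl

end FlagSpace

namespace ZGraph

variable {X Y Z : Type} {k : Type u} [Field k]

/-- The partition into connected components. -/
def conn (s : ZGraph X) : Setoid X := Relation.EqvGen.setoid fun x y => y = s.r x ∨ y = s.ι x

/-- The graph is connected and not empty. -/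
def IsConn (s : ZGraph X) : Prop := Nonempty X ∧ ∀ x y, s.conn x y

theorem conn_r (s : ZGraph X) (x : X) : s.conn x (s.r x) := Relation.EqvGen.rel _ _ (Or.inl rfl)

theorem conn_ι (s : ZGraph X) (x : X) : s.conn x (s.ι x) := Relation.EqvGen.rel _ _ (Or.inr rfl)

theorem conn_induction (s : ZGraph X) {P : X → Prop} (hr : ∀ x, P x ↔ P (s.r x))
    (hι : ∀ x, P x ↔ P (s.ι x)) {x y : X} (h : s.conn x y) : P x ↔ P y := by
  induction h with
  | rel x y h =>
    rcases h with rfl | rfl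
    · exact hr x
    · exact hι x
  | refl => rfl
  | symm _ _ _ ih => exact ih.symm
  | trans _ _ _ _ _ ih1 ih2 => exact ih1.trans ih2

theorem conn_map {s : ZGraph X} {t : ZGraph Z} {φ : X → Z} (hr : ∀ x, t.r (φ x) = φ (s.r x))
    (hι : ∀ x, t.ι (φ x) = φ (s.ι x)) {x y : X} (h : s.conn x y) : t.conn (φ x) (φ y) := by
  induction h with
  | rel x y h =>
    rcases h with rfl | rfl
    · rw [← hr]; exact t.conn_r _
    · rw [← hι]; exact t.conn_ι _
  | refl => exact t.conn.refl' _
  | symm _ _ _ ih => exact t.conn.symm' ih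
  | trans _ _ _ _ _ ih1 ih2 => exact t.conn.trans' ih1 ih2

theorem ι_zpow (s : ZGraph X) (n : ℤ) (x : X) : s.ι ((s.π ^ n) x) = (s.π ^ n) (s.ι x) :=
  s.pairing.comm_zpow n x

theorem ι_pow (s : ZGraph X) (n : ℕ) (x : X) : s.ι ((s.π ^ n) x) = (s.π ^ n) (s.ι x) := by
  rw [← zpow_natCast, ι_zpow]

theorem conn_zpow (s : ZGraph X) (n : ℤ) {x y : X} (h : s.conn x y) :
    s.conn ((s.π ^ n) x) ((s.π ^ n) y) := conn_map (fun x => s.r_zpow n x) (fun x => s.ι_zpow n x) h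

theorem conn_pow (s : ZGraph X) (n : ℕ) {x y : X} (h : s.conn x y) :
    s.conn ((s.π ^ n) x) ((s.π ^ n) y) := by
  rw [← zpow_natCast]; exact s.conn_zpow n h

namespace Embeds

variable {m : ℕ} {s₀ : ZGraph X} {s : ZGraph Z} {φ : X → Z}

/-- The image of an embedding is a union of components: it is closed under `r` and `ι`, and by the
field `star` it contains all flags at its vertices. -/
theorem conn_exists (h : Embeds m s₀ s φ) {x : X} {z : Z} (hz : s.conn (φ x) z) :
    ∃ x', φ x' = z ∧ s₀.conn x x' := by
  refine (s.conn_induction (P := fun z => ∃ x', φ x' = z ∧ s₀.conn x x') ?_ ?_ hz).1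
    ⟨x, rfl, s₀.conn.refl' _⟩
  · intro z
    constructor
    · rintro ⟨x', rfl, hx⟩
      exact ⟨s₀.r x', (h.r x').symm, s₀.conn.trans' hx (s₀.conn_r _)⟩
    · rintro ⟨x', hx', hx⟩
      obtain ⟨x'', rfl⟩ := h.star z x' hx'.symm
      rw [h.r] at hx'
      obtain rfl := h.inj hx'
      exact ⟨x'', rfl, s₀.conn.trans' hx (s₀.conn.symm' (s₀.conn_r _))⟩
  · have key : ∀ z, (∃ x', φ x' = z ∧ s₀.conn x x') → ∃ x', φ x' = s.ι z ∧ s₀.conn x x' := by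
      rintro _ ⟨x', rfl, hx⟩
      exact ⟨s₀.ι x', (h.ι x').symm, s₀.conn.trans' hx (s₀.conn_ι _)⟩
    intro z
    refine ⟨key z, fun hz => ?_⟩
    have := key _ hz
    rwa [s.pairing.invol] at this

theorem conn (h : Embeds m s₀ s φ) {x y : X} (hx : s₀.conn x y) : s.conn (φ x) (φ y) :=
  conn_map h.r h.ι hx

end Embeds

/-- Restriction to a union of components that is stable under a power of the automorphism. -/
theorem exists_embeds [Finite X] (s : ZGraph Z) (m : ℕ) {φ : X → Z} (hφ : Function.Injective φ)
    (hc : ∀ x z, s.conn (φ x) z → ∃ x', φ x' = z) (hp : ∀ x, ∃ x', φ x' = (s.π ^ m) (φ x))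
    (hd : ∀ x x' (n : ℕ), (s.π ^ n) (φ x) = φ x' → m ∣ n) : ∃ s₀, Embeds m s₀ s φ := by
  choose r hr using fun x => hc x _ (s.conn_r (φ x))
  choose ι hι using fun x => hc x _ (s.conn_ι (φ x))
  choose π hπ using hp
  have hπi : Function.Injective π := fun x y hxy => hφ ((s.π ^ m).injective (by rw [← hπ, ← hπ, hxy]))
  have hflag : ∀ x, r x = x ↔ s.r (φ x) = φ x := fun x => by rw [← hr, hφ.eq_iff]
  have hstar : ∀ z x, s.r z = φ x → ∃ x', φ x' = z := fun z x h =>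
    hc x z (s.conn.symm' (h ▸ s.conn_r z))
  -- The structure is pulled back along `φ`. Stability survives because no flag at a vertex of the
  -- image is lost.
  let f : FlagSpace X :=
    { r := r
      g := fun x => s.g (φ x)
      π := Equiv.ofBijective π (Finite.injective_iff_bijective.1 hπi)
      r_r := fun x => hφ (by rw [hr, hr, s.r_r])
      g_flag := fun x hx => s.g_flag _ (mt (hflag x).2 hx)
      r_π := fun x => hφ (by
        change φ (r (π x)) = φ (π (r x))
        rw [hr, hπ, hπ, hr, s.r_pow])
      g_π := fun x => by
        change s.g (φ (π x)) = _
        rw [hπ, s.g_pow]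
      stable := fun v hv => by
        refine (s.stable (φ v) ((hflag v).1 hv)).trans_eq ?_
        congr 1
        refine (Nat.card_congr (Equiv.ofBijective
          (fun y : {y // r y = v ∧ y ≠ v} => (⟨φ y.1, by rw [← hr, y.2.1], fun hh => y.2.2 (hφ hh)⟩ :
            {y // s.r y = φ v ∧ y ≠ φ v})) ⟨fun y y' hy => Subtype.ext (hφ (congrArg Subtype.val hy)), ?_⟩)).symm
        rintro ⟨z, hz, hz'⟩
        obtain ⟨x, rfl⟩ := hstar z v hz
        rw [← hr] at hz
        exact ⟨⟨x, hφ hz, fun hh => hz' (by rw [hh])⟩, rfl⟩ }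
  refine ⟨{ f with ι := ι, pairing := ?_ }, ⟨hφ, fun x => (hr x).symm, fun x => (hι x).symm, fun _ => rfl, hstar,
    fun x => (hπ x).symm, hd⟩⟩
  have hfl : ∀ x, x ∈ f.flags ↔ φ x ∈ s.flags := fun x => not_congr (hflag x)
  refine ⟨fun x => hφ (by rw [hι, hι, s.pairing.invol]), fun x => hφ ?_, fun x hx => hφ ?_⟩
  · change φ (ι (π x)) = φ (π (ι x))
    rw [hι, hπ, hπ, hι, s.ι_pow]
  · rw [hι]
    exact s.pairing.fix _ (mt (hfl x).2 hx)

/-- `s` consists of `n + 1` copies of `s₀`, permuted cyclically by the automorphism, and of `s₂`. -/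
structure Splits {n : ℕ} (e : Fin (n + 1) × X ⊕ Y ≃ Z) (s₀ : ZGraph X) (s₂ : ZGraph Y) (s : ZGraph Z) :
    Prop where
  left : Embeds (n + 1) s₀ s fun x => e (inl (0, x))
  right : Embeds 1 s₂ s fun y => e (inr y)
  shift : ∀ (i : Fin (n + 1)) x, (s.π ^ (i : ℕ)) (e (inl (0, x))) = e (inl (i, x))

/-- The copies of the component of `p` are labelled by `e`. -/
structure Marks {n : ℕ} (e : Fin (n + 1) × X ⊕ Y ≃ Z) (s : ZGraph Z) (p : Z) : Prop where
  conn_iff : ∀ z, s.conn p z ↔ ∃ x, e (inl (0, x)) = z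
  shift : ∀ (i : Fin (n + 1)) x, (s.π ^ (i : ℕ)) (e (inl (0, x))) = e (inl (i, x))
  ret : s.conn p ((s.π ^ (n + 1)) p)

/-- Multiples of `n + 1` preserve copy `0`, so `π ^ N` carries copy `0` to copy `N % (n + 1)`;
arriving in copy `0` forces the remainder to be zero. -/
theorem dvd_of_shift {n : ℕ} {e : Fin (n + 1) × X ⊕ Y ≃ Z} {π : Equiv.Perm Z}
    (h1 : ∀ x, ∃ x', e (inl (0, x')) = (π ^ (n + 1)) (e (inl (0, x))))
    (h2 : ∀ (i : Fin (n + 1)) x, (π ^ (i : ℕ)) (e (inl (0, x))) = e (inl (i, x))) (N : ℕ) (x x' : X)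
    (h : (π ^ N) (e (inl (0, x))) = e (inl (0, x'))) : n + 1 ∣ N := by
  have h3 : ∀ q x, ∃ x', e (inl (0, x')) = (π ^ ((n + 1) * q)) (e (inl (0, x))) := by
    intro q
    induction q with
    | zero => exact fun x => ⟨x, rfl⟩
    | succ q ih =>
      intro x
      obtain ⟨x1, hx1⟩ := ih x
      obtain ⟨x2, hx2⟩ := h1 x1
      refine ⟨x2, ?_⟩
      rw [hx2, hx1, ← Equiv.Perm.mul_apply, ← pow_add, mul_add, mul_one, add_comm]
  obtain ⟨x1, hx1⟩ := h3 (N / (n + 1)) x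
  have hlt : N % (n + 1) < n + 1 := Nat.mod_lt _ (Nat.succ_pos _)
  have h4 := h2 ⟨N % (n + 1), hlt⟩ x1
  rw [hx1, ← Equiv.Perm.mul_apply, ← pow_add, Nat.mod_add_div, h, e.apply_eq_iff_eq] at h4
  have h5 := congrArg Fin.val (congrArg Prod.fst (inl.inj h4))
  exact Nat.dvd_of_mod_eq_zero h5.symm

theorem Splits.marks {n : ℕ} {e : Fin (n + 1) × X ⊕ Y ≃ Z} {s₀ : ZGraph X} {s₂ : ZGraph Y} {s : ZGraph Z}
    (h : Splits e s₀ s₂ s) (h0 : s₀.IsConn) (x : X) : Marks e s (e (inl (0, x))) := by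
  refine ⟨fun z => ⟨fun hz => ?_, ?_⟩, h.shift, ?_⟩
  · obtain ⟨x', hx', -⟩ := h.left.conn_exists hz
    exact ⟨x', hx'⟩
  · rintro ⟨x', rfl⟩
    exact h.left.conn (h0.2 _ _)
  · have := h.left.pow x
    rw [this]
    exact h.left.conn (h0.2 _ _)

/-- The part `s₀` is the component of `p` with the automorphism `π ^ (n + 1)`, and `s₂` is the
complement of the `n + 1` copies. The copies are stable under `π` and are unions of components,
hence so is the complement. -/
theorem Marks.exists_splits [Finite X] [Finite Y] {n : ℕ} {e : Fin (n + 1) × X ⊕ Y ≃ Z} {s : ZGraph Z} {p : Z}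
    (h : Marks e s p) : ∃ (s₀ : ZGraph X) (s₂ : ZGraph Y) (x : X),
      s₀.IsConn ∧ Splits e s₀ s₂ s ∧ e (inl (0, x)) = p := by
  obtain ⟨p0, hp0⟩ := (h.conn_iff p).1 (s.conn.refl' p)
  have hpow : ∀ x, ∃ x', e (inl (0, x')) = (s.π ^ (n + 1)) (e (inl (0, x))) := fun x =>
    (h.conn_iff _).1 (s.conn.trans' h.ret (s.conn_pow _ ((h.conn_iff _).2 ⟨x, rfl⟩)))
  obtain ⟨s₀, h₀⟩ := s.exists_embeds (n + 1) (φ := fun x => e (inl (0, x)))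
    (fun x y hxy => by simpa using hxy)
    (fun x z hz => (h.conn_iff z).1 (s.conn.trans' ((h.conn_iff _).2 ⟨x, rfl⟩) hz)) hpow
    fun x x' N => dvd_of_shift hpow h.shift N x x'
  -- From copy `i` to copy `i + 1`, and from the last copy back to copy `0`, by `ret`.
  have hπ : ∀ i x, ∃ j x', s.π (e (inl (i, x))) = e (inl (j, x')) := by
    intro i x
    rw [← h.shift, ← Equiv.Perm.mul_apply, ← pow_succ']
    by_cases hi : (i : ℕ) + 1 < n + 1
    · exact ⟨⟨i + 1, hi⟩, x, h.shift ⟨i + 1, hi⟩ x⟩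
    · have : (i : ℕ) + 1 = n + 1 := by omega
      obtain ⟨x', hx'⟩ := hpow x
      exact ⟨0, x', by rw [this, hx']⟩
  have hr : ∀ i x, ∃ x', s.r (e (inl (i, x))) = e (inl (i, x')) := fun i x =>
    ⟨s₀.r x, by rw [← h.shift, s.r_pow, h₀.r, h.shift]⟩
  have hι : ∀ i x, ∃ x', s.ι (e (inl (i, x))) = e (inl (i, x')) := fun i x =>
    ⟨s₀.ι x, by rw [← h.shift, s.ι_pow, h₀.ι, h.shift]⟩
  have hcl : ∀ y, ∃ y', e (inr y') = s.π (e (inr y)) := by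
    intro y
    have hinj : ∃ f : Fin (n + 1) × X → Fin (n + 1) × X, ∀ a, e (inl (f a)) = s.π (e (inl a)) := by
      choose f g hfg using hπ
      exact ⟨fun a => (f a.1 a.2, g a.1 a.2), fun a => (hfg a.1 a.2).symm⟩
    obtain ⟨f, hf⟩ := hinj
    have hfi : Function.Injective f := fun a b hab => by
      have : s.π (e (inl a)) = s.π (e (inl b)) := by rw [← hf, ← hf, hab]
      simpa using this
    -- The permutation is injective on the finite union of the copies, hence onto it, so no point of
    -- the complement can enter.
    have hfs := Finite.surjective_of_injective hfi
    rcases hz : e.symm (s.π (e (inr y))) with a | b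
    · obtain ⟨a', rfl⟩ := hfs a
      have := congrArg e hz
      rw [e.apply_symm_apply, hf] at this
      simp at this
    · exact ⟨b, by rw [← hz, e.apply_symm_apply]⟩
  have hcc : ∀ y z, s.conn (e (inr y)) z → ∃ y', e (inr y') = z := by
    intro y z hz
    have key : ∀ z, (∃ y', e (inr y') = z) ↔ ¬ ∃ a, e (inl a) = z := by
      intro z
      rcases hz : e.symm z with a | b
      · rw [Equiv.symm_apply_eq] at hz
        subst hz
        simp
      · rw [Equiv.symm_apply_eq] at hz
        subst hz
        simp
    refine (s.conn_induction (P := fun z => ∃ y', e (inr y') = z) ?_ ?_ hz).1 ⟨y, rfl⟩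
    · intro z
      rw [key, key, not_iff_not]
      constructor
      · rintro ⟨⟨i, x⟩, rfl⟩
        obtain ⟨x', hx'⟩ := hr i x
        exact ⟨(i, x'), hx'.symm⟩
      · rintro ⟨⟨i, x⟩, hx⟩
        rw [← h.shift] at hx
        -- Translation back by `π ^ (-i)` reduces copy `i` to copy `0`, which is a whole component.
        have : s.conn ((s.π ^ (-(i : ℤ))) ((s.π ^ (i : ℕ)) (e (inl (0, x))))) ((s.π ^ (-(i : ℤ))) z) :=
          s.conn_zpow _ (hx ▸ s.conn.symm' (s.conn_r z))
        rw [← zpow_natCast, ← Equiv.Perm.mul_apply, ← zpow_add, neg_add_cancel, zpow_zero] at this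
        obtain ⟨x', hx'⟩ := (h.conn_iff _).1 (s.conn.trans' ((h.conn_iff _).2 ⟨x, rfl⟩) this)
        refine ⟨(i, x'), ?_⟩
        rw [← h.shift, hx', ← zpow_natCast, ← Equiv.Perm.mul_apply, ← zpow_add, add_neg_cancel, zpow_zero]
        rfl
    · have key2 : ∀ z, (∃ a, e (inl a) = z) → ∃ a, e (inl a) = s.ι z := by
        rintro _ ⟨⟨i, x⟩, rfl⟩
        obtain ⟨x', hx'⟩ := hι i x
        exact ⟨(i, x'), hx'.symm⟩
      intro z
      rw [key, key, not_iff_not]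
      refine ⟨key2 z, fun hz => ?_⟩
      have := key2 _ hz
      rwa [s.pairing.invol] at this
  obtain ⟨s₂, h₂⟩ := s.exists_embeds 1 (φ := fun y => e (inr y)) (fun x y hxy => by simpa using hxy) hcc
    (fun y => by simpa using hcl y) fun _ _ _ _ => one_dvd _
  refine ⟨s₀, s₂, p0, ⟨⟨p0⟩, fun x y => ?_⟩, ⟨h₀, h₂, h.shift⟩, hp0⟩
  obtain ⟨y', hy', hy⟩ := h₀.conn_exists (x := x) (z := e (inl (0, y)))
    (s.conn.trans' (s.conn.symm' ((h.conn_iff _).2 ⟨x, rfl⟩)) ((h.conn_iff _).2 ⟨y, rfl⟩))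
  have : y' = y := by simpa using hy'
  exact this ▸ hy

theorem Embeds.unique {m : ℕ} {s₀ s₁ : ZGraph X} {s : ZGraph Z} {φ : X → Z} (h₀ : Embeds m s₀ s φ)
    (h₁ : Embeds m s₁ s φ) : s₀ = s₁ := by
  refine ZGraph.ext ?_ ?_ ?_ ?_
  · exact funext fun x => h₀.inj (by rw [← h₀.r, ← h₁.r])
  · exact funext fun x => by rw [← h₀.g, ← h₁.g]
  · exact Equiv.ext fun x => h₀.inj (by rw [← h₀.pow, ← h₁.pow])
  · exact funext fun x => h₀.inj (by rw [← h₀.ι, ← h₁.ι])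

/-- On copy `i` everything is obtained from copy `0` by the translation `π ^ i`, and the step out of
the last copy is given by the automorphism of `s₀`. -/
theorem Splits.unique {n : ℕ} {e : Fin (n + 1) × X ⊕ Y ≃ Z} {s₀ : ZGraph X} {s₂ : ZGraph Y} {s t : ZGraph Z}
    (h : Splits e s₀ s₂ s) (h' : Splits e s₀ s₂ t) : s = t := by
  have hπ : s.π = t.π := by
    refine Equiv.ext fun z => ?_
    obtain ⟨⟨i, x⟩ | y, rfl⟩ := e.surjective z
    · rw [← h.shift, ← Equiv.Perm.mul_apply, ← pow_succ']
      conv_rhs => rw [h.shift, ← h'.shift, ← Equiv.Perm.mul_apply, ← pow_succ']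
      by_cases hi : (i : ℕ) + 1 < n + 1
      · exact (h.shift ⟨i + 1, hi⟩ x).trans (h'.shift ⟨i + 1, hi⟩ x).symm
      · have : (i : ℕ) + 1 = n + 1 := by omega
        rw [this]
        exact (h.left.pow x).trans (h'.left.pow x).symm
    · have := (h.right.pow y).trans (h'.right.pow y).symm
      simpa using this
  refine ZGraph.ext (funext fun z => ?_) (funext fun z => ?_) hπ (funext fun z => ?_)
  · obtain ⟨⟨i, x⟩ | y, rfl⟩ := e.surjective z
    · have h1 : s.r (e (inl (i, x))) = e (inl (i, s₀.r x)) := by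
        rw [← h.shift, s.r_pow, h.left.r, h.shift]
      have h2 : t.r (e (inl (i, x))) = e (inl (i, s₀.r x)) := by
        rw [← h'.shift, t.r_pow, h'.left.r, h'.shift]
      rw [h1, h2]
    · exact (h.right.r y).trans (h'.right.r y).symm
  · obtain ⟨⟨i, x⟩ | y, rfl⟩ := e.surjective z
    · rw [← h.shift, s.g_pow, h.left.g, h.shift, ← h'.shift, t.g_pow, h'.left.g]
    · exact (h.right.g y).trans (h'.right.g y).symm
  · obtain ⟨⟨i, x⟩ | y, rfl⟩ := e.surjective z
    · have h1 : s.ι (e (inl (i, x))) = e (inl (i, s₀.ι x)) := by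
        rw [← h.shift, s.ι_pow, h.left.ι, h.shift]
      have h2 : t.ι (e (inl (i, x))) = e (inl (i, s₀.ι x)) := by
        rw [← h'.shift, t.ι_pow, h'.left.ι, h'.shift]
      rw [h1, h2]
    · exact (h.right.ι y).trans (h'.right.ι y).symm

theorem Splits.unique_left {n : ℕ} {e : Fin (n + 1) × X ⊕ Y ≃ Z} {s₀ s₀' : ZGraph X} {s₂ s₂' : ZGraph Y}
    {s : ZGraph Z} (h : Splits e s₀ s₂ s) (h' : Splits e s₀' s₂' s) : s₀ = s₀' ∧ s₂ = s₂' :=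
  ⟨h.left.unique h'.left, h.right.unique h'.right⟩

/-- The automorphism moves each copy identically to the next, except that the step from the last
copy to copy `0` applies `s₀.π`. Then the first return to copy `0` is `s₀.π`. -/
theorem exists_splits {n : ℕ} (e : Fin (n + 1) × X ⊕ Y ≃ Z) (s₀ : ZGraph X) (s₂ : ZGraph Y) :
    ∃ s, Splits e s₀ s₂ s := by
  let ρ : Equiv.Perm (Fin (n + 1) × X) := Equiv.prodShear (finRotate (n + 1))
    fun i => if i = Fin.last n then s₀.π else 1
  let π' : Equiv.Perm (Fin (n + 1) × X ⊕ Y) := Equiv.sumCongr ρ s₂.π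
  let r' : Fin (n + 1) × X ⊕ Y → Fin (n + 1) × X ⊕ Y := Sum.map (Prod.map id s₀.r) s₂.r
  let ι' : Fin (n + 1) × X ⊕ Y → Fin (n + 1) × X ⊕ Y := Sum.map (Prod.map id s₀.ι) s₂.ι
  have hρ : ∀ f : X → X, (∀ x, f (s₀.π x) = s₀.π (f x)) → ∀ a, ρ (Prod.map id f a) = Prod.map id f (ρ a) := by
    rintro f hf ⟨i, x⟩
    refine Prod.ext rfl ?_
    change (if i = Fin.last n then s₀.π else 1) (f x) = f ((if i = Fin.last n then s₀.π else 1) x)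
    split_ifs
    · rw [hf]
    · rfl
  have hri : ∀ a : Fin (n + 1) × X ⊕ Y, r' a = a ↔ Sum.elim (fun a => s₀.r a.2 = a.2) (fun y => s₂.r y = y) a := by
    rintro (⟨i, x⟩ | y)
    · simp [r']
    · simp [r']
  have hπe : ∀ a, (e.symm.trans (π'.trans e)) (e a) = e (π' a) := fun a => by simp
  let f : FlagSpace Z :=
    { r := fun z => e (r' (e.symm z))
      g := fun z => Sum.elim (fun a => s₀.g a.2) s₂.g (e.symm z)
      π := e.symm.trans (π'.trans e)
      r_r := fun z => by
        obtain ⟨⟨i, x⟩ | y, rfl⟩ := e.surjective z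
        · simp [r', s₀.r_r]
        · simp [r', s₂.r_r]
      g_flag := fun z hz => by
        obtain ⟨⟨i, x⟩ | y, rfl⟩ := e.surjective z
        · simp only [r', e.symm_apply_apply, Sum.map_inl, Prod.map, ne_eq, e.apply_eq_iff_eq] at hz
          simp only [e.symm_apply_apply, Sum.elim_inl]
          exact s₀.g_flag _ fun hh => hz (by rw [hh]; rfl)
        · simp only [r', e.symm_apply_apply, Sum.map_inr, ne_eq, e.apply_eq_iff_eq] at hz
          simp only [e.symm_apply_apply, Sum.elim_inr]
          exact s₂.g_flag _ fun hh => hz (by rw [hh])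
      r_π := fun z => by
        obtain ⟨a | y, rfl⟩ := e.surjective z
        · simp only [r', π', Equiv.trans_apply, e.symm_apply_apply, Equiv.sumCongr_apply, Sum.map_inl,
            hρ s₀.r s₀.r_π]
        · simp only [r', π', Equiv.trans_apply, e.symm_apply_apply, Equiv.sumCongr_apply, Sum.map_inr, s₂.r_π]
      g_π := fun z => by
        obtain ⟨⟨i, x⟩ | y, rfl⟩ := e.surjective z
        · simp only [π', Equiv.trans_apply, e.symm_apply_apply, Equiv.sumCongr_apply, Sum.map_inl, Sum.elim_inl]
          change s₀.g ((if i = Fin.last n then s₀.π else 1) x) = _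
          split_ifs
          · rw [s₀.g_π]
          · rfl
        · simp only [π', Equiv.trans_apply, e.symm_apply_apply, Equiv.sumCongr_apply, Sum.map_inr, Sum.elim_inr,
            s₂.g_π]
      stable := fun z hz => by
        obtain ⟨⟨i, x⟩ | y, rfl⟩ := e.surjective z
        · simp only [r', e.symm_apply_apply, Sum.map_inl, Prod.map, e.apply_eq_iff_eq, inl.injEq, Prod.mk.injEq,
            id, true_and] at hz
          refine (s₀.stable x hz).trans_eq ?_
          simp only [e.symm_apply_apply, Sum.elim_inl]
          congr 1
          refine Nat.card_congr (Equiv.ofBijective (fun y => ⟨e (inl (i, y.1)), ?_, ?_⟩) ⟨?_, ?_⟩)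
          · simp [r', y.2.1]
          · simpa using y.2.2
          · intro y y' h
            simpa [Subtype.ext_iff] using h
          · rintro ⟨z, hz1, hz2⟩
            obtain ⟨⟨j, x'⟩ | y, rfl⟩ := e.surjective z
            · have hz3 := hz1
              simp only [r', e.symm_apply_apply, Sum.map_inl, Prod.map, e.apply_eq_iff_eq, inl.injEq,
                Prod.mk.injEq, id] at hz3
              obtain ⟨rfl, hz3⟩ := hz3
              exact ⟨⟨x', hz3, fun hh => hz2 (by rw [hh])⟩, rfl⟩
            · simp [r'] at hz1
        · simp only [r', e.symm_apply_apply, Sum.map_inr, e.apply_eq_iff_eq, inr.injEq] at hz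
          refine (s₂.stable y hz).trans_eq ?_
          simp only [e.symm_apply_apply, Sum.elim_inr]
          congr 1
          refine Nat.card_congr (Equiv.ofBijective (fun y => ⟨e (inr y.1), ?_, ?_⟩) ⟨?_, ?_⟩)
          · simp [r', y.2.1]
          · simpa using y.2.2
          · intro y y' h
            simpa [Subtype.ext_iff] using h
          · rintro ⟨z, hz1, hz2⟩
            obtain ⟨⟨j, x'⟩ | y', rfl⟩ := e.surjective z
            · simp [r'] at hz1
            · have hz3 := hz1
              simp only [r', e.symm_apply_apply, Sum.map_inr, e.apply_eq_iff_eq, inr.injEq] at hz3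
              exact ⟨⟨y', hz3, fun hh => hz2 (by rw [hh])⟩, rfl⟩ }
  have hpair : IsPairing f.π f.flags (fun z => e (ι' (e.symm z))) := by
    refine ⟨fun z => ?_, fun z => ?_, fun z hz => ?_⟩
    · obtain ⟨⟨i, x⟩ | y, rfl⟩ := e.surjective z
      · simp [ι', s₀.pairing.invol]
      · simp [ι', s₂.pairing.invol]
    · obtain ⟨a | y, rfl⟩ := e.surjective z
      · simp only [f, ι', π', Equiv.trans_apply, e.symm_apply_apply, Equiv.sumCongr_apply, Sum.map_inl,
          hρ s₀.ι s₀.pairing.comm]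
      · simp only [f, ι', π', Equiv.trans_apply, e.symm_apply_apply, Equiv.sumCongr_apply, Sum.map_inr,
          s₂.pairing.comm]
    · have hz : f.r z = z := not_not.1 hz
      obtain ⟨⟨i, x⟩ | y, rfl⟩ := e.surjective z
      · simp only [f, r', e.symm_apply_apply, Sum.map_inl, Prod.map, e.apply_eq_iff_eq, inl.injEq, Prod.mk.injEq,
            id, true_and] at hz
        have := s₀.pairing.fix x (fun h => h hz)
        simp [ι', this]
      · simp only [f, r', e.symm_apply_apply, Sum.map_inr, e.apply_eq_iff_eq, inr.injEq] at hz
        have := s₂.pairing.fix y (fun h => h hz)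
        simp [ι', this]
  have hstep : ∀ (i : Fin (n + 1)) (x : X) (hi : (i : ℕ) + 1 < n + 1),
      f.π (e (inl (i, x))) = e (inl (⟨i + 1, hi⟩, x)) := by
    intro i x hi
    have h1 : i ≠ Fin.last n := fun hh => by rw [hh] at hi; simp at hi
    have h2 : ρ (i, x) = (⟨i + 1, hi⟩, x) := by
      refine Prod.ext ?_ ?_
      · change finRotate (n + 1) i = _
        refine Fin.ext ?_
        rw [finRotate_apply, Fin.val_add_one, if_neg h1]
      · change (if i = Fin.last n then s₀.π else 1) x = x
        rw [if_neg h1]; rfl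
    change e (π' (e.symm (e (inl (i, x))))) = _
    rw [e.symm_apply_apply]
    change e (inl (ρ (i, x))) = _
    rw [h2]
  have hshift : ∀ (i : Fin (n + 1)) x, (f.π ^ (i : ℕ)) (e (inl (0, x))) = e (inl (i, x)) := by
    rintro ⟨i, hi⟩ x
    induction i with
    | zero => rfl
    | succ i ih =>
      change (f.π ^ (i + 1)) _ = _
      rw [pow_succ', Equiv.Perm.mul_apply, ih (by omega)]
      exact hstep ⟨i, by omega⟩ x hi
  -- After `n` identical steps the last one carries the twist by `s₀.π`.
  have hlast : ∀ x, (f.π ^ (n + 1)) (e (inl (0, x))) = e (inl (0, s₀.π x)) := by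
    intro x
    rw [pow_succ', Equiv.Perm.mul_apply]
    have := hshift (Fin.last n) x
    rw [Fin.val_last] at this
    rw [this]
    change e (π' (e.symm (e (inl (Fin.last n, x))))) = _
    rw [e.symm_apply_apply]
    change e (inl (ρ (Fin.last n, x))) = _
    congr 2
    refine Prod.ext ?_ ?_
    · change finRotate (n + 1) (Fin.last n) = _
      rw [finRotate_last]
    · change (if Fin.last n = Fin.last n then s₀.π else 1) x = _
      rw [if_pos rfl]
  refine ⟨{ f with ι := _, pairing := hpair }, ⟨?_, ?_, ?_, ?_, ?_, ?_, ?_⟩, ⟨?_, ?_, ?_, ?_, ?_, ?_, ?_⟩, hshift⟩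
  · intro x y h
    simpa using h
  · intro x; simp [f, r']
  · intro x; simp [ι']
  · intro x; simp [f]
  · intro z x hz
    obtain ⟨⟨j, x'⟩ | y', rfl⟩ := e.surjective z
    · simp only [f, r', e.symm_apply_apply, Sum.map_inl, Prod.map, e.apply_eq_iff_eq, inl.injEq,
        Prod.mk.injEq, id] at hz
      exact ⟨x', by rw [hz.1]⟩
    · simp [f, r'] at hz
  · exact hlast
  · exact fun x x' N => dvd_of_shift (fun x => ⟨_, (hlast x).symm⟩) hshift N x x'
  · intro x y h
    simpa using h
  · intro x; simp [f, r']
  · intro x; simp [ι']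
  · intro x; simp [f]
  · intro z x hz
    obtain ⟨⟨j, x'⟩ | y', rfl⟩ := e.surjective z
    · simp [f, r'] at hz
    · exact ⟨y', rfl⟩
  · intro y
    simp [f, π']
  · exact fun _ _ _ _ => one_dvd _

theorem Splits.weight_eq [Finite X] [Finite Y] [Finite Z] {n : ℕ} {e : Fin (n + 1) × X ⊕ Y ≃ Z} {s₀ : ZGraph X}
    {s₂ : ZGraph Y} {s : ZGraph Z} (h : Splits e s₀ s₂ s)
    {c : ∀ (_ : ℕ) (I : Type) [Finite I], Equiv.Perm I → k} (hc : IsClassFunction c) (x : k) :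
    s.weight c x = plethNat (n + 1) (s₀.weight c x) * s₂.weight c x := by
  refine weight_eq_mul (Nat.succ_pos n) h.left h.right (fun a b N hN => ?_) (fun z => ?_) hc x
  · have h1 : ∀ (N : ℕ) y, ∃ y', (s.π ^ N) (e (inr y)) = e (inr y') := by
      intro N
      induction N with
      | zero => exact fun y => ⟨y, rfl⟩
      | succ N ih =>
        intro y
        have h2 := h.right.pow y
        rw [pow_one] at h2
        obtain ⟨y', hy'⟩ := ih (s₂.π y)
        exact ⟨y', by rw [pow_succ, Equiv.Perm.mul_apply, h2, hy']⟩
    have h3 : SameCycle s.π (e (inr b)) (e (inl (0, a))) := by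
      rw [← hN]
      exact sameCycle_pow_left.2 SameCycle.rfl
    obtain ⟨M, hM⟩ := h3.exists_nat_pow_eq
    obtain ⟨y', hy'⟩ := h1 M b
    rw [hy'] at hM
    simp at hM
  · obtain ⟨⟨i, a⟩ | b, rfl⟩ := e.surjective z
    · exact Or.inl ⟨a, i, h.shift i a⟩
    · exact Or.inr ⟨b, rfl⟩

theorem Splits.wt_eq [Fintype X] [Fintype Y] [Fintype Z] {n : ℕ} {e : Fin (n + 1) × X ⊕ Y ≃ Z} {s₀ : ZGraph X}
    {s₂ : ZGraph Y} {s : ZGraph Z} (h : Splits e s₀ s₂ s) : s.wt = (n + 1) * s₀.wt + s₂.wt := by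
  unfold FlagSpace.wt
  rw [← e.sum_comp, Fintype.sum_sum_type, Fintype.sum_prod_type]
  congr 1
  · have hc : (n + 1) * ∑ x, s₀.vwt x = ∑ _i : Fin (n + 1), ∑ x, s₀.vwt x := by simp
    rw [hc]
    refine Finset.sum_congr rfl fun i _ => Finset.sum_congr rfl fun x _ => ?_
    rw [← h.shift, s.vwt_pow]
    exact h.left.vwt_eq x
  · exact Finset.sum_congr rfl fun y _ => h.right.vwt_eq y

end ZGraph

end ModularOperads

set_option linter.unusedSimpArgs false

/-! ### Finiteness for given weight, and the generating series -/

namespace ModularOperads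

open Equiv.Perm Sum

namespace FlagSpace

variable {X : Type} (s : FlagSpace X)

theorem vwt_eq_zero {x : X} (h : s.r x ≠ x) : s.vwt x = 0 := if_neg h

theorem vwt_add_two {x : X} (h : s.r x = x) : s.vwt x + 2 = 2 * s.g x + Nat.card (s.Star x) := by
  have h1 : 3 ≤ 2 * s.g x + Nat.card (s.Star x) := s.stable x h
  have h2 : s.vwt x = 2 * s.g x + Nat.card (s.Star x) - 2 := if_pos h
  omega

theorem vwt_pos {x : X} (h : s.r x = x) : 0 < s.vwt x := by
  have h1 : 3 ≤ 2 * s.g x + Nat.card (s.Star x) := s.stable x h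
  have := s.vwt_add_two h
  omega

/-- A stable vertex of weight `v ≥ 1` has at most `v + 2` flags; together with itself these are at
most `v + 3 ≤ 4 v` cells. -/
theorem card_le [Fintype X] : Fintype.card X ≤ 4 * s.wt := by
  classical
  have h := Finset.card_eq_sum_card_fiberwise (s := (Finset.univ : Finset X)) (t := Finset.univ) (f := s.r)
    (fun _ _ => Finset.mem_univ _)
  rw [Finset.card_univ] at h
  rw [h, wt, Finset.mul_sum]
  refine Finset.sum_le_sum fun v _ => ?_
  by_cases hv : s.r v = v
  · have h1 : Finset.univ.filter (fun y => s.r y = v) = insert v (Finset.univ.filter fun y => s.r y = v ∧ y ≠ v) := by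
      ext y
      simp only [Finset.mem_filter, Finset.mem_univ, true_and, Finset.mem_insert]
      by_cases hy : y = v
      · simp [hy, hv]
      · simp [hy]
    have h2 : Nat.card (s.Star v) = (Finset.univ.filter fun y => s.r y = v ∧ y ≠ v).card := by
      rw [Nat.card_eq_fintype_card, Fintype.card_subtype]
    have h3 := Finset.card_insert_le v (Finset.univ.filter fun y => s.r y = v ∧ y ≠ v)
    rw [← h1, ← h2] at h3
    have h4 := s.vwt_add_two hv
    have h5 := s.vwt_pos hv
    omega
  · have h1 : Finset.univ.filter (fun y => s.r y = v) = ∅ := by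
      refine Finset.filter_eq_empty_iff.2 fun y _ hy => hv ?_
      rw [← hy, s.r_r]
    rw [h1]
    simp

theorem g_le [Fintype X] (x : X) : s.g x ≤ s.wt + 1 := by
  by_cases h : s.r x = x
  · have h1 := s.vwt_add_two h
    have h2 : s.vwt x ≤ s.wt := Finset.single_le_sum (f := s.vwt) (fun _ _ => Nat.zero_le _) (Finset.mem_univ x)
    omega
  · rw [s.g_flag x h]
    exact Nat.zero_le _

end FlagSpace

namespace ZGraph

/-- On a finite set only the genera are not bounded a priori, and the weight bounds them. -/
theorem finite_wt_le {X : Type} [Fintype X] (w : ℕ) : {s : ZGraph X | s.wt ≤ w}.Finite := by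
  classical
  refine Set.Finite.of_injOn (f := fun s : ZGraph X => (s.r, s.ι, s.π, s.g))
    (t := Set.univ ×ˢ Set.univ ×ˢ Set.univ ×ˢ Set.univ.pi fun _ => Set.Iic (w + 1)) ?_ ?_ ?_
  · intro s hs
    refine ⟨trivial, trivial, trivial, fun x _ => ?_⟩
    exact (s.g_le x).trans (Nat.succ_le_succ hs)
  · intro s _ t _ h
    simp only [Prod.mk.injEq] at h
    exact ZGraph.ext h.1 h.2.2.2 h.2.2.1 h.2.1
  · exact Set.finite_univ.prod (Set.finite_univ.prod (Set.finite_univ.prod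
      (Set.Finite.pi fun _ => Set.finite_Iic _)))

/-- The graphs of weight at most `w` on the set `{0, …, N - 1}`. -/
noncomputable def graphsLE (N w : ℕ) : Finset (ZGraph (Fin N)) := (finite_wt_le w).toFinset

theorem mem_graphsLE {N w : ℕ} {s : ZGraph (Fin N)} : s ∈ graphsLE N w ↔ s.wt ≤ w := by
  simp [graphsLE]

variable {k : Type u} [Field k]

open Classical in
/-- The generating series of the graphs with property `P`, counted with weights. -/
noncomputable def series (P : ∀ N, ZGraph (Fin N) → Prop)
    (c : ∀ (_ : ℕ) (I : Type) [Finite I], Equiv.Perm I → k) (x : k) : LambdaSeries k :=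
  PowerSeries.mk fun w => ∑ N ∈ Finset.range (4 * w + 1), (N.factorial : k)⁻¹ •
    ∑ s ∈ graphsLE N w, if s.wt = w ∧ P N s then s.weight c x else 0

theorem le_of_wt_le {N w : ℕ} {s : ZGraph (Fin N)} (h : s.wt ≤ w) : N < 4 * w + 1 := by
  have := s.card_le
  rw [Fintype.card_fin] at this
  omega

open Classical in
-- The bounds on `N` and on the set of graphs may be enlarged, so that coefficients of different
-- weights become sums over a common range.
theorem coeff_series (P : ∀ N, ZGraph (Fin N) → Prop)
    (c : ∀ (_ : ℕ) (I : Type) [Finite I], Equiv.Perm I → k) (x : k) {w W : ℕ} (h : w ≤ W) :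
    PowerSeries.coeff w (series P c x) = ∑ N ∈ Finset.range (4 * W + 1), (N.factorial : k)⁻¹ •
      ∑ s ∈ graphsLE N W, if s.wt = w ∧ P N s then s.weight c x else 0 := by
  rw [series, PowerSeries.coeff_mk]
  have h1 : ∀ N, ∑ s ∈ graphsLE N w, (if s.wt = w ∧ P N s then s.weight c x else 0)
      = ∑ s ∈ graphsLE N W, if s.wt = w ∧ P N s then s.weight c x else 0 := fun N => by
    refine Finset.sum_subset (fun s hs => mem_graphsLE.2 ((mem_graphsLE.1 hs).trans h)) fun s _ hs => ?_
    rw [if_neg]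
    rintro ⟨rfl, -⟩
    exact hs (mem_graphsLE.2 le_rfl)
  rw [Finset.sum_congr rfl fun N _ => congrArg _ (h1 N)]
  refine Finset.sum_subset (fun N hN => ?_) fun N _ hN => ?_
  · rw [Finset.mem_range] at hN ⊢
    omega
  · rw [Finset.sum_eq_zero, smul_zero]
    intro s _
    rw [if_neg]
    rintro ⟨rfl, -⟩
    exact hN (Finset.mem_range.2 (le_of_wt_le le_rfl))

end ZGraph

/-! ### Labellings of the orbit of the component of a marked cell -/

section Marks

open ZGraph

variable {X Y Z : Type}

/-- The number `n + 1` is the first return time of the component: if `n' < n`, then `π ^ (n' + 1) p`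
would lie both in copy `0` and in copy `n' + 1`. -/
theorem ZGraph.Marks.le {n n' : ℕ} {X' Y' : Type} {e : Fin (n + 1) × X ⊕ Y ≃ Z} {e' : Fin (n' + 1) × X' ⊕ Y' ≃ Z}
    {s : ZGraph Z} {p : Z} (h : Marks e s p) (h' : Marks e' s p) : n ≤ n' := by
  by_contra hlt
  obtain ⟨x, hx⟩ := (h.conn_iff p).1 (s.conn.refl' p)
  obtain ⟨y, hy⟩ := (h.conn_iff _).1 h'.ret
  have h1 := h.shift ⟨n' + 1, by omega⟩ x
  rw [hx] at h1
  rw [h1] at hy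
  simp [Fin.ext_iff] at hy

theorem ZGraph.Marks.card_eq {n n' : ℕ} {X' Y' : Type} {e : Fin (n + 1) × X ⊕ Y ≃ Z}
    {e' : Fin (n' + 1) × X' ⊕ Y' ≃ Z}
    {s : ZGraph Z} {p : Z} (h : Marks e s p) (h' : Marks e' s p) : Nat.card X = Nat.card X' := by
  have h1 : ∀ {n : ℕ} {X Y : Type} {e : Fin (n + 1) × X ⊕ Y ≃ Z}, Marks e s p →
      Nat.card X = Nat.card {z // s.conn p z} := by
    intro n X Y e h
    refine Nat.card_congr (Equiv.ofBijective (fun x => ⟨e (inl (0, x)), (h.conn_iff _).2 ⟨x, rfl⟩⟩) ⟨?_, ?_⟩)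
    · intro x y hxy
      simpa using congrArg Subtype.val hxy
    · rintro ⟨z, hz⟩
      obtain ⟨x, rfl⟩ := (h.conn_iff z).1 hz
      exact ⟨x, rfl⟩
  rw [h1 h, h1 h']

/-- Take for `n + 1` the first return time of the component of `p`. Its translates before that time
are disjoint, and what is left over is numbered arbitrarily. -/
theorem ZGraph.exists_marks {N : ℕ} (s : ZGraph (Fin N)) (p : Fin N) :
    ∃ (n a b : ℕ) (e : Fin (n + 1) × Fin a ⊕ Fin b ≃ Fin N), Marks e s p := by
  classical
  have hex : ∃ n, s.conn p ((s.π ^ (n + 1)) p) :=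
    ⟨period s.π p - 1, by
      rw [Nat.sub_add_cancel (period_pos _ _), pow_period]⟩
  set n := Nat.find hex with hn
  have hret := Nat.find_spec hex
  have hmin : ∀ m, 0 < m → m < n + 1 → ¬ s.conn p ((s.π ^ m) p) := by
    intro m hm hmn h
    obtain ⟨m, rfl⟩ := Nat.exists_eq_succ_of_ne_zero hm.ne'
    exact Nat.find_min hex (by omega) h
  let K := {z // s.conn p z}
  let φ : Fin (Nat.card K) ≃ K := (Finite.equivFin K).symm
  let f : Fin (n + 1) × Fin (Nat.card K) → Fin N := fun a => (s.π ^ (a.1 : ℕ)) (φ a.2).1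
  -- If two translates met, their difference `d = j - i` would be an earlier return time.
  have key : ∀ (i j : Fin (n + 1)) x y, (i : ℕ) ≤ j → f (i, x) = f (j, y) → i = j ∧ x = y := by
    intro i j x y hij h
    obtain ⟨d, hd⟩ := Nat.exists_eq_add_of_le hij
    have h1 : (s.π ^ (i : ℕ)) (φ x).1 = (s.π ^ (j : ℕ)) (φ y).1 := h
    rw [hd, pow_add, Equiv.Perm.mul_apply, (s.π ^ (i : ℕ)).apply_eq_iff_eq] at h1
    have hd0 : d = 0 := by
      by_contra hd0
      refine hmin d (Nat.pos_of_ne_zero hd0) (by have := j.2; omega) ?_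
      refine s.conn.trans' (φ x).2 ?_
      rw [h1]
      exact s.conn_pow d (s.conn.symm' (φ y).2)
    subst hd0
    refine ⟨Fin.ext (by omega), φ.injective (Subtype.ext h1)⟩
  have hf : Function.Injective f := by
    rintro ⟨i, x⟩ ⟨j, y⟩ h
    rcases le_total (i : ℕ) j with hij | hij
    · obtain ⟨rfl, rfl⟩ := key i j x y hij h
      rfl
    · obtain ⟨rfl, rfl⟩ := key j i y x hij h.symm
      rfl
  let e : Fin (n + 1) × Fin (Nat.card K) ⊕ Fin (Nat.card ↥(Set.range f)ᶜ) ≃ Fin N :=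
    (Equiv.sumCongr (Equiv.ofInjective f hf) (Finite.equivFin _).symm).trans (Equiv.Set.sumCompl (Set.range f))
  have he : ∀ a, e (inl a) = f a := fun a => by
    change (Equiv.Set.sumCompl (Set.range f)) (inl _) = f a
    rw [Equiv.Set.sumCompl_apply_inl]
    rfl
  refine ⟨n, Nat.card K, _, e, ⟨fun z => ⟨fun hz => ⟨φ.symm ⟨z, hz⟩, ?_⟩, ?_⟩, fun i x => ?_, hret⟩⟩
  · rw [he]
    simp [f]
  · rintro ⟨x, rfl⟩
    rw [he]
    exact (φ x).2
  · rw [he, he]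
    simp [f]

/-- Two labellings for the same marked cell differ by a permutation of `X`, which is the same on all
copies because of `shift`, and by a permutation of `Y`. -/
theorem ZGraph.Marks.card [Finite X] [Finite Y] {n : ℕ} {e₀ : Fin (n + 1) × X ⊕ Y ≃ Z} {s : ZGraph Z} {p : Z}
    (h₀ : Marks e₀ s p) : Nat.card {e : Fin (n + 1) × X ⊕ Y ≃ Z // Marks e s p}
      = (Nat.card X).factorial * (Nat.card Y).factorial := by
  rw [← Nat.card_perm, ← Nat.card_perm, ← Nat.card_prod]
  let F : Equiv.Perm X × Equiv.Perm Y → (Fin (n + 1) × X ⊕ Y ≃ Z) := fun q =>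
    (Equiv.sumCongr (Equiv.prodCongr (Equiv.refl _) q.1) q.2).trans e₀
  have hF : ∀ q, Marks (F q) s p := by
    intro q
    refine ⟨fun z => ?_, fun i x => h₀.shift i _, h₀.ret⟩
    rw [h₀.conn_iff, ← q.1.exists_congr_right]
    exact Iff.rfl
  refine (Nat.card_congr (Equiv.ofBijective (fun q => ⟨F q, hF q⟩) ⟨?_, ?_⟩)).symm
  · intro q q' hq
    have h1 : F q = F q' := congrArg Subtype.val hq
    refine Prod.ext (Equiv.ext fun x => ?_) (Equiv.ext fun y => ?_)
    · have := Equiv.congr_fun h1 (inl (0, x))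
      simpa [F] using this
    · have := Equiv.congr_fun h1 (inr y)
      simpa [F] using this
  · rintro ⟨e, he⟩
    have h1 : ∀ x, ∃ x', e₀ (inl (0, x')) = e (inl (0, x)) := fun x =>
      (h₀.conn_iff _).1 ((he.conn_iff _).2 ⟨x, rfl⟩)
    choose α hα using h1
    have hα' : ∀ i x, e (inl (i, x)) = e₀ (inl (i, α x)) := fun i x => by
      rw [← he.shift, ← hα, h₀.shift]
    have hαi : Function.Injective α := fun x y hxy => by
      have := hα x
      rw [hxy, hα] at this
      simpa using this.symm
    have h2 : ∀ y, ∃ y', e₀ (inr y') = e (inr y) := by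
      intro y
      rcases hz : e₀.symm (e (inr y)) with ⟨i, x⟩ | b
      · obtain ⟨x', rfl⟩ := Finite.surjective_of_injective hαi x
        rw [Equiv.symm_apply_eq, ← hα'] at hz
        simp at hz
      · exact ⟨b, by rw [← hz, e₀.apply_symm_apply]⟩
    choose β hβ using h2
    have hβi : Function.Injective β := fun x y hxy => by
      have := hβ x
      rw [hxy, hβ] at this
      simpa using this.symm
    refine ⟨(Equiv.ofBijective α (Finite.injective_iff_bijective.1 hαi),
      Equiv.ofBijective β (Finite.injective_iff_bijective.1 hβi)), Subtype.ext (Equiv.ext ?_)⟩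
    rintro (⟨i, x⟩ | y)
    · exact (hα' i x).symm
    · exact hβ y

end Marks

/-! ### The exponential formula -/

section Exponential

open ZGraph

variable {k : Type u} [Field k]

/-- Reindexing with `d = n + 1` components of weight `u` each and the rest of weight `w'`. The terms
`u = 0` on the right have no counterpart on the left and vanish by `hF`. -/
theorem sum_antidiagonal_divisors {M : Type*} [AddCommMonoid M] (w : ℕ) (F : ℕ → ℕ → ℕ → M)
    (hF : ∀ d w', F d 0 w' = 0) :
    ∑ p ∈ Finset.HasAntidiagonal.antidiagonal w, ∑ d ∈ p.1.divisors, F d (p.1 / d) p.2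
      = ∑ n ∈ Finset.range w, ∑ u ∈ Finset.range (w + 1), ∑ w' ∈ Finset.range (w + 1),
        if (n + 1) * u + w' = w then F (n + 1) u w' else 0 := by
  rw [Finset.sum_sigma', Finset.sum_sigma', Finset.sum_sigma', ← Finset.sum_filter, eq_comm]
  refine Finset.sum_bij_ne_zero (fun q _ _ => ⟨((q.1.1 + 1) * q.1.2, q.2), q.1.1 + 1⟩) ?_ ?_ ?_ ?_
  · rintro ⟨⟨n, u⟩, w'⟩ h hne
    simp only [Finset.mem_filter, Finset.mem_sigma, Finset.mem_range] at h
    have hu : u ≠ 0 := by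
      rintro rfl
      exact hne (hF _ _)
    simp only [Finset.mem_sigma, Finset.HasAntidiagonal.mem_antidiagonal, Nat.mem_divisors]
    exact ⟨h.2, Dvd.intro _ rfl, by positivity⟩
  · rintro ⟨⟨n, u⟩, w'⟩ - - ⟨⟨n', u'⟩, w''⟩ - - h
    simp only [Sigma.mk.injEq, Prod.mk.injEq, heq_eq_eq] at h
    obtain ⟨⟨h1, rfl⟩, h2⟩ := h
    obtain rfl : n = n' := by omega
    obtain rfl := Nat.eq_of_mul_eq_mul_left (Nat.succ_pos n) h1
    rfl
  · rintro ⟨⟨v, w'⟩, d⟩ h hne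
    simp only [Finset.mem_sigma, Finset.HasAntidiagonal.mem_antidiagonal, Nat.mem_divisors] at h
    obtain ⟨rfl, ⟨u, rfl⟩, h0⟩ := h
    have hd : 0 < d := Nat.pos_of_ne_zero fun h => h0 (by rw [h, zero_mul])
    have hu : 0 < u := Nat.pos_of_ne_zero fun h => h0 (by rw [h, mul_zero])
    obtain ⟨n, rfl⟩ := Nat.exists_eq_succ_of_ne_zero hd.ne'
    have h1 : (n + 1) * u / (n + 1) = u := Nat.mul_div_cancel_left u hd
    refine ⟨⟨⟨n, u⟩, w'⟩, ?_, ?_, ?_⟩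
    · simp only [Finset.mem_filter, Finset.mem_sigma, Finset.mem_range, and_true]
      have h3 : n + 1 ≤ (n + 1) * u := Nat.le_mul_of_pos_right _ hu
      have h4 : u ≤ (n + 1) * u := Nat.le_mul_of_pos_left _ hd
      simp only [Nat.succ_eq_add_one]
      omega
    · simp only [Nat.succ_eq_add_one, h1] at hne
      exact hne
    · rfl
  · rintro ⟨⟨n, u⟩, w'⟩ - -
    simp only
    rw [Nat.mul_div_cancel_left u (Nat.succ_pos n)]

variable (c : ∀ (_ : ℕ) (I : Type) [Finite I], Equiv.Perm I → k) (x : k)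

open Classical in
/-- The contribution of the pairs of a connected graph with `a` elements and a graph with `b` elements. -/
noncomputable def pairTerm (w n a b : ℕ) : LambdaPoly k :=
  ∑ s₀ ∈ graphsLE a w, ∑ s₂ ∈ graphsLE b w, ∑ y : Fin a,
    if s₀.IsConn ∧ (n + 1) * s₀.wt + s₂.wt = w then
      (s₀.vwt y : k) • (plethNat (n + 1) (s₀.weight c x) * s₂.weight c x) else 0

open Classical in
-- For a fixed labelling `e`, graphs with a marked cell correspond bijectively to triples of a
-- connected graph, a cell `y` in it, and a complementary graph; weights are multiplicative by
-- `Splits.weight_eq`.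
theorem sum_marks_eq (hc : IsClassFunction c) {w n a b N : ℕ} (e : Fin (n + 1) × Fin a ⊕ Fin b ≃ Fin N) :
    ∑ s ∈ graphsLE N w, ∑ p, (if s.wt = w ∧ Marks e s p then (s.vwt p : k) • s.weight c x else 0)
      = pairTerm c x w n a b := by
  simp only [pairTerm]
  simp_rw [← Finset.sum_product', ← Finset.sum_filter]
  symm
  refine Finset.sum_bij (fun q _ => ((exists_splits e q.1 q.2.1).choose, e (inl (0, q.2.2)))) ?_ ?_ ?_ ?_
  · rintro ⟨s₀, s₂, y⟩ h
    simp only [Finset.mem_filter, Finset.mem_product, Finset.mem_univ, and_true, mem_graphsLE] at h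
    have hs := (exists_splits e s₀ s₂).choose_spec
    simp only [Finset.mem_filter, Finset.mem_product, Finset.mem_univ, and_true, mem_graphsLE]
    have h1 : (exists_splits e s₀ s₂).choose.wt = w := hs.wt_eq.trans h.2.2
    exact ⟨h1.le, h1, hs.marks h.2.1 y⟩
  · rintro ⟨s₀, s₂, y⟩ h ⟨t₀, t₂, z⟩ h' heq
    simp only [Prod.mk.injEq, e.apply_eq_iff_eq, inl.injEq, true_and] at heq
    have h1 := (exists_splits e s₀ s₂).choose_spec
    have h2 := (exists_splits e t₀ t₂).choose_spec
    rw [heq.1] at h1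
    obtain ⟨rfl, rfl⟩ := h1.unique_left h2
    rw [heq.2]
  · rintro ⟨s, p⟩ h
    simp only [Finset.mem_filter, Finset.mem_product, Finset.mem_univ, and_true, mem_graphsLE] at h
    obtain ⟨s₀, s₂, y, hconn, hs, rfl⟩ := h.2.2.exists_splits
    have h1 := hs.wt_eq.symm.trans h.2.1
    have h2 : s₀.wt ≤ (n + 1) * s₀.wt := Nat.le_mul_of_pos_left _ (Nat.succ_pos n)
    refine ⟨(s₀, s₂, y), ?_, ?_⟩
    · simp only [Finset.mem_filter, Finset.mem_product, Finset.mem_univ, and_true, mem_graphsLE]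
      exact ⟨⟨by omega, by omega⟩, hconn, h1⟩
    · exact Prod.ext ((exists_splits e s₀ s₂).choose_spec.unique hs) rfl
  · rintro ⟨s₀, s₂, y⟩ h
    have hs := (exists_splits e s₀ s₂).choose_spec
    rw [hs.weight_eq hc, ← hs.left.vwt_eq]

open Classical in
-- The marked cell determines `n`, `a` and `b`, and for these there are exactly `a! b!` labellings.
-- The resulting expression for `1` introduces the labellings into the sum over graphs.
theorem sum_card_marks [CharZero k] {N w : ℕ} {s : ZGraph (Fin N)} (hs : s.wt = w) {p : Fin N} (hp : s.vwt p ≠ 0) :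
    ∑ n ∈ Finset.range w, ∑ a ∈ Finset.range (4 * w + 1), ∑ b ∈ Finset.range (4 * w + 1),
      ((a.factorial * b.factorial : ℕ) : k)⁻¹ *
        (Nat.card {e : Fin (n + 1) × Fin a ⊕ Fin b ≃ Fin N // Marks e s p} : k) = 1 := by
  obtain ⟨n, a, b, e, he⟩ := s.exists_marks p
  have hcard : (n + 1) * a + b = N := by
    have := Fintype.card_congr e
    simpa using this
  have hN : N < 4 * w + 1 := le_of_wt_le hs.le
  obtain ⟨s₀, s₂, y, hconn, hsp, rfl⟩ := he.exists_splits
  -- The marked cell has positive weight, so the orbit of its component already has weight at least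
  -- `n + 1`.
  have hn : n < w := by
    have h1 := hsp.wt_eq
    have h2 : s₀.vwt y ≤ s₀.wt := Finset.single_le_sum (f := s₀.vwt) (fun _ _ => Nat.zero_le _) (Finset.mem_univ y)
    have h3 := hsp.left.vwt_eq y
    have h4 : n + 1 ≤ (n + 1) * s₀.wt := Nat.le_mul_of_pos_right _ (by omega)
    omega
  have ha : a ≤ (n + 1) * a := Nat.le_mul_of_pos_left _ (Nat.succ_pos n)
  have huniq : ∀ n' a' b', n' ≠ n ∨ a' ≠ a ∨ b' ≠ b →
      Nat.card {e' : Fin (n' + 1) × Fin a' ⊕ Fin b' ≃ Fin N // Marks e' s (e (inl (0, y)))} = 0 := by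
    intro n' a' b' h
    have : IsEmpty {e' : Fin (n' + 1) × Fin a' ⊕ Fin b' ≃ Fin N // Marks e' s (e (inl (0, y)))} := by
      refine ⟨fun ⟨e', he'⟩ => ?_⟩
      have h1 : n' = n := le_antisymm (he'.le he) (he.le he')
      have h2 : a' = a := by simpa using he'.card_eq he
      have h3 : (n' + 1) * a' + b' = N := by
        have := Fintype.card_congr e'
        simpa using this
      subst h1 h2
      omega
    exact Nat.card_of_isEmpty
  rw [Finset.sum_eq_single n, Finset.sum_eq_single a, Finset.sum_eq_single b, he.card, Nat.card_fin, Nat.card_fin,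
    inv_mul_cancel₀]
  · exact_mod_cast (Nat.mul_pos a.factorial_pos b.factorial_pos).ne'
  · intro b' _ hb
    rw [huniq _ _ _ (Or.inr (Or.inr hb)), Nat.cast_zero, mul_zero]
  · intro h
    exact absurd (Finset.mem_range.2 (by omega)) h
  · intro a' _ ha
    refine Finset.sum_eq_zero fun b' _ => ?_
    rw [huniq _ _ _ (Or.inr (Or.inl ha)), Nat.cast_zero, mul_zero]
  · intro h
    exact absurd (Finset.mem_range.2 (by omega)) h
  · intro n' _ hn
    refine Finset.sum_eq_zero fun a' _ => Finset.sum_eq_zero fun b' _ => ?_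
    rw [huniq _ _ _ (Or.inl hn), Nat.cast_zero, mul_zero]
  · intro h
    exact absurd (Finset.mem_range.2 hn) h

open Classical in
-- The factor `w` is the sum of the weights of the cells, that is, a marked cell `p` counted with
-- its weight. After the labellings are inserted by `sum_card_marks`, their number `N!` cancels the
-- factor `1 / N!`.
theorem smul_coeff_series [CharZero k] (hc : IsClassFunction c) (w : ℕ) :
    (w : k) • PowerSeries.coeff w (series (fun _ _ => True) c x)
      = ∑ n ∈ Finset.range w, ∑ a ∈ Finset.range (4 * w + 1), ∑ b ∈ Finset.range (4 * w + 1),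
        ((a.factorial * b.factorial : ℕ) : k)⁻¹ • pairTerm c x w n a b := by
  have h1 : ∀ N, ∀ s ∈ graphsLE N w, (w : k) • (if s.wt = w ∧ True then s.weight c x else 0)
      = ∑ n ∈ Finset.range w, ∑ a ∈ Finset.range (4 * w + 1), ∑ b ∈ Finset.range (4 * w + 1),
        ∑ e : Fin (n + 1) × Fin a ⊕ Fin b ≃ Fin N, ((a.factorial * b.factorial : ℕ) : k)⁻¹ •
          ∑ p, if s.wt = w ∧ Marks e s p then (s.vwt p : k) • s.weight c x else 0 := by
    intro N s _
    by_cases hs : s.wt = w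
    swap
    · simp [hs]
    have h2 : ∀ p, (s.vwt p : k) • s.weight c x
        = ∑ n ∈ Finset.range w, ∑ a ∈ Finset.range (4 * w + 1), ∑ b ∈ Finset.range (4 * w + 1),
          ∑ e : Fin (n + 1) × Fin a ⊕ Fin b ≃ Fin N, ((a.factorial * b.factorial : ℕ) : k)⁻¹ •
            if s.wt = w ∧ Marks e s p then (s.vwt p : k) • s.weight c x else 0 := by
      intro p
      by_cases hp : s.vwt p = 0
      · simp [hp]
      conv_lhs => rw [← one_smul k ((s.vwt p : k) • s.weight c x), ← sum_card_marks (k := k) hs hp]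
      simp only [Finset.sum_smul]
      refine Finset.sum_congr rfl fun n _ => Finset.sum_congr rfl fun a _ => Finset.sum_congr rfl fun b _ => ?_
      rw [← Finset.smul_sum, mul_smul]
      congr 1
      simp only [hs, true_and]
      rw [← Finset.sum_filter, Finset.sum_const, Nat.card_eq_fintype_card, Fintype.card_subtype,
        Nat.cast_smul_eq_nsmul]
    have h3 : (w : k) = ∑ p, (s.vwt p : k) := by
      rw [← hs, FlagSpace.wt, Nat.cast_sum]
    rw [if_pos ⟨hs, trivial⟩, h3, Finset.sum_smul, Finset.sum_congr rfl fun p _ => h2 p]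
    rw [Finset.sum_comm]
    refine Finset.sum_congr rfl fun n _ => ?_
    rw [Finset.sum_comm]
    refine Finset.sum_congr rfl fun a _ => ?_
    rw [Finset.sum_comm]
    refine Finset.sum_congr rfl fun b _ => ?_
    rw [Finset.sum_comm]
    refine Finset.sum_congr rfl fun e _ => ?_
    rw [Finset.smul_sum]
  rw [coeff_series _ _ _ le_rfl, Finset.smul_sum]
  have h4 : ∀ N, (w : k) • (N.factorial : k)⁻¹ • ∑ s ∈ graphsLE N w, (if s.wt = w ∧ True then s.weight c x else 0)
      = ∑ n ∈ Finset.range w, ∑ a ∈ Finset.range (4 * w + 1), ∑ b ∈ Finset.range (4 * w + 1),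
        ((N.factorial : k)⁻¹ * (Fintype.card (Fin (n + 1) × Fin a ⊕ Fin b ≃ Fin N) : k)) •
          ((a.factorial * b.factorial : ℕ) : k)⁻¹ • pairTerm c x w n a b := by
    intro N
    rw [smul_comm, Finset.smul_sum, Finset.sum_congr rfl (h1 N), Finset.sum_comm, Finset.smul_sum]
    refine Finset.sum_congr rfl fun n _ => ?_
    rw [Finset.sum_comm, Finset.smul_sum]
    refine Finset.sum_congr rfl fun a _ => ?_
    rw [Finset.sum_comm, Finset.smul_sum]
    refine Finset.sum_congr rfl fun b _ => ?_
    rw [Finset.sum_comm, mul_smul]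
    congr 1
    rw [Finset.sum_congr rfl fun e _ => ((Finset.smul_sum (r := ((a.factorial * b.factorial : ℕ) : k)⁻¹)).symm.trans
      (congrArg _ (sum_marks_eq c x hc e))), Finset.sum_const, Finset.card_univ, Nat.cast_smul_eq_nsmul]
  refine (Finset.sum_congr rfl fun N _ => Eq.trans (by congr!) (h4 N)).trans ?_
  rw [Finset.sum_comm]
  refine Finset.sum_congr rfl fun n _ => ?_
  rw [Finset.sum_comm]
  refine Finset.sum_congr rfl fun a _ => ?_
  rw [Finset.sum_comm]
  refine Finset.sum_congr rfl fun b _ => ?_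
  rw [← Finset.sum_smul]
  by_cases hN : (n + 1) * a + b < 4 * w + 1
  · rw [Finset.sum_eq_single ((n + 1) * a + b), Fintype.card_equiv (Fintype.equivFinOfCardEq (by simp))]
    · simp only [Fintype.card_sum, Fintype.card_prod, Fintype.card_fin]
      rw [inv_mul_cancel₀, one_smul]
      exact_mod_cast (Nat.factorial_pos _).ne'
    · intro N _ hne
      have : IsEmpty (Fin (n + 1) × Fin a ⊕ Fin b ≃ Fin N) := ⟨fun e => hne (by
        have := Fintype.card_congr e
        simpa using this.symm)⟩
      simp
    · intro h
      exact absurd (Finset.mem_range.2 hN) h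
  -- Sizes outside the range of summation do not occur, since the number of cells is at most four
  -- times the weight.
  · have h0 : pairTerm c x w n a b = 0 := by
      refine Finset.sum_eq_zero fun s₀ _ => Finset.sum_eq_zero fun s₂ _ => Finset.sum_eq_zero fun y _ => if_neg ?_
      rintro ⟨-, h⟩
      have h1 := s₀.card_le
      have h2 := s₂.card_le
      rw [Fintype.card_fin] at h1 h2
      have h3 : (n + 1) * a ≤ (n + 1) * (4 * s₀.wt) := Nat.mul_le_mul_left _ h1
      have h4 : (n + 1) * (4 * s₀.wt) = 4 * ((n + 1) * s₀.wt) := by ring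
      omega
    rw [h0, smul_zero, smul_zero]

open Classical in
-- Grouping the pairs by their weights `u` and `w'`; the sum over the marked cell of the connected
-- graph gives the factor `u`.
theorem sum_pairTerm (w n : ℕ) :
    ∑ a ∈ Finset.range (4 * w + 1), ∑ b ∈ Finset.range (4 * w + 1),
        ((a.factorial * b.factorial : ℕ) : k)⁻¹ • pairTerm c x w n a b
      = ∑ u ∈ Finset.range (w + 1), ∑ w' ∈ Finset.range (w + 1), if (n + 1) * u + w' = w then
        ((u : k) • plethNat (n + 1) (PowerSeries.coeff u (series (fun _ s => s.IsConn) c x)))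
          * PowerSeries.coeff w' (series (fun _ _ => True) c x) else 0 := by
  have h1 : ∀ u ∈ Finset.range (w + 1), ∀ w' ∈ Finset.range (w + 1), (if (n + 1) * u + w' = w then
        ((u : k) • plethNat (n + 1) (PowerSeries.coeff u (series (fun _ s => s.IsConn) c x)))
          * PowerSeries.coeff w' (series (fun _ _ => True) c x) else 0)
      = ∑ a ∈ Finset.range (4 * w + 1), ∑ b ∈ Finset.range (4 * w + 1),
        ((a.factorial * b.factorial : ℕ) : k)⁻¹ • ∑ s₀ ∈ graphsLE a w, ∑ s₂ ∈ graphsLE b w,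
          if s₀.wt = u ∧ s₂.wt = w' ∧ s₀.IsConn ∧ (n + 1) * s₀.wt + s₂.wt = w then
            (s₀.wt : k) • (plethNat (n + 1) (s₀.weight c x) * s₂.weight c x) else 0 := by
    intro u hu w' hw'
    rw [Finset.mem_range] at hu hw'
    by_cases hw : (n + 1) * u + w' = w
    swap
    · rw [if_neg hw, eq_comm]
      refine Finset.sum_eq_zero fun a _ => Finset.sum_eq_zero fun b _ => ?_
      rw [Finset.sum_eq_zero, smul_zero]
      intro s₀ _
      refine Finset.sum_eq_zero fun s₂ _ => if_neg ?_
      rintro ⟨rfl, rfl, -, h⟩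
      exact hw h
    rw [if_pos hw, coeff_series _ _ _ (Nat.lt_succ_iff.1 hu), coeff_series _ _ _ (Nat.lt_succ_iff.1 hw'), map_sum,
      Finset.smul_sum, Finset.sum_mul_sum]
    refine Finset.sum_congr rfl fun a _ => Finset.sum_congr rfl fun b _ => ?_
    rw [plethPoly_smul, map_sum, smul_comm, smul_mul_smul_comm, Finset.smul_sum, Finset.sum_mul_sum, Nat.cast_mul,
      mul_inv]
    congr 1
    refine Finset.sum_congr rfl fun s₀ _ => Finset.sum_congr rfl fun s₂ _ => ?_
    by_cases h0 : s₀.wt = u ∧ s₀.IsConn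
    · by_cases h2 : s₂.wt = w'
      · rw [if_pos h0, if_pos ⟨h2, trivial⟩, if_pos ⟨h0.1, h2, h0.2, by rw [h0.1, h2, hw]⟩, smul_mul_assoc, h0.1]
      · simp [h2]
    · rw [if_neg h0, map_zero, smul_zero, zero_mul]
      exact (if_neg fun h => h0 ⟨h.1, h.2.2.1⟩).symm
  rw [Finset.sum_congr rfl fun u hu => Finset.sum_congr rfl fun w' hw' => h1 u hu w' hw']
  symm
  rw [Finset.sum_congr rfl fun u _ => Finset.sum_comm, Finset.sum_comm]
  refine Finset.sum_congr rfl fun a _ => ?_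
  rw [Finset.sum_congr rfl fun u _ => Finset.sum_comm, Finset.sum_comm]
  refine Finset.sum_congr rfl fun b _ => ?_
  simp_rw [← Finset.smul_sum]
  congr 1
  rw [Finset.sum_congr rfl fun u _ => Finset.sum_comm, Finset.sum_comm, pairTerm]
  refine Finset.sum_congr rfl fun s₀ hs₀ => ?_
  rw [Finset.sum_congr rfl fun u _ => Finset.sum_comm, Finset.sum_comm]
  refine Finset.sum_congr rfl fun s₂ hs₂ => ?_
  rw [Finset.sum_eq_single s₀.wt, Finset.sum_eq_single s₂.wt]
  · by_cases h : s₀.IsConn ∧ (n + 1) * s₀.wt + s₂.wt = w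
    · rw [if_pos ⟨rfl, rfl, h⟩]
      simp only [if_pos h]
      rw [← Finset.sum_smul, FlagSpace.wt, Nat.cast_sum]
    · rw [if_neg fun h' => h h'.2.2]
      simp only [if_neg h, Finset.sum_const_zero]
  · intro w' _ hne
    exact if_neg fun h => hne h.2.1.symm
  · intro h
    exact absurd (Finset.mem_range.2 (Nat.lt_succ_of_le (mem_graphsLE.1 hs₂))) h
  · intro u _ hne
    exact Finset.sum_eq_zero fun w' _ => if_neg fun h => hne h.1.symm
  · intro h
    exact absurd (Finset.mem_range.2 (Nat.lt_succ_of_le (mem_graphsLE.1 hs₀))) h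

theorem coeff_zero_series : PowerSeries.coeff 0 (series (fun _ _ => True) c x) = 1 := by
  classical
  let s : ZGraph (Fin 0) :=
    { r := id, g := fun _ => 0, π := 1, ι := id, r_r := fun x => x.elim0, g_flag := fun x => x.elim0,
      r_π := fun x => x.elim0, g_π := fun x => x.elim0, stable := fun x => x.elim0,
      pairing := ⟨fun x => x.elim0, fun x => x.elim0, fun x => x.elim0⟩ }
  have hu : ∀ t : ZGraph (Fin 0), t = s := fun t =>
    ZGraph.ext (Subsingleton.elim _ _) (Subsingleton.elim _ _) (Subsingleton.elim _ _) (Subsingleton.elim _ _)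
  have hw : s.wt = 0 := Finset.sum_eq_zero fun x _ => x.elim0
  have hW : s.weight c x = 1 := by
    have h1 : ∀ (R : Setoid (Fin 0)) (u : Fin 0 → LambdaPoly k), classProd R u = 1 := fun R u =>
      finprod_of_isEmpty _
    rw [ZGraph.weight, FlagSpace.vertProd, h1, h1, one_mul]
  have hG : graphsLE 0 0 = {s} := by
    ext t
    simp [mem_graphsLE, hu t, hw]
  rw [series, PowerSeries.coeff_mk, mul_zero, zero_add, Finset.sum_range_one, hG, Finset.sum_singleton,
    if_pos ⟨hw, trivial⟩, hW]
  simp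

/-- The exponential formula: all graphs are counted by the plethystic exponential of the series that counts
connected graphs. -/
theorem series_eq_Exp [CharZero k] (hc : IsClassFunction c) :
    series (fun _ _ => True) c x = Exp (series (fun _ s => s.IsConn) c x) := by
  -- In the recursion of `eq_Exp` the divisor `d = n + 1` is the number of components in the orbit
  -- of the marked cell, and `p.1 / d` is the weight of one of them.
  refine eq_Exp (coeff_zero_series c x) fun w => ?_
  rw [smul_coeff_series c x hc, Finset.sum_congr rfl fun n _ => sum_pairTerm c x w n]
  simp_rw [Finset.sum_mul]
  exact (sum_antidiagonal_divisors w (fun d u w' =>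
    ((u : k) • plethNat d (PowerSeries.coeff u (series (fun _ s => s.IsConn) c x)))
      * PowerSeries.coeff w' (series (fun _ _ => True) c x)) fun d w' => by simp).symm

end Exponential

end ModularOperads

/-! ### The action of `exp(-Δ)` on generating series of graphs -/

namespace ModularOperads

open Equiv.Perm

variable {k : Type u} [Field k]

theorem classProd_eq_zero {X M : Type*} [CommMonoidWithZero M] [Finite X] {R : Setoid X} {u : X → M}
    (hu : ∀ y y', R y y' → u y = u y') {y : X} (hy : u y = 0) : classProd R u = 0 := by
  classical
  have := Fintype.ofFinite (Quotient R)
  rw [classProd, finprod_eq_prod_of_fintype]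
  refine Finset.prod_eq_zero (Finset.mem_univ (Quotient.mk R y)) ?_
  rw [hu _ _ (Quotient.mk_out (s := R) y), hy]

/-- A pairing other than the identity joins some flag and thus has a factor `x = 0`. -/
theorem pairSum_zero {X : Type*} [Fintype X] {π : Equiv.Perm X} {F : Set X} (hF : ∀ y, π y ∈ F ↔ y ∈ F) :
    pairSum (0 : k) π F = cycleProd k π F := by
  classical
  have hid : IsPairing π F id := ⟨fun _ => rfl, fun _ => rfl, fun _ _ => rfl⟩
  rw [pairSum, Finset.sum_eq_single id]
  · refine (classProd_comp (R := SameCycle.setoid π) id (fun x x' => ?_) (fun y => ⟨y, Setoid.refl' _ y⟩)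
      (flagWeight_of_glue hF hid)).trans (classProd_congr fun y => ?_)
    · rw [hid.glue_iff]
      exact or_self_iff.symm
    · simp only [flagWeight, id, if_true]
  · intro ι hι hne
    rw [Finset.mem_filter] at hι
    obtain ⟨y, hy⟩ := Function.ne_iff.1 hne
    have hyF : y ∈ F := by
      by_contra h
      exact hy (hι.2.fix y h)
    refine classProd_eq_zero (flagWeight_of_glue hF hι.2) (y := y) ?_
    rw [flagWeight, if_pos hyF, if_neg (show ¬ ι y = y from hy), zero_smul]
  · intro h
    exact absurd (Finset.mem_filter.2 ⟨Finset.mem_univ _, hid⟩) h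

theorem expDelta_pairSum_zero [CharZero k] {X : Type*} [Fintype X] {π : Equiv.Perm X} {F : Set X}
    (hF : ∀ y, π y ∈ F ↔ y ∈ F) : expDelta (pairSum (0 : k) π F) = pairSum (-1) π F := by
  rw [pairSum_zero hF, expDelta_cycleProd F hF]

namespace ZGraph

variable (c : ∀ (_ : ℕ) (I : Type) [Finite I], Equiv.Perm I → k)

/-- The vertex factors contain no `pₙ`, so the operator `exp(-Δ)`, linear over Laurent polynomials
in `ħ`, passes them by. -/
theorem exists_vertProd_eq_C {X : Type} [Finite X] (s : FlagSpace X) :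
    ∃ a, s.vertProd c = MvPolynomial.C a := by
  classical
  have h : ∀ v, ∃ a, s.vertWeight c v = MvPolynomial.C a := by
    intro v
    unfold FlagSpace.vertWeight
    split_ifs
    · refine ⟨c (s.g v) (s.Star v) (s.starPerm v) • LaurentPolynomial.T (period s.π v * ((s.g v : ℤ) - 1)), ?_⟩
      rw [hbar]
      change _ = MvPolynomial.monomial 0 _
      rw [← MvPolynomial.smul_monomial]
      rfl
    · exact ⟨1, (map_one _).symm⟩
  choose a ha using h
  refine ⟨classProd (SameCycle.setoid s.π) a, ?_⟩
  have := map_classProd (R := SameCycle.setoid s.π) (MvPolynomial.C : LaurentPolynomial k →+* LambdaPoly k).toMonoidHom a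
  exact (classProd_congr ha).trans this.symm

open Classical in
-- A graph is a flag space with a pairing of its flags. The weight and the vertex factors depend on
-- the flag space only, so the sum over pairings can be carried out first.
theorem sum_weight (x : k) (N w : ℕ) :
    ∑ s ∈ graphsLE N w, (if s.wt = w ∧ True then s.weight c x else 0)
      = ∑ f ∈ (graphsLE N w).image ZGraph.toFlagSpace,
          if f.wt = w then f.vertProd c * pairSum x f.π f.flags else 0 := by
  rw [← Finset.sum_fiberwise_of_maps_to (g := ZGraph.toFlagSpace)
    (fun s hs => Finset.mem_image_of_mem ZGraph.toFlagSpace hs)]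
  refine Finset.sum_congr rfl fun f hf => ?_
  by_cases hw : f.wt = w
  swap
  · rw [if_neg hw]
    refine Finset.sum_eq_zero fun s hs => if_neg ?_
    rw [Finset.mem_filter] at hs
    rw [hs.2]
    exact fun h => hw h.1
  rw [if_pos hw, pairSum, Finset.mul_sum]
  refine Finset.sum_bij' (fun s _ => s.ι)
    (fun ι hι => { f with ι := ι, pairing := by simpa using hι }) ?_ ?_ ?_ ?_ ?_
  · intro s hs
    rw [Finset.mem_filter] at hs
    simp only [Finset.mem_filter, Finset.mem_univ, true_and]
    rw [← hs.2]
    exact s.pairing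
  · intro ι hι
    rw [Finset.mem_filter, mem_graphsLE]
    exact ⟨hw.le, rfl⟩
  · rintro s hs
    rw [Finset.mem_filter] at hs
    obtain ⟨-, rfl⟩ := hs
    rfl
  · intro ι hι
    rfl
  · intro s hs
    rw [Finset.mem_filter] at hs
    obtain ⟨-, rfl⟩ := hs
    rw [if_pos ⟨hw, trivial⟩]
    rfl

/-- For every flag space with its automorphism, Wick's theorem replaces the product of the `p_l`
over cycles of flags by the sum over all pairings with `x = -1`. -/
theorem expNegDelta_series [CharZero k] :
    expNegDelta (series (fun _ _ => True) c 0) = series (fun _ _ => True) c (-1) := by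
  classical
  ext1 w
  rw [coeff_expNegDelta, series, series, PowerSeries.coeff_mk, PowerSeries.coeff_mk, map_sum]
  refine Finset.sum_congr rfl fun N _ => ?_
  have hsmul : ∀ (a : k) (f : LambdaPoly k), expDelta (a • f) = a • expDelta f := fun a f => by
    rw [← algebraMap_smul (LaurentPolynomial k) a f, map_smul, algebraMap_smul]
  rw [hsmul]
  congr 1
  have h := sum_weight c (0 : k) N w
  have h' := sum_weight c (-1 : k) N w
  refine Eq.trans (congrArg expDelta (Eq.trans (by congr!) h)) (Eq.trans ?_ (h'.symm.trans (by congr!)))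
  rw [map_sum]
  refine Finset.sum_congr rfl fun f _ => ?_
  split_ifs
  · obtain ⟨a, ha⟩ := exists_vertProd_eq_C c f
    rw [ha, ← MvPolynomial.smul_eq_C_mul, ← MvPolynomial.smul_eq_C_mul, map_smul, expDelta_pairSum_zero f.π_mem_flags]
  · exact map_zero _

end ZGraph

end ModularOperads

namespace ModularOperads

open Equiv.Perm

/-! ### Products over cycles and the sign of a permutation -/

section CycleProducts

variable {X : Type*} [Fintype X] {M : Type*} [CommMonoid M]

theorem prod_eq_classProd {π : Equiv.Perm X} {u : X → M} (hu : ∀ y y', SameCycle π y y' → u y = u y') :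
    ∏ y, u y = classProd (SameCycle.setoid π) (fun y => u y ^ period π y) := by
  classical
  have := Fintype.ofFinite (Quotient (SameCycle.setoid π))
  rw [classProd, finprod_eq_prod_of_fintype,
    ← Finset.prod_fiberwise_of_maps_to (g := Quotient.mk (SameCycle.setoid π)) (t := Finset.univ)
      (fun _ _ => Finset.mem_univ _)]
  refine Finset.prod_congr rfl fun q _ => ?_
  have h : Finset.univ.filter (fun y => Quotient.mk (SameCycle.setoid π) y = q)
      = Finset.univ.filter fun y => SameCycle π q.out y := by
    ext y
    rw [Finset.mem_filter, Finset.mem_filter, and_congr_right_iff]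
    intro _
    conv_lhs => rw [← q.out_eq]
    exact Quotient.eq.trans (sameCycle_comm (f := π))
  rw [h, ← card_cycle π q.out, Finset.prod_eq_pow_card]
  intro y hy
  exact (hu _ _ (Finset.mem_filter.1 hy).2).symm

/-- The parts of the partition are the lengths of the nontrivial cycles, together with a part `1`
for each fixed point; the two kinds of classes are matched separately. -/
theorem prod_partition [DecidableEq X] (π : Equiv.Perm X) (F : ℕ → M) :
    (π.partition.parts.map F).prod = classProd (SameCycle.setoid π) (fun y => F (period π y)) := by
  classical
  have := Fintype.ofFinite (Quotient (SameCycle.setoid π))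
  have hout : ∀ x, SameCycle π (Quotient.mk (SameCycle.setoid π) x).out x :=
    fun x => Quotient.mk_out (s := SameCycle.setoid π) x
  have hfix : ∀ {x y}, SameCycle π x y → (π x = x ↔ π y = y) := by
    intro x y h
    have h1 : ∀ z, π z = z ↔ period π z = 1 := fun z => by
      rw [← Nat.dvd_one, ← pow_apply_eq_self_iff, pow_one]
    rw [h1, h1, period_sameCycle h]
  rw [classProd, finprod_eq_prod_of_fintype, parts_partition, Multiset.map_add, Multiset.prod_add,
    ← Finset.prod_filter_mul_prod_filter_not Finset.univ
      (fun q : Quotient (SameCycle.setoid π) => π q.out ≠ q.out)]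
  congr 1
  · rw [cycleType_def, Multiset.map_map]
    change ∏ f ∈ π.cycleFactorsFinset, F f.support.card = _
    symm
    refine Finset.prod_bij (fun q _ => cycleOf π q.out) ?_ ?_ ?_ ?_
    · intro q hq
      rw [cycleOf_mem_cycleFactorsFinset_iff, mem_support]
      exact (Finset.mem_filter.1 hq).2
    · intro q hq q' hq' h
      have h1 : q.out ∈ (cycleOf π q.out).support :=
        mem_support_cycleOf_iff.2 ⟨SameCycle.rfl, mem_support.2 (Finset.mem_filter.1 hq).2⟩
      rw [h, mem_support_cycleOf_iff] at h1
      rw [← q.out_eq, ← q'.out_eq]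
      exact Quotient.sound (s := SameCycle.setoid π) h1.1.symm
    · intro f hf
      obtain ⟨x, hx⟩ := ((mem_cycleFactorsFinset_iff.1 hf).1).nonempty_support
      have hfx : f = cycleOf π x := cycle_is_cycleOf hx hf
      refine ⟨Quotient.mk _ x, ?_, ?_⟩
      · rw [Finset.mem_filter]
        refine ⟨Finset.mem_univ _, ?_⟩
        rw [Ne, hfix (hout x)]
        exact mem_support.1 (mem_cycleFactorsFinset_support_le hf hx)
      · rw [hfx]
        exact (hout x).cycleOf_eq
    · intro q hq
      congr 1
      rw [← card_cycle π q.out]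
      congr 1
      ext y
      rw [Finset.mem_filter, mem_support_cycleOf_iff]
      exact ⟨fun h => ⟨h.2, mem_support.2 (Finset.mem_filter.1 hq).2⟩, fun h => ⟨Finset.mem_univ _, h.1⟩⟩
  · rw [Multiset.map_replicate, Multiset.prod_replicate]
    have h1 : ∀ q ∈ Finset.univ.filter (fun q : Quotient (SameCycle.setoid π) => ¬ π q.out ≠ q.out),
        F (period π q.out) = F 1 := by
      intro q hq
      congr 1
      rw [← Nat.dvd_one, ← pow_apply_eq_self_iff, pow_one]
      exact not_not.1 (Finset.mem_filter.1 hq).2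
    rw [Finset.prod_congr rfl h1, Finset.prod_const]
    congr 1
    rw [← Finset.card_compl]
    symm
    refine Finset.card_bij (fun q _ => q.out) ?_ ?_ ?_
    · intro q hq
      rw [Finset.mem_compl, mem_support]
      exact (Finset.mem_filter.1 hq).2
    · intro q _ q' _ h
      rw [← q.out_eq, ← q'.out_eq, h]
    · intro x hx
      rw [Finset.mem_compl, mem_support, not_not] at hx
      have h2 : (Quotient.mk (SameCycle.setoid π) x).out = x := by
        have h3 := (hfix (hout x)).2 hx
        obtain ⟨n, hn⟩ := (hout x).exists_nat_pow_eq
        rw [(pow_apply_eq_self_iff π _ n).2] at hn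
        · exact hn
        · refine Dvd.dvd.trans ?_ (one_dvd n)
          rw [← pow_apply_eq_self_iff, pow_one, h3]
      exact ⟨Quotient.mk _ x, by rw [Finset.mem_filter, h2]; exact ⟨Finset.mem_univ _, not_not.2 hx⟩, h2⟩

/-- A cycle of length `l` has the sign `-(-1) ^ l`; for fixed points this is `1`. -/
theorem classProd_eq_sign [DecidableEq X] (π : Equiv.Perm X) :
    classProd (SameCycle.setoid π) (fun y => -(-1 : ℤˣ) ^ period π y) = sign π := by
  rw [← prod_partition π fun n => -(-1 : ℤˣ) ^ n, parts_partition, Multiset.map_add, Multiset.prod_add,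
    ← sign_of_cycleType', Multiset.map_replicate]
  simp

end CycleProducts

/-! ### Inversions and signs -/

section Inversions

variable {α β γ : Type*} [Fintype α] [LinearOrder α] [LinearOrder β]

/-- The parity of the number of inversions of a map between ordered sets. -/
def inversionSign (f : α → β) : ℤˣ := (-1) ^ Finset.card {p : α × α | p.1 < p.2 ∧ f p.2 < f p.1}

theorem inversionSign_fin {n : ℕ} (σ : Equiv.Perm (Fin n)) : inversionSign σ = sign σ := by
  rw [sign_eq_prod_prod_Ioi, Finset.prod_sigma', inversionSign]
  have h : ∀ x ∈ (Finset.univ : Finset (Fin n)).sigma Finset.Ioi,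
      (if σ x.1 < σ x.2 then (1 : ℤˣ) else -1) = if σ x.2 < σ x.1 then -1 else 1 := by
    rintro ⟨i, j⟩ hx
    rw [Finset.mem_sigma, Finset.mem_Ioi] at hx
    have hne : σ i ≠ σ j := fun h => hx.2.ne (σ.injective h)
    rcases lt_or_gt_of_ne hne with h | h
    · rw [if_pos h, if_neg (lt_asymm h)]
    · rw [if_pos h, if_neg (lt_asymm h)]
  rw [Finset.prod_congr rfl h, ← Finset.prod_filter, Finset.prod_const]
  congr 1
  refine Finset.card_bij (fun p _ => ⟨p.1, p.2⟩) ?_ ?_ ?_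
  · intro p hp
    simpa using hp
  · rintro ⟨a, b⟩ _ ⟨a', b'⟩ _ h
    simpa using h
  · rintro ⟨a, b⟩ h
    exact ⟨(a, b), by simpa using h, rfl⟩

theorem inversionSign_order {α' β' : Type*} [Fintype α'] [LinearOrder α'] [LinearOrder β']
    (a : α ≃o α') (b : β ≃o β') {f : α → β} {f' : α' → β'} (h : ∀ x, f' (a x) = b (f x)) :
    inversionSign f = inversionSign f' := by
  rw [inversionSign, inversionSign]
  congr 1
  refine Finset.card_equiv (a.toEquiv.prodCongr a.toEquiv) fun p => ?_
  simp [h]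

theorem exists_perm_inversionSign (f : α → β) (hf : Function.Bijective f) {n : ℕ}
    (a : α ≃o Fin n) (b : β ≃o Fin n) :
    inversionSign f = sign ((a.symm.toEquiv.trans (Equiv.ofBijective f hf)).trans b.toEquiv) := by
  rw [← inversionSign_fin]
  exact inversionSign_order a b fun x => by simp

/-- Order isomorphisms with `Fin n` turn all maps into permutations of `Fin n`, where the parity of
inversions is the sign homomorphism. -/
theorem inversionSign_comp [Fintype β] [Fintype γ] [LinearOrder γ] {f : α → β} {g : β → γ} (hf : Function.Bijective f) (hg : Function.Bijective g) :
    inversionSign (g ∘ f) = inversionSign g * inversionSign f := by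
  have hβ : Fintype.card β = Fintype.card α := (Fintype.card_of_bijective hf).symm
  have hγ : Fintype.card γ = Fintype.card α := (Fintype.card_of_bijective hg).symm.trans hβ
  let a : α ≃o Fin (Fintype.card α) := (Fintype.orderIsoFinOfCardEq α rfl).symm
  let b : β ≃o Fin (Fintype.card α) := (Fintype.orderIsoFinOfCardEq β hβ).symm
  let c : γ ≃o Fin (Fintype.card α) := (Fintype.orderIsoFinOfCardEq γ hγ).symm
  rw [exists_perm_inversionSign f hf a b, exists_perm_inversionSign g hg b c,
    exists_perm_inversionSign (g ∘ f) (hg.comp hf) a c, ← Equiv.Perm.sign_mul]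
  congr 1
  ext x
  simp

theorem inversionSign_perm (σ : Equiv.Perm α) : inversionSign σ = sign σ := by
  classical
  let a : α ≃o Fin (Fintype.card α) := (Fintype.orderIsoFinOfCardEq α rfl).symm
  rw [exists_perm_inversionSign σ σ.bijective a a]
  exact sign_bij (fun x _ => a.symm x) (fun x _ _ => by simp) (fun x y _ _ h => a.symm.injective h)
    fun y hy => ⟨a y, by simpa using hy, by simp⟩

/-- The inversions among the odd points give the sign of `σ` restricted to them. A cycle of `l` odd
points has sign `-(-1) ^ l`, and the product contributes `(-1) ^ l`, so `-1` remains for each cycle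
whatever its length. This turns the Koszul sign in a supertrace into one sign per cycle. -/
theorem inversionSign_mul_prod (σ : Equiv.Perm α) {S : α → Bool} (hS : ∀ x, S (σ x) = S x) :
    (-1 : ℤˣ) ^ Finset.card {p : α × α | p.1 < p.2 ∧ σ p.2 < σ p.1 ∧ S p.1 ∧ S p.2}
      * ∏ x, (if S x then -1 else 1)
      = classProd (SameCycle.setoid σ) (fun x => if S x then (-1 : ℤˣ) else 1) := by
  classical
  have hc : ∀ x y, SameCycle σ x y → S x = S y := by
    intro x y h
    obtain ⟨n, rfl⟩ := h.exists_nat_pow_eq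
    induction n with
    | zero => rfl
    | succ n ih => rw [pow_succ', Equiv.Perm.mul_apply, hS]; exact ih (sameCycle_pow_right.2 SameCycle.rfl)
  let τ : Equiv.Perm {x // S x = true} := σ.subtypePerm fun x => by rw [hS]
  let τ' : Equiv.Perm {x // ¬ S x = true} := σ.subtypePerm fun x => by rw [hS]
  have hτ : ∀ x, (τ x).1 = σ x.1 := fun _ => rfl
  have h1 : Finset.card {p : α × α | p.1 < p.2 ∧ σ p.2 < σ p.1 ∧ S p.1 ∧ S p.2}
      = Finset.card {p : {x // S x = true} × {x // S x = true} | p.1 < p.2 ∧ τ p.2 < τ p.1} := by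
    symm
    refine Finset.card_bij (fun p _ => (p.1.1, p.2.1)) ?_ ?_ ?_
    · rintro ⟨x, y⟩ h
      simp only [Finset.mem_filter, Finset.mem_univ, true_and] at h ⊢
      exact ⟨h.1, h.2, x.2, y.2⟩
    · rintro ⟨x, y⟩ _ ⟨x', y'⟩ _ h
      simp only [Prod.mk.injEq] at h
      exact Prod.ext (Subtype.ext h.1) (Subtype.ext h.2)
    · rintro ⟨x, y⟩ h
      simp only [Finset.mem_filter, Finset.mem_univ, true_and] at h
      exact ⟨(⟨x, h.2.2.1⟩, ⟨y, h.2.2.2⟩), by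
        simp only [Finset.mem_filter, Finset.mem_univ, true_and]; exact ⟨h.1, h.2.1⟩, rfl⟩
  have h2 : ∏ x, (if S x then (-1 : ℤˣ) else 1) = ∏ _x : {x // S x = true}, (-1 : ℤˣ) := by
    rw [← Finset.prod_filter]
    exact Finset.prod_subtype _ (fun x => by simp) _
  have hsc : ∀ x y : {x // S x = true}, SameCycle τ x y ↔ SameCycle σ x.1 y.1 :=
    fun x y => sameCycle_subtypePerm
  have hsc' : ∀ x y : {x // ¬ S x = true}, SameCycle τ' x y ↔ SameCycle σ x.1 y.1 :=
    fun x y => sameCycle_subtypePerm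
  have h3 := inversionSign_perm τ
  rw [inversionSign] at h3
  rw [h1, h3, h2, ← classProd_eq_sign, prod_eq_classProd (π := τ) (fun _ _ _ => rfl), ← classProd_mul,
    classProd_sum (R := SameCycle.setoid τ) (S := SameCycle.setoid τ') Subtype.val Subtype.val hsc hsc'
      (fun x y h => y.2 ((hc _ _ h).symm.trans x.2)) (fun z => ?_) (fun z z' h => by rw [hc z z' h])]
  · have h4 : classProd (SameCycle.setoid τ') (fun y => if S y.1 then (-1 : ℤˣ) else 1) = 1 :=
      (classProd_congr fun y => if_neg y.2).trans classProd_one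
    rw [h4, mul_one]
    refine classProd_congr fun x => ?_
    rw [if_pos x.2, neg_mul, ← mul_pow]
    simp
  · by_cases hz : S z = true
    · exact Or.inl ⟨⟨z, hz⟩, SameCycle.rfl⟩
    · exact Or.inr ⟨⟨z, hz⟩, SameCycle.rfl⟩

end Inversions

end ModularOperads

/-! ### Alternating characters -/

namespace ModularOperads

open Equiv.Perm

theorem cycleMonomial_eq {k : Type u} [Field k] {n : ℕ} (σ : Equiv.Perm (Fin n)) :
    cycleMonomial σ = classProd (SameCycle.setoid σ) (cycleVar k σ) :=
  prod_partition σ fun a => (MvPolynomial.X a.toPNat' : LambdaPoly k)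

namespace StableSModule

variable {k : Type u} [Field k] (A : StableSModule.{u, w} k)

/-- The alternating sum of the traces of the action of a permutation. -/
noncomputable def character (g : ℕ) (I : Type) [Finite I] (σ : Equiv.Perm I) : k :=
  LinearMap.trace k (A.tot g I) (A.totSign g I ∘ₗ A.totMap σ)

theorem totMap_refl (g : ℕ) (I : Type) [Finite I] : A.totMap (g := g) (Equiv.refl I) = LinearMap.id :=
  A.tot_ext fun i x => by rw [totMap_incl, A.map_refl, LinearMap.id_apply]

theorem totMap_trans (g : ℕ) {I J K : Type} [Finite I] [Finite J] [Finite K] (e : I ≃ J) (f : J ≃ K) :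
    A.totMap (g := g) (e.trans f) = A.totMap f ∘ₗ A.totMap e :=
  A.tot_ext fun i x => by simp only [LinearMap.comp_apply, totMap_incl, A.map_trans]

theorem totMap_totSign (g : ℕ) {I J : Type} [Finite I] [Finite J] (e : I ≃ J) :
    A.totMap e ∘ₗ A.totSign g I = A.totSign g J ∘ₗ A.totMap e :=
  A.tot_ext fun i x => by
    simp only [LinearMap.comp_apply, totMap_incl, totSign_incl]
    split_ifs <;> simp [totMap_incl]

theorem isClassFunction_character : IsClassFunction A.character := by
  intro g I J _ _ e σ τ h
  have he : ∀ {I J : Type} [Finite I] [Finite J] (e : I ≃ J), A.totMap (g := g) e.symm ∘ₗ A.totMap e = LinearMap.id := by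
    intro I J _ _ e
    rw [← totMap_trans, Equiv.self_trans_symm, totMap_refl]
  let E : A.tot g I ≃ₗ[k] A.tot g J :=
    LinearEquiv.ofLinearMap (A.totMap e) (A.totMap e.symm) (he e.symm) (he e)
  rw [character, character, ← LinearMap.trace_conj' _ E, LinearEquiv.conj_apply]
  congr 1
  have h1 : A.totMap (g := g) τ = A.totMap e ∘ₗ A.totMap σ ∘ₗ A.totMap e.symm := by
    rw [← totMap_trans, ← totMap_trans]
    congr 1
    ext x
    simp [h]
  change A.totMap e ∘ₗ (A.totSign g I ∘ₗ A.totMap σ) ∘ₗ A.totMap e.symm = _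
  rw [h1, ← LinearMap.comp_assoc, ← LinearMap.comp_assoc, totMap_totSign]
  rfl

/-- The component of degree `i`. -/
noncomputable def totComp (g : ℕ) (I : Type) [Finite I] (i : ℤ) : A.tot g I →ₗ[k] A.obj g I i :=
  DirectSum.component k ℤ (A.obj g I) i

theorem totComp_incl_self (g : ℕ) (I : Type) [Finite I] (i : ℤ) (x : A.obj g I i) :
    A.totComp g I i (A.incl g I i x) = x :=
  DirectSum.component.lof_self k i x

theorem totComp_incl_ne (g : ℕ) (I : Type) [Finite I] {i j : ℤ} (h : i ≠ j) (x : A.obj g I i) :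
    A.totComp g I j (A.incl g I i x) = 0 := by
  have := DirectSum.component.of (R := k) (ι := ℤ) (M := A.obj g I) j i x
  rw [dif_neg h] at this
  exact this

theorem incl_injective (g : ℕ) (I : Type) [Finite I] (i : ℤ) : Function.Injective (A.incl g I i) :=
  Function.LeftInverse.injective (A.totComp_incl_self g I i)

variable (g : ℕ) (I : Type) [Finite I]

/-- The projection to the component of degree `i`. -/
noncomputable def totProj (i : ℤ) : A.tot g I →ₗ[k] A.tot g I := A.incl g I i ∘ₗ A.totComp g I i

theorem totProj_incl_self (i : ℤ) (x : A.obj g I i) : A.totProj g I i (A.incl g I i x) = A.incl g I i x := by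
  rw [totProj, LinearMap.comp_apply, totComp_incl_self]

theorem totProj_incl_ne {i j : ℤ} (h : i ≠ j) (x : A.obj g I i) : A.totProj g I j (A.incl g I i x) = 0 := by
  rw [totProj, LinearMap.comp_apply, totComp_incl_ne _ _ _ h, map_zero]

variable [Module.Finite k (A.tot g I)]

theorem finite_obj (i : ℤ) : Module.Finite k (A.obj g I i) :=
  Module.Finite.of_injective (A.incl g I i) (A.incl_injective g I i)

theorem exists_degrees : ∃ D : Finset ℤ, ∀ i, i ∉ D → Subsingleton (A.obj g I i) := by
  classical
  obtain ⟨S, hS⟩ := (Module.Finite.fg_top : (⊤ : Submodule k (A.tot g I)).FG)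
  let supp : A.tot g I → Finset ℤ := fun x => DFinsupp.support (x : DirectSum ℤ (A.obj g I))
  refine ⟨S.biUnion supp, fun i hi => ?_⟩
  have h0 : A.totComp g I i = 0 := by
    refine LinearMap.ext_on hS fun x hx => ?_
    by_contra hne
    exact hi (Finset.mem_biUnion.2 ⟨x, hx, DFinsupp.mem_support_iff.2 hne⟩)
  refine subsingleton_of_forall_eq 0 fun x => ?_
  rw [← A.totComp_incl_self g I i x, h0, LinearMap.zero_apply]

/-- The degrees of the non-trivial components. -/
noncomputable def degrees : Finset ℤ := (A.exists_degrees g I).choose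

theorem subsingleton_of_notMem {i : ℤ} (h : i ∉ A.degrees g I) : Subsingleton (A.obj g I i) :=
  (A.exists_degrees g I).choose_spec i h

theorem sum_totProj : ∑ i ∈ A.degrees g I, A.totProj g I i = LinearMap.id := by
  refine A.tot_ext fun j x => ?_
  rw [LinearMap.sum_apply, LinearMap.id_apply]
  by_cases hj : j ∈ A.degrees g I
  · rw [Finset.sum_eq_single j (fun i _ hi => A.totProj_incl_ne g I hi.symm x) (fun h => absurd hj h),
      totProj_incl_self]
  · have := A.subsingleton_of_notMem g I hj
    rw [Subsingleton.elim x 0]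
    simp

theorem totSign_eq : A.totSign g I = ∑ i ∈ A.degrees g I, (-1 : k) ^ i • A.totProj g I i := by
  refine A.tot_ext fun j x => ?_
  rw [LinearMap.sum_apply, totSign_incl]
  have hsign : (if Odd j then -A.incl g I j x else A.incl g I j x) = (-1 : k) ^ j • A.incl g I j x := by
    split_ifs with h
    · rw [h.neg_one_zpow, neg_one_smul]
    · rw [(Int.not_odd_iff_even.1 h).neg_one_zpow, one_smul]
  rw [hsign]
  by_cases hj : j ∈ A.degrees g I
  · rw [Finset.sum_eq_single j (fun i _ hi => by
      rw [LinearMap.smul_apply, A.totProj_incl_ne g I hi.symm x, smul_zero]) (fun h => absurd hj h),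
      LinearMap.smul_apply, totProj_incl_self]
  · have := A.subsingleton_of_notMem g I hj
    rw [Subsingleton.elim x 0]
    simp

/-- The sign operator is a combination of projections to degrees, finitely many of which matter, and
the trace of a projection composed with `σ` is the trace on that component. -/
theorem character_eq (σ : Equiv.Perm I) :
    A.character g I σ = ∑ᶠ i : ℤ, (-1) ^ i * LinearMap.trace k (A.obj g I i) (A.map σ i) := by
  have hf := fun i => A.finite_obj g I i
  rw [finsum_eq_sum_of_support_subset (s := A.degrees g I), character, totSign_eq]
  · have h : (∑ i ∈ A.degrees g I, (-1 : k) ^ i • A.totProj g I i) ∘ₗ A.totMap σ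
        = ∑ i ∈ A.degrees g I, (-1 : k) ^ i • (A.totProj g I i ∘ₗ A.totMap σ) := by
      refine LinearMap.ext fun x => ?_
      simp only [LinearMap.comp_apply, LinearMap.sum_apply, LinearMap.smul_apply]
    rw [h, map_sum]
    refine Finset.sum_congr rfl fun i _ => ?_
    rw [map_smul, smul_eq_mul, totProj, LinearMap.comp_assoc, LinearMap.trace_comp_comm']
    congr 2
    refine LinearMap.ext fun x => ?_
    rw [LinearMap.comp_apply, LinearMap.comp_apply, totMap_incl, totComp_incl_self]
  · intro i hi
    by_contra h
    have := A.subsingleton_of_notMem g I h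
    refine hi ?_
    change (-1) ^ i * LinearMap.trace k (A.obj g I i) (A.map σ i) = 0
    rw [Subsingleton.elim (A.map σ i) 0, map_zero, mul_zero]

end StableSModule

/-! ### Corollas, and the characteristic as a series of connected graphs without edges -/

section Corolla

variable {X : Type} {n : ℕ} (e : Option (Fin n) ≃ X)

/-- The graph with the vertex `e none` and the flags `e (some i)`. -/
noncomputable def corollaSpace (g : ℕ) (σ : Equiv.Perm (Fin n)) (h : 3 ≤ 2 * g + n) : FlagSpace X where
  r _ := e none
  g x := (e.symm x).elim g fun _ => 0
  π := e.symm.trans ((Equiv.optionCongr σ).trans e)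
  r_r _ := rfl
  g_flag x hx := by
    obtain ⟨_ | i, rfl⟩ := e.surjective x
    · exact absurd rfl hx
    · simp
  r_π x := by simp
  g_π x := by
    obtain ⟨_ | i, rfl⟩ := e.surjective x <;> simp
  stable v hv := by
    subst hv
    refine h.trans_eq ?_
    rw [e.symm_apply_apply]
    congr 1
    refine (Nat.card_fin n).symm.trans (Nat.card_congr ?_)
    refine (Equiv.ofBijective (fun i => ⟨e (some i), rfl, by simp⟩) ⟨fun i j hij => ?_, ?_⟩)
    · simpa using congrArg Subtype.val hij
    · rintro ⟨x, -, hx⟩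
      obtain ⟨_ | i, rfl⟩ := e.surjective x
      · exact absurd rfl hx
      · exact ⟨i, rfl⟩

/-- A graph without edges and with a single vertex. -/
noncomputable def corolla (g : ℕ) (σ : Equiv.Perm (Fin n)) (h : 3 ≤ 2 * g + n) : ZGraph X where
  toFlagSpace := corollaSpace e g σ h
  ι := id
  pairing := ⟨fun _ => rfl, fun _ => rfl, fun _ _ => rfl⟩

variable {e} {g : ℕ} {σ : Equiv.Perm (Fin n)} {h : 3 ≤ 2 * g + n}

theorem corolla_isConn : (corolla e g σ h).IsConn :=
  ⟨⟨e none⟩, fun x y => (corolla e g σ h).conn.trans' ((corolla e g σ h).conn_r x)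
    ((corolla e g σ h).conn.symm' ((corolla e g σ h).conn_r y))⟩

theorem corolla_pow_none (m : ℕ) : ((corolla e g σ h).π ^ m) (e none) = e none := by
  induction m with
  | zero => rfl
  | succ m ih =>
    rw [pow_succ, Equiv.Perm.mul_apply]
    have : (corolla e g σ h).π (e none) = e none := by simp [corolla, corollaSpace]
    rw [this, ih]

theorem corolla_pow_some (m : ℕ) (i : Fin n) :
    ((corolla e g σ h).π ^ m) (e (some i)) = e (some ((σ ^ m) i)) := by
  induction m generalizing i with
  | zero => rfl
  | succ m ih =>
    rw [pow_succ, Equiv.Perm.mul_apply]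
    have : (corolla e g σ h).π (e (some i)) = e (some (σ i)) := by simp [corolla, corollaSpace]
    rw [this, ih, pow_succ, Equiv.Perm.mul_apply]

theorem corolla_sameCycle_some [Finite X] (i j : Fin n) :
    SameCycle (corolla e g σ h).π (e (some i)) (e (some j)) ↔ SameCycle σ i j := by
  constructor
  · intro hh
    obtain ⟨m, hm⟩ := hh.exists_nat_pow_eq
    rw [corolla_pow_some] at hm
    exact ⟨m, by rw [zpow_natCast]; simpa using hm⟩
  · intro hh
    obtain ⟨m, rfl⟩ := hh.exists_nat_pow_eq
    rw [← corolla_pow_some (e := e) (g := g) (h := h)]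
    exact sameCycle_pow_right.2 SameCycle.rfl

theorem corolla_not_sameCycle [Finite X] (i : Fin n) :
    ¬ SameCycle (corolla e g σ h).π (e none) (e (some i)) := by
  intro hh
  obtain ⟨m, hm⟩ := hh.exists_nat_pow_eq
  rw [corolla_pow_none] at hm
  simp at hm

theorem corolla_classProd {M : Type*} [CommMonoid M] [Finite X] {u : X → M}
    (hu : ∀ x y, SameCycle (corolla e g σ h).π x y → u x = u y) :
    classProd (SameCycle.setoid (corolla e g σ h).π) u
      = u (e none) * classProd (SameCycle.setoid σ) (fun i => u (e (some i))) := by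
  rw [classProd_sum (R := (⊤ : Setoid Unit)) (S := SameCycle.setoid σ) (fun _ => e none) (fun i => e (some i))
    (fun x y => ⟨fun _ => SameCycle.rfl, fun _ => trivial⟩) (fun i j => (corolla_sameCycle_some i j).symm)
    (fun _ i => corolla_not_sameCycle i) (fun z => ?_) hu]
  · congr 1
    rw [classProd]
    have : Unique (Quotient (⊤ : Setoid Unit)) := ⟨⟨Quotient.mk _ ()⟩, fun q => Quotient.inductionOn q fun _ => rfl⟩
    exact finprod_unique _
  · obtain ⟨_ | i, rfl⟩ := e.surjective z
    · exact Or.inl ⟨(), SameCycle.rfl⟩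
    · exact Or.inr ⟨i, SameCycle.rfl⟩

theorem corolla_starEquiv : Nonempty {f : (corolla e g σ h).Star (e none) ≃ Fin n //
    ∀ y, e (some (f y)) = y.1} := by
  refine ⟨⟨(Equiv.ofBijective (fun i => ⟨e (some i), rfl, by simp⟩) ⟨fun i j hij => ?_, ?_⟩).symm, fun y => ?_⟩⟩
  · simpa using congrArg Subtype.val hij
  · rintro ⟨x, -, hx⟩
    obtain ⟨_ | i, rfl⟩ := e.surjective x
    · exact absurd rfl hx
    · exact ⟨i, rfl⟩
  · have := Equiv.apply_symm_apply (Equiv.ofBijective (fun i => (⟨e (some i), rfl, by simp⟩ :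
      (corolla e g σ h).Star (e none))) ⟨fun i j hij => by simpa using congrArg Subtype.val hij, by
        rintro ⟨x, -, hx⟩
        obtain ⟨_ | i, rfl⟩ := e.surjective x
        · exact absurd rfl hx
        · exact ⟨i, rfl⟩⟩) y
    exact congrArg Subtype.val this

theorem corolla_wt [Fintype X] : (corolla e g σ h).wt = 2 * g + n - 2 := by
  rw [FlagSpace.wt, Finset.sum_eq_single (e none)]
  · obtain ⟨f, -⟩ := corolla_starEquiv (e := e) (σ := σ) (h := h)
    have h1 := (corolla e g σ h).vwt_add_two (x := e none) rfl
    rw [Nat.card_congr f, Nat.card_fin] at h1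
    have h2 : (corolla e g σ h).g (e none) = g := by simp [corolla, corollaSpace]
    rw [h2] at h1
    omega
  · intro x _ hx
    exact (corolla e g σ h).vwt_eq_zero fun hh => hx hh.symm
  · intro hh
    exact absurd (Finset.mem_univ _) hh

theorem corolla_weight {k : Type u} [Field k] [Finite X] {c : ∀ (_ : ℕ) (I : Type) [Finite I], Equiv.Perm I → k}
    (hc : IsClassFunction c) (x : k) :
    (corolla e g σ h).weight c x = hbar ((g : ℤ) - 1) * (c g (Fin n) σ • cycleMonomial σ) := by
  have hp : period (corolla e g σ h).π (e none) = 1 := by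
    rw [← Nat.dvd_one, ← pow_apply_eq_self_iff, corolla_pow_none]
  have hg : (corolla e g σ h).g (e none) = g := by simp [corolla, corollaSpace]
  have hglue : ∀ x y, glue (corolla e g σ h).π (corolla e g σ h).ι x y ↔ SameCycle (corolla e g σ h).π x y := by
    intro x y
    rw [(corolla e g σ h).pairing.glue_iff]
    exact or_self_iff
  have h1 : (corolla e g σ h).vertProd c = c g (Fin n) σ • hbar ((g : ℤ) - 1) := by
    rw [FlagSpace.vertProd, corolla_classProd (ZGraph.vertWeight_of_sameCycle _ hc)]
    have h2 : classProd (SameCycle.setoid σ) (fun i => (corolla e g σ h).vertWeight c (e (some i))) = 1 := by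
      refine (classProd_congr fun i => if_neg ?_).trans classProd_one
      change ¬ e none = e (some i)
      simp
    rw [h2, mul_one, FlagSpace.vertWeight, if_pos (show (corolla e g σ h).r (e none) = e none from rfl), hp, hg, Nat.cast_one, one_mul]
    congr 1
    obtain ⟨f, hf⟩ := corolla_starEquiv (e := e) (σ := σ) (h := h)
    refine hc _ _ _ f _ _ fun y => ?_
    have h3 := (corolla e g σ h).starPerm_val (e none) y
    rw [hp, ← hf y, corolla_pow_some, pow_one, ← hf] at h3
    simpa using h3
  have h2 : classProd (glue (corolla e g σ h).π (corolla e g σ h).ι) ((corolla e g σ h).legWeight x)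
      = cycleMonomial σ := by
    have hu := flagWeight_of_glue (x := x) (corolla e g σ h).π_mem_flags (corolla e g σ h).pairing
    rw [ZGraph.legWeight, classProd_setoid_congr (R' := SameCycle.setoid (corolla e g σ h).π) hu
      (fun y z hyz => hu y z ((hglue y z).2 hyz)) (fun y z _ => hglue y z),
      corolla_classProd (fun y z hyz => hu y z ((hglue y z).2 hyz)), cycleMonomial_eq]
    have h3 : flagWeight x (corolla e g σ h).π (corolla e g σ h).flags (corolla e g σ h).ι (e none) = 1 :=
      if_neg fun hh => hh rfl
    rw [h3, one_mul]
    refine classProd_congr fun i => ?_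
    have h4 : e (some i) ∈ (corolla e g σ h).flags := by
      change e none ≠ e (some i)
      simp
    rw [flagWeight, if_pos h4, if_pos (show (corolla e g σ h).ι (e (some i)) = e (some i) from rfl), cycleVar, cycleVar]
    congr 2
    refine period_eq_of_forall fun m => ?_
    rw [corolla_pow_some]
    simp
  rw [ZGraph.weight, h1, h2, smul_mul_assoc, mul_smul_comm]

/-- Without edges, connectedness leaves a single vertex. The automorphism fixes it and hence is a
permutation `σ` of the flags. -/
theorem exists_corolla {s : ZGraph X} (hs : s.IsConn) (hι : ∀ x, s.ι x = x) (hr : s.r (e none) = e none) :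
    ∃ (g : ℕ) (σ : Equiv.Perm (Fin n)) (h : 3 ≤ 2 * g + n), corolla e g σ h = s := by
  have hr' : ∀ x, s.r x = e none := fun x =>
    (s.conn_induction (P := fun x => s.r x = e none) (fun x => by rw [s.r_r]) (fun x => by rw [hι])
      (hs.2 (e none) x)).1 hr
  have hπ : s.π (e none) = e none := by
    have h := s.r_π (e none)
    rw [hr', hr] at h
    exact h.symm
  have h3 : 3 ≤ 2 * s.g (e none) + n := by
    refine (s.stable (e none) hr).trans_eq ?_
    congr 1
    refine Eq.trans (Nat.card_congr (Equiv.ofBijective (fun i => ⟨e (some i), hr' _, by simp⟩) ⟨fun i j hij => ?_, ?_⟩)).symm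
      (Nat.card_fin n)
    · simpa using congrArg Subtype.val hij
    · rintro ⟨x, -, hx⟩
      obtain ⟨_ | i, rfl⟩ := e.surjective x
      · exact absurd rfl hx
      · exact ⟨i, rfl⟩
  let τ : Equiv.Perm (Option (Fin n)) := e.trans (s.π.trans e.symm)
  have hτ : τ none = none := by simp [τ, hπ]
  -- Since `τ` fixes `none`, removing `none` loses nothing.
  have hτ' : Equiv.optionCongr (Equiv.removeNone τ) = τ := by
    rw [map_equiv_removeNone, hτ, Equiv.swap_self]
    rfl
  refine ⟨s.g (e none), Equiv.removeNone τ, h3, ZGraph.ext ?_ ?_ ?_ ?_⟩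
  · exact funext fun x => (hr' x).symm
  · funext x
    obtain ⟨_ | i, rfl⟩ := e.surjective x
    · simp [corolla, corollaSpace]
    · have : s.g (e (some i)) = 0 := s.g_flag _ (by rw [hr']; simp)
      simp [corolla, corollaSpace, this]
  · change e.symm.trans ((Equiv.optionCongr (Equiv.removeNone τ)).trans e) = s.π
    rw [hτ']
    ext x
    simp [τ]
  · exact funext fun x => (hι x).symm

theorem corolla_injective {g' : ℕ} {σ' : Equiv.Perm (Fin n)} {h' : 3 ≤ 2 * g' + n}
    (hh : corolla e g σ h = corolla e g' σ' h') : g = g' ∧ σ = σ' := by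
  constructor
  · have := congrFun (congrArg (fun s => s.g) hh) (e none)
    simpa [corolla, corollaSpace] using this
  · ext i
    have := Equiv.congr_fun (congrArg (fun s => s.π) hh) (e (some i))
    simpa [corolla, corollaSpace, ← Fin.ext_iff] using this

end Corolla

namespace ZGraph

variable {k : Type u} [Field k]

theorem weight_zero_of_ne {X : Type} [Finite X] (c : ∀ (_ : ℕ) (I : Type) [Finite I], Equiv.Perm I → k)
    (s : ZGraph X) {y : X} (hy : s.ι y ≠ y) : s.weight c 0 = 0 := by
  have hyF : y ∈ s.flags := by
    by_contra h
    exact hy (s.pairing.fix y h)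
  rw [weight, legWeight, classProd_eq_zero (y := y) (flagWeight_of_glue s.π_mem_flags s.pairing), mul_zero]
  rw [flagWeight, if_pos hyF, if_neg hy, zero_smul]

open Classical in
-- For `x = 0` a graph with an edge has weight zero, so only corollas contribute. Any of the `n + 1`
-- elements can be the vertex; this factor later reduces `(n + 1)!` to the `n!` in the Frobenius
-- characteristic.
theorem sum_corollas {c : ∀ (_ : ℕ) (I : Type) [Finite I], Equiv.Perm I → k} (hc : IsClassFunction c) (n w : ℕ) :
    ∑ s ∈ graphsLE (n + 1) w, (if s.wt = w ∧ s.IsConn then s.weight c 0 else 0)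
      = (n + 1) • ∑ g ∈ Finset.range (w + 3) with 2 * g + n = w + 2 ∧ 0 < w, ∑ σ : Equiv.Perm (Fin n),
          hbar ((g : ℤ) - 1) * (c g (Fin n) σ • cycleMonomial σ) := by
  have h1 : ∀ s ∈ graphsLE (n + 1) w, (if s.wt = w ∧ s.IsConn then s.weight c 0 else 0)
      = ∑ v : Fin (n + 1), if s.wt = w ∧ s.IsConn ∧ s.r v = v ∧ ∀ x, s.ι x = x then s.weight c 0 else 0 := by
    intro s _
    by_cases h : s.wt = w ∧ s.IsConn
    swap
    · rw [if_neg h, eq_comm]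
      exact Finset.sum_eq_zero fun v _ => if_neg fun hh => h ⟨hh.1, hh.2.1⟩
    rw [if_pos h]
    by_cases hι : ∀ x, s.ι x = x
    swap
    · push Not at hι
      obtain ⟨y, hy⟩ := hι
      rw [s.weight_zero_of_ne c hy, eq_comm]
      exact Finset.sum_eq_zero fun v _ => by split_ifs <;> rfl
    obtain ⟨x0⟩ := h.2.1
    have hr' : ∀ x, s.r x = s.r x0 := fun x =>
      (s.conn_induction (P := fun x => s.r x = s.r x0) (fun x => by rw [s.r_r]) (fun x => by rw [hι])
        (h.2.2 x0 x)).1 rfl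
    rw [Finset.sum_eq_single (s.r x0)]
    · rw [if_pos ⟨h.1, h.2, s.r_r x0, hι⟩]
    · intro v _ hv
      exact if_neg fun hh => hv (hh.2.2.1.symm.trans (hr' v))
    · intro hh
      exact absurd (Finset.mem_univ _) hh
  rw [Finset.sum_congr rfl h1, Finset.sum_comm]
  have h2 : ∀ v : Fin (n + 1), ∑ s ∈ graphsLE (n + 1) w,
      (if s.wt = w ∧ s.IsConn ∧ s.r v = v ∧ ∀ x, s.ι x = x then s.weight c 0 else 0)
      = ∑ g ∈ Finset.range (w + 3) with 2 * g + n = w + 2 ∧ 0 < w, ∑ σ : Equiv.Perm (Fin n),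
          hbar ((g : ℤ) - 1) * (c g (Fin n) σ • cycleMonomial σ) := by
    intro v
    have he : (finSuccEquiv' v).symm none = v := finSuccEquiv'_symm_none v
    rw [← Finset.sum_filter, ← Finset.sum_product']
    have hst : ∀ p : ℕ × Equiv.Perm (Fin n),
        p ∈ ((Finset.range (w + 3)).filter fun g => 2 * g + n = w + 2 ∧ 0 < w) ×ˢ Finset.univ → 3 ≤ 2 * p.1 + n := by
      intro p hp
      rw [Finset.mem_product, Finset.mem_filter] at hp
      have h1 := hp.1.2
      omega
    symm
    refine Finset.sum_bij (fun p hp => corolla (finSuccEquiv' v).symm p.1 p.2 (hst p hp)) ?_ ?_ ?_ ?_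
    · intro p hp
      have hw : (corolla (finSuccEquiv' v).symm p.1 p.2 (hst p hp)).wt = w := by
        rw [corolla_wt]
        rw [Finset.mem_product, Finset.mem_filter] at hp
        have h1 := hp.1.2
        omega
      rw [Finset.mem_filter, mem_graphsLE]
      exact ⟨hw.le, hw, corolla_isConn, he, fun _ => rfl⟩
    · intro p hp q hq h
      obtain ⟨h1, h2⟩ := corolla_injective h
      exact Prod.ext h1 h2
    · intro s hs
      rw [Finset.mem_filter] at hs
      obtain ⟨-, hw, hconn, hr, hι⟩ := hs
      obtain ⟨g, σ, h, rfl⟩ := exists_corolla (e := (finSuccEquiv' v).symm) hconn hι (by rw [he, hr])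
      rw [corolla_wt] at hw
      refine ⟨(g, σ), ?_, rfl⟩
      rw [Finset.mem_product, Finset.mem_filter, Finset.mem_range]
      exact ⟨⟨by simp only; omega, by simp only; omega⟩, Finset.mem_univ _⟩
    · intro p hp
      rw [corolla_weight hc]
  rw [Finset.sum_congr rfl fun v _ => h2 v, Finset.sum_const, Finset.card_univ, Fintype.card_fin]

end ZGraph

open ZGraph in
theorem StableSModule.CCh_eq_series {k : Type u} [Field k] [CharZero k] (A : StableSModule.{u, w} k)
    (hA : ∀ g n : ℕ, Module.Finite k (A.tot g (Fin n))) :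
    A.CCh = series (fun _ s => s.IsConn) A.character 0 := by
  classical
  ext1 w
  rw [CCh, PowerSeries.coeff_mk, series, PowerSeries.coeff_mk, Finset.sum_range_succ']
  have h0 : ∑ s ∈ graphsLE 0 w, (if s.wt = w ∧ s.IsConn then s.weight A.character 0 else 0) = 0 :=
    Finset.sum_eq_zero fun s _ => if_neg fun h => h.2.1.elim fun x => x.elim0
  have h1 : ∀ n, ((n + 1).factorial : k)⁻¹ • ∑ s ∈ graphsLE (n + 1) w,
      (if s.wt = w ∧ s.IsConn then s.weight A.character 0 else 0)
      = ∑ g ∈ Finset.range (w + 3), if 2 * g + n = w + 2 ∧ 0 < w then hbar ((g : ℤ) - 1) * A.ch g n else 0 := by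
    intro n
    rw [sum_corollas A.isClassFunction_character, ← Finset.sum_filter, ← Nat.cast_smul_eq_nsmul k, smul_smul,
      Nat.factorial_succ, Nat.cast_mul, mul_inv, mul_comm (((n + 1 : ℕ) : k)⁻¹), mul_assoc, inv_mul_cancel₀
        (by exact_mod_cast n.succ_ne_zero), mul_one, Finset.smul_sum]
    refine Finset.sum_congr rfl fun g _ => ?_
    have := hA g n
    rw [ch, ← Finset.mul_sum, mul_smul_comm]
    congr 2
    exact Finset.sum_congr rfl fun σ _ => by rw [character_eq]
  rw [h0, smul_zero, add_zero, Finset.sum_congr rfl fun n _ => h1 n, Finset.sum_filter, Finset.sum_product,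
    Finset.sum_comm]
  by_cases hw : 0 < w
  swap
  · rw [Finset.sum_eq_zero, Finset.sum_eq_zero]
    · exact fun n _ => Finset.sum_eq_zero fun g _ => if_neg fun h => hw h.2
    · exact fun n _ => Finset.sum_eq_zero fun g _ => if_neg fun h => hw h.2
  have hz : ∀ n, n ∉ Finset.range (w + 3) → ∑ g ∈ Finset.range (w + 3),
      (if 2 * g + n = w + 2 ∧ 0 < w then hbar ((g : ℤ) - 1) * A.ch g n else 0) = 0 := by
    intro n hn
    refine Finset.sum_eq_zero fun g _ => if_neg fun h => hn (Finset.mem_range.2 (by omega))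
  -- Here `w ≥ 1` is needed. The summand for `N = 0` has been split off, so `n = N - 1` runs up to
  -- `4 * w - 1`.
  have hsub : Finset.range (w + 3) ⊆ Finset.range (4 * w) := fun n hn => by
    rw [Finset.mem_range] at hn ⊢
    omega
  exact Finset.sum_subset hsub fun n _ hn => hz n hn

end ModularOperads

/-! ### Graphs as structures on the set of their cells -/

namespace ModularOperads

open Sum

namespace Graph

variable {G H K : Graph}

/-- The vertices and flags. -/
abbrev Cell (G : Graph) : Type := G.V ⊕ G.Flag

/-- The vertex of a flag. -/
def root (G : Graph) : G.Cell → G.Cell := Sum.elim inl fun a => inl (G.vert a)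

/-- The other half of an edge. -/
def oppFlag (G : Graph) : G.Flag → G.Flag := Sum.map id (Prod.map id not)

/-- The involution of the cells that exchanges the halves of edges. -/
def opp (G : Graph) : G.Cell → G.Cell := Sum.map id G.oppFlag

/-- The genus, extended by zero to flags. -/
def cellGenus (G : Graph) : G.Cell → ℕ := Sum.elim G.genus fun _ => 0

theorem oppFlag_eq_self_iff (a : G.Flag) : G.oppFlag a = a ↔ ∃ l, a = inl l := by
  rcases a with l | ⟨e, b⟩
  · exact ⟨fun _ => ⟨l, rfl⟩, fun _ => rfl⟩
  · simp [oppFlag]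

/-- All vertices are stable. -/
def IsStable (G : Graph) : Prop := ∀ v, 3 ≤ 2 * G.genus v + Nat.card (G.Star v)

namespace Hom

/-- Isomorphisms of graphs. -/
def IsIso (h : G.Hom H) : Prop := Function.Bijective h.onV ∧ Function.Bijective h.onE

theorem onF_oppFlag (h : G.Hom H) (a : H.Flag) : h.onF (H.oppFlag a) = G.oppFlag (h.onF a) := by
  rcases a with l | ⟨e, b⟩
  · rfl
  · simp [onF, oppFlag]

theorem IsIso.onF_bijective {h : G.Hom H} (hh : h.IsIso) : Function.Bijective h.onF := by
  refine ⟨h.onF_inj, ?_⟩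
  rintro (l | ⟨e, b⟩)
  · exact ⟨inl (h.onL.symm l), by simp [onF]⟩
  · obtain ⟨e', rfl⟩ := hh.2.2 e
    exact ⟨inr (e', xor b (h.flip e')), by simp [onF]⟩

theorem IsIso.genus_onV {h : G.Hom H} (hh : h.IsIso) (u : G.V) : H.genus (h.onV u) = G.genus u := by
  classical
  have h1 := h.genus_eq (h.onV u)
  have h2 : (Finset.univ.filter fun x => h.onV x = h.onV u) = {u} := by
    ext x
    simp [hh.1.1.eq_iff]
  have h3 : (Finset.univ.filter fun e => e ∉ Set.range h.onE ∧ h.onV (G.vert (inr (e, false))) = h.onV u) = ∅ := by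
    ext e
    simpa using fun h4 => absurd (hh.2.2 e) (by simpa using h4)
  rw [h2, h3] at h1
  simp at h1
  omega

/-- The isomorphism with given maps on vertices, edges and legs. -/
def ofIso (onV : G.V → H.V) (onE : H.E → G.E) (flip : H.E → Bool) (onL : H.L ≃ G.L) (hV : Function.Bijective onV)
    (hE : Function.Bijective onE) (vert_leg : ∀ l, onV (G.vert (inl (onL l))) = H.vert (inl l))
    (vert_edge : ∀ e b, onV (G.vert (inr (onE e, xor b (flip e)))) = H.vert (inr (e, b)))
    (genus : ∀ u, H.genus (onV u) = G.genus u) : G.Hom H where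
  onV := onV
  onE := onE
  flip := flip
  onL := onL
  onE_inj := hE.1
  onV_surj := hV.2
  vert_leg := vert_leg
  vert_edge := vert_edge
  contract e he := absurd (hE.2 e) he
  conn u v huv := by rw [hV.1 huv]
  genus_eq v := by
    classical
    obtain ⟨u, rfl⟩ := hV.2 v
    have h2 : (Finset.univ.filter fun x => onV x = onV u) = {u} := by
      ext x
      simp [hV.1.eq_iff]
    have h3 : (Finset.univ.filter fun e => e ∉ Set.range onE ∧ onV (G.vert (inr (e, false))) = onV u) = ∅ := by
      ext e
      simpa using fun h4 => absurd (hE.2 e) (by simpa using h4)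
    rw [h2, h3, genus]
    simp

theorem IsIso.comp {h : G.Hom H} {h' : H.Hom K} (hh : h.IsIso) (hh' : h'.IsIso) : (h'.comp h).IsIso :=
  ⟨hh'.1.comp hh.1, hh.2.comp hh'.2⟩

theorem IsIso.exists_comp_eq {h : G.Hom H} {f : G.Hom K} (hh : h.IsIso) (hf : f.IsIso) :
    ∃ h' : H.Hom K, h'.comp h = f ∧ h'.IsIso :=
  Hom.exists_comp_eq h f (by rw [hh.2.2.range_eq, hf.2.2.range_eq])

theorem IsIso.comp_injective {h : G.Hom H} (hh : h.IsIso) {f f' : H.Hom K} (hf : f.comp h = f'.comp h) : f = f' := by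
  have hE : f.onE = f'.onE := funext fun e => hh.2.1 (congrFun (congrArg Hom.onE hf) e)
  refine ext' ?_ hE ?_ ?_
  · funext x
    obtain ⟨u, rfl⟩ := hh.1.2 x
    exact congrFun (congrArg Hom.onV hf) u
  · funext e
    have h1 : xor (f.flip e) (h.flip (f.onE e)) = xor (f'.flip e) (h.flip (f'.onE e)) :=
      congrFun (congrArg Hom.flip hf) e
    rw [hE] at h1
    simpa using h1
  · ext l
    exact h.onL.injective (Equiv.congr_fun (congrArg Hom.onL hf) l)

theorem edgeSign_eq (k : Type u) [Field k] (h : G.Hom H) :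
    h.edgeSign k = (((inversionSign h.onE : ℤˣ) : ℤ) : k) := by
  simp [edgeSign, inversionSign]

theorem edgeSign_comp (k : Type u) [Field k] {h : G.Hom H} {h' : H.Hom K} (hh : h.IsIso) (hh' : h'.IsIso) :
    (h'.comp h).edgeSign k = h'.edgeSign k * h.edgeSign k := by
  have h1 := inversionSign_comp (f := h'.onE) (g := h.onE) hh'.2 hh.2
  have h2 : (h'.comp h).edgeSign k = (((inversionSign (h.onE ∘ h'.onE) : ℤˣ) : ℤ) : k) :=
    edgeSign_eq k (h'.comp h)
  rw [h2, h1, edgeSign_eq, edgeSign_eq, Units.val_mul, Int.cast_mul, mul_comm]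

theorem edgeSign_mul_self (k : Type u) [Field k] (h : G.Hom H) : h.edgeSign k * h.edgeSign k = 1 := by
  rw [edgeSign, ← mul_pow]
  simp

end Hom

end Graph

open ModularOperads.Graph

namespace ZGraph

section

variable {X : Type} (γ : ZGraph X)

theorem ι_ι (x : X) : γ.ι (γ.ι x) = x := γ.pairing.invol x

theorem r_ι_ne {x : X} : γ.r (γ.ι x) ≠ γ.ι x ↔ γ.r x ≠ x := γ.pairing.apply_mem_iff

theorem ι_of_r {x : X} (h : γ.r x = x) : γ.ι x = x := γ.pairing.fix x fun h' => h' h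

end

variable {X : Type} [Finite X] [LinearOrder X] (γ : ZGraph X)

/-- The graph with vertices and flags in `X`. -/
noncomputable def toGraph : Graph where
  V := {v // γ.r v = v}
  -- Each edge is named by the smaller of its two halves.
  E := {f // γ.r f ≠ f ∧ f < γ.ι f}
  L := {f // γ.r f ≠ f ∧ γ.ι f = f}
  fintypeV := Fintype.ofFinite _
  fintypeE := Fintype.ofFinite _
  vert := Sum.elim (fun l => ⟨γ.r l, γ.r_r _⟩) fun x => ⟨γ.r (cond x.2 (γ.ι x.1) x.1), γ.r_r _⟩
  genus v := γ.g v

/-- The flags of the graph as elements of `X`. -/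
noncomputable def flagVal : γ.toGraph.Flag → X :=
  Sum.elim (fun l => l.1) fun x => cond x.2 (γ.ι x.1.1) x.1.1

theorem vert_val (a : γ.toGraph.Flag) : (γ.toGraph.vert a).1 = γ.r (γ.flagVal a) := by
  rcases a with l | ⟨e, b⟩ <;> rfl

theorem r_flagVal_ne (a : γ.toGraph.Flag) : γ.r (γ.flagVal a) ≠ γ.flagVal a := by
  rcases a with l | ⟨e, b⟩
  · exact l.2.1
  · cases b
    · exact e.2.1
    · exact γ.r_ι_ne.2 e.2.1

theorem flagVal_oppFlag (a : γ.toGraph.Flag) : γ.flagVal (γ.toGraph.oppFlag a) = γ.ι (γ.flagVal a) := by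
  rcases a with l | ⟨e, b⟩
  · exact l.2.2.symm
  · cases b
    · rfl
    · exact (γ.ι_ι _).symm

/-- Legs are fixed by `ι` and halves of edges are not; and the order prevents the smaller half of
one edge from being the larger half of another. -/
theorem flagVal_injective : Function.Injective γ.flagVal := by
  have h1 : ∀ (l : γ.toGraph.L) (x : γ.toGraph.E × Bool), γ.flagVal (inl l) ≠ γ.flagVal (inr x) := by
    intro l x hx
    have h2 := γ.flagVal_oppFlag (inl l)
    have h3 := γ.flagVal_oppFlag (inr x)
    rw [hx] at h2
    have h4 : γ.ι (γ.flagVal (inr x)) = γ.flagVal (inr x) := by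
      rw [← h2, ← hx]; rfl
    obtain ⟨e, b⟩ := x
    cases b
    · exact e.2.2.ne' h4
    · exact e.2.2.ne' ((γ.ι_ι _).symm.trans h4).symm
  rintro (l | ⟨e, b⟩) (l' | ⟨e', b'⟩) h
  · exact congrArg inl (Subtype.ext h)
  · exact absurd h (h1 _ _)
  · exact absurd h.symm (h1 _ _)
  · have h2 : ∀ e e' : γ.toGraph.E, e.1 ≠ γ.ι e'.1 := by
      intro e e' hh
      have h3 := e.2.2
      have h4 := e'.2.2
      rw [← hh] at h4
      rw [hh, γ.ι_ι, ← hh] at h3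
      exact lt_asymm h3 h4
    cases b <;> cases b'
    · rw [Subtype.ext (show e.1 = e'.1 from h)]
    · exact absurd h (h2 e e')
    · exact absurd h.symm (h2 e' e)
    · have h3 : γ.ι e.1 = γ.ι e'.1 := h
      rw [Subtype.ext (show e.1 = e'.1 by rw [← γ.ι_ι e.1, h3, γ.ι_ι])]

theorem exists_flagVal {f : X} (hf : γ.r f ≠ f) : ∃ a, γ.flagVal a = f := by
  rcases lt_trichotomy f (γ.ι f) with h | h | h
  · exact ⟨inr (⟨f, hf, h⟩, false), rfl⟩
  · exact ⟨inl ⟨f, hf, h.symm⟩, rfl⟩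
  · exact ⟨inr (⟨γ.ι f, γ.r_ι_ne.2 hf, by rwa [γ.ι_ι]⟩, true), γ.ι_ι f⟩

/-- A bijection of the cells of `G` with `X` that identifies `G` with the graph `γ`. -/
structure IsModel {G : Graph} (β : G.Cell ≃ X) : Prop where
  root : ∀ c, β (G.root c) = γ.r (β c)
  opp : ∀ c, β (G.opp c) = γ.ι (β c)
  genus : ∀ c, G.cellGenus c = γ.g (β c)

/-- The cells of the graph as elements of `X`. -/
noncomputable def cellEquiv : γ.toGraph.Cell ≃ X :=
  Equiv.ofBijective (Sum.elim (fun v => v.1) γ.flagVal) (by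
    constructor
    · rintro (v | a) (v' | a') h
      · exact congrArg inl (Subtype.ext h)
      · exact absurd (show γ.r (γ.flagVal a') = γ.flagVal a' by
          have h' : v.1 = γ.flagVal a' := h
          rw [← h']; exact v.2) (γ.r_flagVal_ne a')
      · exact absurd (show γ.r (γ.flagVal a) = γ.flagVal a by
          have h' : γ.flagVal a = v'.1 := h
          rw [h']; exact v'.2) (γ.r_flagVal_ne a)
      · exact congrArg inr (γ.flagVal_injective h)
    · intro x
      by_cases hx : γ.r x = x
      · exact ⟨inl ⟨x, hx⟩, rfl⟩
      · obtain ⟨a, ha⟩ := γ.exists_flagVal hx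
        exact ⟨inr a, ha⟩)

theorem cellEquiv_inr (a : γ.toGraph.Flag) : γ.cellEquiv (inr a) = γ.flagVal a := rfl

theorem isModel_cellEquiv : γ.IsModel γ.cellEquiv := by
  constructor
  · rintro (v | a)
    · exact v.2.symm
    · exact γ.vert_val a
  · rintro (v | a)
    · exact (γ.ι_of_r v.2).symm
    · exact γ.flagVal_oppFlag a
  · rintro (v | a)
    · rfl
    · exact (γ.g_flag _ (γ.r_flagVal_ne a)).symm

variable {γ} {G : Graph}

/-- `β` is the bijection of cells which is induced by `h`. -/
def Induces (h : G.Hom γ.toGraph) (β : G.Cell → X) : Prop :=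
  (∀ u, (h.onV u).1 = β (inl u)) ∧ ∀ a, γ.flagVal a = β (inr (h.onF a))

theorem exists_induces {h : G.Hom γ.toGraph} (hh : h.IsIso) : ∃ β : G.Cell ≃ X, γ.IsModel β ∧ Induces h β := by
  let β : G.Cell ≃ X := (Equiv.sumCongr (Equiv.ofBijective _ hh.1)
    (Equiv.ofBijective _ hh.onF_bijective).symm).trans γ.cellEquiv
  have h1 : ∀ u, β (inl u) = (h.onV u).1 := fun u => rfl
  have h2 : ∀ a, β (inr (h.onF a)) = γ.flagVal a := fun a => by
    change γ.cellEquiv (inr ((Equiv.ofBijective _ hh.onF_bijective).symm (h.onF a))) = _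
    rw [Equiv.ofBijective_symm_apply_apply, cellEquiv_inr]
  refine ⟨β, ⟨?_, ?_, ?_⟩, fun u => (h1 u).symm, fun a => (h2 a).symm⟩
  · rintro (u | a)
    · exact (h.onV u).2.symm
    · obtain ⟨a, rfl⟩ := hh.onF_bijective.2 a
      rw [h2, ← vert_val, ← h.vert_onF]
      rfl
  · rintro (u | a)
    · exact (γ.ι_of_r (h.onV u).2).symm
    · obtain ⟨a, rfl⟩ := hh.onF_bijective.2 a
      change β (inr (G.oppFlag (h.onF a))) = _
      rw [← h.onF_oppFlag, h2, h2, flagVal_oppFlag]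
  · rintro (u | a)
    · exact (hh.genus_onV u).symm
    · obtain ⟨a, rfl⟩ := hh.onF_bijective.2 a
      rw [h2, γ.g_flag _ (γ.r_flagVal_ne a)]
      rfl

theorem Induces.eq {h h' : G.Hom γ.toGraph} {β : G.Cell ≃ X} (hb : Induces h β) (hb' : Induces h' β) : h = h' := by
  have hF : ∀ a, h.onF a = h'.onF a := fun a =>
    Sum.inr_injective (β.injective ((hb.2 a).symm.trans (hb'.2 a)))
  have hE : ∀ e, (h.onE e, xor false (h.flip e)) = (h'.onE e, xor false (h'.flip e)) := fun e =>
    Sum.inr_injective (hF (inr (e, false)))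
  refine Hom.ext' ?_ ?_ ?_ ?_
  · exact funext fun u => Subtype.ext ((hb.1 u).trans (hb'.1 u).symm)
  · exact funext fun e => congrArg Prod.fst (hE e)
  · funext e
    simpa using congrArg Prod.snd (hE e)
  · ext l
    exact Sum.inl_injective (hF (inl l))

theorem Induces.unique {h : G.Hom γ.toGraph} (hh : h.IsIso) {β β' : G.Cell ≃ X} (hb : Induces h β) (hb' : Induces h β') :
    β = β' := by
  ext c
  rcases c with u | a
  · exact (hb.1 u).symm.trans (hb'.1 u)
  · obtain ⟨a, rfl⟩ := hh.onF_bijective.2 a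
    exact (hb.2 a).symm.trans (hb'.2 a)

/-- The flags fixed by the involution are the legs on both sides, so `β` matches legs with legs and
halves of edges with halves of edges. The half of an edge of `G` that is sent to the smaller element
may be either one, which is what `flip` records. -/
theorem IsModel.exists_iso {β : G.Cell ≃ X} (hβ : γ.IsModel β) : ∃ h : G.Hom γ.toGraph, h.IsIso ∧ Induces h β := by
  have hr : ∀ u, γ.r (β (inl u)) = β (inl u) := fun u => (hβ.root (inl u)).symm
  have hf : ∀ a, γ.r (β (inr a)) ≠ β (inr a) := fun a ha => by
    rw [← hβ.root] at ha
    exact Sum.inl_ne_inr (β.injective ha)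
  have hflag : ∀ f, γ.r f ≠ f → ∃ a, β (inr a) = f := by
    intro f hf
    obtain ⟨u | a, rfl⟩ := β.surjective f
    · exact absurd (hr u) hf
    · exact ⟨a, rfl⟩
  have hopp : ∀ a, β (inr (G.oppFlag a)) = γ.ι (β (inr a)) := fun a => hβ.opp (inr a)
  have hinj : ∀ a b, β (inr a) = β (inr b) → a = b := fun a b h => Sum.inr_injective (β.injective h)
  have hL : ∀ l : γ.toGraph.L, ∃ l' : G.L, β (inr (inl l')) = l.1 := by
    intro l
    obtain ⟨a, ha⟩ := hflag l.1 l.2.1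
    obtain ⟨l', rfl⟩ := (oppFlag_eq_self_iff a).1 (hinj _ _ (by rw [hopp, ha, l.2.2]))
    exact ⟨l', ha⟩
  have hE : ∀ e : γ.toGraph.E, ∃ x : G.E × Bool, β (inr (inr x)) = e.1 := by
    intro e
    obtain ⟨l | x, ha⟩ := hflag e.1 e.2.1
    · have h1 := hopp (inl l)
      rw [ha] at h1
      exact absurd (h1.symm.trans ha) e.2.2.ne'
    · exact ⟨x, ha⟩
  choose onL honL using hL
  choose onE honE using hE
  -- For the second half both sides are moved by the involution.
  have hE' : ∀ (e : γ.toGraph.E) b, β (inr (inr ((onE e).1, xor b (onE e).2))) = γ.flagVal (inr (e, b)) := by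
    intro e b
    cases b
    · rw [Bool.false_xor]
      exact honE e
    · rw [Bool.true_xor]
      exact (hopp (inr (onE e))).trans (congrArg γ.ι (honE e))
  have hLb : Function.Bijective onL := by
    constructor
    · intro l l' h
      exact Subtype.ext (by rw [← honL, h, honL])
    · intro l
      refine ⟨⟨β (inr (inl l)), hf _, (hopp (inl l)).symm⟩, ?_⟩
      exact Sum.inl_injective (hinj _ _ (honL _))
  have hEb : Function.Bijective fun e => (onE e).1 := by
    constructor
    · intro e e' h
      have h1 := hE' e (xor (onE e').2 (onE e).2)
      rw [Bool.xor_assoc, Bool.xor_self, Bool.xor_false, show (onE e).1 = (onE e').1 from h] at h1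
      have h2 := γ.flagVal_injective (h1.symm.trans (show _ = γ.flagVal (inr (e', false)) from honE e'))
      simpa using (congrArg Prod.fst (Sum.inr_injective h2))
    · intro e
      obtain ⟨l | ⟨x, b⟩, hx⟩ := γ.exists_flagVal (hf (inr (e, false)))
      · have := γ.flagVal_oppFlag (inl l)
        rw [hx, ← hopp] at this
        have h2 := hinj _ _ (hx.symm.trans this)
        simp [oppFlag] at h2
      · rw [← hE'] at hx
        exact ⟨x, by simpa using congrArg Prod.fst (Sum.inr_injective (hinj _ _ hx))⟩
  have hvert : ∀ a b, β (inr a) = γ.flagVal b → (⟨β (inl (G.vert a)), hr _⟩ : γ.toGraph.V) = γ.toGraph.vert b := by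
    intro a b hab
    refine Subtype.ext ?_
    rw [vert_val, ← hab]
    exact hβ.root (inr a)
  refine ⟨Hom.ofIso (fun u => ⟨β (inl u), hr u⟩) (fun e => (onE e).1) (fun e => (onE e).2) (Equiv.ofBijective onL hLb)
    ⟨fun u u' h => Sum.inl_injective (β.injective (congrArg Subtype.val h)), ?_⟩ hEb
    (fun l => hvert _ _ (honL l)) (fun e b => hvert _ _ (hE' e b)) (fun u => (hβ.genus (inl u)).symm), ⟨⟨?_, ?_⟩, hEb⟩, ?_, ?_⟩
  · rintro ⟨x, hx⟩
    obtain ⟨u | a, rfl⟩ := β.surjective x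
    · exact ⟨u, rfl⟩
    · exact absurd hx (hf a)
  · exact fun u u' h => Sum.inl_injective (β.injective (congrArg Subtype.val h))
  · rintro ⟨x, hx⟩
    obtain ⟨u | a, rfl⟩ := β.surjective x
    · exact ⟨u, rfl⟩
    · exact absurd hx (hf a)
  · exact fun u => rfl
  · rintro (l | ⟨e, b⟩)
    · exact (honL l).symm
    · exact (hE' e b).symm

/-- The isomorphisms of `G` with `γ` are the bijections of cells which identify `G` with `γ`. -/
noncomputable def isoEquiv (G : Graph) (γ : ZGraph X) :
    {h : G.Hom γ.toGraph // h.IsIso} ≃ {β : G.Cell ≃ X // γ.IsModel β} :=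
  Equiv.ofBijective (fun h => ⟨(exists_induces h.2).choose, (exists_induces h.2).choose_spec.1⟩) (by
    constructor
    · intro h h' hh
      have h1 := (exists_induces h.2).choose_spec.2
      have h2 := (exists_induces h'.2).choose_spec.2
      rw [← show (exists_induces h.2).choose = (exists_induces h'.2).choose from congrArg Subtype.val hh] at h2
      exact Subtype.ext (h1.eq h2)
    · rintro ⟨β, hβ⟩
      obtain ⟨h, hh, hi⟩ := hβ.exists_iso
      exact ⟨⟨h, hh⟩, Subtype.ext ((exists_induces hh).choose_spec.2.unique hh hi)⟩)

theorem isoEquiv_induces (h : {h : G.Hom γ.toGraph // h.IsIso}) : Induces h.1 (isoEquiv G γ h).1 :=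
  (exists_induces h.2).choose_spec.2

instance (G : Graph) (γ : ZGraph X) : Finite {h : G.Hom γ.toGraph // h.IsIso} :=
  Finite.of_equiv _ (isoEquiv G γ).symm

theorem card_star_of_model {β : G.Cell ≃ X} {r : X → X} (hr : ∀ c, β (G.root c) = r (β c)) (v : G.V) :
    Nat.card {y // r y = β (inl v) ∧ y ≠ β (inl v)} = Nat.card (G.Star v) := by
  have h1 : ∀ a : G.Star v, r (β (inr a.1)) = β (inl v) := fun a => by
    rw [← hr]
    exact congrArg (fun u => β (inl u)) a.2
  refine (Nat.card_congr (Equiv.ofBijective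
    (fun a : G.Star v => ⟨β (inr a.1), h1 a, fun h => Sum.inr_ne_inl (β.injective h)⟩) ⟨?_, ?_⟩)).symm
  · intro a b hab
    exact Subtype.ext (Sum.inr_injective (β.injective (congrArg Subtype.val hab)))
  · rintro ⟨y, hy, hy'⟩
    obtain ⟨u | a, rfl⟩ := β.surjective y
    · rw [← hr] at hy
      exact absurd hy hy'
    · rw [← hr] at hy
      exact ⟨⟨a, Sum.inl_injective (β.injective hy)⟩, rfl⟩

/-- Transport of structure along `β`; a `ZGraph` has stable vertices, whence `hG`. Thus bijections
of the cells of `G` with `X` amount to graphs on `X` together with an isomorphism from `G`. -/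
theorem exists_unique_model (hG : G.IsStable) (β : G.Cell ≃ X) : ∃! γ : ZGraph X, γ.π = 1 ∧ γ.IsModel β := by
  have hroot : ∀ c, G.root (G.root c) = G.root c := by rintro (v | a) <;> rfl
  have hflag : ∀ c, G.root c ≠ c → ∃ a, c = inr a := by
    rintro (v | a) h
    · exact absurd rfl h
    · exact ⟨a, rfl⟩
  refine ⟨⟨⟨fun x => β (G.root (β.symm x)), fun x => G.cellGenus (β.symm x), 1, ?_, ?_, ?_, ?_, ?_⟩,
    fun x => β (G.opp (β.symm x)), ⟨?_, ?_, ?_⟩⟩, ⟨rfl, ?_, ?_, ?_⟩, ?_⟩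
  · intro x
    simp [hroot]
  · intro x hx
    obtain ⟨a, ha⟩ := hflag (β.symm x) fun h => hx (by rw [h, β.apply_symm_apply])
    rw [ha]
    rfl
  · exact fun x => rfl
  · exact fun x => rfl
  · intro x hx
    obtain ⟨v | a, rfl⟩ := β.surjective x
    · refine (hG v).trans_eq ?_
      rw [← card_star_of_model (β := β) (r := fun x => β (G.root (β.symm x))) (fun c => by simp)]
      simp [cellGenus]
    · rw [β.symm_apply_apply] at hx
      exact absurd (β.injective hx) Sum.inl_ne_inr
  · intro x
    obtain ⟨v | (l | ⟨e, b⟩), rfl⟩ := β.surjective x <;> simp [Graph.opp, oppFlag]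
  · exact fun x => rfl
  · intro x hx
    obtain ⟨v | a, rfl⟩ := β.surjective x
    · simp [Graph.opp]
    · refine absurd (show β (G.root (β.symm (β (inr a)))) ≠ β (inr a) from ?_) hx
      rw [β.symm_apply_apply]
      exact fun h => Sum.inl_ne_inr (β.injective h)
  · exact fun c => by simp
  · exact fun c => by simp
  · exact fun c => by simp
  · rintro γ ⟨hπ, hγ⟩
    refine ZGraph.ext ?_ ?_ hπ ?_
    · funext x
      obtain ⟨c, rfl⟩ := β.surjective x
      simp [hγ.root]
    · funext x
      obtain ⟨c, rfl⟩ := β.surjective x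
      simp [hγ.genus]
    · funext x
      obtain ⟨c, rfl⟩ := β.surjective x
      simp [hγ.opp]

end ZGraph

end ModularOperads

/-! ### Connectedness and genus; the action of isomorphisms on `A((G))` -/

namespace ModularOperads

open Sum

namespace Graph

theorem sum_card_star (G : Graph) : ∑ v, Nat.card (G.Star v) = Nat.card G.L + 2 * Fintype.card G.E := by
  classical
  have := Fintype.ofFinite G.L
  have h := Fintype.card_congr (Equiv.sigmaFiberEquiv G.vert)
  rw [Fintype.card_sigma] at h
  simp only [Nat.card_eq_fintype_card]
  rw [h]
  simp [Fintype.card_sum, Fintype.card_prod]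
  ring

/-- The bound for connected simple graphs is applied after loops and multiple edges are discarded.
It ensures that the genus of a connected graph is a natural number. -/
theorem Connected.card_V_le {G : Graph} (h : G.Connected) : Fintype.card G.V ≤ Fintype.card G.E + 1 := by
  classical
  let S : SimpleGraph G.V := SimpleGraph.fromRel (G.Joined fun _ => True)
  have hS : S.Connected := by
    have := h.1
    refine ⟨fun u v => ?_⟩
    induction h.2 u v with
    | refl => exact SimpleGraph.Reachable.refl u
    | @tail a b _ hj ih =>
      by_cases hab : a = b
      · rwa [← hab]
      · exact ih.trans (SimpleGraph.Adj.reachable ((SimpleGraph.fromRel_adj _ _ _).2 ⟨hab, Or.inl hj⟩))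
  have h1 := hS.card_vert_le_card_edgeSet_add_one
  have h2 : Nat.card S.edgeSet ≤ Nat.card G.E := by
    let f : G.E → Sym2 G.V := fun e => s(G.vert (inr (e, false)), G.vert (inr (e, true)))
    have hf : S.edgeSet ⊆ Set.range f := by
      intro z
      induction z using Sym2.ind with
      | _ a b =>
        intro hz
        rw [SimpleGraph.mem_edgeSet] at hz
        rcases ((SimpleGraph.fromRel_adj _ _ _).1 hz).2 with ⟨e, -, c, rfl, rfl⟩ | ⟨e, -, c, rfl, rfl⟩ <;> cases c
        · exact ⟨e, rfl⟩
        · exact ⟨e, Sym2.eq_swap⟩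
        · exact ⟨e, Sym2.eq_swap⟩
        · exact ⟨e, rfl⟩
    calc Nat.card S.edgeSet ≤ Nat.card (Set.range f) := Nat.card_mono (Set.toFinite _) hf
      _ ≤ Nat.card G.E := Nat.card_le_card_of_surjective _ Set.rangeFactorization_surjective
  rw [Nat.card_eq_fintype_card] at h1
  rw [Nat.card_eq_fintype_card (α := G.E)] at h2
  omega

end Graph

namespace ZGraph

variable {X : Type} [LinearOrder X]

theorem toGraph_connected [Finite X] (γ : ZGraph X) : γ.toGraph.Connected ↔ γ.IsConn := by
  constructor
  · rintro ⟨⟨v⟩, h⟩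
    have h1 : ∀ u v : γ.toGraph.V, γ.conn u.1 v.1 := by
      intro u v
      induction h u v with
      | refl => exact γ.conn.refl' _
      | tail _ hj ih =>
        obtain ⟨e, -, b, rfl, rfl⟩ := hj
        refine γ.conn.trans' ih ?_
        rw [vert_val, vert_val]
        have h2 := γ.flagVal_oppFlag (inr (e, b))
        refine γ.conn.trans' (γ.conn.symm' (γ.conn_r _)) (γ.conn.trans' (γ.conn_ι _) ?_)
        rw [← h2]
        exact γ.conn_r _
    refine ⟨⟨v.1⟩, fun x y => ?_⟩
    exact γ.conn.trans' (γ.conn_r x) (γ.conn.trans' (h1 ⟨_, γ.r_r x⟩ ⟨_, γ.r_r y⟩) (γ.conn.symm' (γ.conn_r y)))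
  · rintro ⟨⟨x⟩, h⟩
    have h1 : ∀ x y, γ.toGraph.Chain (fun _ => True) ⟨γ.r x, γ.r_r x⟩ ⟨γ.r y, γ.r_r y⟩ := by
      intro x y
      refine (γ.conn_induction (P := fun y => γ.toGraph.Chain (fun _ => True) ⟨γ.r x, γ.r_r x⟩ ⟨γ.r y, γ.r_r y⟩)
        (fun y => ?_) (fun y => ?_) (h x y)).1 .refl
      · simp only [γ.r_r]
      · have key : ∀ y, γ.toGraph.Chain (fun _ => True) ⟨γ.r x, γ.r_r x⟩ ⟨γ.r y, γ.r_r y⟩ →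
            γ.toGraph.Chain (fun _ => True) ⟨γ.r x, γ.r_r x⟩ ⟨γ.r (γ.ι y), γ.r_r (γ.ι y)⟩ := by
          intro y hy
          by_cases hf : γ.r y = y
          · simpa only [γ.ι_of_r hf] using hy
          obtain ⟨l | ⟨e, b⟩, rfl⟩ := γ.exists_flagVal hf
          · have h2 : γ.ι (γ.flagVal (inl l)) = γ.flagVal (inl l) := l.2.2
            simpa only [h2] using hy
          · refine hy.tail ⟨e, trivial, b, Subtype.ext (vert_val _ _), Subtype.ext ?_⟩
            rw [vert_val]
            exact congrArg γ.r (γ.flagVal_oppFlag (inr (e, b)))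
        refine ⟨key y, fun hy => ?_⟩
        have := key _ hy
        simpa only [γ.ι_ι] using this
    refine ⟨⟨⟨γ.r x, γ.r_r x⟩⟩, fun u v => ?_⟩
    have := h1 u.1 v.1
    have h2 : ∀ u : γ.toGraph.V, (⟨γ.r u.1, γ.r_r u.1⟩ : γ.toGraph.V) = u := fun u => Subtype.ext u.2
    rwa [h2, h2] at this

theorem card_star_toGraph [Finite X] (γ : ZGraph X) (v : γ.toGraph.V) :
    Nat.card (γ.toGraph.Star v) = Nat.card (γ.Star v.1) :=
  (card_star_of_model (β := γ.cellEquiv) γ.isModel_cellEquiv.root v).symm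

theorem wt_add_eq [Fintype X] (γ : ZGraph X) :
    γ.wt + 2 * Fintype.card γ.toGraph.V
      = 2 * ∑ v, γ.toGraph.genus v + 2 * Fintype.card γ.toGraph.E + Nat.card γ.toGraph.L := by
  classical
  have h1 : γ.wt = ∑ v : γ.toGraph.V, γ.vwt v.1 := by
    have h2 : ∑ v : γ.toGraph.V, γ.vwt v.1 = ∑ x with γ.r x = x, γ.vwt x :=
      (Finset.sum_subtype (f := γ.vwt) (p := fun x => γ.r x = x) _ (by simp)).symm
    rw [h2, FlagSpace.wt, Finset.sum_filter]
    refine Finset.sum_congr rfl fun x _ => ?_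
    split_ifs with h
    · rfl
    · exact γ.vwt_eq_zero h
  have h2 : ∑ v : γ.toGraph.V, (γ.vwt v.1 + 2) = ∑ v : γ.toGraph.V, (2 * γ.toGraph.genus v + Nat.card (γ.toGraph.Star v)) :=
    Finset.sum_congr rfl fun v _ => by
      rw [γ.vwt_add_two v.2, card_star_toGraph]
      rfl
  rw [Finset.sum_add_distrib, Finset.sum_add_distrib, ← h1, Graph.sum_card_star, ← Finset.mul_sum, Finset.sum_const,
    Finset.card_univ, smul_eq_mul] at h2
  omega

/-- Summing `2 (g(v) - 1) + n(v)` over the vertices counts every edge twice, and so yields `2 (g -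
1) + n` for the whole graph. -/
theorem hasGenus_iff [Fintype X] (γ : ZGraph X) (g : ℕ) :
    γ.toGraph.HasGenus g ↔ 2 * g + Nat.card γ.toGraph.L = γ.wt + 2 := by
  have := γ.wt_add_eq
  unfold Graph.HasGenus
  omega

theorem IsConn.exists_genus [Finite X] {γ : ZGraph X} (h : γ.IsConn) : ∃ g, γ.toGraph.HasGenus g := by
  have := (γ.toGraph_connected.2 h).card_V_le
  -- The subtraction of natural numbers is exact by `Connected.card_V_le`.
  refine ⟨∑ v, γ.toGraph.genus v + Fintype.card γ.toGraph.E + 1 - Fintype.card γ.toGraph.V, ?_⟩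
  unfold Graph.HasGenus
  omega

end ZGraph

namespace StableSModule

variable {k : Type u} [Field k] (A : StableSModule.{u, w} k)

/-- The action of a bijection, for equal genera. -/
noncomputable def totIso {g g' : ℕ} (h : g = g') {I J : Type} [Finite I] [Finite J] (e : I ≃ J) :
    A.tot g I →ₗ[k] A.tot g' J :=
  Eq.rec (motive := fun g' _ => A.tot g I →ₗ[k] A.tot g' J) (A.totMap e) h

theorem totIso_rfl {g : ℕ} (h : g = g) {I J : Type} [Finite I] [Finite J] (e : I ≃ J) :
    A.totIso h e = A.totMap e := rfl

theorem totIso_refl {g : ℕ} (h : g = g) {I : Type} [Finite I] (x : A.tot g I) :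
    A.totIso h (Equiv.refl I) x = x := by
  rw [totIso_rfl, totMap_refl, LinearMap.id_apply]

theorem totIso_totIso {g g' g'' : ℕ} (h : g = g') (h' : g' = g'') {I J K : Type} [Finite I] [Finite J] [Finite K]
    (e : I ≃ J) (f : J ≃ K) (x : A.tot g I) :
    A.totIso h' f (A.totIso h e x) = A.totIso (h.trans h') (e.trans f) x := by
  subst h h'
  simp only [totIso_rfl, totMap_trans, LinearMap.comp_apply]

theorem exists_totIso_incl {g g' : ℕ} (h : g = g') {I J : Type} [Finite I] [Finite J] (e : I ≃ J) (i : ℤ)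
    (x : A.obj g I i) : ∃ y, A.totIso h e (A.incl g I i x) = A.incl g' J i y := by
  subst h
  exact ⟨_, by rw [totIso_rfl, totMap_incl]⟩

theorem koszul_pureTens {G H : Graph} (f : G.Hom H) (deg : G.V → ℤ)
    (x : ∀ v, A.obj (G.genus v) (G.Star v) (deg v)) :
    A.koszul f (A.pureTens G deg x) = koszulSign (k := k) f (fun v => decide (Odd (deg v))) • A.pureTens G deg x := by
  rw [koszul, LinearMap.sum_apply, Finset.sum_eq_single fun v => decide (Odd (deg v))]
  · rw [LinearMap.smul_apply, pureTens, PiTensorProduct.map_tprod]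
    congr 2
    funext v
    rw [totParity_incl, if_pos rfl]
  · intro s _ hs
    obtain ⟨v, hv⟩ := Function.ne_iff.1 hs
    rw [LinearMap.smul_apply, pureTens, PiTensorProduct.map_tprod]
    refine smul_eq_zero_of_right _ (MultilinearMap.map_coord_zero _ v ?_)
    rw [totParity_incl, if_neg hv]
  · exact fun h => absurd (Finset.mem_univ _) h

end StableSModule

namespace Graph.Hom

variable {G H K : Graph}

theorem IsIso.star_bijective {h : G.Hom H} (hh : h.IsIso) {u : G.V} {v : H.V} (huv : h.onV u = v) :
    Function.Bijective fun a : H.Star v => (⟨h.onF a.1, hh.1.1 (by rw [h.vert_onF, a.2, huv])⟩ : G.Star u) := by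
  constructor
  · intro a b hab
    exact Subtype.ext (h.onF_inj (congrArg Subtype.val hab))
  · rintro ⟨a, ha⟩
    obtain ⟨a, rfl⟩ := hh.onF_bijective.2 a
    exact ⟨⟨a, by rw [← h.vert_onF, ha, huv]⟩, rfl⟩

/-- The bijection of the flags at a vertex induced by an isomorphism. -/
noncomputable def starIso {h : G.Hom H} (hh : h.IsIso) {u : G.V} {v : H.V} (huv : h.onV u = v) : G.Star u ≃ H.Star v :=
  (Equiv.ofBijective _ (hh.star_bijective huv)).symm

theorem onF_starIso {h : G.Hom H} (hh : h.IsIso) {u : G.V} {v : H.V} (huv : h.onV u = v) (a : G.Star u) :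
    h.onF (starIso hh huv a).1 = a.1 :=
  congrArg Subtype.val ((Equiv.ofBijective _ (hh.star_bijective huv)).apply_symm_apply a)

end Graph.Hom

open ModularOperads.Graph

namespace ModularOperad

variable {k : Type u} [Field k] (A : ModularOperad.{u, w} k) {G H K : Graph}

theorem comp_corolla_of_eq (G : Graph) (v : G.V) (hV : ∀ u, u = v) (hE : IsEmpty G.E) {g : ℕ} (h : G.genus v = g)
    (hc : G.Connected) (hg : G.HasGenus g) (x : ∀ u, A.tot (G.genus u) (G.Star u)) :
    A.comp G g hc hg (PiTensorProduct.tprod k x) = A.totIso h (G.starEquivL v hV hE) (x v) := by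
  subst h
  exact A.comp_corolla G v hV hE hc hg x

/-- The maps on the factors of `A((G))` induced by an isomorphism of graphs, without signs. -/
noncomputable def isoMap {h : G.Hom H} (hh : h.IsIso) :
    (∀ u, A.tot (G.genus u) (G.Star u)) →ₗ[k] ∀ v, A.tot (H.genus v) (H.Star v) :=
  LinearMap.pi fun v => A.totIso
    ((hh.genus_onV _).symm.trans (congrArg H.genus (Function.surjInv_eq hh.1.2 v)))
    (Hom.starIso hh (Function.surjInv_eq hh.1.2 v)) ∘ₗ LinearMap.proj _

/-- Frees `isoMap` from the chosen preimage of `v`: any vertex over `v` may be used, with the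
identification of genera adapted. -/
theorem isoMap_apply {h : G.Hom H} (hh : h.IsIso) (x : ∀ u, A.tot (G.genus u) (G.Star u)) {u : G.V} {v : H.V}
    (huv : h.onV u = v) : A.isoMap hh x v
      = A.totIso ((hh.genus_onV u).symm.trans (congrArg H.genus huv)) (Hom.starIso hh huv) (x u) := by
  have h1 : ∀ (u' : G.V) (hu' : h.onV u' = v), u' = u →
      A.totIso ((hh.genus_onV u').symm.trans (congrArg H.genus hu')) (Hom.starIso hh hu') (x u')
        = A.totIso ((hh.genus_onV u).symm.trans (congrArg H.genus huv)) (Hom.starIso hh huv) (x u) := by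
    rintro u' hu' rfl
    rfl
  exact h1 _ (Function.surjInv_eq hh.1.2 v) (hh.1.1 ((Function.surjInv_eq hh.1.2 v).trans huv.symm))

/-- The fibres of an isomorphism have one vertex and no edges, so the composition along each is the
relabelling prescribed by the unit axiom `comp_corolla`. -/
theorem fibreTens_iso {h : G.Hom H} (hh : h.IsIso) (x : ∀ u, A.tot (G.genus u) (G.Star u)) :
    A.fibreTens h (PiTensorProduct.tprod k x) = PiTensorProduct.tprod k (A.isoMap hh x) := by
  refine (PiTensorProduct.lift.tprod _).trans ?_
  change PiTensorProduct.tprod k _ = _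
  congr 1
  funext v
  obtain ⟨u, rfl⟩ := hh.1.2 v
  rw [A.isoMap_apply hh x rfl]
  change A.comp (h.fibre (h.onV u)) _ _ _ (PiTensorProduct.tprod k fun u' : (h.fibre (h.onV u)).V =>
    A.totMap (h.starEquiv (h.onV u) u').symm (x u'.1)) = _
  have hV : ∀ u' : (h.fibre (h.onV u)).V, u' = ⟨u, rfl⟩ := fun u' => Subtype.ext (hh.1.1 u'.2)
  have hE : IsEmpty (h.fibre (h.onV u)).E := ⟨fun e => e.2.1 (hh.2.2 e.1)⟩
  rw [A.comp_corolla_of_eq (h.fibre (h.onV u)) ⟨u, rfl⟩ hV hE (hh.genus_onV u).symm]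
  refine (A.totIso_totIso (rfl : G.genus u = G.genus u) (hh.genus_onV u).symm
    (h.starEquiv (h.onV u) ⟨u, rfl⟩).symm _ (x u)).trans ?_
  congr 2
  rw [← Equiv.symm_symm (Hom.starIso hh rfl), ← Equiv.symm_symm (Equiv.trans _ _)]
  refine congrArg Equiv.symm (Equiv.ext fun a => Subtype.ext ?_)
  rfl

theorem mapHom_pureTens {h : G.Hom H} (hh : h.IsIso) (deg : G.V → ℤ)
    (x : ∀ v, A.obj (G.genus v) (G.Star v) (deg v)) :
    A.mapHom h (A.pureTens G deg x) = StableSModule.koszulSign (k := k) h (fun v => decide (Odd (deg v))) •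
      PiTensorProduct.tprod k (A.isoMap hh fun v => A.incl _ _ _ (x v)) := by
  rw [ModularPreOperad.mapHom, LinearMap.comp_apply, A.koszul_pureTens, map_smul, StableSModule.pureTens,
    fibreTens_iso]

end ModularOperad

end ModularOperads

/-! ### Traces along the orbits of a permutation -/

namespace ModularOperads

open Equiv.Perm

section Matrix

variable {k : Type*} [CommRing k] {J : Type*} [Fintype J] [DecidableEq J]

/-- The entries of a power of a matrix as sums over paths. -/
theorem sum_paths (K : Matrix J J k) (m : ℕ) (f : J → J → k) :
    ∑ y : Fin (m + 1) → J, f (y 0) (y (Fin.last m)) * ∏ i : Fin m, K (y i.castSucc) (y i.succ)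
      = ∑ a, ∑ b, f a b * (K ^ m) a b := by
  induction m generalizing f with
  | zero =>
    rw [← (Equiv.funUnique (Fin 1) J).symm.sum_comp]
    refine Finset.sum_congr rfl fun a _ => ?_
    rw [Finset.sum_eq_single a]
    · simp
    · intro b _ hb
      rw [pow_zero, Matrix.one_apply_ne hb.symm, mul_zero]
    · exact fun h => absurd (Finset.mem_univ _) h
  | succ m ih =>
    rw [← (Fin.consEquiv fun _ => J).sum_comp, Fintype.sum_prod_type]
    refine Finset.sum_congr rfl fun a _ => ?_
    have h1 : ∀ z : Fin (m + 1) → J, f ((Fin.consEquiv fun _ => J) (a, z) 0)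
        ((Fin.consEquiv fun _ => J) (a, z) (Fin.last (m + 1))) * ∏ i : Fin (m + 1),
          K ((Fin.consEquiv fun _ => J) (a, z) i.castSucc) ((Fin.consEquiv fun _ => J) (a, z) i.succ)
        = f a (z (Fin.last m)) * K a (z 0) * ∏ i : Fin m, K (z i.castSucc) (z i.succ) := by
      intro z
      rw [Fin.prod_univ_succ, mul_assoc]
      rfl
    rw [Finset.sum_congr rfl fun z _ => h1 z, ih fun c b => f a b * K a c, Finset.sum_comm]
    refine Finset.sum_congr rfl fun b _ => ?_
    rw [pow_succ', Matrix.mul_apply, Finset.mul_sum]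
    exact Finset.sum_congr rfl fun c _ => mul_assoc _ _ _

/-- Closed paths of length `m + 1`, with the extra factor `t` at the starting point, give the
weighted trace of `K ^ (m + 1)`. -/
theorem sum_cycles (K : Matrix J J k) (m : ℕ) (t : J → k) :
    ∑ y : Fin (m + 1) → J, t (y 0) * ∏ i : Fin (m + 1), K (y i) (y (i + 1)) = ∑ a, t a * (K ^ (m + 1)) a a := by
  have h1 : ∀ y : Fin (m + 1) → J, t (y 0) * ∏ i : Fin (m + 1), K (y i) (y (i + 1))
      = t (y 0) * K (y (Fin.last m)) (y 0) * ∏ i : Fin m, K (y i.castSucc) (y i.succ) := by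
    intro y
    rw [Fin.prod_univ_castSucc, Fin.last_add_one, mul_assoc, mul_comm (K _ _)]
    simp only [Fin.coeSucc_eq_succ]
  rw [Finset.sum_congr rfl fun y _ => h1 y, sum_paths K m fun a b => t a * K b a]
  refine Finset.sum_congr rfl fun a _ => ?_
  rw [pow_succ, Matrix.mul_apply, Finset.mul_sum]
  exact Finset.sum_congr rfl fun b _ => by ring

variable {V : Type*} [Fintype V] (τ : Equiv.Perm V)

/-- The points of a permuted set as representatives of orbits with exponents. -/
noncomputable def orbitEquiv :
    ((q : Quotient (SameCycle.setoid τ)) × Fin (period τ q.out - 1 + 1)) ≃ V :=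
  Equiv.ofBijective (fun p => (τ ^ (p.2 : ℕ)) p.1.out) (by
    have hpos : ∀ q : Quotient (SameCycle.setoid τ), period τ q.out - 1 + 1 = period τ q.out := fun q =>
      Nat.sub_add_cancel (period_pos τ q.out)
    constructor
    · rintro ⟨q, i⟩ ⟨q', i'⟩ h
      have hq : q = q' := by
        rw [← q.out_eq, ← q'.out_eq]
        refine Quotient.sound ?_
        change SameCycle τ _ _
        have h' : (τ ^ (i : ℕ)) q.out = (τ ^ (i' : ℕ)) q'.out := h
        rw [← sameCycle_pow_left (n := (i : ℕ)), h', sameCycle_pow_left]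
      subst hq
      have h' : (τ ^ (i : ℕ)) q.out = (τ ^ (i' : ℕ)) q.out := h
      rw [pow_apply_eq_pow_iff] at h'
      have h3 : (i : ℕ) = i' := Nat.ModEq.eq_of_lt_of_lt h' (i.2.trans_eq (hpos q)) (i'.2.trans_eq (hpos q))
      rw [Fin.ext h3]
    · intro v
      have h : SameCycle τ (Quotient.mk (SameCycle.setoid τ) v).out v :=
        Quotient.exact (s := SameCycle.setoid τ) (Quotient.out_eq _)
      obtain ⟨n, hn⟩ := h.exists_nat_pow_eq
      refine ⟨⟨Quotient.mk _ v, ⟨n % period τ (Quotient.mk (SameCycle.setoid τ) v).out, ?_⟩⟩, ?_⟩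
      · rw [hpos]
        exact Nat.mod_lt _ (period_pos _ _)
      · refine Eq.trans ?_ hn
        change (τ ^ (n % _)) _ = _
        rw [pow_apply_eq_pow_iff]
        exact Nat.mod_modEq _ _)

theorem apply_orbitEquiv (q : Quotient (SameCycle.setoid τ)) (i : Fin (period τ q.out - 1 + 1)) :
    τ (orbitEquiv τ ⟨q, i⟩) = orbitEquiv τ ⟨q, i + 1⟩ := by
  change τ ((τ ^ (i : ℕ)) q.out) = (τ ^ ((i + 1 : Fin _) : ℕ)) q.out
  have hpos : period τ q.out - 1 + 1 = period τ q.out := Nat.sub_add_cancel (period_pos τ q.out)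
  have h : ((i + 1 : Fin (period τ q.out - 1 + 1)) : ℕ) = ((i : ℕ) + 1) % period τ q.out := by
    refine Eq.trans ?_ (congrArg (((i : ℕ) + 1) % ·) hpos)
    rw [Fin.val_add, Fin.val_one', Nat.add_mod_mod]
  rw [h, ← Equiv.Perm.mul_apply, ← pow_succ', pow_apply_eq_pow_iff]
  exact (Nat.mod_modEq _ _).symm

/-- A function on `V` is a family of closed paths, one along each orbit of `τ`, so the sum factors
into weighted traces of powers of `K`. -/
theorem sum_orbits [DecidableEq V] [Fintype (Quotient (SameCycle.setoid τ))] (K : Matrix J J k) (t : Quotient (SameCycle.setoid τ) → J → k) :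
    ∑ x : V → J, (∏ q, t q (x q.out)) * ∏ v, K (x v) (x (τ v))
      = ∏ q, ∑ a, t q a * (K ^ period τ q.out) a a := by
  classical
  have hpos : ∀ q : Quotient (SameCycle.setoid τ), period τ q.out = period τ q.out - 1 + 1 := fun q =>
    (Nat.sub_add_cancel (period_pos τ q.out)).symm
  have h1 : ∀ q : Quotient (SameCycle.setoid τ), ∑ a, t q a * (K ^ period τ q.out) a a
      = ∑ y : Fin (period τ q.out - 1 + 1) → J, t q (y 0) * ∏ i, K (y i) (y (i + 1)) := fun q => by
    rw [sum_cycles, ← hpos]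
  rw [Finset.prod_congr rfl fun q _ => h1 q, Finset.prod_univ_sum, Fintype.piFinset_univ]
  let E : (V → J) ≃ ∀ q : Quotient (SameCycle.setoid τ), Fin (period τ q.out - 1 + 1) → J :=
    ((orbitEquiv τ).arrowCongr (Equiv.refl J)).symm.trans (Equiv.piCurry fun _ _ => J)
  have hE : ∀ x q i, E x q i = x (orbitEquiv τ ⟨q, i⟩) := fun x q i => rfl
  refine Fintype.sum_equiv E _ _ fun x => ?_
  rw [Finset.prod_mul_distrib, ← (orbitEquiv τ).prod_comp, Fintype.prod_sigma]
  congr 1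
  refine Finset.prod_congr rfl fun q _ => Finset.prod_congr rfl fun i _ => ?_
  rw [hE, hE, apply_orbitEquiv]

end Matrix

/-- The index sets at the points of `V` are merged into one, so that `sum_orbits` applies to a block
matrix whose only blocks lead from `v` to `τ v`. Functions that are not sections contribute zero. -/
theorem sum_sections {k : Type*} [CommRing k] {V : Type*} [Fintype V] [DecidableEq V] (τ : Equiv.Perm V)
    [Fintype (Quotient (SameCycle.setoid τ))] {J : V → Type*} [∀ v, Fintype (J v)] [∀ v, DecidableEq (J v)]
    (K : Matrix (Σ v, J v) (Σ v, J v) k) (hK : ∀ a b, K a b ≠ 0 → b.1 = τ a.1) (s : (Σ v, J v) → k) :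
    ∑ x : ∀ v, J v, (∏ q : Quotient (SameCycle.setoid τ), s ⟨q.out, x q.out⟩) * ∏ v, K ⟨v, x v⟩ ⟨τ v, x (τ v)⟩
      = ∏ q : Quotient (SameCycle.setoid τ), ∑ a : J q.out, s ⟨q.out, a⟩ * (K ^ period τ q.out) ⟨q.out, a⟩ ⟨q.out, a⟩ := by
  have h := sum_orbits τ K fun q a => if a.1 = q.out then s a else 0
  have h1 : ∀ q : Quotient (SameCycle.setoid τ),
      ∑ a : Σ v, J v, (if a.1 = q.out then s a else 0) * (K ^ period τ q.out) a a
      = ∑ a : J q.out, s ⟨q.out, a⟩ * (K ^ period τ q.out) ⟨q.out, a⟩ ⟨q.out, a⟩ := by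
    intro q
    rw [Fintype.sum_sigma, Finset.sum_eq_single q.out]
    · exact Finset.sum_congr rfl fun a _ => by rw [if_pos rfl]
    · intro v _ hv
      exact Finset.sum_eq_zero fun a _ => by rw [if_neg hv, zero_mul]
    · exact fun h => absurd (Finset.mem_univ _) h
  rw [← Finset.prod_congr rfl fun q _ => h1 q, ← h]
  refine Finset.sum_of_injOn (fun x v => ⟨v, x v⟩) ?_ (fun _ _ => Finset.mem_coe.2 (Finset.mem_univ _)) ?_ ?_
  · intro x _ y _ hxy
    funext v
    have := congrFun hxy v
    simpa using this
  · intro x _ hx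
    by_contra hne
    have h2 : ∀ q : Quotient (SameCycle.setoid τ), (x q.out).1 = q.out := by
      intro q
      by_contra hq
      exact hne (by rw [Finset.prod_eq_zero (Finset.mem_univ q) (if_neg hq), zero_mul])
    have h3 : ∀ v, (x (τ v)).1 = τ (x v).1 := by
      intro v
      refine hK _ _ fun h0 => hne ?_
      rw [Finset.prod_eq_zero (f := fun v => K (x v) (x (τ v))) (Finset.mem_univ v) h0, mul_zero]
    -- The extra factor puts `x` over the right point at the representative of each orbit, and
    -- nonzero matrix entries carry this along the orbit.
    have h4 : ∀ v, (x v).1 = v := by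
      intro v
      obtain ⟨⟨q, i⟩, rfl⟩ := (orbitEquiv τ).surjective v
      obtain ⟨n, hn⟩ := i
      induction n with
      | zero => exact h2 q
      | succ n ih =>
        have h5 := ih (Nat.lt_of_succ_lt hn)
        have h6 : orbitEquiv τ ⟨q, ⟨n + 1, hn⟩⟩ = τ (orbitEquiv τ ⟨q, ⟨n, Nat.lt_of_succ_lt hn⟩⟩) := by
          change (τ ^ (n + 1)) q.out = τ ((τ ^ n) q.out)
          rw [pow_succ', Equiv.Perm.mul_apply]
        rw [h6, h3, h5]
    refine hx ⟨fun v => h4 v ▸ (x v).2, Finset.mem_coe.2 (Finset.mem_univ _), ?_⟩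
    funext v
    refine Sigma.ext (h4 v).symm ?_
    simp
  · intro x _
    congr 1
    exact Finset.prod_congr rfl fun q _ => by rw [if_pos rfl]

end ModularOperads

/-! ### The supertrace of a graph automorphism on `A((G))` -/

namespace ModularOperads

open Equiv.Perm

namespace StableSModule

variable {k : Type u} [Field k] (A : StableSModule.{u, w} k)

/-- A basis of homogeneous elements. -/
structure HomBasis (g : ℕ) (I : Type) [Finite I] where
  J : Type w
  [fintype : Fintype J]
  [decEq : DecidableEq J]
  basis : Module.Basis J k (A.tot g I)
  deg : J → ℤ
  vec : ∀ a, A.obj g I (deg a)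
  basis_apply : ∀ a, basis a = A.incl g I (deg a) (vec a)

attribute [instance] HomBasis.fintype HomBasis.decEq

open Classical in
theorem nonempty_homBasis (g : ℕ) (I : Type) [Finite I] [Module.Finite k (A.tot g I)] : Nonempty (A.HomBasis g I) := by
  let b : Module.Basis (Σ i, Module.Basis.ofVectorSpaceIndex k (A.obj g I i)) k (A.tot g I) :=
    DFinsupp.basis fun i => Module.Basis.ofVectorSpace k (A.obj g I i)
  have := Module.Finite.finite_basis b
  have := Fintype.ofFinite (Σ i, Module.Basis.ofVectorSpaceIndex k (A.obj g I i))
  refine ⟨⟨_, b, fun a => a.1, fun a => Module.Basis.ofVectorSpace k (A.obj g I a.1) a.2, ?_⟩⟩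
  rintro ⟨i, a⟩
  apply b.repr.injective
  rw [b.repr_self]
  ext ⟨j, c⟩
  change _ = (Module.Basis.ofVectorSpace k (A.obj g I j)).repr
    (A.totComp g I j (A.incl g I i (Module.Basis.ofVectorSpace k (A.obj g I i) a))) c
  by_cases hij : i = j
  · subst hij
    rw [totComp_incl_self, Module.Basis.repr_self, Finsupp.single_apply, Finsupp.single_apply]
    simp
  · rw [A.totComp_incl_ne _ _ hij, map_zero, Finsupp.single_apply, if_neg fun h => hij (congrArg Sigma.fst h)]
    rfl

theorem HomBasis.repr_incl_of_ne {A : StableSModule.{u, w} k} {g : ℕ} {I : Type} [Finite I] (b : A.HomBasis g I) {i : ℤ}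
    (y : A.obj g I i) {a : b.J} (h : b.deg a ≠ i) : b.basis.repr (A.incl g I i y) a = 0 := by
  have h1 : b.basis.coord a ∘ₗ A.totProj g I (b.deg a) = b.basis.coord a := by
    refine b.basis.ext fun c => ?_
    rw [LinearMap.comp_apply, b.basis_apply c]
    by_cases hc : b.deg c = b.deg a
    · rw [← hc, totProj_incl_self]
    · rw [A.totProj_incl_ne g I hc, map_zero, ← b.basis_apply, Module.Basis.coord_apply, Module.Basis.repr_self,
        Finsupp.single_eq_of_ne]
      rintro rfl
      exact hc rfl
  have h2 := LinearMap.congr_fun h1 (A.incl g I i y)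
  rw [LinearMap.comp_apply, A.totProj_incl_ne g I (Ne.symm h), map_zero] at h2
  exact h2.symm

/-- The sign `(-1) ^ i`. -/
noncomputable def degSign (k : Type u) [Field k] (i : ℤ) : k := if Odd i then -1 else 1

theorem totSign_incl_smul (g : ℕ) (I : Type) [Finite I] (i : ℤ) (x : A.obj g I i) :
    A.totSign g I (A.incl g I i x) = degSign k i • A.incl g I i x := by
  rw [totSign_incl, degSign]
  split_ifs <;> simp

theorem character_eq_sum {g : ℕ} {I : Type} [Finite I] (b : A.HomBasis g I) (σ : Equiv.Perm I) :
    A.character g I σ = ∑ a, degSign k (b.deg a) * b.basis.repr (A.totMap σ (b.basis a)) a := by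
  rw [character, LinearMap.trace_eq_matrix_trace k b.basis, Matrix.trace]
  refine Finset.sum_congr rfl fun a _ => ?_
  rw [Matrix.diag_apply, LinearMap.toMatrix_apply, LinearMap.comp_apply, b.basis_apply, totMap_incl,
    totSign_incl_smul, map_smul, Finsupp.smul_apply, smul_eq_mul]

end StableSModule

namespace ModularOperad

open StableSModule

variable {k : Type u} [Field k] (A : ModularOperad.{u, w} k) {G : Graph}

/-- The permutation of the vertices by an automorphism. -/
noncomputable def _root_.ModularOperads.Graph.Hom.vertPerm {h : G.Hom G} (hh : h.IsIso) : Equiv.Perm G.V :=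
  Equiv.ofBijective h.onV hh.1

/-- The flags are moved by `onF` against the direction of `h`, hence the bijection `e` of stars is
described as inverse to the iterate of `onF`. -/
theorem exists_isoMap_pow {h : G.Hom G} (hh : h.IsIso) (m : ℕ) {v w : G.V} (hw : (Graph.Hom.vertPerm hh ^ m) v = w) :
    ∃ (hg : G.genus v = G.genus w) (e : G.Star v ≃ G.Star w), (∀ a, h.onF^[m] (e a).1 = a.1) ∧
      ∀ x, ((A.isoMap hh) ^ m) x w = A.totIso hg e (x v) := by
  induction m generalizing w with
  | zero =>
    have hw : v = w := hw
    subst hw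
    exact ⟨rfl, Equiv.refl _, fun a => rfl, fun x => (A.totIso_refl rfl (x v)).symm⟩
  | succ m ih =>
    obtain ⟨hg, e, he, hx⟩ := ih rfl
    rw [pow_succ', Equiv.Perm.mul_apply] at hw
    have hw' : h.onV ((Graph.Hom.vertPerm hh ^ m) v) = w := hw
    refine ⟨hg.trans ((hh.genus_onV _).symm.trans (congrArg G.genus hw')), e.trans (Graph.Hom.starIso hh hw'),
      fun a => ?_, fun x => ?_⟩
    · rw [Function.iterate_succ_apply, Equiv.trans_apply, Graph.Hom.onF_starIso, he]
    · rw [pow_succ', Module.End.mul_apply, A.isoMap_apply hh _ hw', hx, totIso_totIso]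

theorem map_totSign_basis (b : ∀ v, A.HomBasis (G.genus v) (G.Star v)) (x : ∀ v, (b v).J) :
    PiTensorProduct.map (fun v => A.totSign (G.genus v) (G.Star v))
        (PiTensorProduct.tprod k fun v => (b v).basis (x v))
      = (∏ v, degSign k ((b v).deg (x v))) • PiTensorProduct.tprod k fun v => (b v).basis (x v) := by
  rw [PiTensorProduct.map_tprod, ← MultilinearMap.map_smul_univ]
  congr 1
  funext v
  rw [(b v).basis_apply, totSign_incl_smul]

/-- The identity `inversionSign_mul_prod` for the permutation of the vertices, with the vertices of
odd degree as the distinguished set: the Koszul sign counts their inversions. -/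
theorem degSign_mul_koszulSign {h : G.Hom G} (hh : h.IsIso) (d : G.V → ℤ)
    (hd : ∀ v, d (h.onV v) = d v) [Fintype (Quotient (SameCycle.setoid (Graph.Hom.vertPerm hh)))] :
    (∏ v, degSign k (d v)) * koszulSign (k := k) h (fun v => decide (Odd (d v)))
      = ∏ q : Quotient (SameCycle.setoid (Graph.Hom.vertPerm hh)), degSign k (d q.out) := by
  let φ : ℤˣ →* k := (Int.castRingHom k).toMonoidHom.comp (Units.coeHom ℤ)
  have h1 : φ (-1) = -1 := by simp [φ]
  have h2 := congrArg φ (inversionSign_mul_prod (Graph.Hom.vertPerm hh) (S := fun v => decide (Odd (d v)))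
    fun v => by rw [show d (Graph.Hom.vertPerm hh v) = d v from hd v])
  have h3 : ∀ v, φ (if decide (Odd (d v)) = true then -1 else 1) = degSign k (d v) := by
    intro v
    rw [degSign]
    by_cases hv : Odd (d v) <;> simp [hv, h1]
  rw [classProd, finprod_eq_prod_of_fintype, map_mul, map_pow, map_prod, map_prod, h1, mul_comm] at h2
  simp only [h3] at h2
  exact h2

/-- In a basis of pure tensors of homogeneous vectors a diagonal entry is, up to sign, a product of
matrix entries from `v` to `h v`. By `sum_sections` the sum factors over the cycles of vertices into
traces of the first-return maps. The signs combine to one degree sign per cycle, which makes these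
traces alternating characters. -/
theorem trace_mapHom_totSign {h : G.Hom G} (hh : h.IsIso)
    (hfin : ∀ v, Module.Finite k (A.tot (G.genus v) (G.Star v))) :
    ∃ e : ∀ v, Equiv.Perm (G.Star v),
      (∀ v a, h.onF^[period (Graph.Hom.vertPerm hh) v] (e v a).1 = a.1) ∧
      LinearMap.trace k (A.tens G) (A.mapHom h ∘ₗ PiTensorProduct.map fun v => A.totSign (G.genus v) (G.Star v))
        = classProd (SameCycle.setoid (Graph.Hom.vertPerm hh)) fun v => A.character (G.genus v) (G.Star v) (e v) := by
  classical
  have := Fintype.ofFinite (Quotient (SameCycle.setoid (Graph.Hom.vertPerm hh)))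
  let b : ∀ v, A.HomBasis (G.genus v) (G.Star v) := fun v => (A.nonempty_homBasis (G.genus v) (G.Star v)).some
  choose hg e he hx using fun v => A.exists_isoMap_pow hh (period (Graph.Hom.vertPerm hh) v) (pow_period _ v)
  refine ⟨e, he, ?_⟩
  let B := Pi.basis fun v => (b v).basis
  -- Transposed, so that an entry reads from the source `v` to the target `h.onV v`.
  let K : Matrix (Σ v, (b v).J) (Σ v, (b v).J) k := (LinearMap.toMatrix B B (A.isoMap hh)).transpose
  have hK' : ∀ m a c, (K ^ m) a c = (b c.1).basis.repr (((A.isoMap hh) ^ m) (Pi.single a.1 ((b a.1).basis a.2)) c.1) c.2 := by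
    intro m a c
    rw [← Matrix.transpose_pow, Matrix.transpose_apply, LinearMap.toMatrix_pow, LinearMap.toMatrix_apply, Pi.basis_apply,
      Pi.basis_repr]
  have hK0 : ∀ v a c, K ⟨v, a⟩ ⟨h.onV v, c⟩ = (b (h.onV v)).basis.repr
      (A.totIso (hh.genus_onV v).symm (Graph.Hom.starIso hh rfl) ((b v).basis a)) c := by
    intro v a c
    have h1 := hK' 1 ⟨v, a⟩ ⟨h.onV v, c⟩
    rw [pow_one, pow_one, A.isoMap_apply hh _ rfl, Pi.single_eq_same] at h1
    exact h1
  have hK1 : ∀ a c, K a c ≠ 0 → c.1 = Graph.Hom.vertPerm hh a.1 := by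
    rintro ⟨v, a⟩ ⟨w, c⟩ hne
    obtain ⟨v', rfl⟩ := hh.1.2 w
    by_contra hvv
    have hvv' : v' ≠ v := fun h' => hvv (congrArg h.onV h')
    have h1 := hK' 1 ⟨v, a⟩ ⟨h.onV v', c⟩
    rw [pow_one, pow_one, A.isoMap_apply hh _ rfl, Pi.single_eq_of_ne hvv', map_zero, map_zero] at h1
    exact hne h1
  -- The action preserves degrees, so in a nonzero term the degree is constant along each cycle, as
  -- the sign identity requires.
  have hKd : ∀ v a c, K ⟨v, a⟩ ⟨h.onV v, c⟩ ≠ 0 → (b (h.onV v)).deg c = (b v).deg a := by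
    intro v a c hne
    by_contra hd
    refine hne ?_
    rw [hK0, (b v).basis_apply]
    obtain ⟨y, hy⟩ := A.exists_totIso_incl (hh.genus_onV v).symm (Graph.Hom.starIso hh rfl) _ ((b v).vec a)
    rw [hy, (b (h.onV v)).repr_incl_of_ne y hd]
  rw [LinearMap.trace_eq_matrix_trace k (Basis.piTensorProduct fun v => (b v).basis), Matrix.trace, classProd,
    finprod_eq_prod_of_fintype]
  have h1 : ∀ q : Quotient (SameCycle.setoid (Graph.Hom.vertPerm hh)),
      A.character (G.genus q.out) (G.Star q.out) (e q.out)
      = ∑ a : (b q.out).J, degSign k ((b q.out).deg a) *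
        (K ^ period (Graph.Hom.vertPerm hh) q.out) ⟨q.out, a⟩ ⟨q.out, a⟩ := by
    intro q
    rw [A.character_eq_sum (b q.out)]
    refine Finset.sum_congr rfl fun a _ => ?_
    rw [hK', hx, Pi.single_eq_same]
    rfl
  rw [Finset.prod_congr rfl fun q _ => h1 q,
    ← sum_sections (Graph.Hom.vertPerm hh) K hK1 fun p => degSign k ((b p.1).deg p.2)]
  refine Finset.sum_congr rfl fun x _ => ?_
  have h2 : (PiTensorProduct.tprod k fun v => (b v).basis (x v))
      = A.pureTens G (fun v => (b v).deg (x v)) fun v => (b v).vec (x v) := by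
    rw [pureTens]
    congr 1
    funext v
    rw [(b v).basis_apply]
  rw [Matrix.diag_apply, LinearMap.toMatrix_apply, Basis.piTensorProduct_apply, LinearMap.comp_apply,
    map_totSign_basis, map_smul, h2, A.mapHom_pureTens hh, smul_smul, map_smul, Finsupp.smul_apply, smul_eq_mul,
    Basis.piTensorProduct_repr_tprod_apply]
  have h3 : ∏ v, (b v).basis.repr (A.isoMap hh (fun v => A.incl (G.genus v) (G.Star v) _ ((b v).vec (x v))) v) (x v)
      = ∏ v, K ⟨v, x v⟩ ⟨Graph.Hom.vertPerm hh v, x (Graph.Hom.vertPerm hh v)⟩ := by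
    rw [← Equiv.prod_comp (Graph.Hom.vertPerm hh)]
    refine Finset.prod_congr rfl fun v _ => ?_
    change (b (h.onV v)).basis.repr (A.isoMap hh _ (h.onV v)) (x (h.onV v)) = K ⟨v, x v⟩ ⟨h.onV v, x (h.onV v)⟩
    rw [hK0, A.isoMap_apply hh _ rfl, (b v).basis_apply]
  rw [h3]
  by_cases hz : ∏ v, K ⟨v, x v⟩ ⟨Graph.Hom.vertPerm hh v, x (Graph.Hom.vertPerm hh v)⟩ = 0
  · rw [hz, mul_zero, mul_zero]
  · rw [← degSign_mul_koszulSign hh fun v => (b v).deg (x v)]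
    intro v
    exact hKd v (x v) (x (h.onV v)) (Finset.prod_ne_zero_iff.1 hz v (Finset.mem_univ v))

end ModularOperad

end ModularOperads

/-! ### Degrees in `A((G))`, and labelled graphs -/

namespace ModularOperads

open ModularOperads.Graph

namespace StableSModule

variable {k : Type u} [Field k] (A : StableSModule.{u, w} k)

theorem degSign_eq_zpow (i : ℤ) : degSign k i = (-1) ^ i := by
  rw [degSign]
  split_ifs with h
  · rw [h.neg_one_zpow]
  · rw [(Int.not_odd_iff_even.1 h).neg_one_zpow]

theorem prod_degSign {ι : Type*} (s : Finset ι) (d : ι → ℤ) : ∏ v ∈ s, degSign k (d v) = degSign k (∑ v ∈ s, d v) := by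
  classical
  induction s using Finset.induction_on with
  | empty => simp [degSign]
  | insert a s ha ih =>
    rw [Finset.prod_insert ha, Finset.sum_insert ha, ih, degSign_eq_zpow, degSign_eq_zpow, degSign_eq_zpow,
      zpow_add₀ (neg_ne_zero.2 one_ne_zero)]

theorem finite_tot (hA : ∀ g n : ℕ, Module.Finite k (A.tot g (Fin n))) (g : ℕ) (I : Type) [Finite I] :
    Module.Finite k (A.tot g I) := by
  have := hA g (Nat.card I)
  refine Module.Finite.of_surjective (A.totMap (g := g) (Finite.equivFin I).symm) fun x =>
    ⟨A.totMap (Finite.equivFin I) x, ?_⟩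
  rw [← LinearMap.comp_apply, ← totMap_trans, Equiv.self_trans_symm, totMap_refl, LinearMap.id_apply]

theorem tens_hom_eq_of_unstable {G : Graph} {M : Type*} [AddCommGroup M] [Module k M] {v : G.V}
    (hv : 2 * G.genus v + Nat.card (G.Star v) ≤ 2) (f f' : A.tens G →ₗ[k] M) : f = f' := by
  refine PiTensorProduct.ext (MultilinearMap.ext fun x => ?_)
  have h0 : x v = 0 := by
    have := A.stable (G.genus v) (G.Star v)
    exact DFinsupp.ext fun j => (this j hv).elim _ _
  exact (MultilinearMap.map_coord_zero _ v h0).trans (MultilinearMap.map_coord_zero _ v h0).symm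

variable [∀ (g : ℕ) (I : Type) [Finite I], Module.Finite k (A.tot g I)] (G : Graph)

instance : Module.Finite k (A.tens G) :=
  Module.Finite.of_basis (Basis.piTensorProduct fun v => Module.finBasis k (A.tot (G.genus v) (G.Star v)))

/-- The families of degrees of the vertices. -/
noncomputable def degFamilies : Finset (G.V → ℤ) :=
  Fintype.piFinset fun v => A.degrees (G.genus v) (G.Star v)

theorem pureTens_eq_zero {d : G.V → ℤ} (hd : d ∉ A.degFamilies G) (x : ∀ v, A.obj (G.genus v) (G.Star v) (d v)) :
    A.pureTens G d x = 0 := by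
  rw [degFamilies, Fintype.mem_piFinset] at hd
  push Not at hd
  obtain ⟨v, hv⟩ := hd
  have := A.subsingleton_of_notMem _ _ hv
  refine MultilinearMap.map_coord_zero _ v ?_
  rw [Subsingleton.elim (x v) 0, map_zero]

theorem sum_map_totProj :
    ∑ d ∈ A.degFamilies G, PiTensorProduct.map (fun v => A.totProj (G.genus v) (G.Star v) (d v)) = LinearMap.id := by
  have h := (PiTensorProduct.mapMultilinear k (fun v => A.tot (G.genus v) (G.Star v))
    (fun v => A.tot (G.genus v) (G.Star v))).map_sum_finset (fun v i => A.totProj (G.genus v) (G.Star v) i)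
    (fun v => A.degrees (G.genus v) (G.Star v))
  simp only [sum_totProj, PiTensorProduct.mapMultilinear_apply] at h
  rw [PiTensorProduct.map_id] at h
  exact h.symm

theorem map_totProj_tprod (d : G.V → ℤ) (x : ∀ v, A.tot (G.genus v) (G.Star v)) :
    PiTensorProduct.map (fun v => A.totProj (G.genus v) (G.Star v) (d v)) (PiTensorProduct.tprod k x)
      = A.pureTens G d fun v => A.totComp _ _ (d v) (x v) := by
  rw [PiTensorProduct.map_tprod]
  rfl

theorem tens_ext {M : Type*} [AddCommGroup M] [Module k M] {f f' : A.tens G →ₗ[k] M}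
    (h : ∀ d x, f (A.pureTens G d x) = f' (A.pureTens G d x)) : f = f' := by
  refine PiTensorProduct.ext (MultilinearMap.ext fun x => ?_)
  change f (PiTensorProduct.tprod k x) = f' (PiTensorProduct.tprod k x)
  rw [← LinearMap.id_apply (R := k) (PiTensorProduct.tprod k x), ← sum_map_totProj, LinearMap.sum_apply, map_sum, map_sum]
  exact Finset.sum_congr rfl fun d _ => by rw [map_totProj_tprod, h]

/-- The projection to the part of degree `j`. -/
noncomputable def degProj (j : ℤ) : A.tens G →ₗ[k] A.tens G :=
  ∑ d ∈ A.degFamilies G with ∑ v, d v = j, PiTensorProduct.map fun v => A.totProj (G.genus v) (G.Star v) (d v)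

theorem map_totProj_pureTens_of_ne {d d' : G.V → ℤ} (h : d' ≠ d) (x : ∀ v, A.obj (G.genus v) (G.Star v) (d v)) :
    PiTensorProduct.map (fun v => A.totProj (G.genus v) (G.Star v) (d' v)) (A.pureTens G d x) = 0 := by
  obtain ⟨v, hv⟩ := Function.ne_iff.1 h
  rw [pureTens, PiTensorProduct.map_tprod]
  exact MultilinearMap.map_coord_zero _ v (A.totProj_incl_ne _ _ hv.symm _)

theorem degProj_pureTens (j : ℤ) (d : G.V → ℤ) (x : ∀ v, A.obj (G.genus v) (G.Star v) (d v)) :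
    A.degProj G j (A.pureTens G d x) = if ∑ v, d v = j then A.pureTens G d x else 0 := by
  by_cases hd : d ∈ A.degFamilies G
  swap
  · rw [A.pureTens_eq_zero G hd, map_zero, ite_self]
  rw [degProj, LinearMap.sum_apply]
  split_ifs with hj
  · rw [Finset.sum_eq_single d]
    · rw [pureTens, PiTensorProduct.map_tprod]
      congr 1
      funext v
      rw [totProj_incl_self]
    · exact fun d' _ hd' => A.map_totProj_pureTens_of_ne G hd' x
    · exact fun h => absurd (Finset.mem_filter.2 ⟨hd, hj⟩) h
  · refine Finset.sum_eq_zero fun d' hd' => A.map_totProj_pureTens_of_ne G ?_ x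
    rintro rfl
    exact hj (Finset.mem_filter.1 hd').2

theorem degProj_of_mem {i : ℤ} (j : ℤ) {t : A.tens G} (ht : t ∈ A.degSub G i) :
    A.degProj G j t = if i = j then t else 0 := by
  induction ht using Submodule.span_induction with
  | mem t h =>
    obtain ⟨d, x, rfl, rfl⟩ := h
    exact A.degProj_pureTens G j d x
  | zero => rw [map_zero, ite_self]
  | add a b _ _ ha hb => rw [map_add, ha, hb]; split_ifs <;> simp
  | smul c a _ ha => rw [map_smul, ha]; split_ifs <;> simp

theorem degProj_mem (j : ℤ) (t : A.tens G) : A.degProj G j t ∈ A.degSub G j := by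
  induction t using PiTensorProduct.induction_on with
  | smul_tprod c x =>
    rw [map_smul, degProj, LinearMap.sum_apply]
    refine Submodule.smul_mem _ c (Submodule.sum_mem _ fun d hd => Submodule.subset_span ?_)
    exact ⟨d, _, (Finset.mem_filter.1 hd).2, (A.map_totProj_tprod G d x).symm⟩
  | add a b ha hb =>
    rw [map_add]
    exact Submodule.add_mem _ ha hb

/-- The degrees of the elements of `A((G))`. -/
noncomputable def degRange : Finset ℤ := (A.degFamilies G).image fun d => ∑ v, d v

theorem degProj_eq_zero {j : ℤ} (hj : j ∉ A.degRange G) : A.degProj G j = 0 := by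
  rw [degProj, Finset.sum_eq_zero]
  intro d hd
  obtain ⟨h1, h2⟩ := Finset.mem_filter.1 hd
  exact absurd (Finset.mem_image.2 ⟨d, h1, h2⟩) hj

theorem sum_degProj : ∑ j ∈ A.degRange G, A.degProj G j = LinearMap.id := by
  rw [← A.sum_map_totProj G]
  exact Finset.sum_fiberwise_of_maps_to (fun d hd => Finset.mem_image_of_mem _ hd) _

theorem map_totSign_eq : PiTensorProduct.map (fun v => A.totSign (G.genus v) (G.Star v))
    = ∑ j ∈ A.degRange G, degSign k j • A.degProj G j := by
  refine A.tens_ext G fun d x => ?_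
  have h1 : PiTensorProduct.map (fun v => A.totSign (G.genus v) (G.Star v)) (A.pureTens G d x)
      = degSign k (∑ v, d v) • A.pureTens G d x := by
    rw [← prod_degSign, pureTens, PiTensorProduct.map_tprod, ← MultilinearMap.map_smul_univ]
    congr 1
    funext v
    rw [totSign_incl_smul]
  rw [h1, LinearMap.sum_apply]
  by_cases hd : d ∈ A.degFamilies G
  · rw [Finset.sum_eq_single (∑ v, d v)]
    · rw [LinearMap.smul_apply, degProj_pureTens, if_pos rfl]
    · intro j _ hj
      rw [LinearMap.smul_apply, degProj_pureTens, if_neg hj.symm, smul_zero]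
    · exact fun h => absurd (Finset.mem_image_of_mem _ hd) h
  · simp [A.pureTens_eq_zero G hd]

end StableSModule

namespace ModularPreOperad

variable {k : Type u} [Field k] (A : ModularPreOperad.{u, w} k)
  [∀ (g : ℕ) (I : Type) [Finite I], Module.Finite k (A.tot g I)]

theorem mapHom_degProj {G H : Graph} (f : G.Hom H) (j : ℤ) (t : A.tens G) :
    A.mapHom f (A.degProj G j t) = A.degProj H j (A.mapHom f t) := by
  have h : A.mapHom f ∘ₗ A.degProj G j = A.degProj H j ∘ₗ A.mapHom f := by
    refine A.tens_ext G fun d x => ?_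
    have hx : A.pureTens G d x ∈ A.degSub G (∑ v, d v) := Submodule.subset_span ⟨d, x, rfl, rfl⟩
    rw [LinearMap.comp_apply, LinearMap.comp_apply, A.degProj_of_mem G j hx, A.degProj_of_mem H j (A.mapHom_degSub f _ hx)]
    split_ifs
    · rfl
    · rw [map_zero]
  exact LinearMap.congr_fun h t

end ModularPreOperad

/-- The connected graphs of weight `w` with cells in `{0, …, N - 1}` for some `N`, with `n` numbered legs. -/
abbrev LabelledGraph (w n : ℕ) : Type :=
  (N : Fin (4 * w + 1)) × (γ : {γ : ZGraph (Fin N) // γ.wt = w ∧ γ.IsConn ∧ γ.π = 1}) × (γ.1.toGraph.L ≃ Fin n)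

instance (w N : ℕ) : Finite {γ : ZGraph (Fin N) // γ.wt = w ∧ γ.IsConn ∧ γ.π = 1} :=
  ((ZGraph.finite_wt_le w).subset fun _ h => h.1.le).to_subtype

namespace LabelledGraph

variable {w n : ℕ}

instance (b : LabelledGraph w n) : Finite b.2.1.1.toGraph.L := Graph.finiteL _

noncomputable instance : Fintype (LabelledGraph w n) := Fintype.ofFinite _

/-- The underlying graph. -/
noncomputable abbrev graph (b : LabelledGraph w n) : Graph := b.2.1.1.toGraph

/-- The numbering of the legs. -/
abbrev lab (b : LabelledGraph w n) : b.graph.L ≃ Fin n := b.2.2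

theorem hasGenus (b : LabelledGraph w n) {g : ℕ} (h : 2 * g + n = w + 2) : b.graph.HasGenus g := by
  rw [graph, ZGraph.hasGenus_iff, Nat.card_congr b.lab, Nat.card_fin, b.2.1.2.1, h]

theorem connected (b : LabelledGraph w n) : b.graph.Connected := (ZGraph.toGraph_connected _).2 b.2.1.2.2.1

/-- The isomorphisms of labelled graphs. -/
def Isos (G : Graph) (ρ : G.L ≃ Fin n) (b : LabelledGraph w n) : Type :=
  {h : G.Hom b.graph // h.IsIso ∧ h.onL.trans ρ = b.lab}

instance (G : Graph) (ρ : G.L ≃ Fin n) (b : LabelledGraph w n) : Finite (Isos G ρ b) :=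
  Finite.of_injective (fun h => (⟨h.1, h.2.1⟩ : {h : G.Hom b.2.1.1.toGraph // h.IsIso}))
    fun _ _ hh => Subtype.ext (Subtype.mk.inj hh)

noncomputable instance (G : Graph) (ρ : G.L ≃ Fin n) (b : LabelledGraph w n) : Fintype (Isos G ρ b) := Fintype.ofFinite _

variable {G : Graph} {ρ : G.L ≃ Fin n}

/-- The bijection of cells given by an isomorphism. -/
noncomputable def Isos.cells {b : LabelledGraph w n} (h : Isos G ρ b) : G.Cell ≃ Fin b.1 :=
  (ZGraph.isoEquiv G b.2.1.1 ⟨h.1, h.2.1⟩).1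

theorem Isos.isModel {b : LabelledGraph w n} (h : Isos G ρ b) : b.2.1.1.IsModel h.cells :=
  (ZGraph.isoEquiv G b.2.1.1 ⟨h.1, h.2.1⟩).2

/-- A bijection of the cells of `G` with `Fin N` determines the graph on `Fin N` and the isomorphism
by transport of structure, and the numbering of the legs is then forced by `ρ`. So the pairs are
counted by such bijections. -/
theorem card_isos (hG : G.IsStable) (hc : G.Connected) {g : ℕ} (hg : G.HasGenus g) (ρ : G.L ≃ Fin n) (hw : 2 * g + n = w + 2)
    (N : Fin (4 * w + 1)) (hN : (N : ℕ) = Nat.card G.Cell) :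
    Nat.card ((γ : (γ : {γ : ZGraph (Fin N) // γ.wt = w ∧ γ.IsConn ∧ γ.π = 1}) × (γ.1.toGraph.L ≃ Fin n)) ×
      Isos G ρ (⟨N, γ⟩ : LabelledGraph w n)) = (N : ℕ).factorial := by
  have e0 : G.Cell ≃ Fin N := (Finite.equivFin G.Cell).trans (finCongr hN.symm)
  have h0 : Nat.card (G.Cell ≃ Fin N) = (N : ℕ).factorial := by
    rw [Nat.card_congr (Equiv.equivCongr e0 (Equiv.refl (Fin N)))]
    rw [Nat.card_eq_fintype_card, Fintype.card_perm, Fintype.card_fin]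
  rw [← h0]
  refine Nat.card_congr (Equiv.ofBijective (fun p => p.2.cells) ⟨?_, ?_⟩)
  · rintro ⟨⟨⟨γ, hγ⟩, lab⟩, h⟩ ⟨⟨⟨γ', hγ'⟩, lab'⟩, h'⟩ hh
    have hh : h.cells = h'.cells := hh
    obtain rfl : γ = γ' := (ZGraph.exists_unique_model hG h.cells).unique ⟨hγ.2.2, h.isModel⟩ ⟨hγ'.2.2, hh ▸ h'.isModel⟩
    have h1 : h.1 = h'.1 := congrArg Subtype.val ((ZGraph.isoEquiv G γ).injective (Subtype.ext hh))
    obtain rfl : lab = lab' := by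
      have h2 := h.2.2
      have h3 := h'.2.2
      rw [← h1] at h3
      exact h2.symm.trans h3
    rw [show h = h' from Subtype.ext h1]
  · intro β
    obtain ⟨γ, ⟨hπ, hγ⟩, -⟩ := ZGraph.exists_unique_model hG β
    let h := (ZGraph.isoEquiv G γ).symm ⟨β, hγ⟩
    have hconn : γ.IsConn := γ.toGraph_connected.1 (h.1.connected_iff.1 hc)
    have hwt : γ.wt = w := by
      have h1 := (γ.hasGenus_iff g).1 ((h.1.hasGenus_iff g).1 hg)
      rw [Nat.card_congr (h.1.onL.trans ρ), Nat.card_fin] at h1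
      omega
    refine ⟨⟨⟨⟨γ, hwt, hconn, hπ⟩, h.1.onL.trans ρ⟩, ⟨h.1, h.2, rfl⟩⟩, ?_⟩
    exact congrArg Subtype.val ((ZGraph.isoEquiv G γ).apply_symm_apply ⟨β, hγ⟩)

/-- The weights `1 / N!` form a partition of unity on the isomorphisms from `G` to labelled graphs;
only `N` equal to the number of cells of `G` occurs. -/
theorem sum_card_isos {k : Type u} [Field k] [CharZero k] (hG : G.IsStable) (hc : G.Connected) {g : ℕ} (hg : G.HasGenus g)
    (ρ : G.L ≃ Fin n) (hw : 2 * g + n = w + 2) :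
    ∑ b : LabelledGraph w n, ((b.1 : ℕ).factorial : k)⁻¹ * (Fintype.card (Isos G ρ b) : k) = 1 := by
  classical
  -- The bound of cells by weight, for a copy of `G` on a standard set.
  have hlt : Nat.card G.Cell < 4 * w + 1 := by
    obtain ⟨γ, ⟨hπ, hγ⟩, -⟩ := ZGraph.exists_unique_model hG (Finite.equivFin G.Cell)
    let h := (ZGraph.isoEquiv G γ).symm ⟨_, hγ⟩
    have h1 := (γ.hasGenus_iff g).1 ((h.1.hasGenus_iff g).1 hg)
    rw [Nat.card_congr (h.1.onL.trans ρ), Nat.card_fin] at h1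
    exact ZGraph.le_of_wt_le (s := γ) (by omega)
  have : ∀ N : Fin (4 * w + 1), Fintype {γ : ZGraph (Fin N) // γ.wt = w ∧ γ.IsConn ∧ γ.π = 1} := fun N => Fintype.ofFinite _
  have : ∀ (N : Fin (4 * w + 1)) (γ : {γ : ZGraph (Fin N) // γ.wt = w ∧ γ.IsConn ∧ γ.π = 1}),
    Fintype (γ.1.toGraph.L ≃ Fin n) := fun N γ => Fintype.ofFinite _
  have h0 : (Finset.univ : Finset (LabelledGraph w n)) = Finset.univ.sigma fun _ => Finset.univ := by
    ext
    simp
  rw [h0, Finset.sum_sigma, Finset.sum_eq_single ⟨Nat.card G.Cell, hlt⟩]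
  · have h1 := card_isos hG hc hg ρ hw ⟨Nat.card G.Cell, hlt⟩ rfl
    rw [Nat.card_eq_fintype_card, Fintype.card_sigma] at h1
    have h2 : ∑ s, ((Nat.card G.Cell).factorial : k)⁻¹ *
        (Fintype.card (Isos G ρ (⟨⟨Nat.card G.Cell, hlt⟩, s⟩ : LabelledGraph w n)) : k) = 1 := by
      rw [← Finset.mul_sum, ← Nat.cast_sum, h1]
      exact inv_mul_cancel₀ (by exact_mod_cast Nat.factorial_ne_zero _)
    exact h2
  · intro N _ hN
    refine Finset.sum_eq_zero fun b _ => ?_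
    have : IsEmpty (Isos G ρ (⟨N, b⟩ : LabelledGraph w n)) :=
      ⟨fun h => hN (Fin.ext (((Nat.card_congr h.cells).trans (Nat.card_fin _)).symm))⟩
    rw [Fintype.card_eq_zero, Nat.cast_zero, mul_zero]
  · exact fun h => absurd (Finset.mem_univ _) h

end LabelledGraph

end ModularOperads

/-! ### The Feynman transform as a retract, and its character -/

namespace ModularOperads

open ModularOperads.Graph

section LinearAlgebra

variable {k : Type*} [Field k]

/-- Since `S ∘ R` is the identity, `f = (f ∘ S) ∘ R`, and the factor `R` can be moved to the front
under the trace. -/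
theorem trace_eq_of_retract {V W : Type*} [AddCommGroup V] [Module k V] [AddCommGroup W] [Module k W] [Module.Finite k W]
    (R : V →ₗ[k] W) (S : W →ₗ[k] V) (h : ∀ v, S (R v) = v) (f : V →ₗ[k] V) :
    LinearMap.trace k V f = LinearMap.trace k W (R ∘ₗ f ∘ₗ S) := by
  have hR : Function.Injective R := Function.LeftInverse.injective h
  have : Module.Finite k V := Module.Finite.of_injective R hR
  refine Eq.trans (congrArg _ (LinearMap.ext fun v => ?_)) (LinearMap.trace_comp_comm' R (f ∘ₗ S))
  rw [LinearMap.comp_apply, LinearMap.comp_apply, h]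

theorem trace_pi {B : Type*} [Fintype B] [DecidableEq B] {W : B → Type*} [∀ b, AddCommGroup (W b)] [∀ b, Module k (W b)]
    [∀ b, Module.Finite k (W b)] (F : (∀ b, W b) →ₗ[k] ∀ b, W b) :
    LinearMap.trace k _ F = ∑ b, LinearMap.trace k (W b) (LinearMap.proj b ∘ₗ F ∘ₗ LinearMap.single k W b) := by
  have h1 : F = ∑ b, (F ∘ₗ LinearMap.single k W b) ∘ₗ LinearMap.proj b := by
    refine LinearMap.ext fun x => ?_
    rw [LinearMap.sum_apply]
    simp only [LinearMap.comp_apply, LinearMap.proj_apply, LinearMap.coe_single]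
    rw [← map_sum, Finset.univ_sum_single]
  conv_lhs => rw [h1, map_sum]
  exact Finset.sum_congr rfl fun b _ => LinearMap.trace_comp_comm' _ _

end LinearAlgebra

namespace ModularOperad

open StableSModule LabelledGraph

variable {k : Type u} [Field k] (A : ModularOperad.{u, w} k)
  [∀ (g : ℕ) (I : Type) [Finite I], Module.Finite k (A.tot g I)] {w n : ℕ}

/-- The families of linear forms on `A((G))` for the finitely many labelled graphs. -/
abbrev Coords (w n : ℕ) : Type (max u w) := ∀ b : LabelledGraph w n, Module.Dual k (A.tens b.graph)

/-- The natural family obtained by averaging over isomorphisms. -/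
noncomputable def average (i : ℤ) : A.Coords w n →ₗ[k] A.Family (Fin n) where
  toFun ψ G ρ := ∑ b : LabelledGraph w n, ((b.1 : ℕ).factorial : k)⁻¹ • ∑ h : Isos G ρ b,
    h.1.edgeSign k • (ψ b ∘ₗ A.mapHom h.1 ∘ₗ A.degProj G (-i - Fintype.card G.E))
  map_add' ψ ψ' := by
    funext G ρ
    simp only [Pi.add_apply, LinearMap.add_comp, smul_add, Finset.sum_add_distrib]
  map_smul' c ψ := by
    funext G ρ
    simp only [Pi.smul_apply, LinearMap.smul_comp, Finset.smul_sum, RingHom.id_apply, smul_smul]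
    refine Finset.sum_congr rfl fun b _ => Finset.sum_congr rfl fun h _ => ?_
    congr 1
    ring

theorem average_apply (i : ℤ) (ψ : A.Coords w n) (G : Graph) (ρ : G.L ≃ Fin n) (t : A.tens G) :
    A.average i ψ G ρ t = ∑ b : LabelledGraph w n, ((b.1 : ℕ).factorial : k)⁻¹ * ∑ h : Isos G ρ b,
      h.1.edgeSign k * ψ b (A.mapHom h.1 (A.degProj G (-i - Fintype.card G.E) t)) := by
  simp [average, LinearMap.sum_apply]

theorem isCochain_average {g : ℕ} (hw : 2 * g + n = w + 2) (i : ℤ) (ψ : A.Coords w n) :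
    A.IsCochain g (Fin n) i (A.average i ψ) := by
  refine ⟨fun G ρ hG => LinearMap.ext fun t => ?_, fun G ρ j hj t ht => ?_, fun {G H} f hV hE ρ t => ?_⟩
  · rw [average_apply, LinearMap.zero_apply]
    refine Finset.sum_eq_zero fun b _ => ?_
    have : IsEmpty (Isos G ρ b) :=
      ⟨fun h => hG ⟨h.1.connected_iff.2 b.connected, (h.1.hasGenus_iff g).2 (b.hasGenus hw)⟩⟩
    rw [Finset.univ_eq_empty, Finset.sum_empty, mul_zero]
  · rw [average_apply, A.degProj_of_mem G _ ht, if_neg fun h => hj (by omega)]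
    simp
  · have hf : f.IsIso := ⟨hV, hE⟩
    rw [average_apply, average_apply, Finset.mul_sum, Fintype.card_of_bijective hE]
    refine Finset.sum_congr rfl fun b _ => ?_
    rw [mul_left_comm]
    congr 1
    rw [Finset.mul_sum]
    -- Precomposition with the isomorphism `f` is a bijection of the index sets, which multiplies
    -- the sign by that of `f`.
    let F : Isos H (f.onL.trans ρ) b → Isos G ρ b := fun h => ⟨h.1.comp f, hf.comp h.2.1, h.2.2⟩
    refine Fintype.sum_bijective (M := k) F ⟨?_, ?_⟩ _ _ ?_
    · exact fun h h' hh => Subtype.ext (hf.comp_injective (congrArg Subtype.val hh))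
    · rintro ⟨h, hh, hl⟩
      obtain ⟨h', rfl, hh'⟩ := hf.exists_comp_eq hh
      exact ⟨⟨h', hh', hl⟩, rfl⟩
    · intro h
      rw [Hom.edgeSign_comp k hf h.2.1, A.mapHom_comp, A.mapHom_degProj f]
      rw [← mul_assoc, mul_comm (f.edgeSign k), mul_assoc (h.1.edgeSign k), Hom.edgeSign_mul_self, mul_one]

/-- The values of a family on the labelled graphs. -/
noncomputable def restrict (w n : ℕ) : A.Family (Fin n) →ₗ[k] A.Coords w n where
  toFun φ b := φ b.graph b.lab
  map_add' _ _ := rfl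
  map_smul' _ _ := rfl

/-- A cochain of degree `i` sees only the part of `A((G))` of degree `-i - |E|`: dualizing reverses
the degree, and `Det` is in degree `-|E|`. -/
theorem apply_degProj {g : ℕ} {I : Type} {i : ℤ} {φ : A.Family I} (hφ : A.IsCochain g I i φ) (G : Graph) (ρ : G.L ≃ I)
    (t : A.tens G) : φ G ρ (A.degProj G (-i - Fintype.card G.E) t) = φ G ρ t := by
  have h : φ G ρ t = ∑ j ∈ A.degRange G, φ G ρ (A.degProj G j t) := by
    rw [← map_sum, ← LinearMap.sum_apply, A.sum_degProj, LinearMap.id_apply]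
  have hne : ∀ j, j ≠ -i - Fintype.card G.E → φ G ρ (A.degProj G j t) = 0 := fun j hj =>
    hφ.degree G ρ j (fun hh => hj (by omega)) _ (A.degProj_mem G j t)
  rw [h]
  by_cases hj : -i - (Fintype.card G.E : ℤ) ∈ A.degRange G
  · rw [Finset.sum_eq_single _ (fun j _ hj => hne j hj) fun h => absurd hj h]
  · rw [A.degProj_eq_zero G hj, LinearMap.zero_apply, map_zero]
    exact (Finset.sum_eq_zero fun j hj' => hne j fun h => hj (h ▸ hj')).symm

/-- By naturality every isomorphism to a labelled graph returns the value of `φ` at `G`, and by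
`sum_card_isos` the weights add up to one. For an unstable graph `A((G))` is zero, so nothing has to
be shown. -/
theorem average_restrict [CharZero k] {g : ℕ} (hw : 2 * g + n = w + 2) {i : ℤ} {φ : A.Family (Fin n)}
    (hφ : A.IsCochain g (Fin n) i φ) : A.average i (A.restrict w n φ) = φ := by
  funext G ρ
  by_cases hG : G.Connected ∧ G.HasGenus g
  swap
  · rw [hφ.genus G ρ hG, (A.isCochain_average hw i _).genus G ρ hG]
  by_cases hs : G.IsStable
  swap
  · rw [IsStable] at hs
    push Not at hs
    obtain ⟨v, hv⟩ := hs
    exact A.tens_hom_eq_of_unstable (Nat.le_of_lt_succ hv) _ _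
  refine LinearMap.ext fun t => ?_
  rw [average_apply]
  have h1 : ∀ (b : LabelledGraph w n) (h : Isos G ρ b),
      h.1.edgeSign k * A.restrict w n φ b (A.mapHom h.1 (A.degProj G (-i - Fintype.card G.E) t)) = φ G ρ t := by
    intro b h
    have h2 := hφ.natural h.1 h.2.1.1 h.2.1.2 ρ (A.degProj G (-i - Fintype.card G.E) t)
    rw [h.2.2, A.apply_degProj hφ] at h2
    change h.1.edgeSign k * φ b.graph b.lab _ = _
    rw [h2, ← mul_assoc, Hom.edgeSign_mul_self, one_mul]
  simp only [h1, Finset.sum_const, Finset.card_univ, nsmul_eq_mul]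
  refine Eq.trans ?_ (one_mul (φ G ρ t))
  rw [← sum_card_isos (k := k) hs hG.1 hG.2 ρ hw, Finset.sum_mul]
  exact Finset.sum_congr rfl fun b _ => (mul_assoc _ _ _).symm

/-- The map from families on labelled graphs to cochains. -/
noncomputable def averageCochain {g : ℕ} (hw : 2 * g + n = w + 2) (i : ℤ) : A.Coords w n →ₗ[k] A.cochain g (Fin n) i :=
  (A.average i).codRestrict _ fun ψ => A.isCochain_average hw i ψ

/-- The values of a cochain on the labelled graphs. -/
noncomputable def restrictCochain (w : ℕ) (g : ℕ) (i : ℤ) : A.cochain g (Fin n) i →ₗ[k] A.Coords w n :=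
  A.restrict w n ∘ₗ (A.cochain g (Fin n) i).subtype

theorem averageCochain_restrictCochain [CharZero k] {g : ℕ} (hw : 2 * g + n = w + 2) (i : ℤ) (φ : A.cochain g (Fin n) i) :
    A.averageCochain hw i (A.restrictCochain w g i φ) = φ :=
  Subtype.ext (A.average_restrict hw φ.2)

theorem finite_cochain [CharZero k] {g : ℕ} (hw : 2 * g + n = w + 2) (i : ℤ) : Module.Finite k (A.cochain g (Fin n) i) :=
  Module.Finite.of_injective (A.restrictCochain w g i)
    (Function.LeftInverse.injective (A.averageCochain_restrictCochain hw i))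

/-- The degrees of cochains. -/
noncomputable def cochainDegrees (w n : ℕ) : Finset ℤ :=
  Finset.univ.biUnion fun b : LabelledGraph w n => (A.degRange b.graph).image fun j => -j - Fintype.card b.graph.E

theorem degProj_eq_zero_of_notMem {i : ℤ} (hi : i ∉ A.cochainDegrees w n) (b : LabelledGraph w n) :
    A.degProj b.graph (-i - Fintype.card b.graph.E) = 0 := by
  refine A.degProj_eq_zero _ fun h => hi ?_
  refine Finset.mem_biUnion.2 ⟨b, Finset.mem_univ b, Finset.mem_image.2 ⟨_, h, ?_⟩⟩
  ring

theorem subsingleton_cochain [CharZero k] {g : ℕ} (hw : 2 * g + n = w + 2) {i : ℤ} (hi : i ∉ A.cochainDegrees w n) :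
    Subsingleton (A.cochain g (Fin n) i) := by
  have h0 : ∀ φ : A.cochain g (Fin n) i, A.restrictCochain w g i φ = 0 := fun φ => funext fun b => LinearMap.ext fun t => by
    change φ.1 b.graph b.lab t = 0
    rw [← A.apply_degProj φ.2, A.degProj_eq_zero_of_notMem hi, LinearMap.zero_apply, map_zero]
  exact ⟨fun φ φ' => Function.LeftInverse.injective (A.averageCochain_restrictCochain hw i) ((h0 φ).trans (h0 φ').symm)⟩

/-- In each degree the cochains embed in the finite-dimensional space of coordinates on labelled
graphs, and only finitely many degrees occur. -/
theorem finite_feynman [CharZero k] (g n : ℕ) : Module.Finite k (A.feynman.tot g (Fin n)) := by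
  classical
  by_cases hs : 2 * g + n ≤ 2
  · have : Subsingleton (A.feynman.tot g (Fin n)) :=
      ⟨fun x y => DFinsupp.ext fun i => (A.feynman.stable g (Fin n) i (by rwa [Nat.card_fin])).elim _ _⟩
    infer_instance
  obtain ⟨w, hw⟩ : ∃ w, 2 * g + n = w + 2 := ⟨2 * g + n - 2, by omega⟩
  have : ∀ i, Module.Finite k (A.feynman.obj g (Fin n) i) := fun i => A.finite_cochain hw i
  let F : (∀ i : A.cochainDegrees w n, A.feynman.obj g (Fin n) i.1) →ₗ[k] A.feynman.tot g (Fin n) :=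
    ∑ i : A.cochainDegrees w n, A.feynman.incl g (Fin n) i.1 ∘ₗ LinearMap.proj i
  have hF : ∀ i x, A.feynman.incl g (Fin n) i x ∈ LinearMap.range F := by
    intro i x
    by_cases hi : i ∈ A.cochainDegrees w n
    · refine ⟨Pi.single ⟨i, hi⟩ x, ?_⟩
      rw [LinearMap.sum_apply, Finset.sum_eq_single ⟨i, hi⟩]
      · rw [LinearMap.comp_apply, LinearMap.proj_apply, Pi.single_eq_same]
      · intro j _ hj
        rw [LinearMap.comp_apply, LinearMap.proj_apply, Pi.single_eq_of_ne hj, map_zero]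
      · exact fun h => absurd (Finset.mem_univ _) h
    · have : Subsingleton (A.feynman.obj g (Fin n) i) := A.subsingleton_cochain hw hi
      rw [Subsingleton.elim x 0, map_zero]
      exact Submodule.zero_mem _
  refine Module.Finite.of_surjective F (LinearMap.range_eq_top.1 ?_)
  have h : (LinearMap.range F).mkQ = 0 := A.feynman.tot_ext fun i x => by
    rw [LinearMap.zero_apply, Submodule.mkQ_apply, Submodule.Quotient.mk_eq_zero]
    exact hF i x
  rw [← Submodule.ker_mkQ (LinearMap.range F), h, LinearMap.ker_zero]

/-- By the retraction the trace may be taken on the coordinates, where only diagonal blocks matter.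
The block of `b` averages over the automorphisms of the graph that act on the numbered legs as `σ`,
and a transpose has the same trace. -/
theorem trace_feynman_map [CharZero k] {g : ℕ} (hw : 2 * g + n = w + 2) (σ : Equiv.Perm (Fin n)) (i : ℤ) :
    LinearMap.trace k (A.feynman.obj g (Fin n) i) (A.feynman.map σ i)
      = ∑ b : LabelledGraph w n, ((b.1 : ℕ).factorial : k)⁻¹ * ∑ h : Isos b.graph (b.lab.trans σ.symm) b,
        h.1.edgeSign k * LinearMap.trace k (A.tens b.graph)
          (A.mapHom h.1 ∘ₗ A.degProj b.graph (-i - Fintype.card b.graph.E)) := by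
  classical
  let T : A.cochain g (Fin n) i →ₗ[k] A.cochain g (Fin n) i := A.feynman.map σ i
  have h0 : LinearMap.trace k (A.cochain g (Fin n) i) T
      = LinearMap.trace k (A.Coords w n) (A.restrictCochain (n := n) w g i ∘ₗ T ∘ₗ A.averageCochain hw i) :=
    trace_eq_of_retract (V := A.cochain g (Fin n) i) (W := A.Coords w n) (A.restrictCochain (n := n) w g i) (A.averageCochain hw i)
      (A.averageCochain_restrictCochain hw i) T
  refine (h0.trans (trace_pi _)).trans ?_
  refine Finset.sum_congr rfl fun b _ => ?_
  have h1 : LinearMap.proj b ∘ₗ (A.restrictCochain (n := n) w g i ∘ₗ T ∘ₗ A.averageCochain hw i) ∘ₗ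
      LinearMap.single k (fun b : LabelledGraph w n => Module.Dual k (A.tens b.graph)) b
      = ((b.1 : ℕ).factorial : k)⁻¹ • ∑ h : Isos b.graph (b.lab.trans σ.symm) b, h.1.edgeSign k •
        Module.Dual.transpose (A.mapHom h.1 ∘ₗ A.degProj b.graph (-i - Fintype.card b.graph.E)) := by
    refine LinearMap.ext fun ψ => LinearMap.ext fun t => ?_
    -- The action of `σ` on families appears as the altered numbering of the legs at which the
    -- average is evaluated.
    change A.average i (Pi.single b ψ) b.graph (b.lab.trans σ.symm) t = _
    rw [average_apply, Finset.sum_eq_single b]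
    · simp [Pi.single_eq_same, LinearMap.sum_apply, Module.Dual.transpose_apply]
    · intro b' _ hb
      rw [Pi.single_eq_of_ne hb]
      simp
    · exact fun h => absurd (Finset.mem_univ _) h
  rw [h1, map_smul, map_sum, smul_eq_mul]
  congr 1
  refine Finset.sum_congr rfl fun h _ => ?_
  rw [map_smul, LinearMap.trace_transpose', smul_eq_mul]

/-- With `i = -j - |E|` the sign `(-1) ^ i` splits into `(-1) ^ |E|` and `(-1) ^ j`; the latter,
summed against the projections to degree `j`, produces the sign operator on `A((G))`. -/
theorem character_feynman [CharZero k] {g : ℕ} (hw : 2 * g + n = w + 2) (σ : Equiv.Perm (Fin n)) :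
    A.feynman.character g (Fin n) σ
      = ∑ b : LabelledGraph w n, ((b.1 : ℕ).factorial : k)⁻¹ * ∑ h : Isos b.graph (b.lab.trans σ.symm) b,
        h.1.edgeSign k * ((-1) ^ Fintype.card b.graph.E * LinearMap.trace k (A.tens b.graph)
          (A.mapHom h.1 ∘ₗ PiTensorProduct.map fun v => A.totSign (b.graph.genus v) (b.graph.Star v))) := by
  have := A.finite_feynman g n
  rw [A.feynman.character_eq, finsum_eq_sum_of_support_subset (s := A.cochainDegrees w n)]
  swap
  · intro i hi
    by_contra h
    refine hi ?_
    change (-1 : k) ^ i * _ = 0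
    rw [A.trace_feynman_map hw, Finset.sum_eq_zero, mul_zero]
    intro b _
    rw [A.degProj_eq_zero_of_notMem h b]
    simp
  simp only [A.trace_feynman_map hw, Finset.mul_sum]
  rw [Finset.sum_comm]
  refine Finset.sum_congr rfl fun b _ => ?_
  rw [Finset.sum_comm]
  refine Finset.sum_congr rfl fun h _ => ?_
  have key : ∑ i ∈ A.cochainDegrees w n, (-1 : k) ^ i * LinearMap.trace k (A.tens b.graph)
        (A.mapHom h.1 ∘ₗ A.degProj b.graph (-i - Fintype.card b.graph.E))
      = (-1) ^ Fintype.card b.graph.E * LinearMap.trace k (A.tens b.graph)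
          (A.mapHom h.1 ∘ₗ PiTensorProduct.map fun v => A.totSign (b.graph.genus v) (b.graph.Star v)) := by
    let F : ℤ → ℤ := fun j => -j - Fintype.card b.graph.E
    have hF : Function.Injective F := fun j j' hj => by simpa [F] using hj
    have h1 : A.mapHom h.1 ∘ₗ (∑ j ∈ A.degRange b.graph, degSign k j • A.degProj b.graph j)
        = ∑ j ∈ A.degRange b.graph, degSign k j • (A.mapHom h.1 ∘ₗ A.degProj b.graph j) := by
      refine LinearMap.ext fun t => ?_
      simp only [LinearMap.comp_apply, LinearMap.sum_apply, LinearMap.smul_apply, map_sum, map_smul]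
    rw [A.map_totSign_eq, h1, map_sum, Finset.mul_sum,
      ← Finset.sum_subset (s₁ := (A.degRange b.graph).image F), Finset.sum_image hF.injOn]
    · refine Finset.sum_congr rfl fun j _ => ?_
      rw [show -F j - (Fintype.card b.graph.E : ℤ) = j by simp only [F]; ring, map_smul,
        smul_eq_mul, degSign_eq_zpow, ← mul_assoc]
      congr 1
      simp only [F]
      rw [sub_eq_add_neg, zpow_add₀ (neg_ne_zero.2 one_ne_zero), mul_comm, ← zpow_natCast]
      have h1 : ∀ m : ℤ, (-1 : k) ^ (-m) = (-1) ^ m := fun m => by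
        rw [zpow_neg, ← inv_zpow, inv_neg_one]
      rw [h1, h1]
    · exact fun i hi => Finset.mem_biUnion.2 ⟨b, Finset.mem_univ b, hi⟩
    · intro i _ hi
      rw [A.degProj_eq_zero, LinearMap.comp_zero, map_zero, mul_zero]
      refine fun hj => hi (Finset.mem_image.2 ⟨_, hj, ?_⟩)
      simp only [F]
      ring
  rw [← key, Finset.mul_sum, Finset.mul_sum]
  refine Finset.sum_congr rfl fun i _ => ?_
  ring

end ModularOperad

end ModularOperads

/-! ### Orbits of legs and of edges -/

namespace ModularOperads

open Equiv.Perm Sum ModularOperads.Graph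

section ClassProducts

variable {X Y Z M : Type*} [CommMonoid M] {R : Setoid X} {S : Setoid Y} {T : Setoid Z}

theorem classProd_of_support [Finite X] [Finite Z] (φ : X → Z) (hφ : ∀ x x', R x x' ↔ T (φ x) (φ x')) {u : Z → M}
    (hu : ∀ z z', T z z' → u z = u z') (hs : ∀ z, (∃ x, T (φ x) z) ∨ u z = 1) :
    classProd T u = classProd R fun x => u (φ x) := by
  let N := {z : Z // ∀ x, ¬ T (φ x) z}
  rw [classProd_sum (R := R) (S := T.comap (Subtype.val : N → Z)) φ Subtype.val hφ (fun _ _ => Iff.rfl)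
    (fun x y h => y.2 x h) (fun z => ?_) hu]
  · rw [classProd_congr (u := fun y : N => u y.1) (v := fun _ => 1) fun y => (hs y.1).resolve_left fun ⟨x, hx⟩ => y.2 x hx,
      classProd_one, mul_one]
  · by_cases hz : ∃ x, T (φ x) z
    · exact Or.inl hz
    · push Not at hz
      exact Or.inr ⟨⟨z, hz⟩, T.refl z⟩

theorem classProd_sum_of_support [Finite X] [Finite Y] [Finite Z] (φ : X → Z) (ψ : Y → Z)
    (hφ : ∀ x x', R x x' ↔ T (φ x) (φ x')) (hψ : ∀ y y', S y y' ↔ T (ψ y) (ψ y'))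
    (hd : ∀ x y, ¬ T (φ x) (ψ y)) {u : Z → M} (hu : ∀ z z', T z z' → u z = u z')
    (hs : ∀ z, (∃ x, T (φ x) z) ∨ (∃ y, T (ψ y) z) ∨ u z = 1) :
    classProd T u = classProd R (fun x => u (φ x)) * classProd S (fun y => u (ψ y)) := by
  let N := {z : Z // ∀ x, ¬ T (φ x) z}
  rw [classProd_sum (R := R) (S := T.comap (Subtype.val : N → Z)) φ Subtype.val hφ (fun _ _ => Iff.rfl)
    (fun x y h => y.2 x h) (fun z => ?_) hu]
  · congr 1
    exact classProd_of_support (fun y => (⟨ψ y, fun x => hd x y⟩ : N)) hψ (fun z z' h => hu _ _ h)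
      fun z => (hs z.1).resolve_left fun ⟨x, hx⟩ => z.2 x hx
  · by_cases hz : ∃ x, T (φ x) z
    · exact Or.inl hz
    · push Not at hz
      exact Or.inr ⟨⟨z, hz⟩, T.refl z⟩

end ClassProducts

section Permutations

variable {X Y : Type*} {φ : X → Y} {σ : Equiv.Perm X} {π : Equiv.Perm Y}

theorem sameCycle_comp (hφ : Function.Injective φ) (h : ∀ x, φ (σ x) = π (φ x)) (x x' : X) :
    SameCycle σ x x' ↔ SameCycle π (φ x) (φ x') := by
  have h1 : ∀ n : ℕ, ∀ x, φ ((σ ^ n) x) = (π ^ n) (φ x) := by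
    intro n
    induction n with
    | zero => intro x; rfl
    | succ n ih => intro x; rw [pow_succ, pow_succ, Equiv.Perm.mul_apply, Equiv.Perm.mul_apply, ih, h]
  have h2 : ∀ n : ℤ, ∀ x, φ ((σ ^ n) x) = (π ^ n) (φ x) := by
    intro n x
    obtain ⟨m, rfl | rfl⟩ := n.eq_nat_or_neg
    · rw [zpow_natCast, zpow_natCast, h1]
    · rw [zpow_neg, zpow_neg, zpow_natCast, zpow_natCast, eq_comm, Equiv.Perm.inv_eq_iff_eq, ← h1]
      rw [← Equiv.Perm.mul_apply, mul_inv_cancel, Equiv.Perm.one_apply]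
  exact exists_congr fun n => by rw [← h2, hφ.eq_iff]

theorem period_inv (π : Equiv.Perm Y) (y : Y) : period π⁻¹ y = period π y := by
  refine period_eq_of_forall fun n => ?_
  rw [inv_pow, Equiv.Perm.inv_eq_iff_eq, eq_comm]

theorem period_comp_inv (hφ : Function.Injective φ) (h : ∀ x, π (φ (σ x)) = φ x) (x : X) : period π (φ x) = period σ x := by
  rw [← period_inv]
  exact period_comp φ hφ (fun x => by rw [eq_comm, Equiv.Perm.inv_eq_iff_eq, h]) x

theorem sameCycle_comp_inv (hφ : Function.Injective φ) (h : ∀ x, π (φ (σ x)) = φ x) (x x' : X) :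
    SameCycle σ x x' ↔ SameCycle π (φ x) (φ x') := by
  rw [← sameCycle_inv (f := π)]
  exact sameCycle_comp hφ (fun x => by rw [eq_comm, Equiv.Perm.inv_eq_iff_eq, h]) x x'

variable {F : Set Y} {ι : Y → Y}

theorem IsPairing.comm_pow (h : IsPairing π F ι) (m : ℕ) (y : Y) : ι ((π ^ m) y) = (π ^ m) (ι y) := by
  rw [← zpow_natCast, h.comm_zpow]

/-- The number `edgeCount` is the length of the orbit of the edge `{y, ι y}`: its multiples are the
powers that preserve this edge, possibly exchanging the halves. -/
theorem IsPairing.edgeCount_dvd_iff [Finite Y] (h : IsPairing π F ι) {y : Y} (hy : ι y ≠ y) (m : ℕ) :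
    edgeCount π ι y ∣ m ↔ (π ^ m) y = y ∨ (π ^ m) y = ι y := by
  rw [edgeCount]
  split_ifs with hc
  swap
  · rw [← pow_apply_eq_self_iff, or_iff_left]
    intro hm
    exact hc (hm ▸ sameCycle_pow_right.2 SameCycle.rfl)
  -- With period `2 q` and `ι y = π ^ a y`, the exponent `a` is an odd multiple of `q`: `ι` is an
  -- involution, and `ι y` differs from `y`.
  obtain ⟨a, ha⟩ := hc.exists_nat_pow_eq
  have h1 : period π y ∣ a * 2 := by
    rw [← pow_apply_eq_self_iff, mul_two, pow_add, Equiv.Perm.mul_apply, ha, ← h.comm_pow, ha, h.invol]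
  have h2 : ¬ period π y ∣ a := by
    rw [← pow_apply_eq_self_iff, ha]
    exact hy
  have h3 : 2 ∣ period π y := by
    by_contra hn
    exact h2 (((Nat.prime_two.coprime_iff_not_dvd.2 hn).symm).dvd_of_dvd_mul_right h1)
  obtain ⟨q, hq⟩ := h3
  have hm1 : (π ^ m) y = y ↔ 2 * q ∣ m := by rw [pow_apply_eq_self_iff, hq]
  have hm2 : (π ^ m) y = ι y ↔ m ≡ a [MOD 2 * q] := by rw [← ha, pow_apply_eq_pow_iff, hq]
  rw [hm1, hm2, hq, Nat.mul_div_cancel_left q two_pos]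
  rw [hq] at h1 h2
  have h4 : q ∣ a := Nat.dvd_of_mul_dvd_mul_left two_pos (by rwa [mul_comm 2 a])
  constructor
  · rintro ⟨t, rfl⟩
    obtain ⟨b, rfl⟩ := h4
    rw [mul_comm 2 q] at h2 ⊢
    have hb : ¬ 2 ∣ b := fun hb => h2 (Nat.mul_dvd_mul_left q hb)
    by_cases ht : 2 ∣ t
    · exact Or.inl (Nat.mul_dvd_mul_left q ht)
    · refine Or.inr (Nat.ModEq.mul_left' q ?_)
      have : t % 2 = b % 2 := by omega
      exact this
  · rintro (hd | hd)
    · exact (Dvd.intro_left 2 rfl).trans hd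
    · exact ((Nat.ModEq.dvd_iff hd (Dvd.intro_left 2 rfl)).2 h4)

theorem IsPairing.pow_cover (h : IsPairing π F ι) (hσ : ∀ x, π (φ (σ x)) = φ x ∨ π (φ (σ x)) = ι (φ x)) (n : ℕ) (x : X) :
    (π ^ n) (φ ((σ ^ n) x)) = φ x ∨ (π ^ n) (φ ((σ ^ n) x)) = ι (φ x) := by
  induction n generalizing x with
  | zero => exact Or.inl rfl
  | succ n ih =>
    rw [pow_succ, pow_succ' σ, Equiv.Perm.mul_apply, Equiv.Perm.mul_apply]
    rcases hσ ((σ ^ n) x) with h2 | h2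
    · rw [h2]
      exact ih x
    · rw [h2, ← h.comm_pow]
      rcases ih x with h3 | h3
      · exact Or.inr (by rw [h3])
      · exact Or.inl (by rw [h3, h.invol])

theorem IsPairing.pow_eq_of_cover (h : IsPairing π F ι) (hφ : Function.Injective φ) (hd : ∀ x x', φ x ≠ ι (φ x'))
    (hσ : ∀ x, π (φ (σ x)) = φ x ∨ π (φ (σ x)) = ι (φ x)) {n : ℕ} {x x' : X}
    (hn : (π ^ n) (φ x') = φ x ∨ (π ^ n) (φ x') = ι (φ x)) : (σ ^ n) x = x' := by
  have h3 : (π ^ n) (φ ((σ ^ n) x)) = (π ^ n) (φ x') ∨ (π ^ n) (φ ((σ ^ n) x)) = (π ^ n) (ι (φ x')) := by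
    rw [← h.comm_pow]
    rcases h.pow_cover hσ n x with h3 | h3 <;> rcases hn with h4 | h4 <;> rw [h3, h4]
    · exact Or.inl rfl
    · exact Or.inr (h.invol _).symm
    · exact Or.inr rfl
    · exact Or.inl rfl
  rcases h3 with h3 | h3
  · exact hφ ((π ^ n).injective h3)
  · exact absurd ((π ^ n).injective h3) (hd _ _)

/-- Here `X` is a set of edges, `φ` selects one half of each, and `σ` is the action on edges inverse
to `π`, known on halves only up to `ι`. Returning to an edge means returning to one of its two
halves. -/
theorem period_eq_edgeCount [Finite Y] (h : IsPairing π F ι) {x : X} (hφ : Function.Injective φ)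
    (hne : ∀ x, ι (φ x) ≠ φ x) (hd : ∀ x x', φ x ≠ ι (φ x'))
    (hσ : ∀ x, π (φ (σ x)) = φ x ∨ π (φ (σ x)) = ι (φ x)) : period σ x = edgeCount π ι (φ x) := by
  have h1 := h.pow_cover hσ
  have h2 : ∀ n : ℕ, (σ ^ n) x = x ↔ edgeCount π ι (φ x) ∣ n := by
    intro n
    rw [h.edgeCount_dvd_iff (hne x)]
    constructor
    · intro hn
      have := h1 n x
      rwa [hn] at this
    · intro hn
      exact h.pow_eq_of_cover hφ hd hσ hn
  refine Nat.dvd_antisymm ?_ ?_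
  · rw [← pow_apply_eq_self_iff, h2]
  · rw [← h2, pow_period]

theorem sameCycle_iff_glue [Finite Y] [Finite X] (h : IsPairing π F ι) {x x' : X} (hφ : Function.Injective φ)
    (hd : ∀ x x', φ x ≠ ι (φ x'))
    (hσ : ∀ x, π (φ (σ x)) = φ x ∨ π (φ (σ x)) = ι (φ x)) : SameCycle σ x x' ↔ glue π ι (φ x) (φ x') := by
  have h1 := h.pow_cover hσ
  rw [h.glue_iff]
  constructor
  · intro hc
    obtain ⟨n, rfl⟩ := hc.exists_nat_pow_eq
    rcases h1 n x with h2 | h2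
    · exact Or.inl (h2 ▸ sameCycle_pow_left.2 SameCycle.rfl)
    · exact Or.inr (h2 ▸ sameCycle_pow_left.2 SameCycle.rfl)
  · intro hc
    have h3 : ∃ n : ℕ, (π ^ n) (φ x') = φ x ∨ (π ^ n) (φ x') = ι (φ x) := by
      rcases hc with hc | hc
      · obtain ⟨n, hn⟩ := hc.symm.exists_nat_pow_eq
        exact ⟨n, Or.inl hn⟩
      · obtain ⟨n, hn⟩ := hc.symm.exists_nat_pow_eq
        exact ⟨n, Or.inr hn⟩
    obtain ⟨n, hn⟩ := h3
    refine ⟨n, ?_⟩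
    rw [zpow_natCast]
    exact h.pow_eq_of_cover hφ hd hσ hn

end Permutations

end ModularOperads

/-! ### The weight for `x = -1` as a signed supertrace -/

namespace ModularOperads

open Equiv.Perm Sum ModularOperads.Graph

section Laurent

variable {k : Type u} [Field k]

theorem hbar_zero : (hbar 0 : LambdaPoly k) = 1 := by
  simp [hbar]

theorem hbar_add (a b : ℤ) : (hbar (a + b) : LambdaPoly k) = hbar a * hbar b := by
  rw [hbar, hbar, hbar, LaurentPolynomial.T_add, map_mul]

theorem hbar_pow (a : ℤ) (n : ℕ) : (hbar a : LambdaPoly k) ^ n = hbar (n * a) := by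
  induction n with
  | zero => rw [pow_zero, Nat.cast_zero, zero_mul, hbar_zero]
  | succ n ih => rw [pow_succ, ih, ← hbar_add]; congr 1; push_cast; ring

theorem prod_hbar {ι : Type*} (s : Finset ι) (a : ι → ℤ) : ∏ v ∈ s, (hbar (a v) : LambdaPoly k) = hbar (∑ v ∈ s, a v) := by
  classical
  induction s using Finset.induction_on with
  | empty => rw [Finset.prod_empty, Finset.sum_empty, hbar_zero]
  | insert i s hi ih => rw [Finset.prod_insert hi, Finset.sum_insert hi, ih, hbar_add]

theorem classProd_smul {X : Type*} [Finite X] {R : Setoid X} (a : X → k) (u : X → LambdaPoly k) :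
    classProd R (fun x => a x • u x) = classProd R a • classProd R u := by
  simp only [Algebra.smul_def]
  rw [classProd_mul]
  congr 1
  exact (map_classProd (algebraMap k (LambdaPoly k)).toMonoidHom a).symm

end Laurent

namespace ZGraph

variable {X : Type} [Fintype X] [LinearOrder X] {k : Type u} [Field k] {s : ZGraph X} {h : s.toGraph.Hom s.toGraph}

/-- `h` is the automorphism of the graph which is given by the permutation of `s`. -/
structure IsAut (s : ZGraph X) (h : s.toGraph.Hom s.toGraph) : Prop where
  iso : h.IsIso
  onV : ∀ v, (h.onV v).1 = s.π v.1
  onF : ∀ a, s.flagVal a = s.π (s.flagVal (h.onF a))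

namespace IsAut

theorem onF_iterate (hs : s.IsAut h) (n : ℕ) (a : s.toGraph.Flag) : s.flagVal a = (s.π ^ n) (s.flagVal (h.onF^[n] a)) := by
  induction n generalizing a with
  | zero => rfl
  | succ n ih => rw [Function.iterate_succ_apply, pow_succ', Equiv.Perm.mul_apply, ← ih, ← hs.onF]

/-- On flags `onF` is inverse to `π`, so a permutation inverse to the iterate of `onF` is the
first-return permutation by `π`. -/
theorem character_starPerm (hs : s.IsAut h) {c : ∀ (_ : ℕ) (I : Type) [Finite I], Equiv.Perm I → k} (hc : IsClassFunction c)
    (v : s.toGraph.V) (e : Equiv.Perm (s.toGraph.Star v))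
    (he : ∀ a, h.onF^[period (Graph.Hom.vertPerm hs.iso) v] (e a).1 = a.1) :
    c (s.g v.1) (s.Star v.1) (s.starPerm v.1) = c (s.toGraph.genus v) (s.toGraph.Star v) e := by
  have hp : period s.π v.1 = period (Graph.Hom.vertPerm hs.iso) v :=
    period_comp Subtype.val Subtype.val_injective (fun v => hs.onV v) v
  have h1 : ∀ a : s.toGraph.Star v, s.r (s.flagVal a.1) = v.1 := fun a => by
    rw [← vert_val]
    exact congrArg Subtype.val a.2
  let f : s.toGraph.Star v ≃ s.Star v.1 := Equiv.ofBijective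
    (fun a => ⟨s.flagVal a.1, h1 a, fun hh => s.r_flagVal_ne a.1 ((h1 a).trans hh.symm)⟩) (by
      constructor
      · exact fun a b hab => Subtype.ext (s.flagVal_injective (congrArg Subtype.val hab))
      · rintro ⟨y, hy, hy'⟩
        obtain ⟨a, rfl⟩ := s.exists_flagVal (f := y) (fun hh => hy' (hh.symm.trans hy))
        exact ⟨⟨a, Subtype.ext ((s.vert_val a).trans hy)⟩, rfl⟩)
  refine (hc _ _ _ f e _ fun a => Subtype.ext ?_).symm
  rw [s.starPerm_val, hp]
  change s.flagVal (e a).1 = (s.π ^ _) (s.flagVal a.1)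
  rw [hs.onF_iterate (period (Graph.Hom.vertPerm hs.iso) v) (e a).1, he]

/-- The exponent `period * (g - 1)` of an orbit distributes `g - 1` to each of its vertices. -/
theorem vertProd_eq (hs : s.IsAut h) {c : ∀ (_ : ℕ) (I : Type) [Finite I], Equiv.Perm I → k} (hc : IsClassFunction c)
    (e : ∀ v, Equiv.Perm (s.toGraph.Star v))
    (he : ∀ v a, h.onF^[period (Graph.Hom.vertPerm hs.iso) v] (e v a).1 = a.1) :
    s.vertProd c = (classProd (SameCycle.setoid (Graph.Hom.vertPerm hs.iso)) fun v =>
        c (s.toGraph.genus v) (s.toGraph.Star v) (e v)) • hbar (∑ v, ((s.toGraph.genus v : ℤ) - 1)) := by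
  let φ : s.toGraph.V → X := fun v => v.1
  have hφ : Function.Injective φ := Subtype.val_injective
  have hσ : ∀ v, φ (Graph.Hom.vertPerm hs.iso v) = s.π (φ v) := hs.onV
  have h1 : s.vertProd c = classProd (SameCycle.setoid (Graph.Hom.vertPerm hs.iso)) fun v => s.vertWeight c v.1 :=
    classProd_of_support (R := SameCycle.setoid (Graph.Hom.vertPerm hs.iso)) φ
      (sameCycle_comp hφ hσ) (ZGraph.vertWeight_of_sameCycle _ hc) fun z => by
        by_cases hz : s.r z = z
        · exact Or.inl ⟨⟨z, hz⟩, SameCycle.rfl⟩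
        · exact Or.inr (if_neg hz)
  have h2 : ∏ v : s.toGraph.V, (hbar ((s.toGraph.genus v : ℤ) - 1) : LambdaPoly k)
      = classProd (SameCycle.setoid (Graph.Hom.vertPerm hs.iso)) fun v =>
        hbar ((s.toGraph.genus v : ℤ) - 1) ^ period (Graph.Hom.vertPerm hs.iso) v := by
    refine prod_eq_classProd fun v v' hv => ?_
    obtain ⟨n, hn⟩ := ((sameCycle_comp hφ hσ v v').1 hv).exists_nat_pow_eq
    have hg : s.toGraph.genus v' = s.toGraph.genus v := (congrArg s.g hn).symm.trans (s.g_pow n v.1)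
    rw [hg]
  rw [h1, ← prod_hbar, h2, ← classProd_smul]
  refine classProd_congr fun v => ?_
  rw [FlagSpace.vertWeight, if_pos v.2, hs.character_starPerm hc v (e v) (he v), hbar_pow,
    ← period_comp φ hφ hσ v]
  rfl

/-- Each orbit of edges contributes `-1` and one `ħ` per edge. The product of these signs is the
sign of the permutation of the edges times `(-1) ^ |E|`, which is how the determinant and the degree
shift of the Feynman transform enter. -/
theorem legWeight_eq (hs : s.IsAut h) :
    classProd (glue s.π s.ι) (s.legWeight (-1 : k))
      = ((h.edgeSign k * (-1) ^ Fintype.card s.toGraph.E) • hbar (Fintype.card s.toGraph.E)) *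
        classProd (SameCycle.setoid (h.onL : Equiv.Perm s.toGraph.L)) (cycleVar k (h.onL : Equiv.Perm s.toGraph.L)) := by
  let σ : Equiv.Perm s.toGraph.E := Equiv.ofBijective h.onE hs.iso.2
  let φ : s.toGraph.L → X := fun l => l.1
  let ψ : s.toGraph.E → X := fun e => e.1
  have hφ : Function.Injective φ := Subtype.val_injective
  have hψ : Function.Injective ψ := Subtype.val_injective
  have hL : ∀ l : s.toGraph.L, s.π (φ (h.onL l)) = φ l := fun l => (hs.onF (inl l)).symm
  -- Which alternative holds is told by `flip e`.
  have hE : ∀ e : s.toGraph.E, s.π (ψ (σ e)) = ψ e ∨ s.π (ψ (σ e)) = s.ι (ψ e) := by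
    intro e
    have h1 : ψ e = s.π (s.flagVal (inr (h.onE e, xor false (h.flip e)))) := hs.onF (inr (e, false))
    cases hf : h.flip e
    · rw [hf] at h1
      exact Or.inl h1.symm
    · rw [hf] at h1
      refine Or.inr ?_
      rw [h1]
      change _ = s.ι (s.π (s.ι (h.onE e).1))
      rw [s.pairing.comm, s.ι_ι]
      rfl
  have hne : ∀ e : s.toGraph.E, s.ι (ψ e) ≠ ψ e := fun e => e.2.2.ne'
  have hd : ∀ e e' : s.toGraph.E, ψ e ≠ s.ι (ψ e') := fun e e' hh => by
    have h1 : s.flagVal (inr (e, false)) = s.flagVal (inr (e', true)) := hh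
    simpa using s.flagVal_injective h1
  have hl : ∀ l : s.toGraph.L, s.ι (φ l) = φ l := fun l => l.2.2
  have hu := flagWeight_of_glue (x := (-1 : k)) s.π_mem_flags s.pairing
  have h1 : classProd (glue s.π s.ι) (s.legWeight (-1 : k))
      = classProd (SameCycle.setoid (h.onL : Equiv.Perm s.toGraph.L)) (fun l => s.legWeight (-1 : k) (φ l))
        * classProd (SameCycle.setoid σ) fun e => s.legWeight (-1 : k) (ψ e) := by
    refine classProd_sum_of_support φ ψ (fun l l' => ?_) (fun e e' => ?_) (fun l e hle => ?_) hu fun z => ?_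
    · refine (sameCycle_comp_inv hφ hL l l').trans ?_
      rw [s.pairing.glue_iff, hl l, or_self_iff]
    · exact sameCycle_iff_glue s.pairing hψ hd hE
    · rw [s.pairing.glue_iff, hl l, or_self_iff] at hle
      obtain ⟨n, hn⟩ := hle.exists_nat_pow_eq
      refine hne e ?_
      rw [← hn, s.pairing.comm_pow, hl]
    · by_cases hz : s.r z = z
      · exact Or.inr (Or.inr (if_neg fun hh => hh hz))
      rcases lt_trichotomy z (s.ι z) with hh | hh | hh
      · exact Or.inr (Or.inl ⟨⟨z, hz, hh⟩, (glue s.π s.ι).refl z⟩)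
      · exact Or.inl ⟨⟨z, hz, hh.symm⟩, (glue s.π s.ι).refl z⟩
      · refine Or.inr (Or.inl ⟨⟨s.ι z, s.r_ι_ne.2 hz, by rwa [s.ι_ι]⟩, ?_⟩)
        rw [s.pairing.glue_iff]
        exact Or.inr (by change SameCycle s.π (s.ι (s.ι z)) z; rw [s.ι_ι])
  have h2 : ∀ l : s.toGraph.L, s.legWeight (-1 : k) (φ l) = cycleVar k (h.onL : Equiv.Perm s.toGraph.L) l := by
    intro l
    rw [legWeight, flagWeight, if_pos (show φ l ∈ s.flags from l.2.1), if_pos (hl l), cycleVar, cycleVar,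
      period_comp_inv hφ hL]
  have h3 : ∀ e : s.toGraph.E, s.legWeight (-1 : k) (ψ e) = (-1 : k) • (hbar 1 : LambdaPoly k) ^ period σ e := by
    intro e
    rw [legWeight, flagWeight, if_pos (show ψ e ∈ s.flags from e.2.1), if_neg (hne e), hbar_pow, mul_one,
      period_eq_edgeCount s.pairing hψ hne hd hE]
  have h4 : classProd (SameCycle.setoid σ) (fun _ => (-1 : k)) = h.edgeSign k * (-1) ^ Fintype.card s.toGraph.E := by
    classical
    -- On a cycle of length `l` the left side gives `-(-1) ^ l * (-1) ^ l = -1`.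
    have h5 : inversionSign σ * (-1 : ℤˣ) ^ Fintype.card s.toGraph.E = classProd (SameCycle.setoid σ) fun _ => (-1 : ℤˣ) := by
      have h6 : (-1 : ℤˣ) ^ Fintype.card s.toGraph.E = ∏ _e : s.toGraph.E, (-1 : ℤˣ) := by simp
      rw [inversionSign_perm, ← classProd_eq_sign, h6, prod_eq_classProd (π := σ) (fun _ _ _ => rfl), ← classProd_mul]
      refine classProd_congr fun e => ?_
      rw [neg_mul, ← mul_pow]
      simp
    let φ : ℤˣ →* k := (Int.castRingHom k).toMonoidHom.comp (Units.coeHom ℤ)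
    have h7 := map_classProd (R := SameCycle.setoid σ) φ fun _ => (-1 : ℤˣ)
    rw [← h5, map_mul, map_pow] at h7
    have h8 : φ (-1) = -1 := by simp [φ]
    rw [h8] at h7
    rw [← h7, Hom.edgeSign_eq]
    rfl
  rw [h1, classProd_congr h2, classProd_congr h3, classProd_smul, h4, ← prod_eq_classProd (fun _ _ _ => rfl), mul_comm,
    prod_hbar]
  simp

end IsAut

end ZGraph

namespace ModularOperad

variable {k : Type u} [Field k] (A : ModularOperad.{u, w} k)
  {X : Type} [Fintype X] [LinearOrder X] {s : ZGraph X} {h : s.toGraph.Hom s.toGraph}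

theorem weight_eq (hA : ∀ (g : ℕ) (I : Type) [Finite I], Module.Finite k (A.tot g I)) (hs : s.IsAut h) {g : ℕ}
    (hg : s.toGraph.HasGenus g) :
    s.weight A.character (-1) = hbar ((g : ℤ) - 1) * ((h.edgeSign k * ((-1) ^ Fintype.card s.toGraph.E *
        LinearMap.trace k (A.tens s.toGraph)
          (A.mapHom h ∘ₗ PiTensorProduct.map fun v => A.totSign (s.toGraph.genus v) (s.toGraph.Star v)))) •
        classProd (SameCycle.setoid (h.onL : Equiv.Perm s.toGraph.L)) (cycleVar k (h.onL : Equiv.Perm s.toGraph.L))) := by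
  obtain ⟨e, he, ht⟩ := A.trace_mapHom_totSign hs.iso fun v => hA _ _
  rw [ht, ZGraph.weight, hs.vertProd_eq A.isClassFunction_character e he, hs.legWeight_eq]
  have h1 : ((g : ℤ) - 1) = ∑ v, ((s.toGraph.genus v : ℤ) - 1) + Fintype.card s.toGraph.E := by
    unfold HasGenus at hg
    rw [Finset.sum_sub_distrib]
    simp only [Finset.sum_const, Finset.card_univ, nsmul_eq_mul, mul_one]
    have := congrArg (Nat.cast : ℕ → ℤ) hg
    push_cast at this
    linarith
  rw [h1, hbar_add]
  simp only [smul_mul_assoc, mul_smul_comm, smul_smul, mul_assoc]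

end ModularOperad

end ModularOperads

/-! ### Graphs with an automorphism as pairs of a graph and an isomorphism to itself -/

namespace ModularOperads

open Equiv.Perm Sum ModularOperads.Graph

namespace ZGraph

section Twist

variable {X : Type} [Fintype X] [LinearOrder X] (γ : ZGraph X)

/-- The automorphisms of the graph `γ`. -/
abbrev Aut : Type := {h : γ.toGraph.Hom γ.toGraph // h.IsIso}

noncomputable instance : Fintype γ.Aut := Fintype.ofFinite _

variable {γ} in
/-- The bijection of cells with `X` that is given by an automorphism. -/
noncomputable def Aut.cells (h : γ.Aut) : γ.toGraph.Cell ≃ X := (isoEquiv γ.toGraph γ h).1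

variable {γ} in
theorem Aut.isModel (h : γ.Aut) : γ.IsModel h.cells := (isoEquiv γ.toGraph γ h).2

/-- The graph `γ` with the permutation given by an automorphism. -/
noncomputable def twist (h : γ.Aut) : ZGraph X where
  r := γ.r
  g := γ.g
  π := γ.cellEquiv.symm.trans h.cells
  ι := γ.ι
  r_r := γ.r_r
  g_flag := γ.g_flag
  r_π x := by
    obtain ⟨c, rfl⟩ := γ.cellEquiv.surjective x
    rw [← γ.isModel_cellEquiv.root, Equiv.trans_apply, Equiv.trans_apply, Equiv.symm_apply_apply, Equiv.symm_apply_apply,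
      h.isModel.root]
  g_π x := by
    obtain ⟨c, rfl⟩ := γ.cellEquiv.surjective x
    rw [Equiv.trans_apply, Equiv.symm_apply_apply, ← h.isModel.genus, γ.isModel_cellEquiv.genus]
  stable := γ.stable
  pairing :=
    { invol := γ.pairing.invol
      comm := fun x => by
        obtain ⟨c, rfl⟩ := γ.cellEquiv.surjective x
        rw [← γ.isModel_cellEquiv.opp, Equiv.trans_apply, Equiv.trans_apply, Equiv.symm_apply_apply, Equiv.symm_apply_apply,
          h.isModel.opp]
      fix := γ.pairing.fix }

theorem isAut_twist (h : γ.Aut) : (γ.twist h).IsAut h.1 where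
  iso := h.2
  onV v := by
    change (h.1.onV v).1 = h.cells (γ.cellEquiv.symm (γ.cellEquiv (inl v)))
    rw [Equiv.symm_apply_apply]
    exact (isoEquiv_induces h).1 v
  onF a := by
    change γ.flagVal a = h.cells (γ.cellEquiv.symm (γ.cellEquiv (inr (h.1.onF a))))
    rw [Equiv.symm_apply_apply]
    exact (isoEquiv_induces h).2 a

/-- The graph `γ` with the identity permutation. -/
def bare : ZGraph X where
  r := γ.r
  g := γ.g
  π := 1
  ι := γ.ι
  r_r := γ.r_r
  g_flag := γ.g_flag
  r_π _ := rfl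
  g_π _ := rfl
  stable := γ.stable
  pairing := ⟨γ.pairing.invol, fun _ => rfl, γ.pairing.fix⟩

/-- The permutation of `γ` composed with the standard model of the bare graph is a second model of
it, and so comes from an automorphism. -/
theorem exists_twist : ∃ h : γ.bare.Aut, γ.bare.twist h = γ := by
  let β : γ.bare.toGraph.Cell ≃ X := γ.bare.cellEquiv.trans γ.π
  have hβ : γ.bare.IsModel β := by
    constructor
    · intro c
      change γ.π (γ.bare.cellEquiv _) = γ.r (γ.π (γ.bare.cellEquiv c))
      rw [γ.bare.isModel_cellEquiv.root, γ.r_π]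
      rfl
    · intro c
      change γ.π (γ.bare.cellEquiv _) = γ.ι (γ.π (γ.bare.cellEquiv c))
      rw [γ.bare.isModel_cellEquiv.opp, γ.pairing.comm]
      rfl
    · intro c
      change _ = γ.g (γ.π (γ.bare.cellEquiv c))
      rw [γ.bare.isModel_cellEquiv.genus, γ.g_π]
      rfl
  let h : γ.bare.Aut := (isoEquiv _ _).symm ⟨β, hβ⟩
  have hc : h.cells = β := congrArg Subtype.val ((isoEquiv γ.bare.toGraph γ.bare).apply_symm_apply ⟨β, hβ⟩)
  refine ⟨h, ZGraph.ext rfl rfl ?_ rfl⟩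
  change γ.bare.cellEquiv.symm.trans h.cells = γ.π
  rw [hc]
  ext x
  simp [β]

variable {γ}

theorem twist_injective {γ' : ZGraph X} {h : γ.Aut} {h' : γ'.Aut} (hγ : γ.π = 1) (hγ' : γ'.π = 1)
    (hh : γ.twist h = γ'.twist h') : (⟨γ, h⟩ : Σ γ : ZGraph X, γ.Aut) = ⟨γ', h'⟩ := by
  obtain rfl : γ = γ' := ZGraph.ext (congrArg (fun s => s.r) hh :) (congrArg (fun s => s.g) hh :) (hγ.trans hγ'.symm)
    (congrArg (fun s => s.ι) hh :)
  have h1 : γ.cellEquiv.symm.trans h.cells = γ.cellEquiv.symm.trans h'.cells := congrArg (fun s => s.π) hh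
  have h2 : h.cells = h'.cells := by
    ext c
    simpa using Equiv.congr_fun h1 (γ.cellEquiv c)
  rw [(isoEquiv γ.toGraph γ).injective (Subtype.ext h2)]

end Twist

open Classical in
theorem sum_graphs_eq {M : Type*} [AddCommMonoid M] (N w : ℕ) (F : ZGraph (Fin N) → M)
    [Fintype {γ : ZGraph (Fin N) // γ.wt = w ∧ γ.IsConn ∧ γ.π = 1}] :
    ∑ s ∈ graphsLE N w, (if s.wt = w ∧ s.IsConn then F s else 0)
      = ∑ γ : {γ : ZGraph (Fin N) // γ.wt = w ∧ γ.IsConn ∧ γ.π = 1}, ∑ h : γ.1.Aut, F (γ.1.twist h) := by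
  rw [← Finset.sum_filter, ← Fintype.sum_sigma']
  symm
  refine Finset.sum_bij (fun p _ => p.1.1.twist p.2) ?_ ?_ ?_ fun _ _ => rfl
  · rintro ⟨γ, h⟩ -
    rw [Finset.mem_filter, mem_graphsLE]
    exact ⟨γ.2.1.le, γ.2.1, γ.2.2.1⟩
  · rintro ⟨⟨γ, hγ⟩, h⟩ - ⟨⟨γ', hγ'⟩, h'⟩ - hh
    have h1 := twist_injective hγ.2.2 hγ'.2.2 hh
    simp only [Sigma.mk.injEq] at h1
    obtain ⟨rfl, h1⟩ := h1
    rw [eq_of_heq h1]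
  · intro s hs
    rw [Finset.mem_filter] at hs
    obtain ⟨h, hh⟩ := s.exists_twist
    exact ⟨⟨⟨s.bare, hs.2.1, hs.2.2, rfl⟩, h⟩, Finset.mem_univ _, hh⟩

end ZGraph

namespace ModularOperad

variable {k : Type u} [Field k] (A : ModularOperad.{u, w} k) {w n : ℕ}

open LabelledGraph

/-- An automorphism of the graph determines the permutation `σ` of the leg numbers, so summing over
`σ` and the isomorphisms compatible with it is summing over all automorphisms. -/
theorem sum_isos_eq (hA : ∀ (g : ℕ) (I : Type) [Finite I], Module.Finite k (A.tot g I)) {g : ℕ} (hw : 2 * g + n = w + 2)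
    (b : LabelledGraph w n) :
    ∑ σ : Equiv.Perm (Fin n), ∑ h : Isos b.graph (b.lab.trans σ.symm) b,
        hbar ((g : ℤ) - 1) * ((h.1.edgeSign k * ((-1) ^ Fintype.card b.graph.E * LinearMap.trace k (A.tens b.graph)
          (A.mapHom h.1 ∘ₗ PiTensorProduct.map fun v => A.totSign (b.graph.genus v) (b.graph.Star v)))) • cycleMonomial σ)
      = ∑ h : b.2.1.1.Aut, (b.2.1.1.twist h).weight A.character (-1) := by
  rw [← Fintype.sum_sigma']
  let Φ : (Σ σ : Equiv.Perm (Fin n), Isos b.graph (b.lab.trans σ.symm) b) → b.2.1.1.Aut := fun p => ⟨p.2.1, p.2.2.1⟩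
  have hΦ : ∀ (p : Σ σ : Equiv.Perm (Fin n), Isos b.graph (b.lab.trans σ.symm) b) (l : b.graph.L), p.1 (b.lab l) = b.lab (p.2.1.onL l) := fun p l => by
    have h1 := Equiv.congr_fun p.2.2.2 l
    rw [← h1]
    simp
  refine Fintype.sum_bijective Φ ⟨?_, ?_⟩ _ _ ?_
  · rintro ⟨σ, h⟩ ⟨σ', h'⟩ hh
    have h1 : h.1 = h'.1 := congrArg Subtype.val hh
    obtain rfl : σ = σ' := by
      ext i
      obtain ⟨l, rfl⟩ := b.lab.surjective i
      rw [hΦ ⟨σ, h⟩ l, hΦ ⟨σ', h'⟩ l, h1]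
    rw [show h = h' from Subtype.ext h1]
  · intro h
    refine ⟨⟨b.lab.symm.trans (h.1.onL.trans b.lab), ⟨h.1, h.2, ?_⟩⟩, rfl⟩
    ext l
    simp
  · rintro ⟨σ, h⟩
    have h1 : cycleMonomial (k := k) σ = classProd (SameCycle.setoid (h.1.onL : Equiv.Perm b.graph.L))
        (cycleVar k (h.1.onL : Equiv.Perm b.graph.L)) := by
      have hl : ∀ l, b.lab (h.1.onL l) = σ (b.lab l) := fun l => (hΦ ⟨σ, h⟩ l).symm
      rw [cycleMonomial_eq, classProd_comp (R := SameCycle.setoid (h.1.onL : Equiv.Perm b.graph.L)) b.lab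
        (sameCycle_comp b.lab.injective hl) (fun i => ⟨b.lab.symm i, by rw [Equiv.apply_symm_apply]⟩)
        fun i j hij => by rw [cycleVar, cycleVar, period_sameCycle hij]]
      refine classProd_congr fun l => ?_
      rw [cycleVar, cycleVar, period_comp b.lab b.lab.injective hl]
    rw [h1]
    exact (A.weight_eq hA (b.2.1.1.isAut_twist (Φ ⟨σ, h⟩)) (b.hasGenus hw)).symm

end ModularOperad

end ModularOperads

/-! ### The characteristic of the Feynman transform, and the conclusion -/

namespace ModularOperads

open ModularOperads.Graph

namespace ModularOperad

variable {k : Type u} [Field k] [CharZero k] (A : ModularOperad.{u, w} k)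

open LabelledGraph

theorem hbar_mul_ch_feynman (hA : ∀ (g : ℕ) (I : Type) [Finite I], Module.Finite k (A.tot g I)) {g n w : ℕ}
    (hw : 2 * g + n = w + 2) :
    hbar ((g : ℤ) - 1) * A.feynman.ch g n = (n.factorial : k)⁻¹ • ∑ b : LabelledGraph w n,
      ((b.1 : ℕ).factorial : k)⁻¹ • ∑ h : b.2.1.1.Aut, (b.2.1.1.twist h).weight A.character (-1) := by
  have := A.finite_feynman g n
  have h1 : A.feynman.ch g n = (n.factorial : k)⁻¹ • ∑ σ : Equiv.Perm (Fin n),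
      A.feynman.character g (Fin n) σ • cycleMonomial σ := by
    rw [StableSModule.ch]
    congr 1
    exact Finset.sum_congr rfl fun σ _ => by rw [A.feynman.character_eq]
  rw [h1, mul_smul_comm, Finset.mul_sum]
  congr 1
  simp only [A.character_feynman hw, ← A.sum_isos_eq hA hw, Finset.sum_smul, Finset.mul_sum, Finset.smul_sum]
  rw [Finset.sum_comm]
  refine Finset.sum_congr rfl fun b _ => Finset.sum_congr rfl fun σ _ => Finset.sum_congr rfl fun h _ => ?_
  rw [mul_smul, mul_smul_comm]

open Classical in
-- A graph with `n` legs has `n!` numberings of them, which the factor `1 / n!` cancels.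
theorem sum_labelledGraphs (n w : ℕ) (F : ∀ N, ZGraph (Fin N) → LambdaPoly k)
    [∀ N : ℕ, Fintype {γ : ZGraph (Fin N) // γ.wt = w ∧ γ.IsConn ∧ γ.π = 1}] :
    (n.factorial : k)⁻¹ • ∑ b : LabelledGraph w n, F b.1 b.2.1.1
      = ∑ N : Fin (4 * w + 1), ∑ γ : {γ : ZGraph (Fin N) // γ.wt = w ∧ γ.IsConn ∧ γ.π = 1},
        if Nat.card γ.1.toGraph.L = n then F N γ.1 else 0 := by
  have : ∀ (N : Fin (4 * w + 1)) (γ : {γ : ZGraph (Fin N) // γ.wt = w ∧ γ.IsConn ∧ γ.π = 1}),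
    Fintype (γ.1.toGraph.L ≃ Fin n) := fun N γ => Fintype.ofFinite _
  have h0 : (Finset.univ : Finset (LabelledGraph w n)) = Finset.univ.sigma fun _ => Finset.univ.sigma fun _ => Finset.univ := by
    ext
    simp
  rw [h0, Finset.sum_sigma, Finset.smul_sum]
  refine Finset.sum_congr rfl fun N _ => ?_
  rw [Finset.sum_sigma, Finset.smul_sum]
  refine Finset.sum_congr rfl fun γ _ => ?_
  change (n.factorial : k)⁻¹ • ∑ _e : γ.1.toGraph.L ≃ Fin n, F N γ.1 = _
  rw [Finset.sum_const, Finset.card_univ, ← Nat.card_eq_fintype_card]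
  split_ifs with h
  · have h1 : Nat.card (γ.1.toGraph.L ≃ Fin n) = n.factorial := by
      have e : γ.1.toGraph.L ≃ Fin n := (Finite.equivFin _).trans (finCongr h)
      rw [Nat.card_congr (Equiv.equivCongr e (Equiv.refl (Fin n))), Nat.card_eq_fintype_card, Fintype.card_perm,
        Fintype.card_fin]
    rw [h1, ← Nat.cast_smul_eq_nsmul k, smul_smul, inv_mul_cancel₀ (by exact_mod_cast Nat.factorial_ne_zero n), one_smul]
  · have : IsEmpty (γ.1.toGraph.L ≃ Fin n) := ⟨fun e => h ((Nat.card_congr e).trans (Nat.card_fin n))⟩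
    rw [Nat.card_of_isEmpty, zero_smul, smul_zero]

theorem CCh_feynman (hA : ∀ (g : ℕ) (I : Type) [Finite I], Module.Finite k (A.tot g I)) :
    A.feynman.CCh = ZGraph.series (fun _ s => s.IsConn) A.character (-1) := by
  classical
  have : ∀ N w : ℕ, Fintype {γ : ZGraph (Fin N) // γ.wt = w ∧ γ.IsConn ∧ γ.π = 1} := fun N w => Fintype.ofFinite _
  ext1 w
  rw [StableSModule.CCh, ZGraph.series, PowerSeries.coeff_mk, PowerSeries.coeff_mk]
  rcases Nat.eq_zero_or_pos w with rfl | hw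
  · rw [Finset.sum_eq_zero fun p hp => absurd (Finset.mem_filter.1 hp).2.2 (lt_irrefl 0), eq_comm]
    refine Finset.sum_eq_zero fun N hN => ?_
    obtain rfl : N = 0 := by simpa using hN
    rw [Finset.sum_eq_zero, smul_zero]
    refine fun s _ => if_neg fun hs => ?_
    obtain ⟨x⟩ := hs.2.1
    exact x.elim0
  have h1 : ∀ p ∈ (Finset.range (w + 3) ×ˢ Finset.range (w + 3)).filter fun p => 2 * p.1 + p.2 = w + 2 ∧ 0 < w,
      hbar ((p.1 : ℤ) - 1) * A.feynman.ch p.1 p.2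
        = ∑ N : Fin (4 * w + 1), ∑ γ : {γ : ZGraph (Fin N) // γ.wt = w ∧ γ.IsConn ∧ γ.π = 1},
          if Nat.card γ.1.toGraph.L = p.2 then ((N : ℕ).factorial : k)⁻¹ •
            ∑ h : γ.1.Aut, (γ.1.twist h).weight A.character (-1) else 0 := fun p hp => by
    rw [A.hbar_mul_ch_feynman hA (Finset.mem_filter.1 hp).2.1]
    exact sum_labelledGraphs p.2 w fun N γ => (N.factorial : k)⁻¹ • ∑ h : γ.Aut, (γ.twist h).weight A.character (-1)
  rw [Finset.sum_congr rfl h1, Finset.sum_comm, ← Fin.sum_univ_eq_sum_range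
    (fun N => (N.factorial : k)⁻¹ • ∑ s ∈ ZGraph.graphsLE N w, if s.wt = w ∧ s.IsConn then s.weight A.character (-1) else 0)]
  refine Finset.sum_congr rfl fun N _ => ?_
  rw [ZGraph.sum_graphs_eq, Finset.sum_comm, Finset.smul_sum]
  refine Finset.sum_congr rfl fun γ _ => ?_
  -- A connected graph of weight `w` contributes to exactly one pair `(g, n)`: the number of legs
  -- fixes `n`, and the weight then fixes `g`.
  obtain ⟨g, hg⟩ := γ.2.2.1.exists_genus
  rw [γ.1.hasGenus_iff, γ.2.1] at hg
  rw [Finset.sum_eq_single (g, Nat.card γ.1.toGraph.L), if_pos rfl]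
  · intro p hp hne
    refine if_neg fun h => hne ?_
    have := (Finset.mem_filter.1 hp).2.1
    exact Prod.ext (by omega) h.symm
  · intro h
    refine absurd (Finset.mem_filter.2 ⟨Finset.mem_product.2 ⟨Finset.mem_range.2 ?_, Finset.mem_range.2 ?_⟩, hg, hw⟩) h
    · change g < w + 3
      omega
    · change Nat.card γ.1.toGraph.L < w + 3
      omega

end ModularOperad

end ModularOperads

theorem mainTheorem10 {k : Type u} [Field k] [CharZero k]
    (A : ModularOperads.ModularOperad.{u, w} k)
    (hA : ∀ g n : ℕ, Module.Finite k (A.tot g (Fin n))) :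
    (∀ g n : ℕ, Module.Finite k (A.feynman.tot g (Fin n))) ∧
      A.feynman.CCh =
        ModularOperads.Log (ModularOperads.expNegDelta (ModularOperads.Exp A.CCh)) := by
  have hA' : ∀ (g : ℕ) (I : Type) [Finite I], Module.Finite k (A.tot g I) := fun g I _ => A.finite_tot hA g I
  refine ⟨A.finite_feynman, ?_⟩
  have hc := A.isClassFunction_character
  -- From connected graphs without edges to all graphs without edges, then to all graphs with `x =
  -- -1`, and back to the connected ones.
  rw [A.CCh_eq_series hA, ← ModularOperads.series_eq_Exp _ _ hc, ModularOperads.ZGraph.expNegDelta_series,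
    ModularOperads.series_eq_Exp _ _ hc, ← A.CCh_feynman hA', ModularOperads.Log_Exp]
  -- `Log_Exp` requires a vanishing term of weight zero, which the stability condition `0 < w` in
  -- `CCh` provides.
  rw [← PowerSeries.coeff_zero_eq_constantCoeff_apply, ModularOperads.StableSModule.CCh, PowerSeries.coeff_mk]
  exact Finset.sum_eq_zero fun p hp => absurd (Finset.mem_filter.1 hp).2.2 (lt_irrefl 0)
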